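/- **Theorem (Bulk asymptotics).** For $x_1,\dots,x_n\ge 0$, $y_1,\dots,y_k\ge 0$ let $F(z)=\prod_{i=1}^n\frac1{1-x_iz}\prod_{j=1}^k\frac1{1+y_j/z}$ and, for $m,m'\in\mathbb Z+\frac12$, $$\mathcal K(m,m')=\oint\!\!\oint_{|w|<|z|}\frac{dz}{2\pi i z}\frac{dw}{2\pi i w}\,\frac{F(z)}{F(w)}\,\frac{w^{m'}}{z^{m}}\,\frac{\sqrt{zw}}{z-w},$$ where both contours encircle $0$ and the $z$ contour encircles all $-y_j$ and excludes all $1/x_i$ ($w^{m'}z^{-m}\sqrt{zw}$ means $w^{m'+1/2}z^{1/2-m}$). Let $x_i=f(i/n)$, $y_j=g(j/k)$, where $k=k(n)$, $n\to\infty$ and $k/n\to c\in(0,\infty)$. Assume: 1. $f,g:[0,1]\to[0,\infty)$ are smooth, and not both identically zero; 2. $\int_0^1\frac{ds}{(1-f(s)z)^2}$ and $\int_0^1\frac{ds}{(z+g(s))^2}$ converge for every $z\in\mathbb C$ away from the poles, i.e. with $1-f(s)z\ne0$ and $z+g(s)\neq 0$ for all $s\in[0,1]$ (and $z=\infty$ is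 away from the poles if $f$ has no zero); 3. the equation $\int_0^1\frac{f(s)z}{(1-f(s)z)^2}ds-c\int_0^1\frac{g(s)z}{(z+g(s))^2}ds=0$ has two distinct roots $z_\pm\in\mathbb C\cup\{\infty\}$ away from the poles. The trivial factor $z$ is removed here: $0$ is a root if $\int_0^1 f=c\int_0^1 1/g$, and $\infty$ is a root if $\int_0^1 1/f=c\int_0^1 g$. Put $T(z)=\int_0^1\frac{f(s)z}{1-f(s)z}ds+c\int_0^1\frac{g(s)}{z+g(s)}ds$, with $T(\infty)=-1$. Assume that $x_\pm=T(z_\pm)$ are real, labelled so that $x_-\le x_+$. Then $[x_-,x_+]\subseteq[-1,c]$, and the following hold. (a) Let $t\in[x_-,x_+]$, $t\ne -1,c$. There is exactly one $z=z(t)\in\mathbb C$ away from the poles with $\operatorname{Im}z\ge0$ and $T(z)=t$, and $z\neq0$. With $\varphi=\arg z(t)$, for all $m,m'\in\mathbb Z+\frac12$, $$\lim_{n\to\infty}|z(t)|^{m-m'}\,\mathcal K(nt+m,nt+m')=\begin{cases}\dfrac{\sin(\varphi\,(m-m'))}{\pi(m-m')},&m\ne m',\\[2mm]\dfrac{\varphi}{\pi},&m=m'.\end{cases}$$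 (b) Let $t\in\mathbb R\setminus[x_-,x_+]$; if $t=c$ assume $z_+\in(0,\infty)$, and if $t=-1$ assume $z_-\in(-\infty,0)$. Then there is $\rho\in\{0,1\}$, not depending on $m,m'$ or on the choice of integers representing $nt$, with $\lim_{n\to\infty}\mathcal K(nt+m,nt+m')=\rho$ if $m=m'$ and $=0$ if $m\ne m'$. In (a) and (b), $nt$ stands for $a_n$, where $(a_n)$ is any sequence of integers with $a_n/n\to t$. -/

import Mathlib

open Set Filter Topology MeasureTheory
open scoped ContDiff Real

namespace DualSchur

noncomputable section

/-! ### The finite correlation kernel -/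

/-- `F(z) = ∏ᵢ 1/(1 - xᵢ z) ∏ⱼ 1/(1 + yⱼ/z)`. -/
def genF {n k : ℕ} (X : Fin n → ℝ) (Y : Fin k → ℝ) (z : ℂ) : ℂ :=
  (∏ i, (1 / (1 - (X i : ℂ) * z))) * ∏ j, (1 / (1 + (Y j : ℂ) / z))

/-- The point where the `z` contour crosses the positive half-line; it lies in `(0, 1/xᵢ)`. -/
def crossing {n : ℕ} (X : Fin n → ℝ) : ℝ := 1 / (2 * (1 + ∑ i, X i))

/-- The `z` contour is the circle around `-halfWidth Y` of radius `halfWidth Y + crossing X`. -/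
def halfWidth {k : ℕ} (Y : Fin k → ℝ) : ℝ := 1 + ∑ j, Y j

/-- The contours used below are admissible: `|w| < |z|`, both encircle `0`, the `z` contour
encircles every `-yⱼ` and excludes every `1/xᵢ`. -/
theorem contours_admissible {n k : ℕ} (X : Fin n → ℝ) (Y : Fin k → ℝ)
    (hX : ∀ i, 0 ≤ X i) (hY : ∀ j, 0 ≤ Y j) :
    0 < crossing X / 2 ∧
    (∀ z ∈ Metric.sphere (-(halfWidth Y : ℂ)) (halfWidth Y + crossing X),
      ∀ w ∈ Metric.sphere (0 : ℂ) (crossing X / 2), ‖w‖ < ‖z‖) ∧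
    (0 : ℂ) ∈ Metric.ball (-(halfWidth Y : ℂ)) (halfWidth Y + crossing X) ∧
    (∀ j, -(Y j : ℂ) ∈ Metric.ball (-(halfWidth Y : ℂ)) (halfWidth Y + crossing X)) ∧
    (∀ i, X i ≠ 0 →
      1 / (X i : ℂ) ∉ Metric.closedBall (-(halfWidth Y : ℂ)) (halfWidth Y + crossing X)) := by
  have hsX : 0 ≤ ∑ i, X i := Finset.sum_nonneg fun i _ => hX i
  have hsY : 0 ≤ ∑ j, Y j := Finset.sum_nonneg fun j _ => hY j
  have hδ : 0 < crossing X := by unfold crossing; positivity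
  have hW : 0 < halfWidth Y := by unfold halfWidth; positivity
  refine ⟨by positivity, ?_, ?_, ?_, ?_⟩
  · intro z hz w hw
    have h1 : ‖z + (halfWidth Y : ℂ)‖ = halfWidth Y + crossing X := by
      simpa [dist_eq_norm] using hz
    have h2 : ‖w‖ = crossing X / 2 := by simpa using hw
    have h3 := norm_add_le z (halfWidth Y : ℂ)
    rw [h1, Complex.norm_real, Real.norm_of_nonneg hW.le] at h3
    linarith
  · simp only [Metric.mem_ball, dist_eq_norm, sub_neg_eq_add, zero_add, Complex.norm_real,
      Real.norm_of_nonneg hW.le]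
    linarith
  · intro j
    have hj : Y j ≤ ∑ j, Y j := Finset.single_le_sum (fun j _ => hY j) (Finset.mem_univ j)
    have h0 := hY j
    have hE : -(Y j : ℂ) - -(halfWidth Y : ℂ) = ((halfWidth Y - Y j : ℝ) : ℂ) := by
      push_cast; ring
    rw [Metric.mem_ball, dist_eq_norm, hE, Complex.norm_real, Real.norm_of_nonneg]
    · linarith
    · unfold halfWidth; linarith
  · intro i hi
    have hi0 : 0 < X i := lt_of_le_of_ne (hX i) (Ne.symm hi)
    have hle : X i ≤ ∑ i, X i := Finset.single_le_sum (fun i _ => hX i) (Finset.mem_univ i)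
    have hlt : crossing X < 1 / X i := by
      unfold crossing
      exact one_div_lt_one_div_of_lt hi0 (by linarith)
    have hE : 1 / (X i : ℂ) - -(halfWidth Y : ℂ) = ((halfWidth Y + 1 / X i : ℝ) : ℂ) := by
      push_cast; ring
    have hp : 0 < 1 / X i := by positivity
    rw [Metric.mem_closedBall, dist_eq_norm, hE, Complex.norm_real,
      Real.norm_of_nonneg (by positivity)]
    linarith

/-- The correlation kernel at the half-integer positions `p + 1/2` and `q + 1/2`:
`∮∮ dz/(2πiz) dw/(2πiw) F(z)/F(w) · w^{q+1/2} z^{-(p+1/2)} √(zw) / (z - w)`,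
with the half-integer powers collected as `w^{q+1} z^{-p}`. -/
def corrKernel {n k : ℕ} (X : Fin n → ℝ) (Y : Fin k → ℝ) (p q : ℤ) : ℂ :=
  ∮ z in C(-(halfWidth Y : ℂ), halfWidth Y + crossing X),
    ∮ w in C(0, crossing X / 2),
      1 / (2 * π * Complex.I * z) * (1 / (2 * π * Complex.I * w)) *
        (genF X Y z / genF X Y w) * (w ^ (q + 1) * z ^ (-p) / (z - w))

/-- The parameters `xᵢ = f(i/n)`, `1 ≤ i ≤ n`. -/
def sampled (f : ℝ → ℝ) (n : ℕ) : Fin n → ℝ := fun i => f (((i : ℕ) + 1 : ℝ) / n)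

/-! ### The limiting critical point equations on the Riemann sphere -/

/-- `z` is away from the poles `1/f(s)` and `-g(s)`; here `1/f(s) = ∞` if `f(s) = 0`. -/
def AwayFromPoles (f g : ℝ → ℝ) (z : OnePoint ℂ) : Prop :=
  z.elim (∀ s ∈ Icc (0 : ℝ) 1, f s ≠ 0)
    (fun z => ∀ s ∈ Icc (0 : ℝ) 1, 1 - (f s : ℂ) * z ≠ 0 ∧ z + (g s : ℂ) ≠ 0)

/-- `T(z) = ∫ f z/(1 - f z) ds + c ∫ g/(z + g) ds`, with the limiting value `-1` at `z = ∞`. -/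
def critFun (f g : ℝ → ℝ) (c : ℝ) (z : OnePoint ℂ) : ℂ :=
  z.elim (-1)
    (fun z => (∫ s in (0 : ℝ)..1, (f s : ℂ) * z / (1 - (f s : ℂ) * z)) +
      (c : ℂ) * ∫ s in (0 : ℝ)..1, (g s : ℂ) / (z + (g s : ℂ)))

/-- `z` is a root in `ℂ ∪ {∞}` of `∫ f z/(1 - f z)² ds - c ∫ g z/(z + g)² ds = 0`, the common
factor `z` being removed; at `∞` the equation is the limit of `z` times the left-hand side. -/
def IsDoubleCritical (f g : ℝ → ℝ) (c : ℝ) (z : OnePoint ℂ) : Prop :=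
  AwayFromPoles f g z ∧
  z.elim ((∫ s in (0 : ℝ)..1, 1 / f s) - c * (∫ s in (0 : ℝ)..1, g s) = 0)
    (fun z => (∫ s in (0 : ℝ)..1, (f s : ℂ) / (1 - (f s : ℂ) * z) ^ 2) -
      (c : ℂ) * (∫ s in (0 : ℝ)..1, (g s : ℂ) / (z + (g s : ℂ)) ^ 2) = 0)

/-- For finite nonzero `z` the factor `z` may be kept. -/
theorem isDoubleCritical_coe_iff (f g : ℝ → ℝ) (c : ℝ) (z : ℂ) (hz : z ≠ 0) :
    IsDoubleCritical f g c (z : OnePoint ℂ) ↔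
      AwayFromPoles f g (z : OnePoint ℂ) ∧
      (∫ s in (0 : ℝ)..1, (f s : ℂ) * z / (1 - (f s : ℂ) * z) ^ 2) -
        (c : ℂ) * (∫ s in (0 : ℝ)..1, (g s : ℂ) * z / (z + (g s : ℂ)) ^ 2) = 0 := by
  have h1 : (∫ s in (0 : ℝ)..1, (f s : ℂ) * z / (1 - (f s : ℂ) * z) ^ 2) =
      (∫ s in (0 : ℝ)..1, (f s : ℂ) / (1 - (f s : ℂ) * z) ^ 2) * z := by
    rw [← intervalIntegral.integral_mul_const]
    congr 1; ext s; ring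
  have h2 : (∫ s in (0 : ℝ)..1, (g s : ℂ) * z / (z + (g s : ℂ)) ^ 2) =
      (∫ s in (0 : ℝ)..1, (g s : ℂ) / (z + (g s : ℂ)) ^ 2) * z := by
    rw [← intervalIntegral.integral_mul_const]
    congr 1; ext s; ring
  rw [h1, h2, ← mul_assoc, ← sub_mul, mul_eq_zero, or_iff_left hz]
  rfl

/-- The discrete sine kernel with parameter `φ` at integer distance `d = m - m'`. -/
def sineKernel (φ : ℝ) (d : ℤ) : ℝ :=
  if d = 0 then φ / π else Real.sin (φ * d) / (π * d)

end

end DualSchur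

namespace DualSchur

noncomputable section

/-! ### Parametric integrals over compactly carried measures -/

/-! The exponential rate of the integrand is the potential `U`, the limit of `n⁻¹ log |F(z)
z^(-nt)|`, whose differential is `Re ((T(z) - t) dz / z)`; its critical points are the solutions of
`T(z) = t`. The measures `μ` and `ν` are the distribution of `f` and `c` times that of `g`.

Geometry. One has `Im T = Im z · D`, with `D` a real function. On a circle about `0` each `|1 -
xz|²` and `|z + y|²` is affine in `Re z`. Hence `D` is strictly increasing in `Re z` there
(`D_sub_of_norm_eq`), and, since the logarithm is concave, `U` lies above its tangents, of slope
`D`, as a function of `Re z` (`U_tangent`). So the circles in a certain range of radii meet `{D =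
0}` in exactly one point of the upper half plane, and this point minimizes `U` on its circle. On the
resulting curve `T` is real and strictly decreasing in the modulus (`T_strictAnti`). Its values fill
the open interval between the two real critical values, one root lying between the poles `-y` and
`1/x`, the other beyond them. This gives existence and uniqueness of `z(t)`, and the inequalities
`-1 ≤ x₋` and `x₊ ≤ c` follow from `T_In0_eq` and the symmetry `z ↦ -1/z`, which exchanges the two
measures.

Kernel. The function `w^q / F(w)` is a Laurent polynomial, and the `w` integral extracts its
negative part. Writing this as the whole minus the nonnegative part turns the `z` integrand `hout`
into `hin + z^(q-p-1)`. The `z` contour is symmetric, so the kernel is an imaginary part of a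
difference of primitives. The path is cut at a point `s`: on the side of the positive crossing `hin`
plus the power is used, on the other side `hout`, which `z ↦ -1/z` converts into `hin` for the
exchanged data. The power integrates to the sine kernel with angle `arg s`, and two increments of
primitives of `hin` remain (`corrKernel_eq_inner`).

Smallness. Let `D(s) = 0` for the finite weights. The nonnegative part is a Cauchy integral over
`|w| = |s|`, where `|w^a / F(w)|` is bounded by its value at `s`. Together with the Poisson kernel
this bounds `hin(z)`, for `|z| < |s|`, by a constant times `exp (U(z) - U(s)) / √(|s|² - |z|²)`
(`norm_hin_le`). Starting from `s` in a direction of descent, the square root singularity is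
integrable. After a short segment one is in the region `|z| < |s|`, `U(z) < U(s)`, and a connected
set in it, made of a circular arc, a piece of the critical curve and a neighbourhood of its end,
leads to the real interval between the poles (`exists_preconnected`). There `hin` is real, so the
imaginary part of a primitive is constant. The segment contributes arbitrarily little and the rest
decays exponentially (`innerSmall_of_contact`).

The contact points are taken exactly critical for the finite weights and converge to `z(t)`, or to a
real critical point when `t` is an endpoint or lies outside the interval. In the real case the angle
is `0` or `π`, which gives `ρ`. Beyond the masses of the measures the Laurent polynomial has only
one sign of exponents and the kernel is explicit. -/

theorem integrable_of_continuousOn_carried {E : Type*} [NormedAddCommGroup E]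
    {m : Measure ℝ} [IsFiniteMeasure m] {A : Set ℝ} (hA : IsCompact A) (hm : m.restrict A = m)
    {φ : ℝ → E} (hφ : ContinuousOn φ A) : Integrable φ m := by
  have := hφ.integrableOn_compact (μ := m) hA
  rwa [IntegrableOn, hm] at this

theorem integral_congr_carried {E : Type*} [NormedAddCommGroup E] [NormedSpace ℝ E]
    {m : Measure ℝ} {A : Set ℝ} (hA : IsCompact A) (hm : m.restrict A = m)
    {φ ψ : ℝ → E} (h : ∀ x ∈ A, φ x = ψ x) : ∫ x, φ x ∂m = ∫ x, ψ x ∂m := by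
  rw [← hm]
  exact setIntegral_congr_fun hA.measurableSet h

theorem ae_mem_carried {m : Measure ℝ} {A : Set ℝ} (hA : IsCompact A) (hm : m.restrict A = m) :
    ∀ᵐ x ∂m, x ∈ A := by
  rw [← hm]
  exact ae_restrict_mem hA.measurableSet

theorem continuousOn_section {P E : Type*} [TopologicalSpace P] [TopologicalSpace E]
    {A : Set ℝ} {F : P → ℝ → E} {O : Set P}
    (hF : ContinuousOn (Function.uncurry F) (O ×ˢ A)) {p : P} (hp : p ∈ O) :
    ContinuousOn (F p) A :=
  hF.comp (f := fun x => (p, x)) (by fun_prop) fun x hx => ⟨hp, hx⟩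

theorem im_integral {m : Measure ℝ} {φ : ℝ → ℂ} (h : Integrable φ m) :
    ∫ x, (φ x).im ∂m = (∫ x, φ x ∂m).im := Complex.imCLM.integral_comp_comm h

theorem re_integral {m : Measure ℝ} {φ : ℝ → ℂ} (h : Integrable φ m) :
    ∫ x, (φ x).re ∂m = (∫ x, φ x ∂m).re := Complex.reCLM.integral_comp_comm h

theorem integral_pos_of_carried {m : Measure ℝ} [IsFiniteMeasure m] {A : Set ℝ}
    (hA : IsCompact A) (hm : m.restrict A = m) (hA0 : ∀ x ∈ A, 0 ≤ x) {φ : ℝ → ℝ}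
    (hφ : Integrable φ m) (h0 : ∀ x ∈ A, 0 ≤ φ x) (h : ∀ x ∈ A, 0 < x → 0 < φ x)
    (hpos : 0 < ∫ x, x ∂m) : 0 < ∫ x, φ x ∂m := by
  have hae := ae_mem_carried hA hm
  have hnn : 0 ≤ᵐ[m] φ := hae.mono h0
  refine lt_of_le_of_ne (integral_nonneg_of_ae hnn) fun h1 => hpos.ne' ?_
  have h2 := (integral_eq_zero_iff_of_nonneg_ae hnn hφ).1 h1.symm
  refine integral_eq_zero_of_ae ?_
  filter_upwards [h2, hae] with x hx hxA
  by_contra hne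
  exact (h x hxA (lt_of_le_of_ne (hA0 x hxA) (Ne.symm hne))).ne' hx

theorem norm_integral_sub_le_carried {E : Type*} [NormedAddCommGroup E] [NormedSpace ℝ E]
    {m : Measure ℝ} [IsFiniteMeasure m] {A : Set ℝ} (hA : IsCompact A) (hm : m.restrict A = m)
    {φ ψ : ℝ → E} (hφ : ContinuousOn φ A) (hψ : ContinuousOn ψ A) {ε : ℝ}
    (h : ∀ x ∈ A, ‖φ x - ψ x‖ ≤ ε) :
    ‖∫ x, φ x ∂m - ∫ x, ψ x ∂m‖ ≤ ε * m.real univ := by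
  rw [← integral_sub (integrable_of_continuousOn_carried hA hm hφ)
    (integrable_of_continuousOn_carried hA hm hψ)]
  exact norm_integral_le_of_norm_le_const ((ae_mem_carried hA hm).mono h)

theorem continuousOn_integral_carried {P E : Type*} [TopologicalSpace P] [NormedAddCommGroup E]
    [NormedSpace ℝ E] {m : Measure ℝ} [IsFiniteMeasure m] {A : Set ℝ} (hA : IsCompact A)
    (hm : m.restrict A = m) {F : P → ℝ → E} {O : Set P}
    (hF : ContinuousOn (Function.uncurry F) (O ×ˢ A)) :
    ContinuousOn (fun p => ∫ x, F p x ∂m) O := by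
  intro q hq
  rw [ContinuousWithinAt, Metric.tendsto_nhds]
  intro ε hε
  have hpos : 0 < m.real univ + 1 := by positivity
  obtain ⟨v, hv, h⟩ := hA.mem_uniformity_of_prod hF hq
    (Metric.dist_mem_uniformity (div_pos hε hpos))
  filter_upwards [hv, self_mem_nhdsWithin] with p hp hpO
  rw [dist_eq_norm]
  refine lt_of_le_of_lt (norm_integral_sub_le_carried hA hm (continuousOn_section hF hpO)
    (continuousOn_section hF hq) (ε := ε / (m.real univ + 1)) fun x hx => ?_) ?_
  · rw [← dist_eq_norm]; exact (h p hp x hx).le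
  · rw [div_mul_eq_mul_div, div_lt_iff₀ hpos]
    nlinarith [measureReal_nonneg (μ := m) (s := univ)]

/-- The measures `m n / n`, carried by `A`, converge weakly to `m'`. -/
def ScaledConv (m : ℕ → Measure ℝ) (m' : Measure ℝ) (A : Set ℝ) : Prop :=
  ∀ φ : ℝ → ℝ, ContinuousOn φ A →
    Tendsto (fun n : ℕ => (n : ℝ)⁻¹ * ∫ x, φ x ∂(m n)) atTop (𝓝 (∫ x, φ x ∂m'))

theorem ScaledConv.complex {m : ℕ → Measure ℝ} {m' : Measure ℝ} {A : Set ℝ}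
    [∀ n, IsFiniteMeasure (m n)] [IsFiniteMeasure m']
    (hA : IsCompact A) (hm : ∀ n, (m n).restrict A = m n) (hm' : m'.restrict A = m')
    (h : ScaledConv m m' A) {φ : ℝ → ℂ} (hφ : ContinuousOn φ A) :
    Tendsto (fun n : ℕ => ((n : ℝ)⁻¹ : ℂ) * ∫ x, φ x ∂(m n)) atTop (𝓝 (∫ x, φ x ∂m')) := by
  have hre := h (fun x => (φ x).re) (Complex.continuous_re.comp_continuousOn hφ)
  have him := h (fun x => (φ x).im) (Complex.continuous_im.comp_continuousOn hφ)
  have key : ∀ (μ : Measure ℝ) [IsFiniteMeasure μ], μ.restrict A = μ →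
      ∫ x, φ x ∂μ = ((∫ x, (φ x).re ∂μ : ℝ) : ℂ) + ((∫ x, (φ x).im ∂μ : ℝ) : ℂ) * Complex.I := by
    intro μ _ hμ
    exact (integral_re_add_im (𝕜 := ℂ) (integrable_of_continuousOn_carried hA hμ hφ)).symm
  rw [key m' hm']
  refine (((Complex.continuous_ofReal.tendsto _).comp hre).add
    (((Complex.continuous_ofReal.tendsto _).comp him).mul_const Complex.I)).congr fun n => ?_
  simp only [Function.comp]
  rw [key (m n) (hm n)]
  push_cast
  ring

/-- Convergence is joint in the index and the parameter, because the points at which the functions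
are evaluated move with `n`. The uniform modulus of continuity over the compact carrier reduces it
to a fixed parameter. -/
theorem ScaledConv.tendsto_prod {P : Type*} [TopologicalSpace P]
    {m : ℕ → Measure ℝ} {m' : Measure ℝ} {A : Set ℝ}
    [∀ n, IsFiniteMeasure (m n)] [IsFiniteMeasure m']
    (hA : IsCompact A) (hm : ∀ n, (m n).restrict A = m n) (hm' : m'.restrict A = m')
    (h : ScaledConv m m' A) {F : P → ℝ → ℂ} {O : Set P} (hO : IsOpen O)
    (hF : ContinuousOn (Function.uncurry F) (O ×ˢ A)) {q : P} (hq : q ∈ O) :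
    Tendsto (fun p : ℕ × P => ((p.1 : ℝ)⁻¹ : ℂ) * ∫ x, F p.2 x ∂(m p.1)) (atTop ×ˢ 𝓝 q)
      (𝓝 (∫ x, F q x ∂m')) := by
  have h0 := h.complex hA hm hm' (continuousOn_section hF hq)
  have h1 : Tendsto (fun n : ℕ => (n : ℝ)⁻¹ * (m n).real univ) atTop (𝓝 (m'.real univ)) := by
    simpa using h (fun _ => 1) continuousOn_const
  have h2 : Tendsto (fun p : ℕ × P => ((p.1 : ℝ)⁻¹ : ℂ) * ∫ x, F p.2 x ∂(m p.1) -
      ((p.1 : ℝ)⁻¹ : ℂ) * ∫ x, F q x ∂(m p.1)) (atTop ×ˢ 𝓝 q) (𝓝 0) := by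
    rw [Metric.tendsto_nhds]
    intro ε hε
    have hpos : 0 < m'.real univ + 1 := by positivity
    obtain ⟨v, hv, h'⟩ := hA.mem_uniformity_of_prod hF hq
      (Metric.dist_mem_uniformity (div_pos hε hpos))
    rw [hO.nhdsWithin_eq hq] at hv
    have e1 : ∀ᶠ n : ℕ in atTop, (n : ℝ)⁻¹ * (m n).real univ < m'.real univ + 1 :=
      h1.eventually_lt_const (by linarith)
    filter_upwards [prod_mem_prod e1 (inter_mem hv (hO.mem_nhds hq))] with p hp
    obtain ⟨hp1, hp2, hp3⟩ := hp
    rw [dist_zero_right, ← mul_sub, norm_mul]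
    have := norm_integral_sub_le_carried hA (hm p.1) (continuousOn_section hF hp3)
      (continuousOn_section hF hq) (ε := ε / (m'.real univ + 1)) fun x hx => by
        rw [← dist_eq_norm]; exact (h' p.2 hp2 x hx).le
    have hn : ‖((p.1 : ℝ)⁻¹ : ℂ)‖ = (p.1 : ℝ)⁻¹ := by
      simp
    rw [hn]
    calc _ ≤ (p.1 : ℝ)⁻¹ * (ε / (m'.real univ + 1) * (m p.1).real univ) := by gcongr
      _ = ε / (m'.real univ + 1) * ((p.1 : ℝ)⁻¹ * (m p.1).real univ) := by ring
      _ < ε / (m'.real univ + 1) * (m'.real univ + 1) := by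
          apply mul_lt_mul_of_pos_left hp1 (by positivity)
      _ = ε := by field_simp
  have h3 := h2.add (h0.comp (tendsto_fst (f := atTop) (g := 𝓝 q)))
  simpa [Function.comp_def] using h3

theorem ScaledConv.tendsto_prod_real {P : Type*} [TopologicalSpace P]
    {m : ℕ → Measure ℝ} {m' : Measure ℝ} {A : Set ℝ}
    [∀ n, IsFiniteMeasure (m n)] [IsFiniteMeasure m']
    (hA : IsCompact A) (hm : ∀ n, (m n).restrict A = m n) (hm' : m'.restrict A = m')
    (h : ScaledConv m m' A) {F : P → ℝ → ℝ} {O : Set P} (hO : IsOpen O)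
    (hF : ContinuousOn (Function.uncurry F) (O ×ˢ A)) {q : P} (hq : q ∈ O) :
    Tendsto (fun p : ℕ × P => (p.1 : ℝ)⁻¹ * ∫ x, F p.2 x ∂(m p.1)) (atTop ×ˢ 𝓝 q)
      (𝓝 (∫ x, F q x ∂m')) := by
  have := h.tendsto_prod hA hm hm' (F := fun p x => (F p x : ℂ)) hO
    (Complex.continuous_ofReal.comp_continuousOn hF) hq
  have := (Complex.continuous_re.tendsto _).comp this
  rw [integral_complex_ofReal] at this
  refine this.congr fun p => ?_
  simp only [Function.comp_def]
  rw [integral_complex_ofReal, ← Complex.ofReal_inv, ← Complex.ofReal_mul, Complex.ofReal_re]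

/-! ### Pairs of weights and the associated functions -/

/-- A pair of finite measures carried by compact sets of nonnegative numbers. -/
structure Weights (A B : Set ℝ) where
  μ : Measure ℝ
  ν : Measure ℝ
  finμ : IsFiniteMeasure μ
  finν : IsFiniteMeasure ν
  hA : IsCompact A
  hB : IsCompact B
  A0 : ∀ x ∈ A, 0 ≤ x
  B0 : ∀ y ∈ B, 0 ≤ y
  μA : μ.restrict A = μ
  νB : ν.restrict B = ν

attribute [instance] Weights.finμ Weights.finν

/-- `z` avoids the points `1/x`, `x ∈ A`, and `-y`, `y ∈ B`. -/
def Away (A B : Set ℝ) (z : ℂ) : Prop :=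
  (∀ x ∈ A, 1 - (x : ℂ) * z ≠ 0) ∧ ∀ y ∈ B, z + (y : ℂ) ≠ 0

/-- The real points between the poles `-y` and the poles `1/x`. -/
def In0 (A B : Set ℝ) (r : ℝ) : Prop :=
  (∀ x ∈ A, x * r < 1) ∧ ∀ y ∈ B, 0 < r + y

namespace Weights

variable {A B : Set ℝ}

/-- The exchange of the two measures, which corresponds to `z ↦ -1/z`. -/
def swap (W : Weights A B) : Weights B A :=
  ⟨W.ν, W.μ, W.finν, W.finμ, W.hB, W.hA, W.B0, W.A0, W.νB, W.μA⟩

def T (W : Weights A B) (z : ℂ) : ℂ :=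
  (∫ x, (x : ℂ) * z / (1 - x * z) ∂W.μ) + ∫ y, (y : ℂ) / (z + y) ∂W.ν

/-- Off the real axis this is `Im T / Im z`, and at real points it is the derivative of `T`. Its
zeros in the upper half plane are thus the points where `T` is real, and its real zeros are the
double critical points. -/
def D (W : Weights A B) (z : ℂ) : ℝ :=
  (∫ x, x / Complex.normSq (1 - x * z) ∂W.μ) - ∫ y, y / Complex.normSq (z + y) ∂W.ν

/-- The second divided difference of `T` at the nodes `z`, `s` and the conjugate of `s`. -/
def Q (W : Weights A B) (z s : ℂ) : ℂ :=
  (∫ x, (x : ℂ) ^ 2 / ((1 - x * z) * (Complex.normSq (1 - x * s) : ℝ)) ∂W.μ) +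
    ∫ y, (y : ℂ) / ((z + y) * (Complex.normSq (s + y) : ℝ)) ∂W.ν

def Ps (W : Weights A B) (z s : ℂ) : ℝ :=
  (∫ x, x ^ 2 / (Complex.normSq (1 - x * z) * Complex.normSq (1 - x * s)) ∂W.μ) +
    ∫ y, y ^ 2 / (Complex.normSq (z + y) * Complex.normSq (s + y)) ∂W.ν

/-- The logarithm of `|F(z) z^(-t)|` for a continuous distribution of parameters. -/
def U (W : Weights A B) (t : ℝ) (z : ℂ) : ℝ :=
  -(∫ x, Real.log ‖1 - (x : ℂ) * z‖ ∂W.μ) - (∫ y, Real.log ‖1 + (y : ℂ) / z‖ ∂W.ν)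
    - t * Real.log ‖z‖

/-- Neither measure pair is concentrated at `0`. -/
def Nontriv (W : Weights A B) : Prop :=
  0 < (∫ x, x ∂W.μ) + ∫ y, y ∂W.ν

end Weights

/-! ### Points away from the poles -/

theorem Away.normSq_pos_left {A B : Set ℝ} {z : ℂ} (h : Away A B z) {x : ℝ} (hx : x ∈ A) :
    0 < Complex.normSq (1 - (x : ℂ) * z) := Complex.normSq_pos.2 (h.1 x hx)

theorem Away.normSq_pos_right {A B : Set ℝ} {z : ℂ} (h : Away A B z) {y : ℝ} (hy : y ∈ B) :
    0 < Complex.normSq (z + (y : ℂ)) := Complex.normSq_pos.2 (h.2 y hy)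

theorem Away.swap {A B : Set ℝ} {z : ℂ} (h : Away A B z) (hz : z ≠ 0) : Away B A (-z⁻¹) := by
  refine ⟨fun y hy h0 => h.2 y hy ?_, fun x hx h0 => h.1 x hx ?_⟩
  · field_simp at h0
    linear_combination h0
  · field_simp at h0
    linear_combination -h0

namespace Weights

variable {A B : Set ℝ} (W : Weights A B)

theorem intA {E : Type*} [NormedAddCommGroup E] {φ : ℝ → E} (hφ : ContinuousOn φ A) :
    Integrable φ W.μ := integrable_of_continuousOn_carried W.hA W.μA hφ

theorem intB {E : Type*} [NormedAddCommGroup E] {φ : ℝ → E} (hφ : ContinuousOn φ B) :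
    Integrable φ W.ν := integrable_of_continuousOn_carried W.hB W.νB hφ

theorem congrA {E : Type*} [NormedAddCommGroup E] [NormedSpace ℝ E] {φ ψ : ℝ → E}
    (h : ∀ x ∈ A, φ x = ψ x) : ∫ x, φ x ∂W.μ = ∫ x, ψ x ∂W.μ :=
  integral_congr_carried W.hA W.μA h

theorem congrB {E : Type*} [NormedAddCommGroup E] [NormedSpace ℝ E] {φ ψ : ℝ → E}
    (h : ∀ x ∈ B, φ x = ψ x) : ∫ x, φ x ∂W.ν = ∫ x, ψ x ∂W.ν :=
  integral_congr_carried W.hB W.νB h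

theorem intDivA {𝕜 : Type*} [RCLike 𝕜] {φ ψ : ℝ → 𝕜} (hφ : Continuous φ) (hψ : Continuous ψ)
    (h : ∀ x ∈ A, ψ x ≠ 0) : Integrable (fun x => φ x / ψ x) W.μ :=
  W.intA (hφ.continuousOn.div hψ.continuousOn h)

theorem intDivB {𝕜 : Type*} [RCLike 𝕜] {φ ψ : ℝ → 𝕜} (hφ : Continuous φ) (hψ : Continuous ψ)
    (h : ∀ x ∈ B, ψ x ≠ 0) : Integrable (fun x => φ x / ψ x) W.ν :=
  W.intB (hφ.continuousOn.div hψ.continuousOn h)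

@[simp] theorem swap_swap : W.swap.swap = W := rfl

theorem _root_.DualSchur.away_of_im_pos {z : ℂ} (hz : 0 < z.im) : Away A B z := by
  refine ⟨fun x hx h => ?_, fun y hy h => ?_⟩
  · have h1 := congrArg Complex.im h
    have h2 := congrArg Complex.re h
    simp at h1 h2
    rcases h1 with h1 | h1
    · rw [h1] at h2; simp at h2
    · exact hz.ne' h1
  · have h1 := congrArg Complex.im h
    simp at h1
    exact hz.ne' h1

theorem _root_.DualSchur.In0.away {r : ℝ} (h : In0 A B r) : Away A B r := by
  refine ⟨fun x hx h0 => ?_, fun y hy h0 => ?_⟩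
  · have := h.1 x hx
    norm_cast at h0
    linarith
  · have := h.2 y hy
    norm_cast at h0
    linarith

theorem isOpen_away (W : Weights A B) : IsOpen {z : ℂ | Away A B z} := by
  have h1 : IsOpen {z : ℂ | ∀ x ∈ A, 1 - (x : ℂ) * z ≠ 0} := by
    rw [isOpen_iff_eventually]
    intro z hz
    refine W.hA.eventually_forall_of_forall_eventually fun x hx => ?_
    have : ContinuousAt (fun p : ℂ × ℝ => 1 - (p.2 : ℂ) * p.1) (z, x) := by fun_prop
    exact this.eventually_ne (hz x hx)
  have h2 : IsOpen {z : ℂ | ∀ y ∈ B, z + (y : ℂ) ≠ 0} := by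
    rw [isOpen_iff_eventually]
    intro z hz
    refine W.hB.eventually_forall_of_forall_eventually fun x hx => ?_
    have : ContinuousAt (fun p : ℂ × ℝ => p.1 + (p.2 : ℂ)) (z, x) := by fun_prop
    exact this.eventually_ne (hz x hx)
  exact h1.inter h2

/-! ### Algebraic identities -/

theorem ofReal_D (z : ℂ) : (W.D z : ℂ) =
    (∫ x, (x : ℂ) / (Complex.normSq (1 - x * z) : ℝ) ∂W.μ) -
      ∫ y, (y : ℂ) / (Complex.normSq (z + y) : ℝ) ∂W.ν := by
  simp only [D, Complex.ofReal_sub, ← integral_complex_ofReal, Complex.ofReal_div]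

variable {W}

/-- Interpolation at `s` and its conjugate, rather than a Taylor expansion at `s`, keeps the
coefficient `D s` real and remains uniform when a conjugate pair of critical points merges on the
real axis. -/
theorem T_sub {z s : ℂ} (hz : Away A B z) (hs : Away A B s) :
    W.T z = W.T s + (z - s) * W.D s + (z - s) * (z - (starRingEnd ℂ) s) * W.Q z s := by
  have a1 := fun x hx => hz.1 x hx
  have a2 := fun x hx => hs.1 x hx
  have a3 : ∀ x ∈ A, (Complex.normSq (1 - (x : ℂ) * s) : ℂ) ≠ 0 := fun x hx => by
    exact_mod_cast (hs.normSq_pos_left hx).ne'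
  have b1 := fun x hx => hz.2 x hx
  have b2 := fun x hx => hs.2 x hx
  have b3 : ∀ x ∈ B, (Complex.normSq (s + (x : ℂ)) : ℂ) ≠ 0 := fun x hx => by
    exact_mod_cast (hs.normSq_pos_right hx).ne'
  have eA : (∫ x, (x : ℂ) * z / (1 - x * z) ∂W.μ) = (∫ x, (x : ℂ) * s / (1 - x * s) ∂W.μ) +
      (z - s) * (∫ x, (x : ℂ) / (Complex.normSq (1 - x * s) : ℝ) ∂W.μ) +
      (z - s) * (z - (starRingEnd ℂ) s) *
        ∫ x, (x : ℂ) ^ 2 / ((1 - x * z) * (Complex.normSq (1 - x * s) : ℝ)) ∂W.μ := by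
    have i1 := W.intDivA (φ := fun x : ℝ => (x : ℂ) * s) (by fun_prop) (by fun_prop) a2
    have i2 := (W.intDivA (φ := fun x : ℝ => (x : ℂ)) (by fun_prop) (by fun_prop) a3).const_mul
      (z - s)
    have i3 := (W.intDivA (φ := fun x : ℝ => (x : ℂ) ^ 2) (by fun_prop) (by fun_prop)
      fun x hx => mul_ne_zero (a1 x hx) (a3 x hx)).const_mul
      ((z - s) * (z - (starRingEnd ℂ) s))
    rw [← integral_const_mul, ← integral_const_mul, ← integral_add i1 i2,
      ← integral_add (i1.fun_add i2) i3]
    refine W.congrA fun x hx => ?_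
    have h1 := a1 x hx
    have h2 := a2 x hx
    have h3 := a3 x hx
    have h4 : (Complex.normSq (1 - (x : ℂ) * s) : ℂ) =
        (1 - x * s) * (1 - x * (starRingEnd ℂ) s) := by
      rw [← Complex.mul_conj]; simp
    rw [h4] at h3 ⊢
    have h5 := right_ne_zero_of_mul h3
    field_simp
    ring
  have eB : (∫ y, (y : ℂ) / (z + y) ∂W.ν) = (∫ y, (y : ℂ) / (s + y) ∂W.ν) +
      (-(z - s)) * (∫ y, (y : ℂ) / (Complex.normSq (s + y) : ℝ) ∂W.ν) +
      (z - s) * (z - (starRingEnd ℂ) s) *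
        ∫ y, (y : ℂ) / ((z + y) * (Complex.normSq (s + y) : ℝ)) ∂W.ν := by
    have i1 := W.intDivB (φ := fun x : ℝ => (x : ℂ)) (by fun_prop) (by fun_prop) b2
    have i2 := (W.intDivB (φ := fun x : ℝ => (x : ℂ)) (by fun_prop) (by fun_prop) b3).const_mul
      (-(z - s))
    have i3 := (W.intDivB (φ := fun x : ℝ => (x : ℂ)) (by fun_prop) (by fun_prop)
      fun x hx => mul_ne_zero (b1 x hx) (b3 x hx)).const_mul
      ((z - s) * (z - (starRingEnd ℂ) s))
    rw [← integral_const_mul, ← integral_const_mul, ← integral_add i1 i2,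
      ← integral_add (i1.fun_add i2) i3]
    refine W.congrB fun x hx => ?_
    have h1 := b1 x hx
    have h2 := b2 x hx
    have h3 := b3 x hx
    have h4 : (Complex.normSq (s + (x : ℂ)) : ℂ) = (s + x) * ((starRingEnd ℂ) s + x) := by
      rw [← Complex.mul_conj]; simp
    rw [h4] at h3 ⊢
    have h5 := right_ne_zero_of_mul h3
    field_simp
    ring
  rw [T, T, ofReal_D, Q, eA, eB]
  ring

theorem T_im {z : ℂ} (hz : Away A B z) : (W.T z).im = z.im * W.D z := by
  have i1 := W.intDivA (φ := fun x : ℝ => (x : ℂ) * z) (by fun_prop) (by fun_prop) hz.1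
  have i2 := W.intDivB (φ := fun x : ℝ => (x : ℂ)) (by fun_prop) (by fun_prop) hz.2
  rw [T, Complex.add_im, ← im_integral i1, ← im_integral i2, D, mul_sub,
    ← integral_const_mul, ← integral_const_mul, sub_eq_add_neg, ← integral_neg]
  congr 1
  · refine W.congrA fun x hx => ?_
    have := hz.normSq_pos_left hx
    simp [Complex.div_im]
    field_simp
    ring
  · refine W.congrB fun x hx => ?_
    have := hz.normSq_pos_right hx
    simp [Complex.div_im]
    field_simp

/-- Each integrand of `z Q(z, s)` is a nonnegative multiple of `z / (1 - xz)` or of `z / (z + y)`,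
and both have imaginary part of the sign of `Im z`. This positivity drives all the monotonicity
below. -/
theorem mul_Q_im {z s : ℂ} (hz : Away A B z) (hs : Away A B s) :
    (z * W.Q z s).im = z.im * W.Ps z s := by
  have a3 : ∀ x ∈ A, (Complex.normSq (1 - (x : ℂ) * s) : ℂ) ≠ 0 := fun x hx => by
    exact_mod_cast (hs.normSq_pos_left hx).ne'
  have b3 : ∀ x ∈ B, (Complex.normSq (s + (x : ℂ)) : ℂ) ≠ 0 := fun x hx => by
    exact_mod_cast (hs.normSq_pos_right hx).ne'
  have i1 := (W.intDivA (φ := fun x : ℝ => (x : ℂ) ^ 2) (by fun_prop) (by fun_prop)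
      fun x hx => mul_ne_zero (hz.1 x hx) (a3 x hx)).const_mul z
  have i2 := (W.intDivB (φ := fun x : ℝ => (x : ℂ)) (by fun_prop) (by fun_prop)
      fun x hx => mul_ne_zero (hz.2 x hx) (b3 x hx)).const_mul z
  rw [Q, mul_add, ← integral_const_mul, ← integral_const_mul, Complex.add_im,
    ← im_integral i1, ← im_integral i2, Ps, mul_add, ← integral_const_mul,
    ← integral_const_mul]
  congr 1
  · refine W.congrA fun x hx => ?_
    have h1 := hz.normSq_pos_left hx
    have h2 := hs.normSq_pos_left hx
    have e : z * ((x : ℂ) ^ 2 / ((1 - x * z) * (Complex.normSq (1 - x * s) : ℝ))) =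
      ((x ^ 2 / Complex.normSq (1 - x * s) : ℝ) : ℂ) * (z / (1 - x * z)) := by
      push_cast; field_simp
    rw [e, Complex.im_ofReal_mul, Complex.div_im]
    simp
    field_simp
    ring
  · refine W.congrB fun x hx => ?_
    have h1 := hz.normSq_pos_right hx
    have h2 := hs.normSq_pos_right hx
    have e : z * ((x : ℂ) / ((z + x) * (Complex.normSq (s + x) : ℝ))) =
      ((x / Complex.normSq (s + x) : ℝ) : ℂ) * (z / (z + x)) := by
      push_cast; field_simp
    rw [e, Complex.im_ofReal_mul, Complex.div_im]
    simp
    field_simp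
    ring

/-- For fixed modulus the squared distances are affine in the real part, with slopes of opposite
sign for the two measures, which enter `D` with opposite signs. -/
theorem D_sub_of_norm_eq {z s : ℂ} (hz : Away A B z) (hs : Away A B s) (h : ‖z‖ = ‖s‖) :
    W.D z - W.D s = 2 * (z.re - s.re) * W.Ps z s := by
  have hn : z.re * z.re + z.im * z.im = s.re * s.re + s.im * s.im := by
    rw [← Complex.normSq_apply, ← Complex.normSq_apply, Complex.normSq_eq_norm_sq,
      Complex.normSq_eq_norm_sq, h]
  have a1 := fun x hx => (hz.normSq_pos_left (x := x) hx).ne'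
  have a2 := fun x hx => (hs.normSq_pos_left (x := x) hx).ne'
  have b1 := fun x hx => (hz.normSq_pos_right (y := x) hx).ne'
  have b2 := fun x hx => (hs.normSq_pos_right (y := x) hx).ne'
  have i1 := W.intDivA (φ := fun x : ℝ => x) (by fun_prop) (by fun_prop) a1
  have i2 := W.intDivA (φ := fun x : ℝ => x) (by fun_prop) (by fun_prop) a2
  have i3 := W.intDivB (φ := fun x : ℝ => x) (by fun_prop) (by fun_prop) b1
  have i4 := W.intDivB (φ := fun x : ℝ => x) (by fun_prop) (by fun_prop) b2
  have eA : (∫ x, x / Complex.normSq (1 - x * z) ∂W.μ) - ∫ x, x / Complex.normSq (1 - x * s) ∂W.μ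
      = 2 * (z.re - s.re) *
        ∫ x, x ^ 2 / (Complex.normSq (1 - x * z) * Complex.normSq (1 - x * s)) ∂W.μ := by
    rw [← integral_const_mul, ← integral_sub i1 i2]
    refine W.congrA fun x hx => ?_
    have h1 := a1 x hx
    have h2 := a2 x hx
    have h3 : Complex.normSq (1 - x * s) - Complex.normSq (1 - x * z) = 2 * x * (z.re - s.re) := by
      simp only [Complex.normSq_apply, Complex.sub_re, Complex.sub_im, Complex.one_re,
        Complex.one_im, Complex.re_ofReal_mul, Complex.im_ofReal_mul]
      linear_combination (-x ^ 2) * hn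
    field_simp
    linear_combination x * h3
  have eB : (∫ y, y / Complex.normSq (z + y) ∂W.ν) - ∫ y, y / Complex.normSq (s + y) ∂W.ν
      = -(2 * (z.re - s.re)) *
        ∫ y, y ^ 2 / (Complex.normSq (z + y) * Complex.normSq (s + y)) ∂W.ν := by
    rw [← integral_const_mul, ← integral_sub i3 i4]
    refine W.congrB fun x hx => ?_
    have h1 := b1 x hx
    have h2 := b2 x hx
    have h3 : Complex.normSq (s + x) - Complex.normSq (z + x) = -(2 * x * (z.re - s.re)) := by
      simp only [Complex.normSq_apply, Complex.add_re, Complex.add_im, Complex.ofReal_re,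
        Complex.ofReal_im]
      linear_combination -hn
    field_simp
    linear_combination x * h3
  rw [D, D, Ps]
  linear_combination eA - eB

theorem integral_nonnegA {φ : ℝ → ℝ} (h : ∀ x ∈ A, 0 ≤ φ x) : 0 ≤ ∫ x, φ x ∂W.μ :=
  integral_nonneg_of_ae ((ae_mem_carried W.hA W.μA).mono h)

theorem integral_nonnegB {φ : ℝ → ℝ} (h : ∀ x ∈ B, 0 ≤ φ x) : 0 ≤ ∫ x, φ x ∂W.ν :=
  integral_nonneg_of_ae ((ae_mem_carried W.hB W.νB).mono h)

theorem add_integral_pos (hW : W.Nontriv) {φ ψ : ℝ → ℝ} (hφ : Integrable φ W.μ)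
    (hψ : Integrable ψ W.ν) (h0 : ∀ x ∈ A, 0 ≤ φ x) (h0' : ∀ x ∈ B, 0 ≤ ψ x)
    (h : ∀ x ∈ A, 0 < x → 0 < φ x) (h' : ∀ x ∈ B, 0 < x → 0 < ψ x) :
    0 < (∫ x, φ x ∂W.μ) + ∫ y, ψ y ∂W.ν := by
  have n1 := W.integral_nonnegA h0
  have n2 := W.integral_nonnegB h0'
  have n3 := W.integral_nonnegA W.A0
  by_cases hpos : 0 < ∫ x, x ∂W.μ
  · linarith [integral_pos_of_carried W.hA W.μA W.A0 hφ h0 h hpos]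
  · have : 0 < ∫ y, y ∂W.ν := by
      unfold Nontriv at hW
      linarith
    linarith [integral_pos_of_carried W.hB W.νB W.B0 hψ h0' h' this]

theorem Ps_pos (hW : W.Nontriv) {z s : ℂ} (hz : Away A B z) (hs : Away A B s) :
    0 < W.Ps z s := by
  refine add_integral_pos hW
    (W.intDivA (by fun_prop) (by fun_prop) fun x hx =>
      (mul_pos (hz.normSq_pos_left hx) (hs.normSq_pos_left hx)).ne')
    (W.intDivB (by fun_prop) (by fun_prop) fun x hx =>
      (mul_pos (hz.normSq_pos_right hx) (hs.normSq_pos_right hx)).ne')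
    (fun x hx => ?_) (fun x hx => ?_) (fun x hx h0 => ?_) (fun x hx h0 => ?_)
  · exact div_nonneg (sq_nonneg _) (mul_nonneg (Complex.normSq_nonneg _) (Complex.normSq_nonneg _))
  · exact div_nonneg (sq_nonneg _) (mul_nonneg (Complex.normSq_nonneg _) (Complex.normSq_nonneg _))
  · exact div_pos (by positivity) (mul_pos (hz.normSq_pos_left hx) (hs.normSq_pos_left hx))
  · exact div_pos (by positivity) (mul_pos (hz.normSq_pos_right hx) (hs.normSq_pos_right hx))

/-- Two points of the critical set: the smaller modulus has the larger value of `T`. -/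
theorem T_strictAnti (hW : W.Nontriv) {z s : ℂ} (hz : 0 < z.im) (hs : Away A B s)
    (hDz : W.D z = 0) (hDs : W.D s = 0) (h1 : z ≠ s) (h2 : z ≠ (starRingEnd ℂ) s) :
    0 < ((W.T z).re - (W.T s).re) * (‖s‖ ^ 2 - ‖z‖ ^ 2) := by
  have hza := away_of_im_pos (A := A) (B := B) hz
  have hz0 : z ≠ 0 := by rintro rfl; simp at hz
  have e1 := T_sub (W := W) hza hs
  rw [hDs, Complex.ofReal_zero, mul_zero, add_zero] at e1
  have imz : (W.T z).im = 0 := by rw [T_im hza, hDz, mul_zero]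
  have ims : (W.T s).im = 0 := by rw [T_im hs, hDs, mul_zero]
  have e2 : W.T z - W.T s = (((W.T z).re - (W.T s).re : ℝ) : ℂ) := by
    apply Complex.ext <;> simp [imz, ims]
  set τ := (W.T z).re - (W.T s).re with hτ
  have hp1 : z - s ≠ 0 := sub_ne_zero.2 h1
  have hp2 : z - (starRingEnd ℂ) s ≠ 0 := sub_ne_zero.2 h2
  have e3 : (τ : ℂ) = (z - s) * (z - (starRingEnd ℂ) s) * W.Q z s := by
    rw [← e2, e1]; ring
  have e4 : (z * W.Q z s).im = z.im * W.Ps z s := mul_Q_im hza hs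
  have hP := Ps_pos hW hza hs
  set P := (z - s) * (z - (starRingEnd ℂ) s) with hPdef
  have hP0 : P ≠ 0 := mul_ne_zero hp1 hp2
  have e5 : z * W.Q z s = τ * (z / P) := by
    rw [e3]; field_simp
  rw [e5, Complex.im_ofReal_mul, Complex.div_im] at e4
  have hN : 0 < Complex.normSq P := Complex.normSq_pos.2 hP0
  have hPre : P.re = z.re ^ 2 - z.im ^ 2 - 2 * s.re * z.re + (s.re ^ 2 + s.im ^ 2) := by
    simp [hPdef]; ring
  have hPim : P.im = 2 * z.re * z.im - 2 * s.re * z.im := by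
    simp [hPdef]; ring
  have e6 : ‖s‖ ^ 2 - ‖z‖ ^ 2 = s.re ^ 2 + s.im ^ 2 - (z.re ^ 2 + z.im ^ 2) := by
    rw [← Complex.normSq_eq_norm_sq, ← Complex.normSq_eq_norm_sq, Complex.normSq_apply,
      Complex.normSq_apply]
    ring
  -- The point is the identity `Im (z · conj P) = Im z (|s|² - |z|²)` for `P = (z - s)(z - conj s)`:
  -- the difference of the critical values inherits the sign of the difference of the squared
  -- moduli.
  have e7 : τ * (z.im * P.re / Complex.normSq P - z.re * P.im / Complex.normSq P) =
      z.im * (τ * (‖s‖ ^ 2 - ‖z‖ ^ 2)) / Complex.normSq P := by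
    rw [e6, hPre, hPim]
    ring
  rw [e7, div_eq_iff hN.ne', mul_assoc] at e4
  rw [mul_left_cancel₀ hz.ne' e4]
  positivity

end Weights

end

end DualSchur

namespace DualSchur

noncomputable section

theorem integrable_re {m : Measure ℝ} {φ : ℝ → ℂ} (h : Integrable φ m) :
    Integrable (fun x => (φ x).re) m := h.re

namespace Weights

variable {A B : Set ℝ} {W : Weights A B}

/-! ### The symmetry `z ↦ -1/z` -/

theorem normSq_swap_left {z : ℂ} (hz : z ≠ 0) (y : ℝ) :
    Complex.normSq (1 - (y : ℂ) * (-z⁻¹)) = Complex.normSq (z + y) / Complex.normSq z := by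
  rw [← Complex.normSq_div]
  congr 1
  field_simp
  ring

theorem normSq_swap_right {z : ℂ} (hz : z ≠ 0) (x : ℝ) :
    Complex.normSq (-z⁻¹ + (x : ℂ)) = Complex.normSq (1 - x * z) / Complex.normSq z := by
  rw [← Complex.normSq_div, ← Complex.normSq_neg]
  congr 1
  field_simp
  ring

theorem T_swap {z : ℂ} (hz : Away A B z) (h0 : z ≠ 0) : W.swap.T (-z⁻¹) = -W.T z := by
  have h := hz.swap h0
  rw [T, T, neg_add, ← integral_neg, ← integral_neg, add_comm]
  congr 1
  · refine W.congrA fun x hx => ?_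
    have h1 := hz.1 x hx
    have h2 := h.2 x hx
    rw [div_eq_iff h2]
    field_simp
    ring
  · refine W.congrB fun x hx => ?_
    have h1 := hz.2 x hx
    have h2 := h.1 x hx
    rw [div_eq_iff h2]
    field_simp
    ring

theorem D_swap {z : ℂ} (hz : Away A B z) (h0 : z ≠ 0) :
    W.swap.D (-z⁻¹) = -(Complex.normSq z * W.D z) := by
  have hn : Complex.normSq z ≠ 0 := (Complex.normSq_pos.2 h0).ne'
  rw [D, D, mul_sub, neg_sub, ← integral_const_mul, ← integral_const_mul]
  congr 1
  · refine W.congrB fun x hx => ?_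
    have h1 := (hz.normSq_pos_right hx).ne'
    rw [normSq_swap_left h0]
    field_simp
  · refine W.congrA fun x hx => ?_
    have h1 := (hz.normSq_pos_left hx).ne'
    rw [normSq_swap_right h0]
    field_simp

/-- In general the transformed integrals carry an additional multiple of `D s`; it drops out at a
critical point. -/
theorem Q_swap {z s : ℂ} (hz : Away A B z) (hs : Away A B s) (hz0 : z ≠ 0) (hs0 : s ≠ 0)
    (hD : W.D s = 0) :
    W.swap.Q (-z⁻¹) (-s⁻¹) = -(z ^ 2 * Complex.normSq s * W.Q z s) := by
  have h := hz.swap hz0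
  have hn : (Complex.normSq s : ℂ) ≠ 0 := by exact_mod_cast (Complex.normSq_pos.2 hs0).ne'
  have a3 : ∀ x ∈ A, (Complex.normSq (1 - (x : ℂ) * s) : ℂ) ≠ 0 := fun x hx => by
    exact_mod_cast (hs.normSq_pos_left hx).ne'
  have b3 : ∀ x ∈ B, (Complex.normSq (s + (x : ℂ)) : ℂ) ≠ 0 := fun x hx => by
    exact_mod_cast (hs.normSq_pos_right hx).ne'
  have i1 := (W.intDivA (φ := fun x : ℝ => (x : ℂ) ^ 2) (by fun_prop) (by fun_prop)
      fun x hx => mul_ne_zero (hz.1 x hx) (a3 x hx)).const_mul (-(z ^ 2 * Complex.normSq s))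
  have i2 := (W.intDivA (φ := fun x : ℝ => (x : ℂ)) (by fun_prop) (by fun_prop) a3).const_mul
      (-(z * Complex.normSq s))
  have i3 := (W.intDivB (φ := fun x : ℝ => (x : ℂ)) (by fun_prop) (by fun_prop)
      fun x hx => mul_ne_zero (hz.2 x hx) (b3 x hx)).const_mul (-(z ^ 2 * Complex.normSq s))
  have i4 := (W.intDivB (φ := fun x : ℝ => (x : ℂ)) (by fun_prop) (by fun_prop) b3).const_mul
      (z * Complex.normSq s)
  have eA : (∫ x, (x : ℂ) / ((-z⁻¹ + x) * (Complex.normSq (-s⁻¹ + x) : ℝ)) ∂W.μ) =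
      -(z ^ 2 * Complex.normSq s) *
        (∫ x, (x : ℂ) ^ 2 / ((1 - x * z) * (Complex.normSq (1 - x * s) : ℝ)) ∂W.μ) +
      -(z * Complex.normSq s) * ∫ x, (x : ℂ) / (Complex.normSq (1 - x * s) : ℝ) ∂W.μ := by
    rw [← integral_const_mul, ← integral_const_mul, ← integral_add i1 i2]
    refine W.congrA fun x hx => ?_
    have h1 := hz.1 x hx
    have h2 := a3 x hx
    rw [normSq_swap_right hs0, show -z⁻¹ + (x : ℂ) = -(1 - x * z) / z by field_simp; ring]
    push_cast
    field_simp
    ring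
  have eB : (∫ y, (y : ℂ) ^ 2 / ((1 - y * (-z⁻¹)) * (Complex.normSq (1 - y * (-s⁻¹)) : ℝ)) ∂W.ν) =
      -(z ^ 2 * Complex.normSq s) *
        (∫ y, (y : ℂ) / ((z + y) * (Complex.normSq (s + y) : ℝ)) ∂W.ν) +
      (z * Complex.normSq s) * ∫ y, (y : ℂ) / (Complex.normSq (s + y) : ℝ) ∂W.ν := by
    rw [← integral_const_mul, ← integral_const_mul, ← integral_add i3 i4]
    refine W.congrB fun x hx => ?_
    have h1 := hz.2 x hx
    have h2 := b3 x hx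
    rw [normSq_swap_left hs0, show 1 - (x : ℂ) * (-z⁻¹) = (z + x) / z by field_simp; ring]
    push_cast
    field_simp
    ring
  have hD' := W.ofReal_D s
  rw [hD, Complex.ofReal_zero] at hD'
  change (∫ y, (y : ℂ) ^ 2 / ((1 - y * (-z⁻¹)) * (Complex.normSq (1 - y * (-s⁻¹)) : ℝ)) ∂W.ν) +
    (∫ x, (x : ℂ) / ((-z⁻¹ + x) * (Complex.normSq (-s⁻¹ + x) : ℝ)) ∂W.μ) = _
  rw [eA, eB, Q]
  linear_combination (z * Complex.normSq s) * hD'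

/-! ### Continuity and differentiability -/

theorem continuousOn_Q : ContinuousOn (fun p : ℂ × ℂ => W.Q p.1 p.2)
    {p | Away A B p.1 ∧ Away A B p.2} := by
  refine (continuousOn_integral_carried W.hA W.μA ?_).add
    (continuousOn_integral_carried W.hB W.νB ?_)
  · refine ContinuousOn.div (by fun_prop) (by fun_prop) ?_
    rintro ⟨p, x⟩ ⟨hp, hx⟩
    exact mul_ne_zero (hp.1.1 x hx) (by exact_mod_cast (hp.2.normSq_pos_left hx).ne')
  · refine ContinuousOn.div (by fun_prop) (by fun_prop) ?_
    rintro ⟨p, x⟩ ⟨hp, hx⟩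
    exact mul_ne_zero (hp.1.2 x hx) (by exact_mod_cast (hp.2.normSq_pos_right hx).ne')

theorem continuousAt_Q {z s : ℂ} (hz : Away A B z) (hs : Away A B s) :
    ContinuousAt (fun p : ℂ × ℂ => W.Q p.1 p.2) (z, s) :=
  continuousOn_Q.continuousAt
    ((W.isOpen_away.prod W.isOpen_away).mem_nhds (x := (z, s)) ⟨hz, hs⟩)

theorem continuousOn_D : ContinuousOn W.D {z | Away A B z} := by
  refine (continuousOn_integral_carried W.hA W.μA ?_).sub
    (continuousOn_integral_carried W.hB W.νB ?_)
  · refine ContinuousOn.div (by fun_prop) (by fun_prop) ?_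
    rintro ⟨p, x⟩ ⟨hp, hx⟩
    exact (Away.normSq_pos_left hp hx).ne'
  · refine ContinuousOn.div (by fun_prop) (by fun_prop) ?_
    rintro ⟨p, x⟩ ⟨hp, hx⟩
    exact (Away.normSq_pos_right hp hx).ne'

theorem continuousAt_D {z : ℂ} (hz : Away A B z) : ContinuousAt W.D z :=
  continuousOn_D.continuousAt (W.isOpen_away.mem_nhds hz)

theorem continuousOn_U (t : ℝ) : ContinuousOn (W.U t) {z | Away A B z ∧ z ≠ 0} := by
  refine ((continuousOn_integral_carried W.hA W.μA ?_).neg.sub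
    (continuousOn_integral_carried W.hB W.νB ?_)).sub
    (continuousOn_const.mul (continuous_norm.continuousOn.log fun z hz => norm_ne_zero_iff.2 hz.2))
  · refine ContinuousOn.log (by fun_prop) ?_
    rintro ⟨p, x⟩ ⟨hp, hx⟩
    exact norm_ne_zero_iff.2 (hp.1.1 x hx)
  · refine ContinuousOn.log (ContinuousOn.norm (continuousOn_const.add (ContinuousOn.div
      (by fun_prop) (by fun_prop) fun p hp => hp.1.2))) ?_
    rintro ⟨p, x⟩ ⟨hp, hx⟩
    have h1 := hp.1.2 x hx
    have h2 := hp.2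
    refine norm_ne_zero_iff.2 ?_
    rw [show 1 + (x : ℂ) / p = (p + x) / p by field_simp]
    exact div_ne_zero h1 h2

theorem continuousAt_U {t : ℝ} {z : ℂ} (hz : Away A B z) (h0 : z ≠ 0) :
    ContinuousAt (W.U t) z :=
  (continuousOn_U t).continuousAt ((W.isOpen_away.inter isOpen_ne).mem_nhds ⟨hz, h0⟩)

/-- Read off from `T_sub` by letting `z` tend to `s`, using only continuity of `Q`. -/
theorem hasDerivAt_T {s : ℂ} (hs : Away A B s) :
    HasDerivAt W.T (W.D s + (s - (starRingEnd ℂ) s) * W.Q s s) s := by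
  rw [hasDerivAt_iff_tendsto_slope]
  have h1 : ContinuousAt (fun z => W.Q z s) s :=
    (continuousAt_Q hs hs).comp (f := fun z : ℂ => (z, s)) (by fun_prop)
  have h2 : ContinuousAt (fun z => (W.D s : ℂ) + (z - (starRingEnd ℂ) s) * W.Q z s) s := by
    fun_prop
  refine (h2.tendsto.mono_left nhdsWithin_le_nhds).congr' ?_
  filter_upwards [self_mem_nhdsWithin, nhdsWithin_le_nhds (W.isOpen_away.mem_nhds hs)] with z hz hza
  have : z - s ≠ 0 := sub_ne_zero.2 hz
  rw [slope_def_field, T_sub hza hs]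
  field_simp
  ring

theorem differentiableOn_T : DifferentiableOn ℂ W.T {z | Away A B z} :=
  fun _ hz => (hasDerivAt_T hz).differentiableAt.differentiableWithinAt

theorem continuousAt_T {z : ℂ} (hz : Away A B z) : ContinuousAt W.T z :=
  (hasDerivAt_T hz).continuousAt

/-- Along circles about `0` the imaginary part of `T` decreases through its zeros. -/
theorem re_mul_deriv_T_neg (hW : W.Nontriv) {s : ℂ} (hs : 0 < s.im) :
    (s * ((s - (starRingEnd ℂ) s) * W.Q s s)).re < 0 := by
  have ha := away_of_im_pos (A := A) (B := B) hs
  have h := mul_Q_im (W := W) ha ha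
  have hP := Ps_pos hW ha ha
  have e : s * ((s - (starRingEnd ℂ) s) * W.Q s s) =
      ((2 * s.im : ℝ) : ℂ) * (Complex.I * (s * W.Q s s)) := by
    rw [Complex.sub_conj]; push_cast; ring
  rw [e, Complex.re_ofReal_mul, Complex.I_mul_re, h]
  have := mul_pos hs (mul_pos hs hP)
  nlinarith

/-! ### The real interval between the poles -/

theorem Q_real_pos (hW : W.Nontriv) {r s : ℝ} (hr : In0 A B r) (hs : In0 A B s) :
    ∃ q : ℝ, 0 < q ∧ W.Q r s = q := by
  have h1 := fun x hx => hs.away.normSq_pos_left (x := x) hx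
  have h2 := fun x hx => hs.away.normSq_pos_right (y := x) hx
  have h3 : ∀ x ∈ A, 0 < 1 - x * r := fun x hx => by linarith [hr.1 x hx]
  refine ⟨(∫ x, x ^ 2 / ((1 - x * r) * (Complex.normSq (1 - x * s))) ∂W.μ) +
    ∫ y, y / ((r + y) * (Complex.normSq (s + y))) ∂W.ν, ?_, ?_⟩
  · refine add_integral_pos hW
      (W.intDivA (by fun_prop) (by fun_prop) fun x hx => (mul_pos (h3 x hx) (h1 x hx)).ne')
      (W.intDivB (by fun_prop) (by fun_prop) fun x hx => (mul_pos (hr.2 x hx) (h2 x hx)).ne')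
      (fun x hx => div_nonneg (sq_nonneg _) (mul_pos (h3 x hx) (h1 x hx)).le)
      (fun x hx => div_nonneg (W.B0 x hx) (mul_pos (hr.2 x hx) (h2 x hx)).le)
      (fun x hx h0 => div_pos (by positivity) (mul_pos (h3 x hx) (h1 x hx)))
      (fun x hx h0 => div_pos (by positivity) (mul_pos (hr.2 x hx) (h2 x hx)))
  · rw [Q, Complex.ofReal_add, ← integral_complex_ofReal, ← integral_complex_ofReal]
    push_cast
    rfl

theorem T_eq_In0 (hW : W.Nontriv) {r s : ℝ} (hr : In0 A B r) (hs : In0 A B s) :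
    ∃ q : ℝ, 0 < q ∧ (W.T r).re = (W.T s).re + (r - s) * W.D s + (r - s) ^ 2 * q := by
  obtain ⟨q, hq, h⟩ := Q_real_pos hW hr hs
  refine ⟨q, hq, ?_⟩
  have := congrArg Complex.re (T_sub (W := W) hr.away hs.away)
  rw [h, Complex.conj_ofReal] at this
  have e : (W.T s + ((r : ℂ) - s) * W.D s + ((r : ℂ) - s) * ((r : ℂ) - s) * q) =
      W.T s + (((r - s) * W.D s + (r - s) ^ 2 * q : ℝ) : ℂ) := by push_cast; ring
  rw [this, e, Complex.add_re, Complex.ofReal_re]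
  ring

theorem T_lt_of_In0 (hW : W.Nontriv) {r s : ℝ} (hr : In0 A B r) (hs : In0 A B s)
    (hD : W.D s = 0) (h : r ≠ s) : (W.T s).re < (W.T r).re := by
  obtain ⟨q, hq, e⟩ := T_eq_In0 hW hr hs
  have := sub_ne_zero.2 h
  rw [e, hD]
  have : 0 < (r - s) ^ 2 * q := by positivity
  linarith

/-- Adding the expansions of `T` about `s` and about `r` cancels the values and leaves `(r - s) D r
= (r - s)² (q + q')` with positive `q`, `q'`. In particular there is at most one critical point
between the poles. -/
theorem D_sign_of_In0 (hW : W.Nontriv) {r s : ℝ} (hr : In0 A B r) (hs : In0 A B s)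
    (hD : W.D s = 0) (h : r ≠ s) : 0 < (r - s) * W.D r := by
  obtain ⟨q, hq, e⟩ := T_eq_In0 hW hr hs
  obtain ⟨q', hq', e'⟩ := T_eq_In0 hW hs hr
  have := sub_ne_zero.2 h
  rw [hD] at e
  have : 0 < (r - s) ^ 2 * (q + q') := by positivity
  nlinarith

theorem one_add_mul_pos (hA : A.Nonempty) (hB : B.Nonempty) {r v : ℝ} (W : Weights A B)
    (hr : In0 A B r) (hv : In0 B A v) : 0 < 1 + r * v := by
  obtain ⟨x, hx⟩ := hA
  obtain ⟨y, hy⟩ := hB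
  have h1 := hr.1 x hx
  have h2 := hr.2 y hy
  have h3 := hv.1 y hy
  have h4 := hv.2 x hx
  have := W.A0 x hx
  have := W.B0 y hy
  rcases le_total 0 r with h | h <;> rcases le_total 0 v with h' | h' <;> nlinarith

/-- Put over a common denominator, the integrands are positive multiples of `1 + r v`, whose sign is
`one_add_mul_pos`. With `v = -1/z` this compares the two critical values and decides which root
belongs to `x₊`. -/
theorem T_add_swap_pos (hW : W.Nontriv) (hA : A.Nonempty) (hB : B.Nonempty) {r v : ℝ}
    (hr : In0 A B r) (hv : In0 B A v) : 0 < (W.T r).re + (W.swap.T v).re := by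
  have h0 := one_add_mul_pos hA hB W hr hv
  have a1 : ∀ x ∈ A, 0 < 1 - x * r := fun x hx => by linarith [hr.1 x hx]
  have b1 : ∀ y ∈ B, 0 < 1 - y * v := fun x hx => by linarith [hv.1 x hx]
  have i1 := W.intDivA (φ := fun x : ℝ => (x : ℂ) * r) (by fun_prop) (by fun_prop) hr.away.1
  have i2 := W.intDivB (φ := fun x : ℝ => (x : ℂ)) (by fun_prop) (by fun_prop) hr.away.2
  have i3 := W.swap.intDivA (φ := fun x : ℝ => (x : ℂ) * v) (by fun_prop) (by fun_prop) hv.away.1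
  have i4 := W.swap.intDivB (φ := fun x : ℝ => (x : ℂ)) (by fun_prop) (by fun_prop) hv.away.2
  have e : (W.T r).re + (W.swap.T v).re =
      (∫ x, x * (1 + r * v) / ((1 - x * r) * (v + x)) ∂W.μ) +
        ∫ y, y * (1 + r * v) / ((r + y) * (1 - y * v)) ∂W.ν := by
    have e1 : (W.T r).re + (W.swap.T v).re = (∫ x, (x * r / (1 - x * r : ℂ)).re ∂W.μ +
        ∫ x, (x / (v + x : ℂ)).re ∂W.μ) + (∫ y, (y / (r + y : ℂ)).re ∂W.ν +
        ∫ y, (y * v / (1 - y * v : ℂ)).re ∂W.ν) := by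
      rw [re_integral i1, re_integral i2, re_integral (m := W.ν) i3, re_integral (m := W.μ) i4, T, T]
      simp only [swap, Complex.add_re]
      ring
    rw [e1, ← integral_add (integrable_re i1) (integrable_re (m := W.μ) i4),
      ← integral_add (integrable_re i2) (integrable_re (m := W.ν) i3)]
    congr 1
    · refine W.congrA fun x hx => ?_
      have h1 := (a1 x hx).ne'
      have h2 := (hv.2 x hx).ne'
      norm_cast
      field_simp
      ring
    · refine W.congrB fun x hx => ?_
      have h1 := (b1 x hx).ne'
      have h2 := (hr.2 x hx).ne'
      norm_cast
      field_simp
      ring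
  rw [e]
  refine add_integral_pos hW
      (W.intDivA (by fun_prop) (by fun_prop) fun x hx => (mul_pos (a1 x hx) (hv.2 x hx)).ne')
      (W.intDivB (by fun_prop) (by fun_prop) fun x hx => (mul_pos (hr.2 x hx) (b1 x hx)).ne')
      (fun x hx => div_nonneg (mul_nonneg (W.A0 x hx) h0.le) (mul_pos (a1 x hx) (hv.2 x hx)).le)
      (fun x hx => div_nonneg (mul_nonneg (W.B0 x hx) h0.le) (mul_pos (hr.2 x hx) (b1 x hx)).le)
      (fun x hx h => div_pos (by positivity) (mul_pos (a1 x hx) (hv.2 x hx)))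
      (fun x hx h => div_pos (by positivity) (mul_pos (hr.2 x hx) (b1 x hx)))

/-- The combination `T - r D` has integrands `-r² x² / (1 - xr)²` and `1 - r² / (r + y)²`. Hence the
critical value is at most the mass of `ν`, with equality only at `r = 0`. -/
theorem T_In0_eq (hW : W.Nontriv) {r : ℝ} (hr : In0 A B r) (hD : W.D r = 0) :
    ∃ q : ℝ, 0 < q ∧ (W.T r).re = W.ν.real univ - r ^ 2 * q := by
  have a1 : ∀ x ∈ A, 1 - x * r ≠ 0 := fun x hx => by linarith [hr.1 x hx]
  have b1 : ∀ x ∈ B, r + x ≠ 0 := fun x hx => (hr.2 x hx).ne'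
  have a2 : ∀ x ∈ A, (1 - x * r) ^ 2 ≠ 0 := fun x hx => pow_ne_zero _ (a1 x hx)
  have b2 : ∀ x ∈ B, (r + x) ^ 2 ≠ 0 := fun x hx => pow_ne_zero _ (b1 x hx)
  have i1 := W.intDivA (φ := fun x : ℝ => (x : ℂ) * r) (by fun_prop) (by fun_prop) hr.away.1
  have i2 := W.intDivB (φ := fun x : ℝ => (x : ℂ)) (by fun_prop) (by fun_prop) hr.away.2
  have i3 := (W.intDivA (φ := fun x : ℝ => x) (by fun_prop) (by fun_prop) a2).const_mul r
  have i4 := (W.intDivA (φ := fun x : ℝ => x ^ 2) (by fun_prop) (by fun_prop) a2).const_mul (r ^ 2)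
  have i5 := (W.intDivB (φ := fun x : ℝ => x) (by fun_prop) (by fun_prop) b2).const_mul r
  have i6 := (W.intDivB (φ := fun x : ℝ => (1 : ℝ)) (by fun_prop) (by fun_prop) b2).const_mul (r ^ 2)
  refine ⟨(∫ x, x ^ 2 / (1 - x * r) ^ 2 ∂W.μ) + ∫ y, 1 / (r + y) ^ 2 ∂W.ν, ?_, ?_⟩
  · refine add_integral_pos hW (W.intDivA (by fun_prop) (by fun_prop) a2)
      (W.intDivB (by fun_prop) (by fun_prop) b2) (fun x hx => by positivity)
      (fun x hx => by positivity) (fun x hx h => ?_) (fun x hx h => ?_)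
    · have := a2 x hx; positivity
    · have := b2 x hx; positivity
  · have eD : W.D r = (∫ x, x / (1 - x * r) ^ 2 ∂W.μ) - ∫ y, y / (r + y) ^ 2 ∂W.ν := by
      simp only [D]
      congr 2 <;> ext x <;> norm_cast <;> rw [Complex.normSq_ofReal, sq]
    rw [hD] at eD
    have e1 : (∫ x, (x * r / (1 - x * r : ℂ)).re ∂W.μ) =
        r * (∫ x, x / (1 - x * r) ^ 2 ∂W.μ) - r ^ 2 * ∫ x, x ^ 2 / (1 - x * r) ^ 2 ∂W.μ := by
      rw [← integral_const_mul, ← integral_const_mul, ← integral_sub i3 i4]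
      refine W.congrA fun x hx => ?_
      have := a1 x hx
      norm_cast
      field_simp
    have e2 : (∫ y, (y / (r + y : ℂ)).re ∂W.ν) =
        W.ν.real univ - r * (∫ x, x / (r + x) ^ 2 ∂W.ν) - r ^ 2 * ∫ x, 1 / (r + x) ^ 2 ∂W.ν := by
      have i7 : Integrable (fun _ : ℝ => (1 : ℝ)) W.ν := integrable_const 1
      have i8 : Integrable (fun x : ℝ => 1 - r * (x / (r + x) ^ 2)) W.ν := i7.sub i5
      rw [← integral_const_mul, ← integral_const_mul,
        show W.ν.real univ = ∫ _, (1 : ℝ) ∂W.ν by simp, ← integral_sub i7 i5,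
        ← integral_sub i8 i6]
      refine W.congrB fun x hx => ?_
      have := b1 x hx
      norm_cast
      field_simp
      ring
    rw [T, Complex.add_re, ← re_integral i1, ← re_integral i2, e1, e2]
    linear_combination (-r) * eD

end Weights

end

end DualSchur

namespace DualSchur

noncomputable section

/-! ### The potential `U` -/

theorem hasDerivAt_log_norm {g : ℝ → ℂ} {g' : ℂ} {ρ : ℝ} (h : HasDerivAt g g' ρ) (h0 : g ρ ≠ 0) :
    HasDerivAt (fun ρ => Real.log ‖g ρ‖) (g' / g ρ).re ρ := by
  have h1 : HasDerivAt (fun ρ => (g ρ).re) g'.re ρ :=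
    Complex.reCLM.hasFDerivAt.comp_hasDerivAt ρ h
  have h2 : HasDerivAt (fun ρ => (g ρ).im) g'.im ρ :=
    Complex.imCLM.hasFDerivAt.comp_hasDerivAt ρ h
  have hN : 0 < Complex.normSq (g ρ) := Complex.normSq_pos.2 h0
  have h3 : HasDerivAt (fun ρ => Complex.normSq (g ρ))
      (g'.re * (g ρ).re + (g ρ).re * g'.re + (g'.im * (g ρ).im + (g ρ).im * g'.im)) ρ := by
    simp only [Complex.normSq_apply]
    exact (h1.mul h1).add (h2.mul h2)
  have h4 := (h3.log hN.ne').div_const 2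
  have e : (fun ρ => Real.log ‖g ρ‖) = fun ρ => Real.log (Complex.normSq (g ρ)) / 2 := by
    ext ρ
    rw [Complex.normSq_eq_norm_sq, Real.log_pow]
    push_cast
    ring
  rw [e]
  refine h4.congr_deriv ?_
  rw [Complex.div_re]
  field_simp
  ring

theorem hasDerivAt_integral_carried {m : Measure ℝ} [IsFiniteMeasure m] {A : Set ℝ}
    (hA : IsCompact A) (hm : m.restrict A = m) {F F' : ℝ → ℝ → ℝ} {O : Set ℝ} {ρ : ℝ}
    (hO : O ∈ 𝓝 ρ) (hF : ∀ r ∈ O, ContinuousOn (F r) A)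
    (hF' : ContinuousOn (Function.uncurry F') (O ×ˢ A))
    (hd : ∀ r ∈ O, ∀ x ∈ A, HasDerivAt (fun r => F r x) (F' r x) r) :
    HasDerivAt (fun r => ∫ x, F r x ∂m) (∫ x, F' ρ x ∂m) ρ := by
  have hρ := mem_of_mem_nhds hO
  obtain ⟨v, hv, h⟩ := hA.mem_uniformity_of_prod hF' hρ (Metric.dist_mem_uniformity one_pos)
  have hv' : v ∩ O ∈ 𝓝 ρ := by
    rw [nhdsWithin_eq_nhds.2 hO] at hv
    exact inter_mem hv hO
  have hae := ae_mem_carried hA hm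
  have hi := integrable_of_continuousOn_carried hA hm (continuousOn_section hF' hρ)
  refine (hasDerivAt_integral_of_dominated_loc_of_deriv_le (F' := F')
    (bound := fun x => ‖F' ρ x‖ + 1) hv' ?_ ?_ hi.aestronglyMeasurable ?_ ?_ ?_).2
  · filter_upwards [hO] with r hr
    exact (integrable_of_continuousOn_carried hA hm (hF r hr)).aestronglyMeasurable
  · exact integrable_of_continuousOn_carried hA hm (hF ρ hρ)
  · filter_upwards [hae] with x hx r hr
    have := h r hr.1 x hx
    simp only [mem_ofPred_eq, dist_eq_norm] at this
    linarith [norm_le_insert' (F' r x) (F' ρ x)]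
  · exact hi.norm.add (integrable_const 1)
  · filter_upwards [hae] with x hx r hr
    exact hd r hr.2 x hx

namespace Weights

variable {A B : Set ℝ} {W : Weights A B}

/-- Integrating `-log |1 - xz| - log |1 + y/z|` and differentiating reproduces the two integrals of
`T`, divided by `z`. -/
theorem hasDerivAt_U (t : ℝ) {z e : ℂ} {ρ : ℝ} (hz : Away A B (z + ρ * e)) (h0 : z + ρ * e ≠ 0) :
    HasDerivAt (fun r : ℝ => W.U t (z + r * e))
      (e * (W.T (z + ρ * e) - t) / (z + ρ * e)).re ρ := by
  have hg : ∀ r : ℝ, HasDerivAt (fun r : ℝ => z + (r : ℂ) * e) e r := fun r => by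
    simpa using ((Complex.ofRealCLM.hasDerivAt (x := r)).mul_const e).const_add z
  have hcont : Continuous fun r : ℝ => z + (r : ℂ) * e := by fun_prop
  set O : Set ℝ := {r : ℝ | Away A B (z + r * e) ∧ z + (r : ℂ) * e ≠ 0} with hOdef
  have hO : O ∈ 𝓝 ρ :=
    ((W.isOpen_away.inter isOpen_ne).preimage hcont).mem_nhds ⟨hz, h0⟩
  have n1 : ∀ r ∈ O, ∀ x ∈ A, 1 - (x : ℂ) * (z + r * e) ≠ 0 := fun r hr x hx => hr.1.1 x hx
  have n2 : ∀ r ∈ O, ∀ x ∈ B, 1 + (x : ℂ) / (z + r * e) ≠ 0 := fun r hr x hx => by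
    have h1 := hr.1.2 x hx
    have h2 := hr.2
    rw [show 1 + (x : ℂ) / (z + r * e) = (z + r * e + x) / (z + r * e) by field_simp]
    exact div_ne_zero h1 h2
  have d1 := hasDerivAt_integral_carried W.hA W.μA (ρ := ρ) hO
    (F := fun r x => Real.log ‖1 - (x : ℂ) * (z + r * e)‖)
    (F' := fun r x => (-(x * e) / (1 - (x : ℂ) * (z + r * e))).re)
    (fun r hr => ContinuousOn.log (by fun_prop) fun x hx => norm_ne_zero_iff.2 (n1 r hr x hx))
    (Complex.continuous_re.comp_continuousOn
      (ContinuousOn.div (by fun_prop) (by fun_prop) fun p hp => n1 p.1 hp.1 p.2 hp.2))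
    (fun r hr x hx => hasDerivAt_log_norm (((hg r).const_mul (x : ℂ)).const_sub 1) (n1 r hr x hx))
  have g2 : ∀ r ∈ O, ∀ x : ℝ, HasDerivAt (fun r : ℝ => 1 + (x : ℂ) / (z + r * e))
      (-(x * e) / (z + r * e) ^ 2) r := fun r hr x => by
    have := ((hasDerivAt_const r (x : ℂ)).fun_div (hg r) hr.2).const_add 1
    simpa only [zero_mul, zero_sub] using this
  have c2 : ContinuousOn (Function.uncurry fun r x : ℝ =>
      ((-(x * e) / (z + r * e) ^ 2) / (1 + (x : ℂ) / (z + r * e))).re) (O ×ˢ B) := by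
    refine Complex.continuous_re.comp_continuousOn (ContinuousOn.div ?_ ?_ ?_)
    · exact ContinuousOn.div (by fun_prop) (by fun_prop) fun p hp => pow_ne_zero 2 hp.1.2
    · exact continuousOn_const.add (ContinuousOn.div (by fun_prop) (by fun_prop) fun p hp => hp.1.2)
    · exact fun p hp => n2 p.1 hp.1 p.2 hp.2
  have d2 := hasDerivAt_integral_carried W.hB W.νB (ρ := ρ) hO
    (F := fun r x => Real.log ‖1 + (x : ℂ) / (z + r * e)‖)
    (F' := fun r x => ((-(x * e) / (z + r * e) ^ 2) / (1 + (x : ℂ) / (z + r * e))).re)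
    (fun r hr => ContinuousOn.log (by fun_prop) fun x hx => norm_ne_zero_iff.2 (n2 r hr x hx))
    c2 (fun r hr x hx => hasDerivAt_log_norm (g2 r hr x) (n2 r hr x hx))
  have d3 := (hasDerivAt_log_norm (hg ρ) h0).const_mul t
  refine ((d1.neg.sub d2).sub d3).congr_deriv ?_
  set w := z + (ρ : ℂ) * e with hw
  have i1 := W.intDivA (φ := fun x : ℝ => -(x * e)) (by fun_prop) (by fun_prop) hz.1
  have i2 := W.intDivB (φ := fun x : ℝ => (x : ℂ)) (by fun_prop) (by fun_prop) hz.2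
  have e2 : (∫ x, ((-((x : ℂ) * e) / w ^ 2) / (1 + (x : ℂ) / w)).re ∂W.ν) =
      ((-e / w) * ∫ y, (y : ℂ) / (w + y) ∂W.ν).re := by
    rw [← integral_const_mul, ← re_integral (i2.const_mul _)]
    refine W.congrB fun x hx => ?_
    congr 1
    have h1 := hz.2 x hx
    rw [show 1 + (x : ℂ) / w = (w + x) / w by field_simp]
    field_simp
  have e1 : (∫ x, (-((x : ℂ) * e) / (1 - (x : ℂ) * w)).re ∂W.μ) =
      ((-e / w) * ∫ x, (x : ℂ) * w / (1 - x * w) ∂W.μ).re := by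
    rw [← integral_const_mul, re_integral i1]
    congr 1
    refine W.congrA fun x hx => ?_
    have h1 := hz.1 x hx
    field_simp
  rw [e1, e2, T, ← Complex.re_ofReal_mul, ← Complex.neg_re, ← Complex.sub_re, ← Complex.sub_re]
  congr 1
  field_simp
  ring

/-- Concavity of the logarithm, applied to the squared norms because these are affine along circles.
-/
theorem log_norm_tangent {a b : ℂ} (ha : a ≠ 0) (hb : b ≠ 0) :
    Real.log ‖a‖ - Real.log ‖b‖ ≤ (Complex.normSq a - Complex.normSq b) / (2 * Complex.normSq b) := by
  have h1 := Complex.normSq_pos.2 ha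
  have h2 := Complex.normSq_pos.2 hb
  have h3 := Real.log_le_sub_one_of_pos (div_pos h1 h2)
  rw [Real.log_div h1.ne' h2.ne', Complex.normSq_eq_norm_sq, Complex.normSq_eq_norm_sq,
    Real.log_pow, Real.log_pow, ← Complex.normSq_eq_norm_sq, ← Complex.normSq_eq_norm_sq] at h3
  have e : (Complex.normSq a - Complex.normSq b) / (2 * Complex.normSq b) =
      (Complex.normSq a / Complex.normSq b - 1) / 2 := by field_simp
  rw [e]
  push_cast at h3
  linarith

/-- On circles about `0`, `U` lies above its tangents as a function of the real part. -/
theorem U_tangent (t : ℝ) {z s : ℂ} (hz : Away A B z) (hs : Away A B s) (hs0 : s ≠ 0)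
    (h : ‖z‖ = ‖s‖) : W.U t s + (z.re - s.re) * W.D s ≤ W.U t z := by
  have hz0 : z ≠ 0 := norm_ne_zero_iff.1 (h ▸ norm_ne_zero_iff.2 hs0)
  have hn : z.re * z.re + z.im * z.im = s.re * s.re + s.im * s.im := by
    rw [← Complex.normSq_apply, ← Complex.normSq_apply, Complex.normSq_eq_norm_sq,
      Complex.normSq_eq_norm_sq, h]
  have b0 : ∀ w : ℂ, Away A B w → w ≠ 0 → ∀ x ∈ B, 1 + (x : ℂ) / w ≠ 0 := fun w hw h0 x hx => by
    have h1 := hw.2 x hx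
    rw [show 1 + (x : ℂ) / w = (w + x) / w by field_simp]
    exact div_ne_zero h1 h0
  have cA : ∀ w : ℂ, Away A B w → Integrable (fun x : ℝ => Real.log ‖1 - (x : ℂ) * w‖) W.μ :=
    fun w hw => W.intA (ContinuousOn.log (by fun_prop) fun x hx => norm_ne_zero_iff.2 (hw.1 x hx))
  have cB : ∀ w : ℂ, Away A B w → w ≠ 0 →
      Integrable (fun x : ℝ => Real.log ‖1 + (x : ℂ) / w‖) W.ν := fun w hw h0 =>
    W.intB (ContinuousOn.log (by fun_prop) fun x hx => norm_ne_zero_iff.2 (b0 w hw h0 x hx))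
  have i1 := (W.intDivA (φ := fun x : ℝ => x) (by fun_prop) (by fun_prop)
    fun x hx => (hs.normSq_pos_left hx).ne').const_mul (-(z.re - s.re))
  have i2 := (W.intDivB (φ := fun x : ℝ => x) (by fun_prop) (by fun_prop)
    fun x hx => (hs.normSq_pos_right hx).ne').const_mul (z.re - s.re)
  have eA : (∫ x, Real.log ‖1 - (x : ℂ) * z‖ ∂W.μ) - (∫ x, Real.log ‖1 - (x : ℂ) * s‖ ∂W.μ) ≤
      -(z.re - s.re) * ∫ x, x / Complex.normSq (1 - x * s) ∂W.μ := by
    rw [← integral_sub (cA z hz) (cA s hs), ← integral_const_mul]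
    refine integral_mono_ae ((cA z hz).sub (cA s hs)) i1 ?_
    filter_upwards [ae_mem_carried W.hA W.μA] with x hx
    refine (log_norm_tangent (hz.1 x hx) (hs.1 x hx)).trans (le_of_eq ?_)
    have h2 := (hs.normSq_pos_left hx).ne'
    have h3 : Complex.normSq (1 - x * z) - Complex.normSq (1 - x * s) = -(2 * x * (z.re - s.re)) := by
      simp only [Complex.normSq_apply, Complex.sub_re, Complex.sub_im, Complex.one_re,
        Complex.one_im, Complex.re_ofReal_mul, Complex.im_ofReal_mul]
      linear_combination (x ^ 2) * hn
    rw [h3]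
    field_simp
  have eB : (∫ x, Real.log ‖1 + (x : ℂ) / z‖ ∂W.ν) - (∫ x, Real.log ‖1 + (x : ℂ) / s‖ ∂W.ν) ≤
      (z.re - s.re) * ∫ x, x / Complex.normSq (s + x) ∂W.ν := by
    rw [← integral_sub (cB z hz hz0) (cB s hs hs0), ← integral_const_mul]
    refine integral_mono_ae ((cB z hz hz0).sub (cB s hs hs0)) i2 ?_
    filter_upwards [ae_mem_carried W.hB W.νB] with x hx
    have e1 : ∀ w : ℂ, Away A B w → w ≠ 0 →
        Real.log ‖1 + (x : ℂ) / w‖ = Real.log ‖w + x‖ - Real.log ‖w‖ := fun w hw h0 => by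
      rw [show 1 + (x : ℂ) / w = (w + x) / w by field_simp, norm_div,
        Real.log_div (norm_ne_zero_iff.2 (hw.2 x hx)) (norm_ne_zero_iff.2 h0)]
    have h1 := log_norm_tangent (hz.2 x hx) (hs.2 x hx)
    have h2 := (hs.normSq_pos_right hx).ne'
    have h3 : Complex.normSq (z + x) - Complex.normSq (s + x) = 2 * x * (z.re - s.re) := by
      simp only [Complex.normSq_apply, Complex.add_re, Complex.add_im, Complex.ofReal_re,
        Complex.ofReal_im]
      linear_combination hn
    rw [e1 z hz hz0, e1 s hs hs0, h]
    have e2 : (Complex.normSq (z + x) - Complex.normSq (s + x)) / (2 * Complex.normSq (s + x)) =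
        (z.re - s.re) * (x / Complex.normSq (s + x)) := by
      rw [h3]; field_simp
    linarith
  rw [U, U, D, h]
  linarith

/-- The tangent inequality at `z`, used towards the side on which the slope `D z` is favourable,
shows quasiconvexity in the real part. -/
theorem U_le_max (t : ℝ) {z z1 z2 : ℂ} (hz : Away A B z) (h1 : Away A B z1) (h2 : Away A B z2)
    (h0 : z ≠ 0) (hn1 : ‖z1‖ = ‖z‖) (hn2 : ‖z2‖ = ‖z‖) (hl : z1.re ≤ z.re) (hr : z.re ≤ z2.re) :
    W.U t z ≤ max (W.U t z1) (W.U t z2) := by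
  have t1 := U_tangent (W := W) t h1 hz h0 hn1
  have t2 := U_tangent (W := W) t h2 hz h0 hn2
  rcases le_total 0 (W.D z) with h | h
  · exact le_max_of_le_right (by nlinarith)
  · exact le_max_of_le_left (by nlinarith)

end Weights

/-! ### Uniformity on compact sets and persistence of zeros -/

theorem eventually_forall_compact {ι X : Type*} [TopologicalSpace X] {l : Filter ι} {K : Set X}
    (hK : IsCompact K) {P : ι → X → Prop} (h : ∀ z ∈ K, ∀ᶠ p : ι × X in l ×ˢ 𝓝 z, P p.1 p.2) :
    ∀ᶠ i in l, ∀ z ∈ K, P i z := by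
  have h1 : ∀ᶠ p in l ×ˢ 𝓝ˢ K, P p.1 p.2 := by
    rw [hK.prod_nhdsSet_eq_biSup]
    simpa [Filter.eventually_iSup] using h
  obtain ⟨p, hp, q, hq, h2⟩ := Filter.eventually_prod_iff.1 h1
  filter_upwards [hp] with i hi z hz
  exact h2 hi (hq.self_of_nhdsSet z hz)

/-- Hurwitz's argument: without a zero in a small disc, the maximum principle for `1 / F i` would
bound its value at the centre by its values on the boundary circle, contradicting `f z₀ = 0`. -/
theorem eventually_exists_zero {ι : Type*} {l : Filter ι} {F : ι → ℂ → ℂ} {f : ℂ → ℂ} {z₀ : ℂ}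
    {O : Set ℂ} (hO : IsOpen O) (hz₀ : z₀ ∈ O) (hF : ∀ᶠ i in l, DifferentiableOn ℂ (F i) O)
    (hf : ContinuousOn f O)
    (hconv : ∀ z ∈ O, Tendsto (fun p : ι × ℂ => F p.1 p.2) (l ×ˢ 𝓝 z) (𝓝 (f z)))
    (h0 : f z₀ = 0) (hne : ∀ᶠ z in 𝓝[≠] z₀, f z ≠ 0) {ε : ℝ} (hε : 0 < ε) :
    ∀ᶠ i in l, ∃ z, ‖z - z₀‖ < ε ∧ F i z = 0 := by
  obtain ⟨r, hr, hball⟩ : ∃ r > 0, ∀ z ∈ Metric.closedBall z₀ r,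
      z ∈ O ∧ (z ≠ z₀ → f z ≠ 0) ∧ ‖z - z₀‖ < ε := by
    have h1 : ∀ᶠ z in 𝓝 z₀, z ∈ O ∧ (z ≠ z₀ → f z ≠ 0) ∧ ‖z - z₀‖ < ε := by
      rw [eventually_nhdsWithin_iff] at hne
      have h2 : ∀ᶠ z in 𝓝 z₀, ‖z - z₀‖ < ε := by
        filter_upwards [Metric.ball_mem_nhds z₀ hε] with z hz
        rwa [← dist_eq_norm]
      have h3 : ∀ᶠ z in 𝓝 z₀, z ∈ O := hO.mem_nhds hz₀
      exact h3.and (hne.and h2)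
    obtain ⟨r, hr, h⟩ := Metric.nhds_basis_closedBall.eventually_iff.1 h1
    exact ⟨r, hr, fun z hz => h hz⟩
  have hsph : IsCompact (Metric.sphere z₀ r) := isCompact_sphere _ _
  have hsO : Metric.sphere z₀ r ⊆ O := fun z hz => (hball z (Metric.sphere_subset_closedBall hz)).1
  obtain ⟨w, hw, hwmin⟩ := hsph.exists_isMinOn (NormedSpace.sphere_nonempty.2 hr.le)
    (hf.mono hsO).norm
  have hm : 0 < ‖f w‖ := norm_pos_iff.2 ((hball w (Metric.sphere_subset_closedBall hw)).2.1
    (Metric.ne_of_mem_sphere hw hr.ne'))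
  have e1 : ∀ᶠ i in l, ∀ z ∈ Metric.sphere z₀ r, ‖f w‖ / 2 < ‖F i z‖ := by
    refine eventually_forall_compact hsph fun z hz => ?_
    refine (hconv z (hsO hz)).norm.eventually_const_lt ?_
    have : ‖f w‖ ≤ ‖f z‖ := hwmin hz
    linarith
  have e2 : ∀ᶠ i in l, ‖F i z₀‖ < ‖f w‖ / 2 := by
    have h1 : Tendsto (fun i => F i z₀) l (𝓝 (f z₀)) := (hconv z₀ hz₀).comp
      (tendsto_id.prodMk (tendsto_const_nhds (x := z₀)))
    rw [h0] at h1
    exact h1.norm.eventually_lt_const (by simpa using half_pos hm)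
  filter_upwards [hF, e1, e2] with i hi h1 h2
  by_contra! hcon
  have hnz : ∀ z ∈ Metric.closedBall z₀ r, F i z ≠ 0 := fun z hz => hcon z (hball z hz).2.2
  have hd : DiffContOnCl ℂ (fun z => (F i z)⁻¹) (Metric.ball z₀ r) := by
    have h3 : DifferentiableOn ℂ (fun z => (F i z)⁻¹) (Metric.closedBall z₀ r) :=
      (hi.mono fun z hz => (hball z hz).1).inv hnz
    refine DifferentiableOn.diffContOnCl ?_
    rwa [closure_ball z₀ hr.ne']
  have h4 := Complex.norm_le_of_forall_mem_frontier_norm_le Metric.isBounded_ball hd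
    (C := (‖f w‖ / 2)⁻¹) (z := z₀) (fun z hz => by
      rw [frontier_ball z₀ hr.ne'] at hz
      rw [norm_inv]
      exact inv_anti₀ (by positivity) (h1 z hz).le) (subset_closure (Metric.mem_ball_self hr))
  rw [norm_inv] at h4
  have h5 : 0 < ‖F i z₀‖ := norm_pos_iff.2 (hnz z₀ (Metric.mem_closedBall_self hr.le))
  exact absurd ((inv_le_inv₀ h5 (by positivity)).1 h4) (not_le.2 h2)

end

end DualSchur

namespace DualSchur

noncomputable section

/-! ### The critical curve -/

/-- The integral `∫ x/|1 - xz|²` is unbounded near the poles, on circles about `0`. -/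
def BlowUp (m : Measure ℝ) (A : Set ℝ) : Prop :=
  ∀ r : ℝ, 0 < r → r⁻¹ ∈ A → ∀ M : ℝ, ∃ z : ℂ, 0 < z.im ∧ ‖z‖ = r ∧ 0 ≤ z.re ∧
    M ≤ ∫ x, x / Complex.normSq (1 - x * z) ∂m

/-- The two real critical points: `zp` between the poles and `-1/vm` outside. -/
structure Crit {A B : Set ℝ} (W : Weights A B) (zp vm : ℝ) : Prop where
  nt : W.Nontriv
  cA : IsPreconnected A
  cB : IsPreconnected B
  nA : A.Nonempty
  nB : B.Nonempty
  hp : In0 A B zp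
  Dp : W.D zp = 0
  hm : In0 B A vm
  Dm : W.swap.D vm = 0
  bA : BlowUp W.μ A
  bB : BlowUp W.ν B

/-- The point of the closed upper half plane with modulus `r` and argument `arccos c`. -/
def pt (r c : ℝ) : ℂ := ⟨r * c, r * √(1 - c ^ 2)⟩

theorem norm_pt {r c : ℝ} (hr : 0 ≤ r) (hc : c ∈ Icc (-1 : ℝ) 1) : ‖pt r c‖ = r := by
  have h : 0 ≤ 1 - c ^ 2 := by nlinarith [hc.1, hc.2]
  have h2 : ‖pt r c‖ ^ 2 = r ^ 2 := by
    rw [← Complex.normSq_eq_norm_sq, Complex.normSq_apply, pt]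
    simp only
    have := Real.mul_self_sqrt h
    linear_combination r ^ 2 * this
  exact (pow_left_inj₀ (norm_nonneg _) hr two_ne_zero).1 h2

theorem pt_im_pos {r c : ℝ} (hr : 0 < r) (hc : c ∈ Ioo (-1 : ℝ) 1) : 0 < (pt r c).im := by
  have h : 0 < 1 - c ^ 2 := by nlinarith [hc.1, hc.2]
  exact mul_pos hr (Real.sqrt_pos.2 h)

theorem continuous_pt : Continuous fun p : ℝ × ℝ => pt p.1 p.2 := by
  have : (fun p : ℝ × ℝ => pt p.1 p.2) =
      fun p => ((p.1 * p.2 : ℝ) : ℂ) + ((p.1 * √(1 - p.2 ^ 2) : ℝ) : ℂ) * Complex.I := by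
    ext p
    apply Complex.ext <;> simp [pt]
  rw [this]
  fun_prop

theorem pt_of_im_nonneg {z : ℂ} (h : 0 ≤ z.im) (h0 : z ≠ 0) : pt ‖z‖ (z.re / ‖z‖) = z := by
  have hn : 0 < ‖z‖ := norm_pos_iff.2 h0
  have e : ‖z‖ ^ 2 = z.re ^ 2 + z.im ^ 2 := by
    rw [← Complex.normSq_eq_norm_sq, Complex.normSq_apply]; ring
  apply Complex.ext
  · simp only [pt]; field_simp
  · have : 1 - (z.re / ‖z‖) ^ 2 = (z.im / ‖z‖) ^ 2 := by
      field_simp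
      rw [e]; ring
    simp only [pt]
    rw [this, Real.sqrt_sq (by positivity)]
    field_simp

theorem re_div_norm_mem {z : ℂ} (h : 0 < z.im) : z.re / ‖z‖ ∈ Ioo (-1 : ℝ) 1 := by
  have hn : 0 < ‖z‖ := h.trans_le ((le_abs_self _).trans (Complex.abs_im_le_norm z))
  have := abs_lt.1 (Complex.abs_re_lt_norm.2 h.ne')
  constructor
  · rw [lt_div_iff₀ hn]; linarith
  · rw [div_lt_iff₀ hn]; linarith

theorem ext_of_re_of_norm {z s : ℂ} (hz : 0 ≤ z.im) (hs : 0 ≤ s.im) (hre : z.re = s.re)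
    (hn : ‖z‖ = ‖s‖) : z = s := by
  by_cases h0 : z = 0
  · subst h0
    exact (norm_eq_zero.1 (by rw [← hn, norm_zero])).symm
  · have hs0 : s ≠ 0 := norm_ne_zero_iff.1 (hn ▸ norm_ne_zero_iff.2 h0)
    rw [← pt_of_im_nonneg hz h0, ← pt_of_im_nonneg hs hs0, hre, hn]

theorem im_neg_inv_pos {z : ℂ} (h : 0 < z.im) : 0 < (-z⁻¹).im := by
  have h0 : z ≠ 0 := by rintro rfl; simp at h
  have := Complex.normSq_pos.2 h0
  rw [Complex.neg_im, Complex.inv_im, neg_div, neg_neg]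
  positivity

/-- By connectedness of the carriers `1 - xr` and `r + y` keep their signs. If both are positive the
point lies between the poles; otherwise it lies beyond one family, and inversion puts it between the
exchanged poles. -/
theorem Weights.away_of_real {A B : Set ℝ} (W : Weights A B) (cA : IsPreconnected A)
    (cB : IsPreconnected B) (nA : A.Nonempty) (nB : B.Nonempty) {r : ℝ} (hr : Away A B r) :
    In0 A B r ∨ r ≠ 0 ∧ In0 B A (-r⁻¹) := by
  have hcase : ∀ {C : Set ℝ} {φ : ℝ → ℝ}, IsPreconnected C → Continuous φ →
      (∀ x ∈ C, φ x ≠ 0) → (∀ x ∈ C, 0 < φ x) ∨ ∀ x ∈ C, φ x < 0 := by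
    intro C φ hC hφ h0
    by_contra! hcon
    obtain ⟨⟨x, hx, h1⟩, y, hy, h2⟩ := hcon
    obtain ⟨z, hz, h3⟩ := hC.intermediate_value hx hy hφ.continuousOn ⟨h1, h2⟩
    exact h0 z hz h3
  have a : ∀ x ∈ A, 1 - x * r ≠ 0 := fun x hx h0 => hr.1 x hx (by exact_mod_cast h0)
  have b : ∀ x ∈ B, r + x ≠ 0 := fun x hx h0 => hr.2 x hx (by exact_mod_cast h0)
  obtain ⟨x0, hx0⟩ := nA
  obtain ⟨y0, hy0⟩ := nB
  have A0 := W.A0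
  have B0 := W.B0
  rcases hcase cA (by fun_prop : Continuous fun x : ℝ => 1 - x * r) a with ha | ha
  · rcases hcase cB (by fun_prop : Continuous fun x : ℝ => r + x) b with hb | hb
    · exact Or.inl ⟨fun x hx => by linarith [ha x hx], hb⟩
    · right
      have hr0 : r < 0 := by linarith [hb y0 hy0, B0 y0 hy0]
      refine ⟨hr0.ne, fun y hy => ?_, fun x hx => ?_⟩
      · have := hb y hy
        rw [mul_neg, ← neg_mul, ← div_eq_mul_inv, div_lt_one_of_neg hr0]
        linarith
      · have : 0 < -r⁻¹ := by
          have := inv_lt_zero.2 hr0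
          linarith
        linarith [A0 x hx]
  · right
    have hr0 : 0 < r := by
      by_contra! hcon
      have := ha x0 hx0
      nlinarith [A0 x0 hx0]
    have hi : 0 < r⁻¹ := inv_pos.2 hr0
    refine ⟨hr0.ne', fun y hy => ?_, fun x hx => ?_⟩
    · nlinarith [B0 y hy]
    · have := ha x hx
      have e : r * r⁻¹ = 1 := mul_inv_cancel₀ hr0.ne'
      have : r * (-r⁻¹ + x) > 0 := by nlinarith
      exact pos_of_mul_pos_right this hr0.le

namespace Crit

variable {A B : Set ℝ} {W : Weights A B} {zp vm : ℝ}

theorem swap (h : Crit W zp vm) : Crit W.swap vm zp := by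
  refine ⟨?_, h.cB, h.cA, h.nB, h.nA, h.hm, h.Dm, h.hp, h.Dp, h.bB, h.bA⟩
  have := h.nt
  unfold Weights.Nontriv at *
  rw [add_comm]
  exact this

theorem away_of_real (h : Crit W zp vm) {r : ℝ} (hr : Away A B r) :
    In0 A B r ∨ r ≠ 0 ∧ In0 B A (-r⁻¹) := W.away_of_real h.cA h.cB h.nA h.nB hr

/-- The range of moduli of the critical curve. -/
def Rng (zp vm : ℝ) : Set ℝ := {r | |zp| < r ∧ r * |vm| < 1}

/-- If the circle passes through a pole `1/x`, the blow-up of the `μ` integral gives a large value,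
while the `ν` integral stays bounded where `Re z ≥ 0`. Otherwise the real point `r` is away from the
poles and on the side of the real critical points where `D r > 0`, so nearby points of the arc
serve. -/
theorem exists_D_pos (h : Crit W zp vm) {r : ℝ} (hr : r ∈ Rng zp vm) :
    ∃ z : ℂ, 0 < z.im ∧ ‖z‖ = r ∧ 0 < W.D z := by
  have hr0 : 0 < r := (abs_nonneg _).trans_lt hr.1
  by_contra! hcon
  have hrA : r⁻¹ ∉ A := by
    intro hmem
    obtain ⟨z, hz, hn, hre, hM⟩ := h.bA r hr0 hmem ((∫ y, y / r ^ 2 ∂W.ν) + 1)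
    have hza := away_of_im_pos (A := A) (B := B) hz
    have h1 : ∫ y, y / Complex.normSq (z + y) ∂W.ν ≤ ∫ y, y / r ^ 2 ∂W.ν := by
      refine integral_mono_ae (W.intDivB (by fun_prop) (by fun_prop)
        fun x hx => (hza.normSq_pos_right hx).ne')
        (W.intDivB (by fun_prop) (by fun_prop) fun x hx => by positivity) ?_
      filter_upwards [ae_mem_carried W.hB W.νB] with y hy
      have hy0 := W.B0 y hy
      refine div_le_div_of_nonneg_left hy0 (by positivity) ?_
      rw [← hn, ← Complex.normSq_eq_norm_sq, Complex.normSq_apply, Complex.normSq_apply]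
      simp
      nlinarith
    have h2 := hcon z hz hn
    unfold Weights.D at h2
    linarith
  have hra : Away A B r := by
    refine ⟨fun x hx h0 => hrA ?_, fun y hy h0 => ?_⟩
    · have : x * r = 1 := by
        have : (1 : ℝ) - x * r = 0 := by exact_mod_cast h0
        linarith
      exact (eq_inv_of_mul_eq_one_left this) ▸ hx
    · have : r + y = 0 := by exact_mod_cast h0
      linarith [W.B0 y hy]
  have hD : W.D r ≤ 0 := by
    have hc : Tendsto (fun c : ℝ => W.D (pt r c)) (𝓝[<] 1) (𝓝 (W.D r)) := by
      have e : pt r 1 = r := by apply Complex.ext <;> simp [pt]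
      have h1 : ContinuousAt W.D (pt r 1) := e ▸ Weights.continuousAt_D hra
      have h2 : ContinuousAt (fun c : ℝ => pt r c) 1 :=
        (continuous_pt.comp (by fun_prop : Continuous fun c : ℝ => (r, c))).continuousAt
      have h3 := ContinuousAt.comp (g := W.D) (f := fun c : ℝ => pt r c) h1 h2
      have h4 : Tendsto (fun c : ℝ => W.D (pt r c)) (𝓝 1) (𝓝 (W.D r)) := by
        have := h3.tendsto
        simpa only [Function.comp_def, e] using this
      exact h4.mono_left nhdsWithin_le_nhds
    refine le_of_tendsto hc ?_
    filter_upwards [Ioo_mem_nhdsLT (show (-1 : ℝ) < 1 by norm_num)] with c hc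
    exact hcon _ (pt_im_pos hr0 hc) (norm_pt hr0.le ⟨hc.1.le, hc.2.le⟩)
  rcases h.away_of_real hra with h1 | ⟨h1, h2⟩
  · have h3 : zp < r := (le_abs_self _).trans_lt hr.1
    have := Weights.D_sign_of_In0 h.nt h1 h.hp h.Dp h3.ne'
    nlinarith
  · have h3 : -r⁻¹ < vm := by
      have h4 := neg_abs_le vm
      have h5 : |vm| < r⁻¹ := by
        rw [← one_div, lt_div_iff₀ hr0, mul_comm]
        exact hr.2
      linarith
    have h4 := Weights.D_sign_of_In0 h.swap.nt h2 h.hm h.Dm h3.ne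
    have h5 := Weights.D_swap (W := W) hra (by exact_mod_cast h1)
    push_cast at h4
    rw [h5] at h4
    have h6 : 0 < Complex.normSq (r : ℂ) := Complex.normSq_pos.2 (by exact_mod_cast h1)
    nlinarith [mul_nonneg h6.le (neg_nonneg.2 hD)]

theorem rng_swap {r : ℝ} (hr : r ∈ Rng zp vm) : r⁻¹ ∈ Rng vm zp := by
  have hr0 : 0 < r := (abs_nonneg _).trans_lt hr.1
  refine ⟨?_, ?_⟩
  · rw [← one_div, lt_div_iff₀ hr0, mul_comm]; exact hr.2
  · rw [inv_mul_lt_iff₀ hr0, mul_one]; exact hr.1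

/-- Inversion reverses the sign of `D`, so this is the preceding statement for the exchanged
measures. -/
theorem exists_D_neg (h : Crit W zp vm) {r : ℝ} (hr : r ∈ Rng zp vm) :
    ∃ z : ℂ, 0 < z.im ∧ ‖z‖ = r ∧ W.D z < 0 := by
  obtain ⟨v, hv, hn, hD⟩ := h.swap.exists_D_pos (rng_swap hr)
  have hv0 : v ≠ 0 := by rintro rfl; simp at hv
  refine ⟨-v⁻¹, im_neg_inv_pos hv, by rw [norm_neg, norm_inv, hn, inv_inv], ?_⟩
  have := Weights.D_swap (W := W.swap) (away_of_im_pos hv) hv0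
  rw [Weights.swap_swap] at this
  rw [this]
  have := Complex.normSq_pos.2 hv0
  nlinarith [mul_pos this hD]

theorem exists_crit (h : Crit W zp vm) {r : ℝ} (hr : r ∈ Rng zp vm) :
    ∃ z : ℂ, 0 < z.im ∧ ‖z‖ = r ∧ W.D z = 0 := by
  have hr0 : 0 < r := (abs_nonneg _).trans_lt hr.1
  obtain ⟨z1, hz1, hn1, hD1⟩ := h.exists_D_pos hr
  obtain ⟨z2, hz2, hn2, hD2⟩ := h.exists_D_neg hr
  have n0 : ∀ z : ℂ, 0 < z.im → z ≠ 0 := by rintro z h1 rfl; simp at h1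
  have hcont : ContinuousOn (fun c => W.D (pt r c)) (Ioo (-1) 1) := by
    refine Weights.continuousOn_D.comp (continuous_pt.comp
      (by fun_prop : Continuous fun c : ℝ => (r, c))).continuousOn fun c hc => ?_
    exact away_of_im_pos (pt_im_pos hr0 hc)
  have e1 := pt_of_im_nonneg hz1.le (n0 _ hz1)
  have e2 := pt_of_im_nonneg hz2.le (n0 _ hz2)
  rw [hn1] at e1
  rw [hn2] at e2
  have m1 := re_div_norm_mem hz1
  have m2 := re_div_norm_mem hz2
  rw [hn1] at m1
  rw [hn2] at m2
  obtain ⟨c, hc, h3⟩ := isPreconnected_Ioo.intermediate_value m2 m1 hcont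
    (show (0 : ℝ) ∈ Icc _ _ by simp only [e1, e2]; exact ⟨hD2.le, hD1.le⟩)
  exact ⟨pt r c, pt_im_pos hr0 hc, norm_pt hr0.le ⟨hc.1.le, hc.2.le⟩, h3⟩

theorem D_lt_of_re_lt (h : Crit W zp vm) {z s : ℂ} (hz : Away A B z) (hs : Away A B s)
    (hn : ‖z‖ = ‖s‖) (hre : z.re < s.re) : W.D z < W.D s := by
  have h1 := Weights.D_sub_of_norm_eq (W := W) hz hs hn
  have h2 := Weights.Ps_pos h.nt hz hs
  nlinarith [mul_pos (sub_pos.2 hre) h2]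

/-- The critical curve, parametrized by the modulus. -/
theorem exists_curve (h : Crit W zp vm) :
    ∃ γ : ℝ → ℂ, (∀ r ∈ Rng zp vm, 0 < (γ r).im ∧ ‖γ r‖ = r ∧ W.D (γ r) = 0) ∧
      ContinuousOn γ (Rng zp vm) := by
  choose! γ hγ using fun r (hr : r ∈ Rng zp vm) => h.exists_crit hr
  refine ⟨γ, hγ, ?_⟩
  have hopen : IsOpen (Rng zp vm) :=
    (isOpen_lt continuous_const continuous_id).inter
      (isOpen_lt (continuous_id.mul continuous_const) continuous_const)
  intro r hr
  have pos : ∀ r ∈ Rng zp vm, 0 < r := fun r hr => (abs_nonneg _).trans_lt hr.1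
  have n0 : ∀ z : ℂ, 0 < z.im → z ≠ 0 := by rintro z h1 rfl; simp at h1
  set c : ℝ → ℝ := fun r => (γ r).re / r with hcdef
  have hc : ∀ r ∈ Rng zp vm, c r ∈ Ioo (-1 : ℝ) 1 ∧ pt r (c r) = γ r := by
    intro r hr
    obtain ⟨h1, h2, h3⟩ := hγ r hr
    have e := pt_of_im_nonneg h1.le (n0 _ h1)
    have m := re_div_norm_mem h1
    rw [h2] at e m
    exact ⟨m, e⟩
  -- On a fixed circle `D` increases with the cosine, so its sign at a test point tells on which
  -- side the critical point lies. Continuity of the curve follows from this order criterion without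
  -- an implicit function theorem.
  have key : ∀ a ∈ Ioo (-1 : ℝ) 1, ∀ r ∈ Rng zp vm, (W.D (pt r a) < 0 → a < c r) ∧
      (0 < W.D (pt r a) → c r < a) := by
    intro a ha r hr
    obtain ⟨m, e⟩ := hc r hr
    have hp := pos r hr
    have hn : ‖pt r a‖ = ‖pt r (c r)‖ := by
      rw [norm_pt hp.le ⟨ha.1.le, ha.2.le⟩, norm_pt hp.le ⟨m.1.le, m.2.le⟩]
    have h0 : W.D (pt r (c r)) = 0 := by rw [e]; exact (hγ r hr).2.2
    have aw1 := away_of_im_pos (A := A) (B := B) (pt_im_pos hp ha)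
    have aw2 := away_of_im_pos (A := A) (B := B) (pt_im_pos hp m)
    constructor
    · intro hneg
      by_contra! hcon
      rcases hcon.lt_or_eq with h4 | h4
      · have := h.D_lt_of_re_lt aw2 aw1 hn.symm (mul_lt_mul_of_pos_left h4 hp)
        linarith
      · rw [← h4, h0] at hneg; exact lt_irrefl _ hneg
    · intro hpos
      by_contra! hcon
      rcases hcon.lt_or_eq with h4 | h4
      · have := h.D_lt_of_re_lt aw1 aw2 hn (mul_lt_mul_of_pos_left h4 hp)
        linarith
      · rw [h4, h0] at hpos; exact lt_irrefl _ hpos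
  obtain ⟨m, e⟩ := hc r hr
  have hp := pos r hr
  have hDcont : ∀ a ∈ Ioo (-1 : ℝ) 1, ContinuousAt (fun r => W.D (pt r a)) r := by
    intro a ha
    exact ContinuousAt.comp (g := W.D) (f := fun r => pt r a)
      (Weights.continuousAt_D (away_of_im_pos (pt_im_pos hp ha)))
      (continuous_pt.comp (by fun_prop : Continuous fun r : ℝ => (r, a))).continuousAt
  have h0 : W.D (pt r (c r)) = 0 := by rw [e]; exact (hγ r hr).2.2
  have aw : ∀ a ∈ Ioo (-1 : ℝ) 1, Away A B (pt r a) := fun a ha =>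
    away_of_im_pos (pt_im_pos hp ha)
  have hnorm : ∀ a ∈ Ioo (-1 : ℝ) 1, ‖pt r a‖ = r := fun a ha => norm_pt hp.le ⟨ha.1.le, ha.2.le⟩
  have hctend : Tendsto c (𝓝 r) (𝓝 (c r)) := by
    have hev : ∀ᶠ r' in 𝓝 r, r' ∈ Rng zp vm := hopen.mem_nhds hr
    refine tendsto_order.2 ⟨fun a ha => ?_, fun a ha => ?_⟩
    · by_cases ha1 : -1 < a
      · have ham : a ∈ Ioo (-1 : ℝ) 1 := ⟨ha1, ha.trans m.2⟩
        have h1 : W.D (pt r a) < 0 := by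
          rw [← h0]
          exact h.D_lt_of_re_lt (aw a ham) (aw _ m) ((hnorm a ham).trans (hnorm _ m).symm)
            (mul_lt_mul_of_pos_left ha hp)
        filter_upwards [hev, (hDcont a ham).eventually_lt_const h1] with r' h2 h3
        exact (key a ham r' h2).1 h3
      · filter_upwards [hev] with r' h2
        exact (not_lt.1 ha1).trans_lt (hc r' h2).1.1
    · by_cases ha1 : a < 1
      · have ham : a ∈ Ioo (-1 : ℝ) 1 := ⟨m.1.trans ha, ha1⟩
        have h1 : 0 < W.D (pt r a) := by
          rw [← h0]
          exact h.D_lt_of_re_lt (aw _ m) (aw a ham) ((hnorm _ m).trans (hnorm a ham).symm)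
            (mul_lt_mul_of_pos_left ha hp)
        filter_upwards [hev, (hDcont a ham).eventually_const_lt h1] with r' h2 h3
        exact (key a ham r' h2).2 h3
      · filter_upwards [hev] with r' h2
        exact (hc r' h2).1.2.trans_le (not_lt.1 ha1)
  have h5 : Tendsto (fun r' => pt r' (c r')) (𝓝 r) (𝓝 (pt r (c r))) :=
    (continuous_pt.tendsto (r, c r)).comp (tendsto_id.prodMk_nhds hctend)
  rw [e] at h5
  refine ContinuousAt.continuousWithinAt (h5.congr' ?_)
  filter_upwards [hopen.mem_nhds hr] with r' hr'
  exact (hc r' hr').2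

end Crit

end

end DualSchur

namespace DualSchur

noncomputable section

/-! ### Critical values along the curve -/

theorem ne_zero_of_im_pos {z : ℂ} (h : 0 < z.im) : z ≠ 0 := by
  rintro rfl; simp at h

namespace Weights

variable {A B : Set ℝ} {W : Weights A B}

theorem eventually_In0 (W : Weights A B) {r₀ : ℝ} (h : In0 A B r₀) :
    ∀ᶠ r : ℝ in 𝓝 r₀, In0 A B r := by
  refine Filter.Eventually.and ?_ ?_
  · refine W.hA.eventually_forall_of_forall_eventually fun x hx => ?_
    have : ContinuousAt (fun p : ℝ × ℝ => p.2 * p.1) (r₀, x) := by fun_prop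
    exact this.eventually_lt_const (h.1 x hx)
  · refine W.hB.eventually_forall_of_forall_eventually fun x hx => ?_
    have : ContinuousAt (fun p : ℝ × ℝ => p.1 + p.2) (r₀, x) := by fun_prop
    exact this.eventually_const_lt (h.2 x hx)

theorem away_of_In0_re {z : ℂ} (h : In0 A B z.re) : Away A B z := by
  refine ⟨fun x hx h0 => ?_, fun y hy h0 => ?_⟩
  · have := h.1 x hx
    have e := congrArg Complex.re h0
    simp at e
    linarith
  · have := h.2 y hy
    have e := congrArg Complex.re h0
    simp at e
    linarith

theorem D_eq_zero_of_T_eq {z : ℂ} (hz : 0 < z.im) {t : ℝ} (h : W.T z = t) : W.D z = 0 := by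
  have := T_im (W := W) (away_of_im_pos hz)
  rw [h, Complex.ofReal_im] at this
  exact (mul_eq_zero.1 this.symm).resolve_left hz.ne'

theorem T_eq_re {z : ℂ} (hz : Away A B z) (h : W.D z = 0) : W.T z = (W.T z).re := by
  apply Complex.ext
  · simp
  · rw [T_im hz, h]; simp

theorem T_conj (z : ℂ) : W.T ((starRingEnd ℂ) z) = (starRingEnd ℂ) (W.T z) := by
  simp only [T, map_add, ← integral_conj]
  simp

theorem away_conj {z : ℂ} (h : Away A B z) : Away A B ((starRingEnd ℂ) z) := by
  refine ⟨fun x hx h0 => h.1 x hx ?_, fun y hy h0 => h.2 y hy ?_⟩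
  · have := congrArg (starRingEnd ℂ) h0
    simpa using this
  · have := congrArg (starRingEnd ℂ) h0
    simpa using this

theorem swap_norm {z : ℂ} : ‖-z⁻¹‖ = ‖z‖⁻¹ := by rw [norm_neg, norm_inv]

theorem neg_inv_neg_inv (z : ℂ) : -(-z⁻¹)⁻¹ = z := by rw [inv_neg, inv_inv, neg_neg]

end Weights

namespace Crit

variable {A B : Set ℝ} {W : Weights A B} {zp vm : ℝ}

/-- `T_strictAnti` compared with the real critical point itself: a smaller value of `T` forces a
larger modulus. -/
theorem norm_gt (h : Crit W zp vm) {z : ℂ} (hz : 0 < z.im) (hD : W.D z = 0)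
    (hT : (W.T z).re < (W.T zp).re) : |zp| < ‖z‖ := by
  have h1 := Weights.T_strictAnti h.nt hz h.hp.away hD h.Dp
    (by rintro rfl; simp at hz)
    (by rw [Complex.conj_ofReal]; rintro rfl; simp at hz)
  rw [Complex.norm_real, Real.norm_eq_abs] at h1
  by_contra! hcon
  have := pow_le_pow_left₀ (norm_nonneg z) hcon 2
  nlinarith

theorem norm_lt (h : Crit W zp vm) {z : ℂ} (hz : 0 < z.im) (hD : W.D z = 0)
    (hT : -(W.swap.T vm).re < (W.T z).re) : ‖z‖ * |vm| < 1 := by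
  have hza := away_of_im_pos (A := A) (B := B) hz
  have h0 := ne_zero_of_im_pos hz
  have h1 := h.swap.norm_gt (im_neg_inv_pos hz) (by rw [Weights.D_swap hza h0, hD]; simp)
    (by rw [Weights.T_swap hza h0, Complex.neg_re]; linarith)
  rw [Weights.swap_norm] at h1
  have := norm_pos_iff.2 h0
  have := mul_lt_mul_of_pos_left h1 this
  rwa [mul_inv_cancel₀ (by positivity)] at this

theorem lower_lt_upper (h : Crit W zp vm) : -(W.swap.T vm).re < (W.T zp).re := by
  have := Weights.T_add_swap_pos h.nt h.nA h.nB h.hp h.hm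
  linarith

theorem crit_unique (h : Crit W zp vm) {z s : ℂ} (hz : 0 < z.im) (hs : 0 < s.im)
    (hDz : W.D z = 0) (hDs : W.D s = 0) (hn : ‖z‖ = ‖s‖) : z = s := by
  refine ext_of_re_of_norm hz.le hs.le ?_ hn
  rcases lt_trichotomy z.re s.re with h1 | h1 | h1
  · have := h.D_lt_of_re_lt (away_of_im_pos hz) (away_of_im_pos hs) hn h1
    linarith
  · exact h1
  · have := h.D_lt_of_re_lt (away_of_im_pos hs) (away_of_im_pos hz) hn.symm h1
    linarith

theorem Q_self_ne (h : Crit W zp vm) : W.Q zp zp ≠ 0 := by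
  obtain ⟨q, hq, e⟩ := Weights.Q_real_pos h.nt h.hp h.hp
  rw [e]
  exact_mod_cast hq.ne'

theorem T_real_eq (h : Crit W zp vm) : W.T zp = ((W.T zp).re : ℂ) :=
  Weights.T_eq_re h.hp.away h.Dp

theorem eventually_T_ne (h : Crit W zp vm) : ∀ᶠ z in 𝓝[≠] (zp : ℂ), W.T z ≠ W.T zp := by
  have h1 : ∀ᶠ z in 𝓝 (zp : ℂ), W.Q z zp ≠ 0 := by
    have : ContinuousAt (fun z : ℂ => W.Q z zp) (zp : ℂ) :=
      ContinuousAt.comp (g := fun p : ℂ × ℂ => W.Q p.1 p.2) (f := fun z : ℂ => (z, (zp : ℂ)))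
        (Weights.continuousAt_Q h.hp.away h.hp.away) (by fun_prop)
    exact this.eventually_ne h.Q_self_ne
  have h2 : ∀ᶠ z in 𝓝 (zp : ℂ), Away A B z := W.isOpen_away.mem_nhds h.hp.away
  filter_upwards [nhdsWithin_le_nhds h1, nhdsWithin_le_nhds h2, self_mem_nhdsWithin]
    with z h3 h4 h5
  have e := Weights.T_sub (W := W) h4 h.hp.away
  rw [h.Dp, Complex.conj_ofReal, Complex.ofReal_zero, mul_zero, add_zero] at e
  rw [e, Ne, add_eq_left]
  have : z - zp ≠ 0 := sub_ne_zero.2 h5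
  positivity

/-- Values slightly below the critical value are taken near the critical point. -/
theorem eventually_exists_near (h : Crit W zp vm) {ε : ℝ} (hε : 0 < ε) :
    ∀ᶠ t : ℝ in 𝓝[<] (W.T zp).re, ∃ z : ℂ, 0 < z.im ∧ ‖z - zp‖ < ε ∧ W.T z = t := by
  obtain ⟨δ, hδ, hball⟩ : ∃ δ > 0, ∀ r : ℝ, ‖(r : ℂ) - zp‖ < δ → In0 A B r := by
    obtain ⟨δ, hδ, hb⟩ := Metric.eventually_nhds_iff.1 (W.eventually_In0 h.hp)
    refine ⟨δ, hδ, fun r hr => hb ?_⟩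
    rw [← Complex.ofReal_sub, Complex.norm_real] at hr
    rwa [Real.dist_eq]
  have hF := eventually_exists_zero (l := 𝓝[<] (W.T zp).re) (F := fun (t : ℝ) z => W.T z - t)
    (f := fun z => W.T z - (W.T zp).re) (z₀ := zp) (O := {z | Away A B z}) W.isOpen_away
    h.hp.away (Eventually.of_forall fun t => Weights.differentiableOn_T.sub_const _)
    (Weights.differentiableOn_T.continuousOn.sub continuousOn_const)
    (fun z hz => by
      refine Tendsto.sub ?_ ?_
      · exact (Weights.continuousAt_T hz).tendsto.comp tendsto_snd
      · exact ((Complex.continuous_ofReal.tendsto _).mono_left nhdsWithin_le_nhds).comp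
          tendsto_fst)
    (by rw [← h.T_real_eq, sub_self])
    (by
      filter_upwards [h.eventually_T_ne] with z hz
      rw [← h.T_real_eq]
      exact sub_ne_zero.2 hz) (lt_min hε hδ)
  filter_upwards [hF, self_mem_nhdsWithin] with t ⟨z, hz, e⟩ ht
  have e : W.T z = t := sub_eq_zero.1 e
  -- A solution in the lower half plane is conjugated. A real one is impossible: between the poles
  -- `T` is at least its critical value.
  rcases lt_trichotomy z.im 0 with h1 | h1 | h1
  · refine ⟨(starRingEnd ℂ) z, by simpa using h1, ?_, ?_⟩
    · rw [← Complex.conj_ofReal zp, ← map_sub, Complex.norm_conj]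
      exact hz.trans_le (min_le_left _ _)
    · rw [Weights.T_conj, e, Complex.conj_ofReal]
  · exfalso
    have ez : z = (z.re : ℂ) := Complex.ext (by simp) (by simp [h1])
    have hI : In0 A B z.re := hball _ (ez ▸ hz.trans_le (min_le_right _ _))
    by_cases h2 : z.re = zp
    · rw [ez, h2] at e
      rw [e] at ht
      simp at ht
    · have := Weights.T_lt_of_In0 h.nt hI h.hp h.Dp h2
      rw [← ez, e] at this
      exact lt_asymm ht (by simpa using this)
  · exact ⟨z, h1, hz.trans_le (min_le_left _ _), e⟩

theorem exists_near (h : Crit W zp vm) {ε : ℝ} (hε : 0 < ε) {t₀ : ℝ} (ht : t₀ < (W.T zp).re) :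
    ∃ t : ℝ, t₀ < t ∧ t < (W.T zp).re ∧
      ∃ z : ℂ, 0 < z.im ∧ ‖z - zp‖ < ε ∧ W.T z = t := by
  obtain ⟨t, h1, h2⟩ := ((h.eventually_exists_near hε).and (Ioo_mem_nhdsLT ht)).exists
  exact ⟨t, h2.1, h2.2, h1⟩

theorem mem_rng (h : Crit W zp vm) {z : ℂ} (hz : 0 < z.im) (hD : W.D z = 0)
    (h1 : -(W.swap.T vm).re < (W.T z).re) (h2 : (W.T z).re < (W.T zp).re) :
    ‖z‖ ∈ Rng zp vm := ⟨h.norm_gt hz hD h2, h.norm_lt hz hD h1⟩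

theorem rng_ordConnected : (Rng zp vm).OrdConnected := by
  refine ⟨fun a ha b hb c hc => ⟨ha.1.trans_le hc.1, lt_of_le_of_lt ?_ hb.2⟩⟩
  exact mul_le_mul_of_nonneg_right hc.2 (abs_nonneg _)

/-- Every value strictly between the two critical values is taken in the upper half plane. -/
theorem exists_T_eq (h : Crit W zp vm) {t : ℝ}
    (h1 : -(W.swap.T vm).re < t) (h2 : t < (W.T zp).re) : ∃ z : ℂ, 0 < z.im ∧ W.T z = t := by
  obtain ⟨γ, hγ, hc⟩ := h.exists_curve
  -- Values close to both critical values are attained near the real critical points. The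
  -- corresponding points lie on the curve, and the intermediate value theorem along it covers what
  -- is in between.
  obtain ⟨t1, ht1, ht1', z1, hz1, -, e1⟩ := h.exists_near one_pos h2
  obtain ⟨t2, ht2, ht2', v2, hv2, -, e2⟩ := h.swap.exists_near one_pos
    (show -t < (W.swap.T vm).re by linarith)
  have hv0 := ne_zero_of_im_pos hv2
  have e2' : W.T (-v2⁻¹) = ((-t2 : ℝ) : ℂ) := by
    have := Weights.T_swap (W := W.swap) (away_of_im_pos hv2) hv0
    rw [Weights.swap_swap, e2] at this
    rw [this]; push_cast; ring
  have hz2 := im_neg_inv_pos hv2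
  have D1 := Weights.D_eq_zero_of_T_eq hz1 e1
  have D2 := Weights.D_eq_zero_of_T_eq hz2 e2'
  have m1 : ‖z1‖ ∈ Rng zp vm := h.mem_rng hz1 D1
    (by rw [e1, Complex.ofReal_re]; linarith) (by rwa [e1, Complex.ofReal_re])
  have m2 : ‖-v2⁻¹‖ ∈ Rng zp vm := h.mem_rng hz2 D2
    (by rw [e2', Complex.ofReal_re]; linarith) (by rw [e2', Complex.ofReal_re]; linarith)
  have g1 : γ ‖z1‖ = z1 := by
    obtain ⟨a, b, c⟩ := hγ _ m1
    exact h.crit_unique a hz1 c D1 b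
  have g2 : γ ‖-v2⁻¹‖ = -v2⁻¹ := by
    obtain ⟨a, b, c⟩ := hγ _ m2
    exact h.crit_unique a hz2 c D2 b
  have hcont : ContinuousOn (fun r => (W.T (γ r)).re) (Rng zp vm) := by
    refine Complex.continuous_re.comp_continuousOn
      (Weights.differentiableOn_T.continuousOn.comp hc fun r hr => ?_)
    exact away_of_im_pos (hγ r hr).1
  obtain ⟨r, hr, e⟩ := (rng_ordConnected (zp := zp) (vm := vm)).isPreconnected.intermediate_value
    m2 m1 hcont (show t ∈ Icc _ _ by
      simp only [g1, g2, e1, e2', Complex.ofReal_re]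
      constructor <;> linarith)
  obtain ⟨a, b, c⟩ := hγ r hr
  refine ⟨γ r, a, ?_⟩
  rw [Weights.T_eq_re (away_of_im_pos a) c]
  exact_mod_cast e

theorem T_unique (h : Crit W zp vm) {z s : ℂ} (hz : 0 < z.im) (hs : 0 < s.im) {t : ℝ}
    (h1 : W.T z = t) (h2 : W.T s = t) : z = s := by
  by_contra hne
  have := Weights.T_strictAnti h.nt hz (away_of_im_pos hs) (Weights.D_eq_zero_of_T_eq hz h1)
    (Weights.D_eq_zero_of_T_eq hs h2) hne (by
      rintro rfl
      simp at hz
      linarith)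
  rw [h1, h2, sub_self, zero_mul] at this
  exact lt_irrefl _ this

/-- On the real line `T` takes no value strictly between the critical values, and the critical
values only at the critical points. -/
theorem T_real (h : Crit W zp vm) {r : ℝ} (hr : Away A B r) :
    (r = zp ∨ (W.T zp).re < (W.T r).re) ∨
      r ≠ 0 ∧ In0 B A (-r⁻¹) ∧ (-r⁻¹ = vm ∨ (W.T r).re < -(W.swap.T vm).re) := by
  rcases h.away_of_real hr with h1 | ⟨h1, h2⟩
  · left
    by_cases h3 : r = zp
    · exact Or.inl h3
    · exact Or.inr (Weights.T_lt_of_In0 h.nt h1 h.hp h.Dp h3)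
  · right
    refine ⟨h1, h2, ?_⟩
    by_cases h3 : -r⁻¹ = vm
    · exact Or.inl h3
    · right
      have h4 := Weights.T_lt_of_In0 h.swap.nt h2 h.hm h.Dm h3
      have h5 := Weights.T_swap (W := W) hr (by exact_mod_cast h1)
      push_cast at h4
      rw [h5, Complex.neg_re] at h4
      linarith

/-! ### Growth of the potential along the curve -/

/-- A minimum over `[a, b]` can only be attained at `a`, since every other point has smaller values
just to its left. -/
theorem lt_of_eventually_left_lt {m : ℝ → ℝ} {I : Set ℝ} (hI : I.OrdConnected)
    (hm : ContinuousOn m I) (h : ∀ r ∈ I, ∀ᶠ s in 𝓝[<] r, s ∈ I → m s < m r) {a b : ℝ}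
    (ha : a ∈ I) (hb : b ∈ I) (hab : a < b) : m a < m b := by
  have hsub : Icc a b ⊆ I := hI.out ha hb
  have key : ∀ c ∈ Ioc a b, ∃ s ∈ Icc a b, m s < m c := by
    intro c hc
    obtain ⟨s, h1, h2⟩ := ((h c (hsub ⟨hc.1.le, hc.2⟩)).and (Ioo_mem_nhdsLT hc.1)).exists
    have h3 : s ∈ Icc a b := ⟨h2.1.le, h2.2.le.trans hc.2⟩
    exact ⟨s, h3, h1 (hsub h3)⟩
  obtain ⟨c, hc, hmin⟩ := isCompact_Icc.exists_isMinOn ⟨a, le_rfl, hab.le⟩ (hm.mono hsub)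
  have hca : c = a := by
    by_contra hne
    obtain ⟨s, hs, hlt⟩ := key c ⟨lt_of_le_of_ne hc.1 (Ne.symm hne), hc.2⟩
    exact absurd (hmin hs) (not_le.2 hlt)
  subst hca
  obtain ⟨s, hs, hlt⟩ := key b ⟨hab, le_rfl⟩
  exact (hmin hs).trans_lt hlt

/-- At moduli below `|s|` the curve satisfies `T > t`, so `U` strictly decreases when one moves
radially inwards from a curve point. Returning to the curve along the smaller circle decreases `U`
further, since the curve point minimizes `U` there. No differentiability of the curve is needed. -/
theorem U_curve_lt (h : Crit W zp vm) {γ : ℝ → ℂ}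
    (hγ : ∀ r ∈ Rng zp vm, 0 < (γ r).im ∧ ‖γ r‖ = r ∧ W.D (γ r) = 0)
    (hc : ContinuousOn γ (Rng zp vm)) {t : ℝ} {s : ℂ} (hsa : Away A B s)
    (hs0 : s ≠ 0) (hD : W.D s = 0) (hT : t ≤ (W.T s).re)
    (hclose : ‖s‖ * |vm| ≤ 1) {a b : ℝ} (ha : a ∈ Rng zp vm)
    (hab : a < b) (hb : b < ‖s‖) : W.U t (γ a) < W.U t (γ b) ∧ W.U t (γ a) < W.U t s := by
  set I : Set ℝ := Rng zp vm ∩ Iio ‖s‖ with hIdef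
  have hIo : I.OrdConnected := rng_ordConnected.inter ordConnected_Iio
  have pos : ∀ r ∈ Rng zp vm, 0 < r := fun r hr => (abs_nonneg _).trans_lt hr.1
  have hm : ContinuousOn (fun r => W.U t (γ r)) I :=
    (Weights.continuousOn_U t).comp (hc.mono inter_subset_left) fun r hr =>
      ⟨away_of_im_pos (hγ r hr.1).1, ne_zero_of_im_pos (hγ r hr.1).1⟩
  have hTgt : ∀ r ∈ I, t < (W.T (γ r)).re := by
    intro r hr
    obtain ⟨h1, h2, h3⟩ := hγ r hr.1
    have hrs : r < ‖s‖ := hr.2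
    have := Weights.T_strictAnti h.nt h1 hsa h3 hD
      (by rintro e; rw [e] at h2; linarith)
      (by rintro e; rw [e, Complex.norm_conj] at h2; linarith)
    rw [h2] at this
    have hp := pos r hr.1
    have h5 : 0 < ‖s‖ ^ 2 - r ^ 2 := by nlinarith
    have h6 := pos_of_mul_pos_left this h5.le
    linarith
  have ray : ∀ (w : ℂ), w ≠ 0 → Away A B w → ∀ᶠ r in 𝓝 (‖w‖ : ℝ),
      Away A B (w + ((r / ‖w‖ - 1 : ℝ) : ℂ) * w) ∧ w + ((r / ‖w‖ - 1 : ℝ) : ℂ) * w ≠ 0 := by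
    intro w hw0 hw
    have hn := norm_pos_iff.2 hw0
    have hct : ContinuousAt (fun r : ℝ => w + ((r / ‖w‖ - 1 : ℝ) : ℂ) * w) ‖w‖ := by fun_prop
    have e0 : w + ((‖w‖ / ‖w‖ - 1 : ℝ) : ℂ) * w = w := by rw [div_self hn.ne']; simp
    refine hct.eventually (p := fun z => Away A B z ∧ z ≠ 0) ?_
    simp only [e0]
    exact Filter.Eventually.and (W.isOpen_away.mem_nhds hw) (isOpen_ne.mem_nhds hw0)
  have hray_norm : ∀ (w : ℂ), w ≠ 0 → ∀ r, 0 < r → ‖w + ((r / ‖w‖ - 1 : ℝ) : ℂ) * w‖ = r := by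
    intro w hw0 r hr
    have hn := norm_pos_iff.2 hw0
    have : w + ((r / ‖w‖ - 1 : ℝ) : ℂ) * w = ((r / ‖w‖ : ℝ) : ℂ) * w := by push_cast; ring
    rw [this, norm_mul, Complex.norm_real, Real.norm_of_nonneg (by positivity),
      div_mul_cancel₀ _ hn.ne']
  have hle : ∀ (w : ℂ), w ≠ 0 → Away A B w → ∀ᶠ r in 𝓝 (‖w‖ : ℝ), r ∈ Rng zp vm →
      W.U t (γ r) ≤ W.U t (w + ((r / ‖w‖ - 1 : ℝ) : ℂ) * w) := by
    intro w hw0 hw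
    filter_upwards [ray w hw0 hw] with r h1 hr
    obtain ⟨h2, h3, h4⟩ := hγ r hr
    have := Weights.U_tangent (W := W) t h1.1 (away_of_im_pos h2) (ne_zero_of_im_pos h2)
      ((hray_norm w hw0 r (pos r hr)).trans h3.symm)
    rw [h4, mul_zero, add_zero] at this
    exact this
  have hleft : ∀ r ∈ I, ∀ᶠ r' in 𝓝[<] r, r' ∈ I → W.U t (γ r') < W.U t (γ r) := by
    intro r hr
    obtain ⟨h1, h2, h3⟩ := hγ r hr.1
    set w := γ r with hw
    have hw0 := ne_zero_of_im_pos h1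
    have hwa := away_of_im_pos (A := A) (B := B) h1
    have hp := pos r hr.1
    have hd : HasDerivAt (fun ρ : ℝ => W.U t (w + ρ * w))
        ((W.T w).re - t) 0 := by
      have := Weights.hasDerivAt_U (W := W) t (z := w) (e := w) (ρ := 0) (by simpa using hwa)
        (by simpa using hw0)
      convert this using 1
      simp only [Complex.ofReal_zero, zero_mul, add_zero]
      rw [mul_div_assoc, mul_div_cancel₀ _ hw0]
      simp
    have hg : HasDerivAt (fun r' : ℝ => r' / r - 1) (1 / r) r := by
      simpa using ((hasDerivAt_id r).div_const r).sub_const 1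
    have hg0 : r / r - 1 = 0 := by rw [div_self hp.ne']; ring
    have hd2 : HasDerivAt (fun r' : ℝ => W.U t (w + ((r' / r - 1 : ℝ) : ℂ) * w))
        (((W.T w).re - t) * (1 / r)) r :=
      HasDerivAt.comp (h₂ := fun ρ : ℝ => W.U t (w + ρ * w)) (h := fun r' : ℝ => r' / r - 1) r
        (by rw [hg0]; exact hd) hg
    have hpos : 0 < ((W.T w).re - t) * (1 / r) :=
      mul_pos (sub_pos.2 (hTgt r hr)) (by positivity)
    have hev := (hasDerivWithinAt_iff_tendsto_slope'
      (s := Iio r) (by simp)).1 hd2.hasDerivWithinAt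
    have hev2 := hev.eventually_const_lt hpos
    have hle' := hle w hw0 hwa
    rw [h2] at hle'
    filter_upwards [hev2, nhdsWithin_le_nhds hle', self_mem_nhdsWithin] with r' h4 h5 h6 h7
    have h8 := h5 h7.1
    refine h8.trans_lt ?_
    rw [slope_def_field] at h4
    have h9 : r' - r < 0 := sub_neg.2 h6
    simp only [hg0, Complex.ofReal_zero, zero_mul, add_zero] at h4
    have h10 := mul_neg_of_pos_of_neg h4 h9
    rw [div_mul_cancel₀ _ h9.ne] at h10
    linarith
  have hlt : ∀ a b, a ∈ I → b ∈ I → a < b → W.U t (γ a) < W.U t (γ b) := fun a b ha hb hab =>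
    lt_of_eventually_left_lt hIo hm hleft ha hb hab
  have haI : a ∈ I := ⟨ha, hab.trans hb⟩
  have hmem : ∀ r, a ≤ r → r < ‖s‖ → r ∈ I := by
    intro r h1 h2
    refine ⟨⟨ha.1.trans_le h1, ?_⟩, h2⟩
    rcases (abs_nonneg vm).eq_or_lt with h3 | h3
    · rw [← h3, mul_zero]; exact one_pos
    · exact (mul_lt_mul_of_pos_right h2 h3).trans_le hclose
  have hbI : b ∈ I := hmem b hab.le hb
  refine ⟨hlt a b haI hbI hab, (hlt a b haI hbI hab).trans_le ?_⟩
  have hlim : Tendsto (fun r : ℝ => W.U t (s + ((r / ‖s‖ - 1 : ℝ) : ℂ) * s)) (𝓝[<] ‖s‖)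
      (𝓝 (W.U t s)) := by
    have hn := norm_pos_iff.2 hs0
    have hct : ContinuousAt (fun r : ℝ => s + ((r / ‖s‖ - 1 : ℝ) : ℂ) * s) ‖s‖ := by fun_prop
    have e0 : s + ((‖s‖ / ‖s‖ - 1 : ℝ) : ℂ) * s = s := by rw [div_self hn.ne']; simp
    have := ContinuousAt.comp (g := W.U t) (f := fun r : ℝ => s + ((r / ‖s‖ - 1 : ℝ) : ℂ) * s)
      (x := ‖s‖) (by rw [e0]; exact Weights.continuousAt_U hsa hs0) hct
    have h2 := this.tendsto
    simp only [Function.comp_def, e0] at h2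
    exact h2.mono_left nhdsWithin_le_nhds
  refine ge_of_tendsto hlim ?_
  filter_upwards [nhdsWithin_le_nhds (hle s hs0 hsa), Ioo_mem_nhdsLT hb] with r h1 h2
  have hrI := hmem r (hab.trans h2.1).le h2.2
  exact (hlt b r hbI hrI h2.1).le.trans (h1 hrI.1)

end Crit

end

end DualSchur

namespace DualSchur

noncomputable section

/-! ### Connecting to the real line below a level of the potential -/

/-- Closed upper half plane points used to reach the real interval between the poles. -/
def Low {A B : Set ℝ} (W : Weights A B) (t : ℝ) (s : ℂ) : Set ℂ :=
  {z | (0 < z.im ∨ In0 A B z.re ∧ z.re ≠ 0) ∧ ‖z‖ < ‖s‖ ∧ W.U t z < W.U t s}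

/-- A critical point at which the potential is compared. -/
structure Contact {A B : Set ℝ} (W : Weights A B) (zp vm t : ℝ) (s : ℂ) : Prop where
  im : 0 ≤ s.im
  aw : Away A B s
  ne : s ≠ 0
  D : W.D s = 0
  T : t ≤ (W.T s).re
  lo : |zp| < ‖s‖
  hi : ‖s‖ * |vm| ≤ 1

/-- The continuous extension part of the potential at `0`. -/
theorem Weights.exists_U_le {A B : Set ℝ} (W : Weights A B) (h0 : In0 A B 0) (t : ℝ) :
    ∃ C : ℝ, ∀ᶠ z in 𝓝[≠] (0 : ℂ), W.U t z ≤ C + (W.ν.real univ - t) * Real.log ‖z‖ := by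
  set G : ℂ → ℝ := fun z => -(∫ x, Real.log ‖1 - (x : ℂ) * z‖ ∂W.μ) -
    ∫ y, Real.log ‖z + (y : ℂ)‖ ∂W.ν with hG
  have aw0 : Away A B ((0 : ℝ) : ℂ) := h0.away
  rw [Complex.ofReal_zero] at aw0
  have hc : ContinuousOn G {z | Away A B z} := by
    refine (continuousOn_integral_carried W.hA W.μA ?_).neg.sub
      (continuousOn_integral_carried W.hB W.νB ?_)
    · exact ContinuousOn.log (by fun_prop)
        fun p hp => norm_ne_zero_iff.2 (hp.1.1 _ hp.2)
    · exact ContinuousOn.log (by fun_prop)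
        fun p hp => norm_ne_zero_iff.2 (hp.1.2 _ hp.2)
  have hca : ContinuousAt G 0 := hc.continuousAt (W.isOpen_away.mem_nhds aw0)
  refine ⟨G 0 + 1, ?_⟩
  have h1 := hca.eventually_lt_const (show G 0 < G 0 + 1 by linarith)
  have h2 : ∀ᶠ z in 𝓝 (0 : ℂ), Away A B z := W.isOpen_away.mem_nhds aw0
  filter_upwards [nhdsWithin_le_nhds h1, nhdsWithin_le_nhds h2, self_mem_nhdsWithin]
    with z h3 h4 h5
  have h5 : z ≠ 0 := h5
  have hn := norm_ne_zero_iff.2 h5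
  have e : ∫ y, Real.log ‖1 + (y : ℂ) / z‖ ∂W.ν =
      (∫ y, Real.log ‖z + (y : ℂ)‖ ∂W.ν) - W.ν.real univ * Real.log ‖z‖ := by
    have i1 : Integrable (fun y : ℝ => Real.log ‖z + (y : ℂ)‖) W.ν :=
      W.intB (ContinuousOn.log (by fun_prop) fun y hy => norm_ne_zero_iff.2 (h4.2 _ hy))
    have := W.finν
    rw [← smul_eq_mul, ← integral_const, ← integral_sub i1 (integrable_const _)]
    refine W.congrB fun y hy => ?_
    rw [← Real.log_div (norm_ne_zero_iff.2 (h4.2 _ hy)) hn, ← norm_div]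
    congr 2
    field_simp
  have e2 : W.U t z = G z + (W.ν.real univ - t) * Real.log ‖z‖ := by
    rw [Weights.U, e, hG]; ring
  rw [e2]
  linarith

namespace Crit

variable {A B : Set ℝ} {W : Weights A B} {zp vm : ℝ}

theorem isOpen_low (W : Weights A B) (t : ℝ) (s : ℂ) : IsOpen (Low W t s) := by
  have hO : IsOpen {z : ℂ | 0 < z.im ∨ In0 A B z.re ∧ z.re ≠ 0} := by
    refine (isOpen_lt continuous_const Complex.continuous_im).union ?_
    have : IsOpen {r : ℝ | In0 A B r ∧ r ≠ 0} :=
      (isOpen_iff_eventually.2 fun r hr => W.eventually_In0 hr).inter isOpen_ne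
    exact this.preimage Complex.continuous_re
  have hU : ContinuousOn (W.U t) {z : ℂ | 0 < z.im ∨ In0 A B z.re ∧ z.re ≠ 0} := by
    refine (Weights.continuousOn_U t).mono ?_
    rintro z (hz | hz)
    · exact ⟨away_of_im_pos hz, ne_zero_of_im_pos hz⟩
    · exact ⟨Weights.away_of_In0_re hz.1, by rintro rfl; exact hz.2 rfl⟩
  have h1 := hU.isOpen_inter_preimage hO (isOpen_Iio (a := W.U t s))
  have h2 : Low W t s = ({z : ℂ | 0 < z.im ∨ In0 A B z.re ∧ z.re ≠ 0} ∩
      W.U t ⁻¹' Iio (W.U t s)) ∩ {z | ‖z‖ < ‖s‖} := by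
    ext z
    simp only [Low, mem_ofPred_eq, mem_inter_iff, mem_preimage, mem_Iio]
    tauto
  rw [h2]
  exact h1.inter (isOpen_lt continuous_norm continuous_const)

/-- The arc between two points of the upper half plane with the same modulus. -/
theorem exists_arc (t : ℝ) {z1 z2 : ℂ} (h1 : 0 < z1.im) (h2 : 0 < z2.im) (hn : ‖z1‖ = ‖z2‖) :
    ∃ S : Set ℂ, IsPreconnected S ∧ z1 ∈ S ∧ z2 ∈ S ∧ ∀ z ∈ S, 0 < z.im ∧ ‖z‖ = ‖z1‖ ∧
      W.U t z ≤ max (W.U t z1) (W.U t z2) := by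
  wlog hle : z1.re ≤ z2.re generalizing z1 z2
  · obtain ⟨S, a, b, c, d⟩ := this h2 h1 hn.symm (not_le.1 hle).le
    refine ⟨S, a, c, b, fun z hz => ?_⟩
    obtain ⟨d1, d2, d3⟩ := d z hz
    exact ⟨d1, d2.trans hn.symm, by rwa [max_comm]⟩
  have hr : 0 < ‖z1‖ := norm_pos_iff.2 (ne_zero_of_im_pos h1)
  set c1 := z1.re / ‖z1‖
  set c2 := z2.re / ‖z2‖
  have m1 : c1 ∈ Ioo (-1 : ℝ) 1 := re_div_norm_mem h1
  have m2 : c2 ∈ Ioo (-1 : ℝ) 1 := re_div_norm_mem h2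
  have e1 : pt ‖z1‖ c1 = z1 := pt_of_im_nonneg h1.le (ne_zero_of_im_pos h1)
  have e2 : pt ‖z1‖ c2 = z2 := hn ▸ pt_of_im_nonneg h2.le (ne_zero_of_im_pos h2)
  have h12 : c1 ≤ c2 := by
    simp only [c1, c2, hn]
    exact div_le_div_of_nonneg_right hle (norm_nonneg _)
  refine ⟨(fun c => pt ‖z1‖ c) '' Icc c1 c2, ?_, ⟨c1, ⟨le_rfl, h12⟩, e1⟩,
    ⟨c2, ⟨h12, le_rfl⟩, e2⟩, ?_⟩
  · exact isPreconnected_Icc.image _ (continuous_pt.comp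
      (by fun_prop : Continuous fun c : ℝ => (‖z1‖, c))).continuousOn
  · rintro z ⟨c, hc, rfl⟩
    have mc : c ∈ Ioo (-1 : ℝ) 1 := ⟨m1.1.trans_le hc.1, hc.2.trans_lt m2.2⟩
    have hi := pt_im_pos hr mc
    have hnc : ‖pt ‖z1‖ c‖ = ‖z1‖ := norm_pt hr.le ⟨mc.1.le, mc.2.le⟩
    refine ⟨hi, hnc, ?_⟩
    refine Weights.U_le_max t (away_of_im_pos hi) (away_of_im_pos h1) (away_of_im_pos h2)
      (ne_zero_of_im_pos hi) hnc.symm (hn.symm.trans hnc.symm) ?_ ?_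
    · have := mul_le_mul_of_nonneg_left hc.1 hr.le
      have e := congrArg Complex.re e1
      rw [← e]
      exact this
    · have := mul_le_mul_of_nonneg_left hc.2 hr.le
      have e := congrArg Complex.re e2
      rw [← e]
      exact this

/-- Near `zp` there is a real point that can be reached from all critical points close to `zp`. -/
theorem exists_real_end (h : Crit W zp vm) {t : ℝ} (ht : t < (W.T zp).re) {s : ℂ}
    (hs : Contact W zp vm t s) : ∃ δ > 0, ∃ S : Set ℂ, IsPreconnected S ∧ S ⊆ Low W t s ∧
      (∃ a : ℝ, In0 A B a ∧ a ≠ 0 ∧ (a : ℂ) ∈ S) ∧ ∀ z : ℂ, 0 < z.im → ‖z - zp‖ < δ → z ∈ S := by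
  obtain ⟨γ, hγ, hc⟩ := h.exists_curve
  have hcoe : ContinuousAt (fun z : ℂ => z.re) (zp : ℂ) := by fun_prop
  have hI : ∀ᶠ z in 𝓝 (zp : ℂ), In0 A B z.re :=
    hcoe.eventually (p := fun r => In0 A B r) (by simpa using W.eventually_In0 h.hp)
  have hnorm : ∀ᶠ z in 𝓝 (zp : ℂ), ‖z‖ < ‖s‖ := by
    have : ContinuousAt (fun z : ℂ => ‖z‖) (zp : ℂ) := by fun_prop
    refine this.eventually_lt_const ?_
    simpa only [Complex.norm_real, Real.norm_eq_abs] using hs.lo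
  -- At the origin `U` is singular: it behaves like `(ν(ℝ) - t) log |z|`, which tends to `-∞` since
  -- `t < T(0) = ν(ℝ)`. The set must then avoid `0`; an upper and a right half disc are glued.
  by_cases hz : zp = 0
  · subst hz
    obtain ⟨C, hC⟩ := W.exists_U_le h.hp t
    obtain ⟨q, -, e⟩ := Weights.T_In0_eq h.nt h.hp h.Dp
    have hk : 0 < W.ν.real univ - t := by
      rw [e] at ht
      simp at ht
      linarith
    have hlog : Tendsto (fun z : ℂ => C + (W.ν.real univ - t) * Real.log ‖z‖) (𝓝[≠] 0) atBot := by
      refine tendsto_atBot_add_const_left _ _ (Tendsto.const_mul_atBot hk ?_)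
      exact Real.tendsto_log_nhdsGT_zero.comp tendsto_norm_nhdsNE_zero
    have hUlt : ∀ᶠ z in 𝓝[≠] (0 : ℂ), W.U t z < W.U t s := by
      filter_upwards [hC, hlog.eventually_lt_atBot (W.U t s)] with z h1 h2
      exact h1.trans_lt h2
    rw [Complex.ofReal_zero] at hI hnorm
    rw [eventually_nhdsWithin_iff] at hUlt
    obtain ⟨δ, hδ, hb⟩ := Metric.eventually_nhds_iff_ball.1 (hI.and (hnorm.and hUlt))
    set S1 : Set ℂ := Metric.ball 0 δ ∩ {z | 0 < z.im}
    set S2 : Set ℂ := Metric.ball 0 δ ∩ {z | 0 < z.re}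
    have c1 : IsPreconnected S1 :=
      ((convex_ball (0 : ℂ) δ).inter (convex_halfSpace_im_gt 0)).isPreconnected
    have c2 : IsPreconnected S2 :=
      ((convex_ball (0 : ℂ) δ).inter (convex_halfSpace_re_gt 0)).isPreconnected
    refine ⟨δ, hδ, S1 ∪ S2, ?_, ?_, ⟨δ / 2, ?_, by positivity, ?_⟩, ?_⟩
    · refine IsPreconnected.union (((δ / 4 : ℝ) : ℂ) + ((δ / 4 : ℝ) : ℂ) * Complex.I) ?_ ?_ c1 c2
      all_goals
        refine ⟨?_, by simp; positivity⟩
        rw [mem_ball_zero_iff]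
        refine (norm_add_le _ _).trans_lt ?_
        rw [norm_mul, Complex.norm_I, mul_one, Complex.norm_real, Real.norm_of_nonneg (by positivity)]
        linarith
    · rintro z (⟨hz1, hz2⟩ | ⟨hz1, hz2⟩)
      · obtain ⟨h1, h2, h3⟩ := hb z hz1
        exact ⟨Or.inl hz2, h2, h3 (ne_zero_of_im_pos hz2)⟩
      · obtain ⟨h1, h2, h3⟩ := hb z hz1
        have hz2 : 0 < z.re := hz2
        exact ⟨Or.inr ⟨h1, hz2.ne'⟩, h2, h3 (by rintro rfl; simp at hz2)⟩
    · have hmem : ((δ / 2 : ℝ) : ℂ) ∈ Metric.ball (0 : ℂ) δ := by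
        rw [mem_ball_zero_iff, Complex.norm_real, Real.norm_of_nonneg (by positivity)]
        linarith
      simpa using (hb _ hmem).1
    · right
      refine ⟨?_, by simp; positivity⟩
      rw [mem_ball_zero_iff, Complex.norm_real, Real.norm_of_nonneg (by positivity)]
      linarith
    · intro z hz1 hz2
      left
      exact ⟨by simpa using hz2, hz1⟩
  · have hz0 : (zp : ℂ) ≠ 0 := by exact_mod_cast hz
    have hUc := Weights.continuousAt_U (W := W) (t := t) h.hp.away hz0
    -- The potential at `zp` is a limit of values at curve points arbitrarily close to `zp`. These
    -- are below the value at a fixed curve point `z1`, which is strictly below the value at `s`.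
    have hU : W.U t zp < W.U t s := by
      obtain ⟨t1, ht1, ht1', z1, hz1, hd1, e1⟩ := h.exists_near (ε := ‖s‖ - |zp|)
        (by linarith [hs.lo]) (max_lt ht h.lower_lt_upper)
      have D1 := Weights.D_eq_zero_of_T_eq hz1 e1
      have m1 : ‖z1‖ ∈ Rng zp vm := h.mem_rng hz1 D1
        (by rw [e1, Complex.ofReal_re]; exact (le_max_right _ _).trans_lt ht1)
        (by rwa [e1, Complex.ofReal_re])
      have hz1s : ‖z1‖ < ‖s‖ := by
        have := norm_sub_norm_le z1 (zp : ℂ)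
        rw [Complex.norm_real, Real.norm_eq_abs] at this
        linarith
      have hlt := (h.U_curve_lt hγ hc hs.aw hs.ne hs.D hs.T hs.hi m1
        (b := (‖z1‖ + ‖s‖) / 2) (by linarith) (by linarith)).2
      refine lt_of_le_of_lt ?_ hlt
      refine le_of_forall_pos_lt_add fun ε hε => ?_
      have hev : ∀ᶠ z in 𝓝 (zp : ℂ), W.U t zp - ε < W.U t z ∧ ‖z‖ < ‖z1‖ := by
        refine (hUc.eventually_const_lt (by linarith)).and ?_
        have : ContinuousAt (fun z : ℂ => ‖z‖) (zp : ℂ) := by fun_prop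
        refine this.eventually_lt_const ?_
        simpa only [Complex.norm_real, Real.norm_eq_abs] using m1.1
      obtain ⟨δ, hδ, hb⟩ := Metric.eventually_nhds_iff.1 hev
      obtain ⟨t2, ht2, ht2', z2, hz2, hd2, e2⟩ := h.exists_near (ε := δ) hδ h.lower_lt_upper
      have D2 := Weights.D_eq_zero_of_T_eq hz2 e2
      have m2 : ‖z2‖ ∈ Rng zp vm := h.mem_rng hz2 D2
        (by rw [e2, Complex.ofReal_re]; exact ht2) (by rwa [e2, Complex.ofReal_re])
      obtain ⟨h3, h4⟩ := hb (show dist z2 zp < δ by rwa [dist_eq_norm])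
      have g2 : γ ‖z2‖ = z2 := by
        obtain ⟨a, b, c⟩ := hγ _ m2
        exact h.crit_unique a hz2 c D2 b
      have hlt2 := (h.U_curve_lt hγ hc hs.aw hs.ne hs.D hs.T hs.hi m2 h4 hz1s).1
      rw [g2] at hlt2
      linarith
    have h3 : ∀ᶠ z in 𝓝 (zp : ℂ), z.re ≠ 0 := hcoe.eventually_ne (by simpa using hz)
    obtain ⟨δ, hδ, hb⟩ := Metric.eventually_nhds_iff_ball.1
      (hI.and (hnorm.and (h3.and (hUc.eventually_lt_const hU))))
    refine ⟨δ, hδ, Metric.ball zp δ, (convex_ball _ _).isPreconnected, ?_,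
      ⟨zp, h.hp, hz, Metric.mem_ball_self hδ⟩, fun z _ h2 => by rwa [mem_ball_iff_norm]⟩
    intro z hz
    obtain ⟨h4, h5, h6, h7⟩ := hb z hz
    exact ⟨Or.inr ⟨h4, h6⟩, h5, h7⟩

/-- From `e` an arc of its circle leads to the curve; `U` on the arc is at most the larger of its
end values. The curve is followed inwards, where `U` decreases, until the neighbourhood of `zp`
given by `exists_real_end` is reached. -/
theorem exists_preconnected (h : Crit W zp vm) {t : ℝ} (ht : t < (W.T zp).re) {s : ℂ}
    (hs : Contact W zp vm t s) {e : ℂ} (he : 0 < e.im) (he1 : |zp| < ‖e‖) (he2 : ‖e‖ < ‖s‖)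
    (heU : W.U t e < W.U t s) : ∃ S : Set ℂ, IsPreconnected S ∧ S ⊆ Low W t s ∧ e ∈ S ∧
      ∃ a : ℝ, In0 A B a ∧ a ≠ 0 ∧ (a : ℂ) ∈ S := by
  obtain ⟨γ, hγ, hc⟩ := h.exists_curve
  have meR : ‖e‖ ∈ Rng zp vm := by
    refine ⟨he1, ?_⟩
    rcases (abs_nonneg vm).eq_or_lt with h3 | h3
    · rw [← h3, mul_zero]; exact one_pos
    · exact (mul_lt_mul_of_pos_right he2 h3).trans_le hs.hi
  have hcurve : ∀ r ∈ Rng zp vm, r < ‖s‖ → γ r ∈ Low W t s := by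
    intro r hr hrs
    obtain ⟨h1, h2, h3⟩ := hγ r hr
    exact ⟨Or.inl h1, h2.symm ▸ hrs, (h.U_curve_lt hγ hc hs.aw hs.ne hs.D hs.T hs.hi hr
        (b := (r + ‖s‖) / 2) (by linarith) (by linarith)).2⟩
  obtain ⟨g1, g2, g3⟩ := hγ _ meR
  obtain ⟨S1, c1, m1, m1', d1⟩ := exists_arc (W := W) t he g1 g2.symm
  obtain ⟨δ, hδ, S3, c3, d3, ⟨a, ha, ha0, haS⟩, hS3⟩ := h.exists_real_end ht hs
  obtain ⟨t2, ht2, ht2', z2, hz2, hd2, e2⟩ := h.exists_near (ε := min δ (‖e‖ - |zp|))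
    (lt_min hδ (by linarith)) h.lower_lt_upper
  have D2 := Weights.D_eq_zero_of_T_eq hz2 e2
  have m2 : ‖z2‖ ∈ Rng zp vm := h.mem_rng hz2 D2
    (by rw [e2, Complex.ofReal_re]; exact ht2) (by rwa [e2, Complex.ofReal_re])
  have g2' : γ ‖z2‖ = z2 := by
    obtain ⟨a, b, c⟩ := hγ _ m2
    exact h.crit_unique a hz2 c D2 b
  have hz2e : ‖z2‖ < ‖e‖ := by
    have := norm_sub_norm_le z2 (zp : ℂ)
    rw [Complex.norm_real, Real.norm_eq_abs] at this
    have := hd2.trans_le (min_le_right _ _)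
    linarith
  set S2 : Set ℂ := γ '' Icc ‖z2‖ ‖e‖
  have hsub : Icc ‖z2‖ ‖e‖ ⊆ Rng zp vm := rng_ordConnected.out m2 meR
  have c2 : IsPreconnected S2 := isPreconnected_Icc.image _ (hc.mono hsub)
  have k1 : γ ‖e‖ ∈ S2 := ⟨_, ⟨hz2e.le, le_rfl⟩, rfl⟩
  have k2 : z2 ∈ S2 := ⟨_, ⟨le_rfl, hz2e.le⟩, g2'⟩
  have k3 : z2 ∈ S3 := hS3 z2 hz2 (hd2.trans_le (min_le_left _ _))
  refine ⟨S1 ∪ S2 ∪ S3, IsPreconnected.union z2 (Or.inr k2) k3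
    (IsPreconnected.union _ m1' k1 c1 c2) c3, ?_, Or.inl (Or.inl m1), a, ha, ha0, Or.inr haS⟩
  rintro z ((hz | ⟨r, hr, rfl⟩) | hz)
  · obtain ⟨a1, a2, a3⟩ := d1 z hz
    exact ⟨Or.inl a1, a2.symm ▸ he2, a3.trans_lt (max_lt heU (hcurve _ meR he2).2.2)⟩
  · exact hcurve r (hsub hr) (hr.2.trans_lt he2)
  · exact d3 hz

end Crit

/-- Along a connected set the increments of a primitive are controlled by its derivative on a
compact set. -/
theorem exists_compact_chain {G S : Set ℂ} (hG : IsOpen G) (hS : IsPreconnected S) (hSG : S ⊆ G)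
    {a b : ℂ} (ha : a ∈ S) (hb : b ∈ S) : ∃ K ⊆ G, IsCompact K ∧ ∃ C : ℝ,
      ∀ (Φ φ : ℂ → ℂ) (M : ℝ), (∀ z ∈ K, HasDerivAt Φ (φ z) z) → (∀ z ∈ K, ‖φ z‖ ≤ M) →
        ‖Φ b - Φ a‖ ≤ C * M := by
  refine hS.induction₂' (fun a b => ∃ K ⊆ G, IsCompact K ∧ ∃ C : ℝ,
      ∀ (Φ φ : ℂ → ℂ) (M : ℝ), (∀ z ∈ K, HasDerivAt Φ (φ z) z) → (∀ z ∈ K, ‖φ z‖ ≤ M) →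
        ‖Φ b - Φ a‖ ≤ C * M) ?_ ?_ ha hb
  · intro x hx
    obtain ⟨ε, hε, hb⟩ := Metric.nhds_basis_closedBall.mem_iff.1 (hG.mem_nhds (hSG hx))
    have key : ∀ y ∈ Metric.closedBall x ε, ∀ (Φ φ : ℂ → ℂ) (M : ℝ),
        (∀ z ∈ Metric.closedBall x ε, HasDerivAt Φ (φ z) z) →
        (∀ z ∈ Metric.closedBall x ε, ‖φ z‖ ≤ M) → ‖Φ y - Φ x‖ ≤ ε * M := by
      intro y hy Φ φ M h1 h2
      have hM : 0 ≤ M := (norm_nonneg _).trans (h2 x (Metric.mem_closedBall_self hε.le))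
      have := (convex_closedBall x ε).norm_image_sub_le_of_norm_hasDerivWithin_le
        (fun z hz => (h1 z hz).hasDerivWithinAt) h2 (Metric.mem_closedBall_self hε.le) hy
      refine this.trans ?_
      rw [mul_comm]
      exact mul_le_mul_of_nonneg_right (by simpa [dist_eq_norm] using hy) hM
    filter_upwards [nhdsWithin_le_nhds (Metric.closedBall_mem_nhds x hε)] with y hy
    refine ⟨⟨_, hb, isCompact_closedBall x ε, ε, key y hy⟩,
      ⟨_, hb, isCompact_closedBall x ε, ε, fun Φ φ M h1 h2 => ?_⟩⟩
    rw [norm_sub_rev]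
    exact key y hy Φ φ M h1 h2
  · rintro x y z - - - ⟨K1, s1, k1, C1, h1⟩ ⟨K2, s2, k2, C2, h2⟩
    refine ⟨K1 ∪ K2, union_subset s1 s2, k1.union k2, C1 + C2, fun Φ φ M h3 h4 => ?_⟩
    have e : Φ z - Φ x = (Φ z - Φ y) + (Φ y - Φ x) := by ring
    rw [e]
    refine (norm_add_le _ _).trans ?_
    have b1 := h1 Φ φ M (fun w hw => h3 w (Or.inl hw)) fun w hw => h4 w (Or.inl hw)
    have b2 := h2 Φ φ M (fun w hw => h3 w (Or.inr hw)) fun w hw => h4 w (Or.inr hw)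
    linarith

end

end DualSchur

namespace DualSchur

noncomputable section

/-! ### Cauchy type integrals -/

theorem circleAverage_inv_sq {z : ℂ} {r : ℝ} (hz : ‖z‖ < r) :
    ∫ θ in (0 : ℝ)..2 * π, (‖circleMap 0 r θ - z‖ ^ 2)⁻¹ = 2 * π / (r ^ 2 - ‖z‖ ^ 2) := by
  have hr : 0 < r := (norm_nonneg _).trans_lt hz
  -- The Poisson integral of the constant `1` equals `1`.
  have h := DiffContOnCl.circleAverage_poissonKernel_smul' (f := fun _ => (1 : ℝ → ℂ) 0) (c := 0)
    (R := r) (w := z) diffContOnCl_const (by simpa using hz)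
  have hd : r ^ 2 - ‖z‖ ^ 2 ≠ 0 := by nlinarith [norm_nonneg z]
  have h2 : (2 * π)⁻¹ * ∫ θ in (0 : ℝ)..2 * π, (r ^ 2 - ‖z‖ ^ 2) *
      (‖circleMap 0 r θ - z‖ ^ 2)⁻¹ = 1 := by
    have h3 := congrArg Complex.re h
    simp only [Real.circleAverage_def, sub_zero, norm_circleMap_zero, sq_abs, Pi.one_apply] at h3
    rw [Complex.one_re] at h3
    rw [← h3]
    simp only [Complex.real_smul, mul_one]
    rw [intervalIntegral.integral_ofReal, ← Complex.ofReal_mul, Complex.ofReal_re]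
    rfl
  rw [intervalIntegral.integral_const_mul] at h2
  field_simp at h2 ⊢
  linarith

/-- The inequality `1/d ≤ l/(2d²) + 1/(2l)` with `l = √(r² - |z|²)` and the Poisson integral replace
the trivial factor `1/(r - |z|)` by `1/√(r² - |z|²)`, which is integrable along a segment that
leaves the circle transversally. -/
theorem norm_circleIntegral_div_le {φ : ℂ → ℂ} {z : ℂ} {r M : ℝ} (hz : ‖z‖ < r)
    (hφ : ∀ w, ‖w‖ = r → ‖φ w‖ ≤ M) :
    ‖∮ w in C(0, r), φ w / (w - z)‖ ≤ 2 * π * r * M / √(r ^ 2 - ‖z‖ ^ 2) := by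
  have hr : 0 < r := (norm_nonneg _).trans_lt hz
  have hd : 0 < r ^ 2 - ‖z‖ ^ 2 := by nlinarith [norm_nonneg z]
  set l := √(r ^ 2 - ‖z‖ ^ 2) with hl
  have hl0 : 0 < l := Real.sqrt_pos.2 hd
  have hl2 : l ^ 2 = r ^ 2 - ‖z‖ ^ 2 := Real.sq_sqrt hd.le
  have hne : ∀ θ : ℝ, circleMap 0 r θ - z ≠ 0 := by
    intro θ h
    have : ‖circleMap 0 r θ‖ = ‖z‖ := by rw [sub_eq_zero.1 h]
    rw [norm_circleMap_zero, abs_of_pos hr] at this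
    linarith
  have hM : 0 ≤ M := (norm_nonneg _).trans (hφ r (by simp [abs_of_pos hr]))
  have hci : Continuous fun θ : ℝ => (‖circleMap 0 r θ - z‖ ^ 2)⁻¹ := by
    refine Continuous.inv₀ ?_ fun θ => pow_ne_zero 2 (norm_ne_zero_iff.2 (hne θ))
    exact (((continuous_circleMap 0 r).sub continuous_const).norm).pow 2
  have hg : IntervalIntegrable
      (fun θ : ℝ => r * M * (l / 2 * (‖circleMap 0 r θ - z‖ ^ 2)⁻¹ + 1 / (2 * l)))
      volume 0 (2 * π) := by
    refine Continuous.intervalIntegrable ?_ _ _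
    fun_prop
  have h1 := intervalIntegral.norm_integral_le_of_norm_le Real.two_pi_pos.le
    (f := fun θ : ℝ => deriv (circleMap 0 r) θ • (φ (circleMap 0 r θ) / (circleMap 0 r θ - z)))
    (Eventually.of_forall fun θ _ => ?_) hg
  · rw [circleIntegral]
    refine h1.trans_eq ?_
    rw [intervalIntegral.integral_const_mul, intervalIntegral.integral_add
      ((hci.const_mul _).intervalIntegrable _ _) (by simp), intervalIntegral.integral_const_mul,
      circleAverage_inv_sq hz, ← hl2]
    simp only [intervalIntegral.integral_const, smul_eq_mul, sub_zero]
    field_simp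
    ring
  · have hn := norm_pos_iff.2 (hne θ)
    rw [norm_smul, deriv_circleMap, norm_mul, norm_circleMap_zero, Complex.norm_I, mul_one,
      abs_of_pos hr, norm_div, mul_assoc]
    refine mul_le_mul_of_nonneg_left ?_ hr.le
    have h2 : ‖φ (circleMap 0 r θ)‖ ≤ M := hφ _ (by rw [norm_circleMap_zero, abs_of_pos hr])
    rw [div_eq_mul_inv]
    refine mul_le_mul h2 ?_ (by positivity) hM
    set d := ‖circleMap 0 r θ - z‖
    have : l / 2 * (d ^ 2)⁻¹ + 1 / (2 * l) - d⁻¹ = (l - d) ^ 2 / (2 * l * d ^ 2) := by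
      field_simp; ring
    have h3 : 0 ≤ (l - d) ^ 2 / (2 * l * d ^ 2) := by positivity
    linarith

theorem circleIntegrable_zpow_div {r : ℝ} (hr : 0 < r) {z : ℂ} (hz : ‖z‖ ≠ r) (e : ℤ) :
    CircleIntegrable (fun w => w ^ e / (w - z)) 0 r := by
  refine ContinuousOn.circleIntegrable hr.le ?_
  intro w hw
  have hw : ‖w‖ = r := by simpa using hw
  have h0 : w ≠ 0 := norm_ne_zero_iff.1 (by rw [hw]; exact hr.ne')
  refine (ContinuousAt.div (continuousAt_zpow₀ _ _ (Or.inl h0)) (by fun_prop) ?_).continuousWithinAt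
  intro h
  rw [sub_eq_zero.1 h] at hw
  exact hz hw

/-- The recursion `w^(e-1)/(w - z) = z⁻¹ (w^e/(w - z) - w^(e-1))` lowers the exponent; the residue
of the last term enters only at the first step. -/
theorem circleIntegral_neg_zpow_div {r : ℝ} (hr : 0 < r) {z : ℂ} (hz : ‖z‖ ≠ r) (hz0 : z ≠ 0)
    (m : ℕ) : (∮ w in C(0, r), w ^ (-(m + 1 : ℤ)) / (w - z)) =
      z ^ (-(m + 1 : ℤ)) * ((∮ w in C(0, r), (w - z)⁻¹) - 2 * π * Complex.I) := by
  have step : ∀ e : ℤ, (∮ w in C(0, r), w ^ (e - 1) / (w - z)) =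
      z⁻¹ * ((∮ w in C(0, r), w ^ e / (w - z)) - ∮ w in C(0, r), w ^ (e - 1)) := by
    intro e
    rw [← circleIntegral.integral_sub (circleIntegrable_zpow_div hr hz e)
      (ContinuousOn.circleIntegrable hr.le fun w hw => ?_), ← smul_eq_mul,
      ← circleIntegral.integral_smul]
    · refine circleIntegral.integral_congr hr.le fun w hw => ?_
      have hw : ‖w‖ = r := by simpa using hw
      have h0 : w ≠ 0 := norm_ne_zero_iff.1 (by rw [hw]; exact hr.ne')
      have h1 : w - z ≠ 0 := by
        intro h
        rw [sub_eq_zero.1 h] at hw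
        exact hz hw
      simp only [smul_eq_mul]
      rw [zpow_sub_one₀ h0]
      field_simp
      ring
    · have hw : ‖w‖ = r := by simpa using hw
      have h0 : w ≠ 0 := norm_ne_zero_iff.1 (by rw [hw]; exact hr.ne')
      exact (continuousAt_zpow₀ _ _ (Or.inl h0)).continuousWithinAt
  induction m with
  | zero =>
    have h := step 0
    have h2 : (∮ w in C(0, r), w ^ (0 - 1 : ℤ)) = 2 * π * Complex.I := by
      have := circleIntegral.integral_sub_center_inv (0 : ℂ) hr.ne'
      simpa using this
    rw [h2] at h
    simp only [zpow_zero, one_div] at h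
    simpa using h
  | succ m ih =>
    have h := step (-(m + 1 : ℤ))
    have h2 : (∮ w in C(0, r), w ^ (-(m + 1 : ℤ) - 1)) = 0 := by
      have := circleIntegral.integral_sub_zpow_of_ne (n := -(m + 1 : ℤ) - 1) (by omega)
        (0 : ℂ) 0 r
      simpa using this
    rw [h2, ih, sub_zero] at h
    have e1 : (-((m + 1 : ℕ) + 1 : ℤ)) = -(m + 1 : ℤ) - 1 := by push_cast; ring
    rw [e1, h, zpow_sub_one₀ hz0]
    ring

theorem circleIntegral_zpow_div_inside {r : ℝ} {z : ℂ} (hz : ‖z‖ < r) (e : ℤ) :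
    (∮ w in C(0, r), w ^ e / (w - z)) = if 0 ≤ e then 2 * π * Complex.I * z ^ e else 0 := by
  have hr : 0 < r := (norm_nonneg _).trans_lt hz
  have hzb : z ∈ Metric.ball (0 : ℂ) r := by simpa using hz
  split_ifs with he
  · obtain ⟨m, rfl⟩ := Int.eq_ofNat_of_zero_le he
    have := DiffContOnCl.circleIntegral_sub_inv_smul (f := fun w : ℂ => w ^ m) (c := 0) (R := r)
      (show Differentiable ℂ fun w : ℂ => w ^ m by fun_prop).diffContOnCl hzb
    simp only [smul_eq_mul] at this
    rw [zpow_natCast, ← this]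
    refine circleIntegral.integral_congr hr.le fun w _ => ?_
    simp only [zpow_natCast]
    rw [div_eq_mul_inv, mul_comm]
  · obtain ⟨m, rfl⟩ : ∃ m : ℕ, e = -(m + 1 : ℤ) := ⟨(-e - 1).toNat, by omega⟩
    by_cases h0 : z = 0
    · subst h0
      have := circleIntegral.integral_sub_zpow_of_ne (n := -(m + 1 : ℤ) - 1) (by omega)
        (0 : ℂ) 0 r
      refine Eq.trans ?_ this
      refine circleIntegral.integral_congr hr.le fun w hw => ?_
      have hw : ‖w‖ = r := by simpa using hw
      have h0 : w ≠ 0 := norm_ne_zero_iff.1 (by rw [hw]; exact hr.ne')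
      simp only [sub_zero]
      rw [zpow_sub_one₀ h0, div_eq_mul_inv]
    · rw [circleIntegral_neg_zpow_div hr hz.ne h0, circleIntegral.integral_sub_inv_of_mem_ball hzb,
        sub_self, mul_zero]

theorem circleIntegral_zpow_div_outside {r : ℝ} (hr : 0 < r) {z : ℂ} (hz : r < ‖z‖) (e : ℤ) :
    (∮ w in C(0, r), w ^ e / (w - z)) = if 0 ≤ e then 0 else -(2 * π * Complex.I * z ^ e) := by
  have hne : ∀ w ∈ Metric.closedBall (0 : ℂ) r, w - z ≠ 0 := by
    intro w hw h
    rw [sub_eq_zero.1 h, mem_closedBall_zero_iff] at hw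
    linarith
  have hz0 : z ≠ 0 := norm_pos_iff.1 (hr.trans hz)
  have key : ∀ m : ℕ, (∮ w in C(0, r), w ^ m / (w - z)) = 0 := by
    intro m
    refine Complex.circleIntegral_eq_zero_of_differentiable_on_off_countable hr.le
      (s := ∅) (by simp) ?_ ?_
    · exact ContinuousOn.div (by fun_prop) (by fun_prop) hne
    · intro w hw
      exact DifferentiableAt.div (by fun_prop) (by fun_prop)
        (hne w (Metric.ball_subset_closedBall hw.1))
  split_ifs with he
  · obtain ⟨m, rfl⟩ := Int.eq_ofNat_of_zero_le he
    simpa using key m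
  · obtain ⟨m, rfl⟩ : ∃ m : ℕ, e = -(m + 1 : ℤ) := ⟨(-e - 1).toNat, by omega⟩
    have := key 0
    simp only [pow_zero, one_div] at this
    rw [circleIntegral_neg_zpow_div hr hz.ne' hz0, this]
    ring

/-! ### Primitives -/

/-- The open upper half plane with the vertical strips over `J` added. -/
def Strip (J : Set ℝ) : Set ℂ := {z | 0 < z.im ∨ z.re ∈ J}

theorem isOpen_strip {J : Set ℝ} (hJ : IsOpen J) : IsOpen (Strip J) :=
  (isOpen_lt continuous_const Complex.continuous_im).union (hJ.preimage Complex.continuous_re)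

/-- Integration goes from `i` horizontally at height `1` and then vertically, which stays in the
domain for every endpoint. Cauchy's theorem for rectangles gives independence of the path locally.
-/
theorem exists_primitive {J : Set ℝ} (hJ : IsOpen J) {h : ℂ → ℂ}
    (hh : DifferentiableOn ℂ h (Strip J)) : ∃ Φ : ℂ → ℂ, ∀ z ∈ Strip J, HasDerivAt Φ (h z) z := by
  refine ⟨fun z => Complex.wedgeIntegral Complex.I z h, fun z hz => ?_⟩
  obtain ⟨ε, hε, hball⟩ := Metric.isOpen_iff.1 (isOpen_strip hJ) z hz
  have hloc : HasDerivAt (fun w => Complex.wedgeIntegral z w h) (h z) z := by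
    have hcons : Complex.IsConservativeOn h (Metric.ball z ε) :=
      (hh.mono hball).isConservativeOn
    exact hcons.hasDerivAt_wedgeIntegral (hh.mono hball).continuousOn (Metric.mem_ball_self hε)
  have hev : ∀ᶠ w in 𝓝 z, Complex.wedgeIntegral Complex.I w h =
      Complex.wedgeIntegral Complex.I z h + Complex.wedgeIntegral z w h := by
    filter_upwards [Metric.ball_mem_nhds z hε] with w hw
    have hcont := hh.continuousOn
    have hdist : ∀ x ∈ uIcc z.re w.re, ∀ y ∈ uIcc z.im w.im,
        (x + y * Complex.I : ℂ) ∈ Metric.ball z ε := by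
      intro x hx y hy
      rw [mem_ball_iff_norm] at hw ⊢
      refine lt_of_le_of_lt ?_ hw
      rw [← sq_le_sq₀ (norm_nonneg _) (norm_nonneg _), ← Complex.normSq_eq_norm_sq,
        ← Complex.normSq_eq_norm_sq, Complex.normSq_apply, Complex.normSq_apply]
      have h1 := abs_sub_left_of_mem_uIcc hx
      have h2 := abs_sub_left_of_mem_uIcc hy
      have h3 := mul_self_le_mul_self (abs_nonneg _) h1
      have h4 := mul_self_le_mul_self (abs_nonneg _) h2
      rw [abs_mul_abs_self, abs_mul_abs_self] at h3 h4
      simpa using add_le_add h3 h4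
    have hmem : ∀ x ∈ uIcc z.re w.re, ∀ y, y ∈ uIcc z.im 1 ∨ y ∈ uIcc z.im w.im →
        (x + y * Complex.I : ℂ) ∈ Strip J := by
      intro x hx y hy
      -- Above a point outside `J` only the open half plane is available; as the ball lies in the
      -- domain, the relevant heights are then positive and the segment up to height `1` stays
      -- inside.
      by_cases hxJ : x ∈ J
      · exact Or.inr (by simpa using hxJ)
      · have p1 : 0 < z.im := by
          have := hball (hdist x hx z.im left_mem_uIcc)
          rcases this with h | h
          · simpa using h
          · exact absurd (by simpa using h) hxJ
        have p2 : 0 < w.im := by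
          have := hball (hdist x hx w.im right_mem_uIcc)
          rcases this with h | h
          · simpa using h
          · exact absurd (by simpa using h) hxJ
        left
        simp only [Complex.add_im, Complex.ofReal_im, Complex.mul_im, Complex.ofReal_re,
          Complex.I_im, Complex.I_re, mul_one, mul_zero, add_zero, zero_add]
        rcases hy with hy | hy
        · exact (lt_min p1 one_pos).trans_le hy.1
        · exact (lt_min p1 p2).trans_le hy.1
    have hH : ∀ a b : ℝ, IntervalIntegrable (fun x : ℝ => h (x + (1 : ℝ) * Complex.I)) volume a b := by
      intro a b
      refine (hcont.comp (by fun_prop) fun x _ => ?_).intervalIntegrable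
      exact Or.inl (by simp)
    have hV : ∀ a b : ℝ, uIcc a b ⊆ uIcc z.im 1 ∪ uIcc z.im w.im →
        IntervalIntegrable (fun y : ℝ => h (w.re + y * Complex.I)) volume a b := by
      intro a b hab
      refine (hcont.comp (by fun_prop) fun y hy => ?_).intervalIntegrable
      exact hmem _ right_mem_uIcc y (hab hy)
    have hrect := Complex.integral_boundary_rect_eq_zero_of_differentiableOn h z ⟨w.re, 1⟩
      (hh.mono fun u hu => by
        have := hmem u.re hu.1 u.im (Or.inl hu.2)
        rwa [Complex.re_add_im] at this)
    have e1 := intervalIntegral.integral_add_adjacent_intervals (hH 0 z.re) (hH z.re w.re)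
    have e2 := intervalIntegral.integral_add_adjacent_intervals
      (hV 1 z.im (by rw [uIcc_comm]; exact subset_union_left)) (hV z.im w.im subset_union_right)
    have e3 := intervalIntegral.integral_symm (f := fun y : ℝ => h (w.re + y * Complex.I))
      (μ := volume) z.im 1
    have e4 := intervalIntegral.integral_symm (f := fun y : ℝ => h (z.re + y * Complex.I))
      (μ := volume) z.im 1
    simp only [Complex.wedgeIntegral, Complex.I_re, Complex.I_im]
    rw [← e1, ← e2]
    simp only [smul_eq_mul] at hrect ⊢
    rw [e3, e4]
    linear_combination -hrect
  exact (hloc.const_add _).congr_of_eventuallyEq hev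

theorem im_primitive_eq {J : Set ℝ} {h Φ : ℂ → ℂ} (hΦ : ∀ z ∈ Strip J, HasDerivAt Φ (h z) z)
    (hreal : ∀ r ∈ J, (h r).im = 0) {a b : ℝ} (hab : uIcc a b ⊆ J) :
    (Φ a).im = (Φ b).im := by
  have hd : ∀ r ∈ uIcc a b, HasDerivAt (fun r : ℝ => (Φ r).im) 0 r := by
    intro r hr
    have h1 := (hΦ r (Or.inr (by simpa using hab hr))).comp_ofReal
    have h2 := (Complex.imCLM.hasFDerivAt (x := Φ r)).comp_hasDerivAt r h1
    have e : Complex.imCLM (h r) = 0 := hreal r (hab hr)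
    rw [e] at h2
    exact h2
  have := (convex_uIcc a b).norm_image_sub_le_of_norm_hasDerivWithin_le (C := 0)
    (fun r hr => (hd r hr).hasDerivWithinAt) (by simp) (left_mem_uIcc) (right_mem_uIcc)
  rw [zero_mul, norm_le_zero_iff, sub_eq_zero] at this
  exact this.symm

end

end DualSchur

namespace DualSchur

noncomputable section

/-! ### The kernel as a contour integral of one variable -/

/-- A Laurent expansion of `w^q / F(w)` with real coefficients. -/
structure Laurent {n k : ℕ} (X : Fin n → ℝ) (Y : Fin k → ℝ) (q : ℤ) where
  S : Finset ℕ
  b : ℕ → ℝ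
  e : ℕ → ℤ
  le : ∀ i ∈ S, q - k ≤ e i
  ge : ∀ i ∈ S, e i ≤ q + n
  eq : ∀ w : ℂ, w ≠ 0 → w ^ q * ((∏ i, (1 - (X i : ℂ) * w)) * ∏ j, (1 + (Y j : ℂ) / w)) =
    ∑ i ∈ S, (b i : ℂ) * w ^ e i

theorem exists_laurent {n k : ℕ} (X : Fin n → ℝ) (Y : Fin k → ℝ) (q : ℤ) :
    Nonempty (Laurent X Y q) := by
  set P : Polynomial ℝ := (∏ i, (1 - Polynomial.C (X i) * Polynomial.X)) *
    ∏ j, (Polynomial.X + Polynomial.C (Y j)) with hP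
  have hdeg : P.natDegree < n + k + 1 := by
    have h1 : (∏ i, (1 - Polynomial.C (X i) * Polynomial.X)).natDegree ≤ n := by
      refine (Polynomial.natDegree_prod_le _ _).trans ?_
      refine (Finset.sum_le_card_nsmul _ _ 1 fun i _ => ?_).trans (by simp)
      compute_degree
    have h2 : (∏ j, (Polynomial.X + Polynomial.C (Y j))).natDegree ≤ k := by
      refine (Polynomial.natDegree_prod_le _ _).trans ?_
      refine (Finset.sum_le_card_nsmul _ _ 1 fun i _ => ?_).trans (by simp)
      compute_degree
    have := Polynomial.natDegree_mul_le (p := ∏ i, (1 - Polynomial.C (X i) * Polynomial.X))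
      (q := ∏ j, (Polynomial.X + Polynomial.C (Y j)))
    rw [← hP] at this
    omega
  refine ⟨⟨Finset.range (n + k + 1), P.coeff, fun i => i + q - k, ?_, ?_, ?_⟩⟩
  · intro i _; omega
  · intro i hi
    have := Finset.mem_range.1 hi
    omega
  · intro w hw
    have h1 := Polynomial.aeval_eq_sum_range' hdeg w
    have h2 : Polynomial.aeval w P = (∏ i, (1 - (X i : ℂ) * w)) * ∏ j, (w + (Y j : ℂ)) := by
      simp [hP, map_prod]
    have h3 : ∏ j, (1 + (Y j : ℂ) / w) = w ^ (-(k : ℤ)) * ∏ j, (w + (Y j : ℂ)) := by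
      have : ∀ j, 1 + (Y j : ℂ) / w = w⁻¹ * (w + Y j) := fun j => by field_simp
      simp_rw [this, Finset.prod_mul_distrib]
      simp
    rw [h3]
    calc _ = w ^ (q - k) * Polynomial.aeval w P := by
          rw [h2, sub_eq_add_neg, zpow_add₀ hw]; ring
      _ = _ := by
          rw [h1, Finset.mul_sum]
          refine Finset.sum_congr rfl fun i _ => ?_
          have : (i : ℤ) + q - k = (q - k) + i := by ring
          rw [this, zpow_add₀ hw, zpow_natCast, Complex.real_smul]
          ring

theorem away_of_re {A B : Set ℝ} {z : ℂ} (h : Away A B z.re) : Away A B z := by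
  have hz : z.im = 0 → z = (z.re : ℂ) := fun h => Complex.ext (by simp) (by simp [h])
  refine ⟨fun x hx h0 => ?_, fun y hy h0 => ?_⟩
  · have h1 := congrArg Complex.im h0
    simp at h1
    rcases h1 with h1 | h1
    · rw [h1] at h0; simp at h0
    · rw [hz h1] at h0; exact h.1 x hx h0
  · have h1 := congrArg Complex.im h0
    simp at h1
    rw [hz h1] at h0; exact h.2 y hy h0

theorem isOpen_away_real {n k : ℕ} (X : Fin n → ℝ) (Y : Fin k → ℝ) :
    IsOpen {r : ℝ | Away (range X) (range Y) r} := by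
  have : {r : ℝ | Away (range X) (range Y) r} =
      (⋂ i, {r : ℝ | 1 - (X i : ℂ) * r ≠ 0}) ∩ ⋂ j, {r : ℝ | (r : ℂ) + Y j ≠ 0} := by
    ext r
    simp [Away]
  rw [this]
  refine (isOpen_iInter_of_finite fun i => ?_).inter (isOpen_iInter_of_finite fun j => ?_)
  · exact isOpen_ne_fun (by fun_prop) continuous_const
  · exact isOpen_ne_fun (by fun_prop) continuous_const

/-- The product of the simple poles. -/
def poles {n k : ℕ} (X : Fin n → ℝ) (Y : Fin k → ℝ) (z : ℂ) : ℂ :=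
  (∏ i, (1 / (1 - (X i : ℂ) * z))) * ∏ j, (1 / (z + (Y j : ℂ)))

theorem genF_eq {n k : ℕ} (X : Fin n → ℝ) (Y : Fin k → ℝ) {z : ℂ} (hz : z ≠ 0) :
    genF X Y z = poles X Y z * z ^ (k : ℤ) := by
  have : ∀ j, 1 / (1 + (Y j : ℂ) / z) = z * (1 / (z + Y j)) := fun j => by
    have : 1 + (Y j : ℂ) / z = (z + Y j) / z := by field_simp
    rw [this, one_div_div]; ring
  simp only [genF, poles, this, Finset.prod_mul_distrib]
  simp
  ring

theorem genF_inv {n k : ℕ} (X : Fin n → ℝ) (Y : Fin k → ℝ) (z : ℂ) :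
    (genF X Y z)⁻¹ = (∏ i, (1 - (X i : ℂ) * z)) * ∏ j, (1 + (Y j : ℂ) / z) := by
  simp [genF, mul_comm]

theorem genF_ne_zero {n k : ℕ} {X : Fin n → ℝ} {Y : Fin k → ℝ} {z : ℂ}
    (h : Away (range X) (range Y) z) (hz : z ≠ 0) : genF X Y z ≠ 0 := by
  rw [← inv_inv (genF X Y z)]
  refine inv_ne_zero ?_
  rw [genF_inv]
  refine mul_ne_zero (Finset.prod_ne_zero_iff.2 fun i _ => h.1 _ ⟨i, rfl⟩)
    (Finset.prod_ne_zero_iff.2 fun j _ => ?_)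
  have : 1 + (Y j : ℂ) / z = (z + Y j) / z := by field_simp
  rw [this]
  exact div_ne_zero (h.2 _ ⟨j, rfl⟩) hz

theorem genF_swap {n k : ℕ} (X : Fin n → ℝ) (Y : Fin k → ℝ) (z : ℂ) :
    genF Y X (-z⁻¹) = genF X Y z := by
  simp only [genF]
  rw [mul_comm]
  congr 1
  · refine Finset.prod_congr rfl fun i _ => ?_
    congr 1
    rw [div_neg, div_inv_eq_mul, sub_eq_add_neg]
  · refine Finset.prod_congr rfl fun i _ => ?_
    congr 1
    rw [mul_neg, sub_neg_eq_add, div_eq_mul_inv]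

namespace Laurent

variable {n k : ℕ} {X : Fin n → ℝ} {Y : Fin k → ℝ} {q : ℤ}

def pos (L : Laurent X Y q) (w : ℂ) : ℂ :=
  ∑ i ∈ L.S, if 0 ≤ L.e i then (L.b i : ℂ) * w ^ L.e i else 0

def neg (L : Laurent X Y q) (w : ℂ) : ℂ :=
  ∑ i ∈ L.S, if 0 ≤ L.e i then 0 else (L.b i : ℂ) * w ^ L.e i

theorem pos_add_neg (L : Laurent X Y q) {w : ℂ} (hw : w ≠ 0) :
    L.pos w + L.neg w = w ^ q * (genF X Y w)⁻¹ := by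
  rw [genF_inv, L.eq w hw, pos, neg, ← Finset.sum_add_distrib]
  refine Finset.sum_congr rfl fun i _ => ?_
  split_ifs <;> simp

/-- The part of the integrand analytic inside. -/
def hin (L : Laurent X Y q) (p : ℤ) (z : ℂ) : ℂ :=
  -(poles X Y z * z ^ ((k : ℤ) - p - 1) * L.pos z)

/-- This is the `z` integrand left after the `w` integral has been evaluated on `|w| < |z|`. -/
def hout (L : Laurent X Y q) (p : ℤ) (z : ℂ) : ℂ :=
  poles X Y z * z ^ ((k : ℤ) - p - 1) * L.neg z

/-- Real points at which `hin` is analytic. -/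
def Jin (X : Fin n → ℝ) (Y : Fin k → ℝ) (p : ℤ) : Set ℝ :=
  {r | Away (range X) (range Y) r ∧ (r ≠ 0 ∨ p + 1 ≤ k)}

def Jout (X : Fin n → ℝ) (Y : Fin k → ℝ) : Set ℝ :=
  {r | Away (range X) (range Y) r ∧ r ≠ 0}

theorem isOpen_Jin (p : ℤ) : IsOpen (Jin X Y p) := by
  by_cases h : p + 1 ≤ k
  · have : Jin X Y p = {r : ℝ | Away (range X) (range Y) r} := by
      ext r; simp [Jin, h]
    rw [this]; exact isOpen_away_real X Y
  · have : Jin X Y p = {r : ℝ | Away (range X) (range Y) r} ∩ {r | r ≠ 0} := by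
      ext r; simp [Jin, h]
    rw [this]; exact (isOpen_away_real X Y).inter isOpen_ne

theorem Jout_subset (p : ℤ) : Jout X Y ⊆ Jin X Y p := fun _ h => ⟨h.1, Or.inl h.2⟩

theorem away_of_strip {p : ℤ} {z : ℂ} (hz : z ∈ Strip (Jin X Y p)) :
    Away (range X) (range Y) z := by
  rcases hz with hz | hz
  · exact away_of_im_pos hz
  · exact away_of_re hz.1

theorem ne_zero_of_strip {z : ℂ} (hz : z ∈ Strip (Jout X Y)) : z ≠ 0 := by
  rcases hz with hz | hz
  · exact ne_zero_of_im_pos hz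
  · rintro rfl; exact hz.2 rfl

theorem strip_mono {J J' : Set ℝ} (h : J ⊆ J') : Strip J ⊆ Strip J' :=
  fun _ hz => hz.imp id fun h' => h h'

theorem mem_strip {z : ℂ} (h : Away (range X) (range Y) z) (h0 : z ≠ 0) (hi : 0 ≤ z.im) :
    z ∈ Strip (Jout X Y) := by
  rcases hi.lt_or_eq with h1 | h1
  · exact Or.inl h1
  · have e : z = (z.re : ℂ) := Complex.ext (by simp) (by simp [← h1])
    exact Or.inr ⟨e ▸ h, fun h2 => h0 (by rw [e, h2]; simp)⟩

theorem differentiableAt_poles {z : ℂ} (h : Away (range X) (range Y) z) :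
    DifferentiableAt ℂ (poles X Y) z := by
  unfold poles
  refine DifferentiableAt.mul (DifferentiableAt.fun_finsetProd fun i _ => ?_)
    (DifferentiableAt.fun_finsetProd fun i _ => ?_)
  · exact DifferentiableAt.div (by fun_prop) (by fun_prop) (h.1 _ ⟨i, rfl⟩)
  · exact DifferentiableAt.div (by fun_prop) (by fun_prop) (h.2 _ ⟨i, rfl⟩)

theorem differentiableOn_hin (L : Laurent X Y q) (p : ℤ) :
    DifferentiableOn ℂ (L.hin p) (Strip (Jin X Y p)) := by
  intro z hz
  have ha := away_of_strip hz
  have h0 : z ≠ 0 ∨ 0 ≤ (k : ℤ) - p - 1 := by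
    rcases hz with hz | hz
    · exact Or.inl (ne_zero_of_im_pos hz)
    · rcases hz.2 with h | h
      · left; rintro rfl; exact h rfl
      · right; omega
  refine DifferentiableAt.differentiableWithinAt ?_
  unfold hin
  refine (((differentiableAt_poles ha).mul (differentiableAt_zpow.2 h0)).mul ?_).neg
  unfold pos
  refine DifferentiableAt.fun_sum fun i _ => ?_
  split_ifs with h
  · exact (differentiableAt_zpow.2 (Or.inr h)).const_mul _
  · fun_prop

/-- The negative part is `w^q / F(w)` minus the nonnegative part; in the first term the factor `F`
cancels and a pure power remains. -/
theorem hout_eq (L : Laurent X Y q) (p : ℤ) {z : ℂ} (h : Away (range X) (range Y) z)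
    (h0 : z ≠ 0) : L.hout p z = L.hin p z + z ^ (q - p - 1) := by
  have h1 := L.pos_add_neg h0
  have h2 := genF_ne_zero h h0
  have h3 := genF_eq X Y h0
  have e1 : L.neg z = z ^ q * (genF X Y z)⁻¹ - L.pos z := by rw [← h1]; ring
  have e2 : poles X Y z * z ^ ((k : ℤ) - p - 1) = genF X Y z * z ^ (-p - 1) := by
    rw [h3, mul_assoc, ← zpow_add₀ h0]; congr 2; ring
  have e3 : z ^ (q - p - 1) = z ^ (-p - 1) * z ^ q := by rw [← zpow_add₀ h0]; congr 1; ring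
  rw [hout, hin, e2, e1, e3]
  field_simp
  ring

theorem conj_poles (z : ℂ) : (starRingEnd ℂ) (poles X Y z) = poles X Y ((starRingEnd ℂ) z) := by
  simp [poles, map_prod]

theorem conj_hin (L : Laurent X Y q) (p : ℤ) (z : ℂ) :
    (starRingEnd ℂ) (L.hin p z) = L.hin p ((starRingEnd ℂ) z) := by
  simp only [hin, map_neg, map_mul, conj_poles, map_zpow₀, pos, map_sum]
  congr 2
  refine Finset.sum_congr rfl fun i _ => ?_
  split_ifs <;> simp

theorem conj_hout (L : Laurent X Y q) (p : ℤ) (z : ℂ) :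
    (starRingEnd ℂ) (L.hout p z) = L.hout p ((starRingEnd ℂ) z) := by
  simp only [hout, map_mul, conj_poles, map_zpow₀, neg, map_sum]
  congr 1
  refine Finset.sum_congr rfl fun i _ => ?_
  split_ifs <;> simp

theorem im_hin_real (L : Laurent X Y q) (p : ℤ) (r : ℝ) : (L.hin p r).im = 0 := by
  rw [← Complex.conj_eq_iff_im, conj_hin, Complex.conj_ofReal]

theorem continuousOn_hout (L : Laurent X Y q) (p : ℤ) :
    ContinuousOn (L.hout p) {z | Away (range X) (range Y) z ∧ z ≠ 0} := by
  intro z hz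
  refine DifferentiableAt.continuousAt (𝕜 := ℂ) ?_ |>.continuousWithinAt
  unfold hout
  refine ((differentiableAt_poles hz.1).mul (differentiableAt_zpow.2 (Or.inl hz.2))).mul ?_
  unfold neg
  refine DifferentiableAt.fun_sum fun i _ => ?_
  split_ifs with h
  · fun_prop
  · exact (differentiableAt_zpow.2 (Or.inl hz.2)).const_mul _

/-- For `z` outside the `w` circle the Cauchy integral annihilates nonnegative powers and reproduces
negative ones. -/
theorem corrKernel_eq (hX : ∀ i, 0 ≤ X i) (hY : ∀ j, 0 ≤ Y j) (L : Laurent X Y q) (p : ℤ) :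
    corrKernel X Y p q = (2 * π * Complex.I)⁻¹ *
      ∮ z in C(-(halfWidth Y : ℂ), halfWidth Y + crossing X), L.hout p z := by
  obtain ⟨hc, hlt, -⟩ := contours_admissible X Y hX hY
  have hR : 0 ≤ halfWidth Y + crossing X := by
    have : 0 ≤ ∑ j, Y j := Finset.sum_nonneg fun j _ => hY j
    unfold halfWidth; linarith
  rw [corrKernel, ← smul_eq_mul (2 * π * Complex.I : ℂ)⁻¹, ← circleIntegral.integral_smul]
  refine circleIntegral.integral_congr hR fun z hz => ?_
  have hz1 : crossing X / 2 < ‖z‖ := by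
    have := hlt z hz ((crossing X / 2 : ℝ) : ℂ) (by simp; linarith)
    rwa [Complex.norm_real, Real.norm_of_nonneg hc.le] at this
  have hz0 : z ≠ 0 := norm_pos_iff.1 (hc.trans hz1)
  have hI : (2 * π * Complex.I : ℂ) ≠ 0 := Complex.two_pi_I_ne_zero
  have e1 : ∀ w ∈ Metric.sphere (0 : ℂ) (crossing X / 2),
      1 / (2 * π * Complex.I * z) * (1 / (2 * π * Complex.I * w)) *
        (genF X Y z / genF X Y w) * (w ^ (q + 1) * z ^ (-p) / (z - w)) =
      (-(genF X Y z * z ^ (-p - 1)) / (2 * π * Complex.I) ^ 2) *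
        ∑ i ∈ L.S, (L.b i : ℂ) * (w ^ L.e i / (w - z)) := by
    intro w hw
    have hwn : ‖w‖ = crossing X / 2 := by simpa using hw
    have hw0 : w ≠ 0 := norm_pos_iff.1 (hwn ▸ hc)
    have hwz : w - z ≠ 0 := by
      intro h
      rw [sub_eq_zero.1 h] at hwn
      linarith
    have h1 : ∑ i ∈ L.S, (L.b i : ℂ) * (w ^ L.e i / (w - z)) = w ^ q * (genF X Y w)⁻¹ / (w - z) := by
      rw [genF_inv, L.eq w hw0, Finset.sum_div]
      exact Finset.sum_congr rfl fun i _ => by ring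
    have hzw : z - w ≠ 0 := by rw [← neg_sub]; exact neg_ne_zero.2 hwz
    have hinv : (z - w)⁻¹ = -(w - z)⁻¹ := by rw [← neg_sub, inv_neg]
    rw [h1, zpow_add_one₀ hw0, zpow_sub_one₀ hz0, div_eq_mul_inv _ (z - w), hinv]
    field_simp
  have hci : ∀ i ∈ L.S, CircleIntegrable (fun w => (L.b i : ℂ) * (w ^ L.e i / (w - z))) 0
      (crossing X / 2) := fun i _ => (circleIntegrable_zpow_div hc hz1.ne' _).const_fun_smul
  rw [circleIntegral.integral_congr hc.le e1]
  have e2 : (∮ w in C(0, crossing X / 2), ∑ i ∈ L.S, (L.b i : ℂ) * (w ^ L.e i / (w - z))) =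
      -(2 * π * Complex.I) * L.neg z := by
    rw [circleIntegral.integral_fun_sum hci, neg, Finset.mul_sum]
    refine Finset.sum_congr rfl fun i _ => ?_
    simp_rw [← smul_eq_mul (L.b i : ℂ)]
    rw [circleIntegral.integral_smul, circleIntegral_zpow_div_outside hc hz1]
    split_ifs
    · simp
    · simp only [smul_eq_mul]; ring
  simp_rw [← smul_eq_mul (-(genF X Y z * z ^ (-p - 1)) / (2 * π * Complex.I) ^ 2)]
  rw [circleIntegral.integral_smul, e2, hout, genF_eq X Y hz0]
  have e3 : z ^ ((k : ℤ) - p - 1) = z ^ (k : ℤ) * z ^ (-p - 1) := by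
    rw [← zpow_add₀ hz0]; congr 1; ring
  rw [e3]
  simp only [smul_eq_mul]
  field_simp

end Laurent

end

end DualSchur

/-! ### Primitives along the contour and the explicit main term -/

namespace DualSchur

noncomputable section

namespace Laurent

variable {n k : ℕ} {X : Fin n → ℝ} {Y : Fin k → ℝ} {q : ℤ}

theorem crossing_pos (hX : ∀ i, 0 ≤ X i) : 0 < crossing X := by
  have : 0 ≤ ∑ i, X i := Finset.sum_nonneg fun j _ => hX j
  unfold crossing; positivity

theorem halfWidth_pos (hY : ∀ i, 0 ≤ Y i) : 0 < halfWidth Y := by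
  have : 0 ≤ ∑ i, Y i := Finset.sum_nonneg fun j _ => hY j
  unfold halfWidth; positivity

theorem mul_crossing_lt (hX : ∀ i, 0 ≤ X i) (i : Fin n) : X i * crossing X < 1 := by
  have h1 : X i ≤ ∑ i, X i := Finset.single_le_sum (fun j _ => hX j) (Finset.mem_univ i)
  have h2 : 0 ≤ ∑ i, X i := Finset.sum_nonneg fun j _ => hX j
  unfold crossing
  rw [mul_one_div, div_lt_one (by positivity)]
  linarith

theorem away_of_pos (hY : ∀ j, 0 ≤ Y j) {r : ℝ} (hr : 0 < r) (h : ∀ i, X i * r < 1) :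
    Away (range X) (range Y) r := by
  refine ⟨?_, ?_⟩
  · rintro _ ⟨i, rfl⟩ h0
    have : 1 - X i * r = 0 := by exact_mod_cast h0
    linarith [h i]
  · rintro _ ⟨i, rfl⟩ h0
    have : r + Y i = 0 := by exact_mod_cast h0
    linarith [hY i]

theorem away_left (hX : ∀ i, 0 ≤ X i) {r : ℝ} (hr : r < 0) (h : ∀ j, r + Y j < 0) :
    Away (range X) (range Y) r := by
  refine ⟨?_, ?_⟩
  · rintro _ ⟨i, rfl⟩ h0
    have : 1 - X i * r = 0 := by exact_mod_cast h0
    nlinarith [hX i]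
  · rintro _ ⟨i, rfl⟩ h0
    have : r + Y i = 0 := by exact_mod_cast h0
    linarith [h i]

theorem circleMap_real (c R θ : ℝ) : (circleMap (c : ℂ) R θ).im = R * Real.sin θ := by
  simp [circleMap, Complex.exp_im, Complex.exp_re]

/-- The upper half circle gives a difference of values of `Φ`. The lower one is treated with the
conjugated primitive `conj (Φ (conj z))`, so the sum is twice an imaginary part. -/
theorem circleIntegral_of_primitive {h Φ : ℂ → ℂ} {J : Set ℝ} {c R : ℝ} (hR : 0 < R)
    (hΦ : ∀ z ∈ Strip J, HasDerivAt Φ (h z) z) (hh : ContinuousOn h (Metric.sphere (c : ℂ) R))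
    (hconj : ∀ z, (starRingEnd ℂ) (h z) = h ((starRingEnd ℂ) z))
    (h1 : c - R ∈ J) (h2 : c + R ∈ J) :
    (∮ z in C(c, R), h z) =
      2 * Complex.I * (((Φ ((c - R : ℝ) : ℂ)).im - (Φ ((c + R : ℝ) : ℂ)).im : ℝ) : ℂ) := by
  have e0 : circleMap (c : ℂ) R 0 = ((c + R : ℝ) : ℂ) := by simp [circleMap]
  have e1 : circleMap (c : ℂ) R π = ((c - R : ℝ) : ℂ) := by
    simp [circleMap]; ring
  have e2 : circleMap (c : ℂ) R (2 * π) = ((c + R : ℝ) : ℂ) := by simp [circleMap]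
  have hcont : Continuous fun θ : ℝ => deriv (circleMap (c : ℂ) R) θ • h (circleMap c R θ) := by
    have a : Continuous fun θ : ℝ => h (circleMap c R θ) :=
      hh.comp_continuous (continuous_circleMap _ _) fun θ => circleMap_mem_sphere _ hR.le _
    simp only [deriv_circleMap]
    exact ((continuous_circleMap 0 R).mul continuous_const).smul a
  have key : ∀ {Ψ : ℂ → ℂ} {a b : ℝ}, (∀ θ ∈ uIcc a b, HasDerivAt Ψ (h (circleMap c R θ))
      (circleMap c R θ)) → ∫ θ in a..b, deriv (circleMap (c : ℂ) R) θ • h (circleMap c R θ) =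
      Ψ (circleMap c R b) - Ψ (circleMap c R a) := by
    intro Ψ a b hab
    refine intervalIntegral.integral_eq_sub_of_hasDerivAt (f := fun θ => Ψ (circleMap c R θ))
      (fun θ hθ => ?_) (hcont.intervalIntegrable _ _)
    have := HasDerivAt.scomp θ (hab θ hθ) (hasDerivAt_circleMap (c : ℂ) R θ)
    rw [deriv_circleMap]
    exact this
  have up : ∀ θ ∈ uIcc 0 π, circleMap (c : ℂ) R θ ∈ Strip J := by
    intro θ hθ
    rw [uIcc_of_le Real.pi_pos.le] at hθ
    rcases hθ.1.eq_or_lt with h3 | h3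
    · rw [← h3, e0]; exact Or.inr (by simpa using h2)
    rcases hθ.2.eq_or_lt with h4 | h4
    · rw [h4, e1]; exact Or.inr (by simpa using h1)
    · left
      rw [circleMap_real]
      exact mul_pos hR (Real.sin_pos_of_pos_of_lt_pi h3 h4)
  have down : ∀ θ ∈ uIcc π (2 * π), (starRingEnd ℂ) (circleMap (c : ℂ) R θ) ∈ Strip J := by
    intro θ hθ
    have h5 : circleMap (c : ℂ) R (2 * π - θ) = (starRingEnd ℂ) (circleMap (c : ℂ) R θ) := by
      simp only [circleMap, map_add, map_mul, Complex.conj_ofReal, ← Complex.exp_conj,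
        Complex.conj_I]
      congr 2
      rw [Complex.exp_eq_exp_iff_exists_int]
      exact ⟨1, by push_cast; ring⟩
    rw [← h5]
    refine up _ ?_
    rw [uIcc_of_le (by linarith [Real.pi_pos])] at hθ
    rw [uIcc_of_le Real.pi_pos.le]
    constructor <;> linarith [hθ.1, hθ.2]
  have i1 := key (Ψ := Φ) (a := 0) (b := π) fun θ hθ => hΦ _ (up θ hθ)
  have i2 := key (Ψ := fun z => (starRingEnd ℂ) (Φ ((starRingEnd ℂ) z))) (a := π) (b := 2 * π)
    fun θ hθ => by
      have := (hΦ _ (down θ hθ)).conj_conj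
      rw [Complex.conj_conj, ← hconj, Complex.conj_conj] at this
      exact this
  rw [circleIntegral, ← intervalIntegral.integral_add_adjacent_intervals
    (hcont.intervalIntegrable 0 π) (hcont.intervalIntegrable π (2 * π)), i1, i2, e0, e1, e2]
  simp only [Complex.conj_ofReal]
  apply Complex.ext <;> simp
  ring

/-- The left end of the contour. -/
def leftEnd (X : Fin n → ℝ) (Y : Fin k → ℝ) : ℝ := -(2 * halfWidth Y + crossing X)

theorem crossing_mem (hX : ∀ i, 0 ≤ X i) (hY : ∀ j, 0 ≤ Y j) : crossing X ∈ Jout X Y :=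
  ⟨away_of_pos hY (crossing_pos hX) (mul_crossing_lt hX), (crossing_pos hX).ne'⟩

theorem leftEnd_neg (hX : ∀ i, 0 ≤ X i) (hY : ∀ j, 0 ≤ Y j) : leftEnd X Y < 0 := by
  have := crossing_pos hX
  have := halfWidth_pos hY
  unfold leftEnd; linarith

theorem leftEnd_add_lt (hX : ∀ i, 0 ≤ X i) (hY : ∀ j, 0 ≤ Y j) (j : Fin k) :
    leftEnd X Y + Y j < 0 := by
  have h0 := crossing_pos hX
  have h1 : Y j ≤ ∑ i, Y i := Finset.single_le_sum (fun j _ => hY j) (Finset.mem_univ j)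
  unfold leftEnd halfWidth
  linarith [hY j]

theorem leftEnd_mem (hX : ∀ i, 0 ≤ X i) (hY : ∀ j, 0 ≤ Y j) : leftEnd X Y ∈ Jout X Y :=
  ⟨away_left hX (leftEnd_neg hX hY) (leftEnd_add_lt hX hY), (leftEnd_neg hX hY).ne⟩

theorem sphere_away (hX : ∀ i, 0 ≤ X i) (hY : ∀ j, 0 ≤ Y j) {z : ℂ}
    (hz : z ∈ Metric.sphere (-(halfWidth Y : ℂ)) (halfWidth Y + crossing X)) :
    Away (range X) (range Y) z ∧ z ≠ 0 := by
  obtain ⟨-, -, h0, h1, h2⟩ := contours_admissible X Y hX hY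
  have hs : ∀ w ∈ Metric.ball (-(halfWidth Y : ℂ)) (halfWidth Y + crossing X), z ≠ w := by
    rintro w hw rfl
    rw [Metric.mem_sphere] at hz
    rw [Metric.mem_ball] at hw
    linarith
  refine ⟨⟨?_, ?_⟩, hs 0 h0⟩
  · rintro _ ⟨i, rfl⟩ he
    have hx : (X i : ℂ) ≠ 0 := by
      intro h; rw [h] at he; simp at he
    refine h2 i (by exact_mod_cast hx) ?_
    have : 1 / (X i : ℂ) = z := by
      field_simp
      linear_combination he
    rw [this]
    exact Metric.sphere_subset_closedBall hz
  · rintro _ ⟨i, rfl⟩ he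
    exact hs _ (h1 i) (by linear_combination he)

theorem corrKernel_eq_im (hX : ∀ i, 0 ≤ X i) (hY : ∀ j, 0 ≤ Y j) (L : Laurent X Y q) (p : ℤ)
    {Φ : ℂ → ℂ} (hΦ : ∀ z ∈ Strip (Jout X Y), HasDerivAt Φ (L.hout p z) z) :
    π * corrKernel X Y p q = (((Φ (leftEnd X Y)).im - (Φ (crossing X)).im : ℝ) : ℂ) := by
  have hR : 0 < halfWidth Y + crossing X := add_pos (halfWidth_pos hY) (crossing_pos hX)
  have hc : Complex.ofReal (-halfWidth Y) = -(halfWidth Y : ℂ) := by push_cast; ring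
  have e1 : -halfWidth Y - (halfWidth Y + crossing X) = leftEnd X Y := by unfold leftEnd; ring
  have e2 : -halfWidth Y + (halfWidth Y + crossing X) = crossing X := by ring
  have := circleIntegral_of_primitive (c := -halfWidth Y) hR hΦ
    ((L.continuousOn_hout p).mono fun z hz => sphere_away hX hY (by rwa [← hc]))
    (L.conj_hout p) (by rw [e1]; exact leftEnd_mem hX hY)
    (by rw [e2]; exact crossing_mem hX hY)
  rw [e1, e2, hc] at this
  rw [corrKernel_eq hX hY L p, this]
  have hpi : (π : ℂ) ≠ 0 := by exact_mod_cast Real.pi_ne_zero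
  field_simp

/-! ### The inversion `z ↦ -1/z` -/

/-- Substituting `w = -1/v` turns the exponent `e` into `-e`; the additional shift by one, absorbing
the Jacobian, makes nonnegative and negative exponents change places exactly. -/
def swap (L : Laurent X Y q) : Laurent Y X (-q - 1) where
  S := L.S
  b := fun i => (-1) ^ (q + L.e i) * L.b i
  e := fun i => -L.e i - 1
  le := fun i hi => by have := L.ge i hi; omega
  ge := fun i hi => by have := L.le i hi; omega
  eq := fun v hv => by
    have h := L.eq (-v⁻¹) (neg_ne_zero.2 (inv_ne_zero hv))
    have hz : ∀ e : ℤ, (-v⁻¹) ^ e = (-1) ^ e * v ^ (-e) := fun e => by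
      rw [neg_eq_neg_one_mul, mul_zpow, inv_zpow']
    have h1 : ∏ i, (1 - (X i : ℂ) * (-v⁻¹)) = ∏ i, (1 + (X i : ℂ) / v) :=
      Finset.prod_congr rfl fun i _ => by rw [mul_neg, sub_neg_eq_add, div_eq_mul_inv]
    have h2 : ∏ j, (1 + (Y j : ℂ) / (-v⁻¹)) = ∏ j, (1 - (Y j : ℂ) * v) :=
      Finset.prod_congr rfl fun i _ => by
        rw [div_neg, div_inv_eq_mul, ← sub_eq_add_neg]
    rw [h1, h2, hz] at h
    have hm : ((-1 : ℂ) ^ q) * (-1) ^ q = 1 := by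
      rw [← mul_zpow]; norm_num
    have h3 : v ^ (-q - 1) * ((∏ j, (1 - (Y j : ℂ) * v)) * ∏ i, (1 + (X i : ℂ) / v)) =
        (-1) ^ q * v⁻¹ * ((-1) ^ q * v ^ (-q) *
          ((∏ i, (1 + (X i : ℂ) / v)) * ∏ j, (1 - (Y j : ℂ) * v))) := by
      rw [zpow_sub_one₀ hv]
      linear_combination (-(v ^ (-q) * v⁻¹ * ((∏ j, (1 - (Y j : ℂ) * v)) *
        ∏ i, (1 + (X i : ℂ) / v)))) * hm
    rw [h3, h, Finset.mul_sum]
    refine Finset.sum_congr rfl fun i _ => ?_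
    rw [hz, zpow_sub_one₀ hv, zpow_add₀ (by norm_num)]
    push_cast
    ring

theorem swap_pos (L : Laurent X Y q) {v : ℂ} (hv : v ≠ 0) :
    L.swap.pos v = (-1) ^ q * v⁻¹ * L.neg (-v⁻¹) := by
  have hz : ∀ e : ℤ, (-v⁻¹) ^ e = (-1) ^ e * v ^ (-e) := fun e => by
    rw [neg_eq_neg_one_mul, mul_zpow, inv_zpow']
  simp only [pos, neg, Finset.mul_sum]
  refine Finset.sum_congr rfl fun i _ => ?_
  have e : L.swap.e i = -L.e i - 1 := rfl
  have b : L.swap.b i = (-1) ^ (q + L.e i) * L.b i := rfl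
  by_cases h : 0 ≤ L.e i
  · rw [if_neg (show ¬(0 ≤ L.swap.e i) by omega), if_pos h, mul_zero]
  · rw [if_pos (show 0 ≤ L.swap.e i by omega), if_neg h, e, b, hz, zpow_sub_one₀ hv,
      zpow_add₀ (by norm_num)]
    push_cast
    ring

/-- The factor `(z²)⁻¹` is the derivative of `z ↦ -1/z`, so as differential forms the outer
integrand is, up to sign, the inner integrand of the exchanged data. -/
theorem hout_eq_swap (L : Laurent X Y q) (p : ℤ) {z : ℂ} (hz : z ≠ 0) :
    L.hout p z = (-1) ^ (p + q) * (L.swap.hin (-p - 1) (-z⁻¹) * (z ^ 2)⁻¹) := by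
  have hv : -z⁻¹ ≠ 0 := neg_ne_zero.2 (inv_ne_zero hz)
  have h1 := genF_eq Y X hv
  rw [genF_swap] at h1
  have h2 := genF_eq X Y hz
  have e0 : -(-z⁻¹)⁻¹ = z := by rw [inv_neg, inv_inv, neg_neg]
  have e1 : poles Y X (-z⁻¹) * (-z⁻¹) ^ ((n : ℤ) - (-p - 1) - 1) = genF X Y z * (-z⁻¹) ^ p := by
    rw [h1, mul_assoc, ← zpow_add₀ hv]
    congr 2; ring
  have e2 : poles X Y z * z ^ ((k : ℤ) - p - 1) = genF X Y z * z ^ (-p - 1) := by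
    rw [h2, mul_assoc, ← zpow_add₀ hz]
    congr 2; ring
  rw [hout, hin, swap_pos L hv, e0, e1, e2]
  have e3 : (-z⁻¹) ^ p = (-1) ^ p * z ^ (-p) := by
    rw [neg_eq_neg_one_mul, mul_zpow, inv_zpow']
  have e4 : (-z⁻¹)⁻¹ = -z := by rw [inv_neg, inv_inv]
  have hm : ∀ a : ℤ, ((-1 : ℂ) ^ a) * (-1) ^ a = 1 := fun a => by
    rw [← mul_zpow]; norm_num
  rw [e3, e4, zpow_add₀ (by norm_num), zpow_sub_one₀ hz]
  have hz2 : z * (z ^ 2)⁻¹ = z⁻¹ := by field_simp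
  linear_combination (-(genF X Y z * z ^ (-p) * L.neg z * z⁻¹) * (-1) ^ q * (-1) ^ q) * hm p
    - (genF X Y z * z ^ (-p) * L.neg z * z⁻¹) * hm q
    - ((-1) ^ p * (-1) ^ p * ((-1) ^ q * (-1) ^ q) * genF X Y z * z ^ (-p) * L.neg z) * hz2

theorem hasDerivAt_swap_primitive (L : Laurent X Y q) (p : ℤ) {Φ : ℂ → ℂ} {z : ℂ} (hz : z ≠ 0)
    (hΦ : HasDerivAt Φ (L.swap.hin (-p - 1) (-z⁻¹)) (-z⁻¹)) :
    HasDerivAt (fun z => (-1) ^ (p + q) * Φ (-z⁻¹)) (L.hout p z) z := by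
  have h1 : HasDerivAt (fun z : ℂ => -z⁻¹) ((z ^ 2)⁻¹) z := by
    simpa using (hasDerivAt_inv hz).fun_neg
  have h2 := (hΦ.comp z h1).const_mul ((-1 : ℂ) ^ (p + q))
  rw [hout_eq_swap L p hz]
  exact h2

/-! ### The kernel in terms of the two inner primitives -/

/-- A primitive of `z ^ (-d - 1)` on the upper half plane. -/
def powPrim (d : ℤ) (z : ℂ) : ℂ :=
  -- Rotating the argument by `-i` moves the branch cut to the negative imaginary axis, so that the
  -- logarithm is analytic near both real half-lines.
  if d = 0 then Complex.log (-(Complex.I * z)) else -(z ^ (-d) / d)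

theorem hasDerivAt_powPrim (d : ℤ) {z : ℂ} (hz : 0 < z.im ∨ z.re ≠ 0) :
    HasDerivAt (powPrim d) (z ^ (-d - 1)) z := by
  have hz0 : z ≠ 0 := by rintro rfl; simp at hz
  unfold powPrim
  split_ifs with h
  · subst h
    have h1 : HasDerivAt (fun z : ℂ => -(Complex.I * z)) (-Complex.I) z := by
      simpa using ((hasDerivAt_id z).const_mul Complex.I).fun_neg
    have h2 := h1.clog (by
      rw [Complex.mem_slitPlane_iff]
      simpa using hz)
    convert h2 using 1
    rw [neg_div_neg_eq, div_mul_eq_div_div, div_self Complex.I_ne_zero, neg_zero, zero_sub,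
      zpow_neg_one, one_div]
  · have hd : (d : ℂ) ≠ 0 := by exact_mod_cast h
    have h1 := ((hasDerivAt_zpow (-d) z (Or.inl hz0)).div_const (d : ℂ)).fun_neg
    refine h1.congr_deriv ?_
    push_cast
    rw [neg_mul, neg_div, neg_neg, mul_div_assoc, mul_div_cancel₀ _ hd]

theorem im_log_neg_I_mul {z : ℂ} (hz : z ≠ 0) (hi : 0 ≤ z.im) :
    (Complex.log (-(Complex.I * z))).im = z.arg - π / 2 := by
  rw [Complex.log_im]
  have hI : (-Complex.I : ℂ).arg = -(π / 2) := Complex.arg_neg_I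
  have := Complex.arg_mul (x := -Complex.I) (y := z) (neg_ne_zero.2 Complex.I_ne_zero) hz
    (by
      rw [hI]
      have := Complex.arg_nonneg_iff.2 hi
      have := Complex.arg_le_pi z
      constructor <;> linarith [Real.pi_pos])
  rw [← neg_mul, this, hI]; ring

/-- The explicit part of the kernel. -/
def mainTerm (d : ℤ) (z : ℂ) : ℝ := if d = 0 then z.arg else -(z ^ (-d) / d).im

theorem im_powPrim_sub (d : ℤ) {z : ℂ} {a : ℝ} (hz : z ≠ 0) (hi : 0 ≤ z.im) (ha : 0 < a) :
    (powPrim d z).im - (powPrim d a).im = mainTerm d z := by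
  unfold powPrim mainTerm
  split_ifs with h
  · rw [im_log_neg_I_mul hz hi, im_log_neg_I_mul (by exact_mod_cast ha.ne') (by simp),
      Complex.arg_ofReal_of_nonneg ha.le]
    ring
  · have : ((a : ℂ) ^ (-d) / d).im = 0 := by
      have : (a : ℂ) ^ (-d) / d = ((a ^ (-d) / d : ℝ) : ℂ) := by push_cast; ring
      rw [this, Complex.ofReal_im]
    rw [Complex.neg_im, Complex.neg_im, this]
    ring

/-- The difference of the primitives is constant on the convex open half plane, and continuity from
above extends this to the real points. -/
theorem sub_eq_sub_of_hasDerivAt {Φ Ψ h : ℂ → ℂ} {O : Set ℂ}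
    (hO : O = {z | Away (range X) (range Y) z ∧ z ≠ 0 ∧ 0 ≤ z.im})
    (h1 : ∀ z ∈ O, HasDerivAt Φ (h z) z) (h2 : ∀ z ∈ O, HasDerivAt Ψ (h z) z) {z w : ℂ}
    (hz : z ∈ O) (hw : w ∈ O) : Φ z - Φ w = Ψ z - Ψ w := by
  have hd : ∀ z ∈ O, HasDerivAt (fun z => Φ z - Ψ z) 0 z := fun z hz => by
    simpa using (h1 z hz).fun_sub (h2 z hz)
  have hI : ∀ z ∈ O, Φ z - Ψ z = Φ Complex.I - Ψ Complex.I := by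
    have hup : ∀ z : ℂ, 0 < z.im → Φ z - Ψ z = Φ Complex.I - Ψ Complex.I := by
      intro z hz
      have := (convex_halfSpace_im_gt 0).norm_image_sub_le_of_norm_hasDerivWithin_le (C := 0)
        (f := fun z => Φ z - Ψ z) (f' := fun _ => 0)
        (fun w (hw : 0 < w.im) => (hd w (by
          rw [hO]
          exact ⟨away_of_im_pos hw, ne_zero_of_im_pos hw, hw.le⟩)).hasDerivWithinAt) (by simp)
        (show Complex.I ∈ {z : ℂ | 0 < z.im} by simp) (show z ∈ {z : ℂ | 0 < z.im} from hz)
      rw [zero_mul, norm_le_zero_iff, sub_eq_zero] at this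
      exact this
    intro z hz
    have hc := (hd z hz).continuousAt
    rw [hO] at hz
    have hi : 0 ≤ z.im := hz.2.2
    have hlim : Tendsto (fun t : ℝ => z + t * Complex.I) (𝓝[>] 0) (𝓝 z) := by
      have : ContinuousAt (fun t : ℝ => z + t * Complex.I) 0 := by fun_prop
      have := this.tendsto
      simp only [Complex.ofReal_zero, zero_mul, add_zero] at this
      exact this.mono_left nhdsWithin_le_nhds
    refine tendsto_nhds_unique (hc.tendsto.comp hlim) (tendsto_const_nhds.congr' ?_)
    filter_upwards [self_mem_nhdsWithin] with t ht
    refine (hup _ ?_).symm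
    have ht : 0 < t := ht
    simp
    linarith
  linear_combination hI z hz - hI w hw

/-- The path from the positive crossing to the left end is cut at `z`. The first piece is measured
by `Φ` plus the primitive of the power, the second by `Φ'` after inversion. Any `z` is allowed here,
which leaves its choice free for the estimates. -/
theorem corrKernel_eq_inner (hX : ∀ i, 0 ≤ X i) (hY : ∀ j, 0 ≤ Y j) (L : Laurent X Y q) (p : ℤ)
    {Φ Φ' : ℂ → ℂ} (hΦ : ∀ z ∈ Strip (Jin X Y p), HasDerivAt Φ (L.hin p z) z)
    (hΦ' : ∀ z ∈ Strip (Jin Y X (-p - 1)), HasDerivAt Φ' (L.swap.hin (-p - 1) z) z) {z : ℂ}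
    (hz : Away (range X) (range Y) z) (h0 : z ≠ 0) (hi : 0 ≤ z.im) :
    π * corrKernel X Y p q = (((Φ z).im - (Φ (crossing X)).im + mainTerm (p - q) z
      - (-1) ^ (p + q) * ((Φ' (-z⁻¹)).im - (Φ' (crossing Y)).im) : ℝ) : ℂ) := by
  have hΨ : ∀ z ∈ Strip (Jout X Y),
      HasDerivAt (fun z => Φ z + powPrim (p - q) z) (L.hout p z) z := by
    intro z hz
    have haz := away_of_strip (strip_mono (Jout_subset p) hz)
    rw [L.hout_eq p haz (ne_zero_of_strip hz)]
    have e : q - p - 1 = -(p - q) - 1 := by ring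
    rw [e]
    refine (hΦ z (strip_mono (Jout_subset p) hz)).fun_add (hasDerivAt_powPrim _ ?_)
    exact hz.imp id fun h => h.2
  have hswap : ∀ z : ℂ, z ∈ Strip (Jout X Y) → 0 ≤ z.im → -z⁻¹ ∈ Strip (Jin Y X (-p - 1)) := by
    intro z hz hi
    have hz0 := ne_zero_of_strip hz
    have haz := away_of_strip (strip_mono (Jout_subset p) hz)
    refine strip_mono (Jout_subset _) (mem_strip (haz.swap hz0) (neg_ne_zero.2 (inv_ne_zero hz0)) ?_)
    rw [Complex.neg_im, Complex.inv_im, neg_div, neg_neg]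
    exact div_nonneg hi (Complex.normSq_nonneg _)
  have hout := corrKernel_eq_im hX hY L p hΨ
  have hΨ' : ∀ z ∈ {z : ℂ | Away (range X) (range Y) z ∧ z ≠ 0 ∧ 0 ≤ z.im},
      HasDerivAt (fun z => (-1 : ℂ) ^ (p + q) * Φ' (-z⁻¹)) (L.hout p z) z := fun z hz =>
    L.hasDerivAt_swap_primitive p hz.2.1 (hΦ' _ (hswap z (mem_strip hz.1 hz.2.1 hz.2.2) hz.2.2))
  have hb := leftEnd_mem hX hY
  have hb0 := leftEnd_neg hX hY
  have hc0 := crossing_pos hX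
  have hsub := sub_eq_sub_of_hasDerivAt rfl
    (fun z hz => hΨ z (mem_strip hz.1 hz.2.1 hz.2.2)) hΨ'
    (z := (leftEnd X Y : ℂ)) (w := z) ⟨hb.1, by exact_mod_cast hb.2, by simp⟩ ⟨hz, h0, hi⟩
  have him := congrArg Complex.im hsub
  have hσ : ((-1 : ℂ) ^ (p + q)) = (((-1 : ℝ) ^ (p + q) : ℝ) : ℂ) := by push_cast; rfl
  -- The inverted left end is a positive number to the left of all poles `1/y`, as is the crossing
  -- for the exchanged data; between them the integrand is real.
  have hreal : (Φ' (-(leftEnd X Y : ℂ)⁻¹)).im = (Φ' (crossing Y)).im := by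
    have e : -(leftEnd X Y : ℂ)⁻¹ = ((-(leftEnd X Y)⁻¹ : ℝ) : ℂ) := by push_cast; rfl
    rw [e]
    refine im_primitive_eq hΦ' (fun r _ => L.swap.im_hin_real _ r) fun r hr => ?_
    have hpos : 0 < -(leftEnd X Y)⁻¹ := neg_pos.2 (inv_lt_zero.2 hb0)
    have hr0 : 0 < r := (lt_min hpos (crossing_pos hY)).trans_le hr.1
    refine Jout_subset _ ⟨away_of_pos hX hr0 fun j => ?_, hr0.ne'⟩
    have h1 := hr.2
    have h2 : Y j * -(leftEnd X Y)⁻¹ < 1 := by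
      have := leftEnd_add_lt hX hY j
      rw [← inv_neg, mul_inv_lt_iff₀ (by linarith)]
      linarith
    have h3 := mul_crossing_lt hY j
    refine lt_of_le_of_lt (mul_le_mul_of_nonneg_left h1 (hY j)) ?_
    rcases max_choice (-(leftEnd X Y)⁻¹) (crossing Y) with h | h <;> rw [h] <;> assumption
  rw [hσ] at him
  simp only [Complex.sub_im, Complex.add_im, Complex.im_ofReal_mul, hreal]
    at him
  rw [hout]
  congr 1
  have hmain := im_powPrim_sub (p - q) h0 hi hc0
  simp only [Complex.add_im]
  linarith

end Laurent

end

end DualSchur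

namespace DualSchur

noncomputable section

/-! ### Weights of finite families -/

/-- The sum of the unit masses at the points of a finite family. -/
def diracs {n : ℕ} (X : Fin n → ℝ) : Measure ℝ := ∑ i, Measure.dirac (X i)

instance {n : ℕ} (X : Fin n → ℝ) : IsFiniteMeasure (diracs X) := by
  unfold diracs; infer_instance

theorem integral_diracs {E : Type*} [NormedAddCommGroup E] [NormedSpace ℝ E] [CompleteSpace E]
    {n : ℕ} (X : Fin n → ℝ) (φ : ℝ → E) : ∫ x, φ x ∂diracs X = ∑ i, φ (X i) := by
  rw [diracs, integral_finsetSum_measure fun i _ => integrable_dirac (by simp)]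
  simp

theorem diracs_restrict {n : ℕ} {X : Fin n → ℝ} {A : Set ℝ} (hA : IsCompact A)
    (hX : ∀ i, X i ∈ A) : (diracs X).restrict A = diracs X := by
  refine Measure.restrict_eq_self_of_ae_mem ?_
  rw [ae_iff, diracs, Measure.finsetSum_apply]
  refine Finset.sum_eq_zero fun i _ => ?_
  have hm : MeasurableSet {a | a ∉ A} := hA.measurableSet.compl
  rw [Measure.dirac_apply' _ hm]
  simp [hX i]

/-- Finite families in `A` and `B` as weights. -/
def Weights.discrete {A B : Set ℝ} (W : Weights A B) {n k : ℕ} (X : Fin n → ℝ) (Y : Fin k → ℝ)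
    (hX : ∀ i, X i ∈ A) (hY : ∀ j, Y j ∈ B) : Weights A B :=
  ⟨diracs X, diracs Y, inferInstance, inferInstance, W.hA, W.hB, W.A0, W.B0,
    diracs_restrict W.hA hX, diracs_restrict W.hB hY⟩

/-- Finite families as weights on their ranges. -/
def rangeWeights {n k : ℕ} (X : Fin n → ℝ) (Y : Fin k → ℝ)
    (hX : ∀ i, 0 ≤ X i) (hY : ∀ j, 0 ≤ Y j) : Weights (range X) (range Y) :=
  ⟨diracs X, diracs Y, inferInstance, inferInstance, (finite_range X).isCompact,
    (finite_range Y).isCompact, by rintro _ ⟨i, rfl⟩; exact hX i, by rintro _ ⟨i, rfl⟩; exact hY i,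
    diracs_restrict (finite_range X).isCompact fun i => ⟨i, rfl⟩,
    diracs_restrict (finite_range Y).isCompact fun i => ⟨i, rfl⟩⟩

/-! ### Size of the inner integrand and ranges with explicit kernel -/

namespace Laurent

variable {n k : ℕ} {X : Fin n → ℝ} {Y : Fin k → ℝ} {q : ℤ}

theorem exp_U (hX : ∀ i, 0 ≤ X i) (hY : ∀ j, 0 ≤ Y j) {z : ℂ}
    (hz : Away (range X) (range Y) z) (h0 : z ≠ 0) (a : ℤ) :
    Real.exp ((rangeWeights X Y hX hY).U a z) = ‖genF X Y z‖ * ‖z‖ ^ (-a) := by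
  have hn := norm_pos_iff.2 h0
  have e1 : (rangeWeights X Y hX hY).U a z = -(∑ i, Real.log ‖1 - (X i : ℂ) * z‖) -
      (∑ j, Real.log ‖1 + (Y j : ℂ) / z‖) - a * Real.log ‖z‖ := by
    simp only [Weights.U, rangeWeights, integral_diracs]
  have p1 : ∀ i, 0 < ‖1 - (X i : ℂ) * z‖ := fun i => norm_pos_iff.2 (hz.1 _ ⟨i, rfl⟩)
  have p2 : ∀ j, 0 < ‖1 + (Y j : ℂ) / z‖ := fun j => by
    have : 1 + (Y j : ℂ) / z = (z + Y j) / z := by field_simp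
    rw [this]
    exact norm_pos_iff.2 (div_ne_zero (hz.2 _ ⟨j, rfl⟩) h0)
  rw [e1, sub_eq_add_neg, sub_eq_add_neg, Real.exp_add, Real.exp_add, Real.exp_neg, Real.exp_neg,
    Real.exp_neg, Real.exp_sum, Real.exp_sum, ← Real.log_zpow, Real.exp_log (zpow_pos hn _),
    zpow_neg]
  congr 1
  rw [genF, norm_mul, norm_prod, norm_prod, ← Finset.prod_inv_distrib, ← Finset.prod_inv_distrib]
  congr 1
  · refine Finset.prod_congr rfl fun i _ => ?_
    rw [Real.exp_log (p1 i), norm_div, norm_one, one_div]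
  · refine Finset.prod_congr rfl fun i _ => ?_
    rw [Real.exp_log (p2 i), norm_div, norm_one, one_div]

/-- The nonnegative part at `z` is the Cauchy integral of the whole Laurent polynomial over any
larger circle. -/
theorem norm_pos_le (L : Laurent X Y q) {z : ℂ} {r M : ℝ} (hz : ‖z‖ < r)
    (hM : ∀ w, ‖w‖ = r → ‖w ^ q * (genF X Y w)⁻¹‖ ≤ M) :
    ‖L.pos z‖ ≤ r * M / √(r ^ 2 - ‖z‖ ^ 2) := by
  have hr : 0 < r := (norm_nonneg _).trans_lt hz
  have h1 := norm_circleIntegral_div_le hz hM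
  have h2 : (∮ w in C(0, r), w ^ q * (genF X Y w)⁻¹ / (w - z)) = 2 * π * Complex.I * L.pos z := by
    have e : ∀ w ∈ Metric.sphere (0 : ℂ) r, w ^ q * (genF X Y w)⁻¹ / (w - z) =
        ∑ i ∈ L.S, (L.b i : ℂ) * (w ^ L.e i / (w - z)) := by
      intro w hw
      have hw : ‖w‖ = r := by simpa using hw
      have h0 : w ≠ 0 := norm_pos_iff.1 (hw ▸ hr)
      rw [genF_inv, L.eq w h0, Finset.sum_div]
      exact Finset.sum_congr rfl fun i _ => by ring
    have hci : ∀ i ∈ L.S, CircleIntegrable (fun w => (L.b i : ℂ) * (w ^ L.e i / (w - z))) 0 r :=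
      fun i _ => (circleIntegrable_zpow_div hr hz.ne _).const_fun_smul
    rw [circleIntegral.integral_congr hr.le e, circleIntegral.integral_fun_sum hci, pos,
      Finset.mul_sum]
    refine Finset.sum_congr rfl fun i _ => ?_
    simp_rw [← smul_eq_mul (L.b i : ℂ)]
    rw [circleIntegral.integral_smul, circleIntegral_zpow_div_inside hz]
    split_ifs
    · simp only [smul_eq_mul]; ring
    · simp
  rw [h2, norm_mul, norm_mul, norm_mul, Complex.norm_I, Complex.norm_ofNat, Complex.norm_real,
    Real.norm_of_nonneg Real.pi_pos.le, mul_one] at h1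
  have hpi := Real.pi_pos
  have e : 2 * π * r * M / √(r ^ 2 - ‖z‖ ^ 2) = 2 * π * (r * M / √(r ^ 2 - ‖z‖ ^ 2)) := by ring
  rw [e] at h1
  exact le_of_mul_le_mul_left h1 (by positivity)

/-- The circle through the critical point `s` is used for the Cauchy integral. There `U` is minimal
at `s`, so `1/F` times the power is at most `exp (-U(s))`, while the prefactor contributes `exp
(U(z))`. -/
theorem norm_hin_le (hX : ∀ i, 0 ≤ X i) (hY : ∀ j, 0 ≤ Y j) {a q p : ℤ}
    (L : Laurent X Y (a + q)) {z s : ℂ} (hs : Away (range X) (range Y) s) (hs0 : s ≠ 0)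
    (hD : (rangeWeights X Y hX hY).D s = 0) (hz : Away (range X) (range Y) z) (hz0 : z ≠ 0)
    (hzs : ‖z‖ < ‖s‖) :
    ‖L.hin (a + p) z‖ ≤ Real.exp ((rangeWeights X Y hX hY).U a z - (rangeWeights X Y hX hY).U a s)
      * (‖z‖ ^ (-p - 1) * ‖s‖ ^ (q + 1) / √(‖s‖ ^ 2 - ‖z‖ ^ 2)) := by
  set V := rangeWeights X Y hX hY with hV
  set r := ‖s‖ with hr
  have hr0 : 0 < r := norm_pos_iff.2 hs0
  have hzn := norm_pos_iff.2 hz0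
  have hM : ∀ w, ‖w‖ = r → ‖w ^ (a + q) * (genF X Y w)⁻¹‖ ≤ r ^ q * Real.exp (-(V.U a s)) := by
    intro w hw
    have hw0 : w ≠ 0 := norm_pos_iff.1 (hw ▸ hr0)
    by_cases hwa : Away (range X) (range Y) w
    · have h1 := Weights.U_tangent (W := V) a hwa hs hs0 hw
      rw [hD, mul_zero, add_zero] at h1
      have h2 := exp_U hX hY hwa hw0 a
      rw [← hV] at h2
      have hG : 0 < ‖genF X Y w‖ := norm_pos_iff.2 (genF_ne_zero hwa hw0)
      rw [norm_mul, norm_zpow, norm_inv, hw, zpow_add₀ hr0.ne']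
      have h3 : r ^ a * ‖genF X Y w‖⁻¹ = Real.exp (-(V.U a w)) := by
        rw [Real.exp_neg, h2, hw, zpow_neg, mul_inv, inv_inv, mul_comm]
      calc r ^ a * r ^ q * ‖genF X Y w‖⁻¹ = r ^ q * Real.exp (-(V.U a w)) := by rw [← h3]; ring
        _ ≤ _ := by
          refine mul_le_mul_of_nonneg_left (Real.exp_le_exp.2 (by linarith)) (by positivity)
    -- If the circle runs through a pole of `F`, the reciprocal vanishes there and the bound is
    -- trivial.
    · have : (genF X Y w)⁻¹ = 0 := by
        rw [genF_inv]
        by_contra h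
        obtain ⟨h1, h2⟩ := mul_ne_zero_iff.1 h
        rw [Finset.prod_ne_zero_iff] at h1 h2
        refine hwa ⟨?_, ?_⟩
        · rintro _ ⟨i, rfl⟩; exact h1 i (Finset.mem_univ i)
        · rintro _ ⟨i, rfl⟩ h3
          refine h2 i (Finset.mem_univ i) ?_
          have : 1 + (Y i : ℂ) / w = (w + Y i) / w := by field_simp
          rw [this, h3, zero_div]
      rw [this, mul_zero, norm_zero]
      positivity
  have h1 := L.norm_pos_le hzs hM
  have e1 : poles X Y z * z ^ ((k : ℤ) - (a + p) - 1) = genF X Y z * z ^ (-(a + p) - 1) := by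
    rw [genF_eq X Y hz0, mul_assoc, ← zpow_add₀ hz0]
    congr 2; ring
  have h2 := exp_U hX hY hz hz0 a
  rw [← hV] at h2
  rw [hin, norm_neg, norm_mul, e1, norm_mul, norm_zpow]
  have e2 : ‖genF X Y z‖ * ‖z‖ ^ (-(a + p) - 1) = Real.exp (V.U a z) * ‖z‖ ^ (-p - 1) := by
    rw [h2, mul_assoc, ← zpow_add₀ hzn.ne']
    congr 2; ring
  rw [e2, sub_eq_add_neg (V.U a z), Real.exp_add]
  refine (mul_le_mul_of_nonneg_left h1 (by positivity)).trans_eq ?_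
  rw [zpow_add_one₀ hr0.ne' q]
  ring

/-- All exponents are at least `q - k ≥ 0`, so there is no negative part. -/
theorem corrKernel_eq_zero (hX : ∀ i, 0 ≤ X i) (hY : ∀ j, 0 ≤ Y j) {p q : ℤ} (h : (k : ℤ) ≤ q) :
    corrKernel X Y p q = 0 := by
  obtain ⟨L⟩ := exists_laurent X Y q
  have : ∀ z, L.hout p z = 0 := by
    intro z
    have : L.neg z = 0 := by
      refine Finset.sum_eq_zero fun i hi => ?_
      rw [if_pos]
      have := L.le i hi
      omega
    rw [hout, this, mul_zero]
  rw [corrKernel_eq hX hY L p]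
  simp [this, circleIntegral]

/-- All exponents are at most `q + n < 0`, so the negative part is everything and only the integral
of `z^(q-p-1)` remains. -/
theorem corrKernel_eq_delta (hX : ∀ i, 0 ≤ X i) (hY : ∀ j, 0 ≤ Y j) {p q : ℤ} (h : q + n < 0) :
    corrKernel X Y p q = if p = q then 1 else 0 := by
  obtain ⟨L⟩ := exists_laurent X Y q
  obtain ⟨-, -, h0, -⟩ := contours_admissible X Y hX hY
  have hR : 0 < halfWidth Y + crossing X := add_pos (halfWidth_pos hY) (crossing_pos hX)
  have hpos : ∀ z, L.pos z = 0 := by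
    intro z
    refine Finset.sum_eq_zero fun i hi => ?_
    rw [if_neg]
    have := L.ge i hi
    omega
  have e : ∀ z ∈ Metric.sphere (-(halfWidth Y : ℂ)) (halfWidth Y + crossing X),
      L.hout p z = (z - 0) ^ (q - p - 1) := by
    intro z hz
    obtain ⟨h1, h2⟩ := sphere_away hX hY hz
    rw [L.hout_eq p h1 h2, hin, hpos, mul_zero, neg_zero, zero_add, sub_zero]
  rw [corrKernel_eq hX hY L p, circleIntegral.integral_congr hR.le e]
  split_ifs with hpq
  · have e2 : q - p - 1 = -1 := by omega
    rw [e2]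
    simp only [zpow_neg_one]
    rw [circleIntegral.integral_sub_inv_of_mem_ball h0, inv_mul_cancel₀ Complex.two_pi_I_ne_zero]
  · rw [circleIntegral.integral_sub_zpow_of_ne (by omega), mul_zero]

end Laurent

end

end DualSchur

namespace DualSchur

noncomputable section

/-! ### Approximation of the limiting weights by finite families -/

structure Approx {A B : Set ℝ} (W : Weights A B) where
  n : ℕ → ℕ
  k : ℕ → ℕ
  X : ∀ m, Fin (n m) → ℝ
  Y : ∀ m, Fin (k m) → ℝ
  hX : ∀ m i, X m i ∈ A
  hY : ∀ m j, Y m j ∈ B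
  cμ : ScaledConv (fun m => diracs (X m)) W.μ A
  cν : ScaledConv (fun m => diracs (Y m)) W.ν B

namespace Approx

variable {A B : Set ℝ} {W : Weights A B} (P : Approx W)

def swap : Approx W.swap := ⟨P.k, P.n, P.Y, P.X, P.hY, P.hX, P.cν, P.cμ⟩

def V (m : ℕ) : Weights A B := W.discrete (P.X m) (P.Y m) (P.hX m) (P.hY m)

theorem X0 (m : ℕ) (i : Fin (P.n m)) : 0 ≤ P.X m i := W.A0 _ (P.hX m i)

theorem Y0 (m : ℕ) (i : Fin (P.k m)) : 0 ≤ P.Y m i := W.B0 _ (P.hY m i)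

theorem away_range (m : ℕ) {z : ℂ} (h : Away A B z) : Away (range (P.X m)) (range (P.Y m)) z := by
  refine ⟨?_, ?_⟩
  · rintro _ ⟨i, rfl⟩; exact h.1 _ (P.hX m i)
  · rintro _ ⟨i, rfl⟩; exact h.2 _ (P.hY m i)

theorem tendsto_A {F : ℂ × ℂ → ℝ → ℂ} {O : Set (ℂ × ℂ)} (hO : IsOpen O)
    (hF : ContinuousOn (Function.uncurry F) (O ×ˢ A)) {q : ℂ × ℂ} (hq : q ∈ O) :
    Tendsto (fun p : ℕ × ℂ × ℂ => ((p.1 : ℝ)⁻¹ : ℂ) * ∫ x, F p.2 x ∂(P.V p.1).μ) (atTop ×ˢ 𝓝 q)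
      (𝓝 (∫ x, F q x ∂W.μ)) := by
  have := W.finμ
  exact ScaledConv.tendsto_prod W.hA (fun m => (P.V m).μA) W.μA P.cμ hO hF hq

theorem tendsto_B {F : ℂ × ℂ → ℝ → ℂ} {O : Set (ℂ × ℂ)} (hO : IsOpen O)
    (hF : ContinuousOn (Function.uncurry F) (O ×ˢ B)) {q : ℂ × ℂ} (hq : q ∈ O) :
    Tendsto (fun p : ℕ × ℂ × ℂ => ((p.1 : ℝ)⁻¹ : ℂ) * ∫ x, F p.2 x ∂(P.V p.1).ν) (atTop ×ˢ 𝓝 q)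
      (𝓝 (∫ x, F q x ∂W.ν)) := by
  have := W.finν
  exact ScaledConv.tendsto_prod W.hB (fun m => (P.V m).νB) W.νB P.cν hO hF hq

theorem isOpen_away2 (W : Weights A B) : IsOpen {p : ℂ × ℂ | Away A B p.1 ∧ Away A B p.2} :=
  (W.isOpen_away.preimage continuous_fst).inter (W.isOpen_away.preimage continuous_snd)

theorem tendsto_Q {z s : ℂ} (hz : Away A B z) (hs : Away A B s) :
    Tendsto (fun p : ℕ × ℂ × ℂ => ((p.1 : ℝ)⁻¹ : ℂ) * (P.V p.1).Q p.2.1 p.2.2)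
      (atTop ×ˢ 𝓝 (z, s)) (𝓝 (W.Q z s)) := by
  have h1 := P.tendsto_A (q := (z, s)) (F := fun p x =>
    (x : ℂ) ^ 2 / ((1 - x * p.1) * (Complex.normSq (1 - x * p.2) : ℝ))) (isOpen_away2 W) (by
      have := Complex.continuous_normSq
      refine ContinuousOn.div (by fun_prop) (by fun_prop) ?_
      rintro ⟨p, x⟩ ⟨hp, hx⟩
      refine mul_ne_zero (hp.1.1 x hx) ?_
      exact_mod_cast (hp.2.normSq_pos_left hx).ne') ⟨hz, hs⟩
  have h2 := P.tendsto_B (q := (z, s)) (F := fun p y =>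
    (y : ℂ) / ((p.1 + y) * (Complex.normSq (p.2 + y) : ℝ))) (isOpen_away2 W) (by
      have := Complex.continuous_normSq
      refine ContinuousOn.div (by fun_prop) (by fun_prop) ?_
      rintro ⟨p, x⟩ ⟨hp, hx⟩
      refine mul_ne_zero (hp.1.2 x hx) ?_
      exact_mod_cast (hp.2.normSq_pos_right hx).ne') ⟨hz, hs⟩
  refine (h1.add h2).congr fun p => ?_
  rw [← mul_add]; rfl

theorem tendsto_T {z : ℂ} (hz : Away A B z) :
    Tendsto (fun p : ℕ × ℂ => ((p.1 : ℝ)⁻¹ : ℂ) * (P.V p.1).T p.2) (atTop ×ˢ 𝓝 z)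
      (𝓝 (W.T z)) := by
  have h1 := ScaledConv.tendsto_prod W.hA (fun m => (P.V m).μA) W.μA P.cμ W.isOpen_away
    (F := fun z x => (x : ℂ) * z / (1 - x * z)) (by
      refine ContinuousOn.div (by fun_prop) (by fun_prop) ?_
      rintro ⟨p, x⟩ ⟨hp, hx⟩
      exact hp.1 x hx) hz
  have h2 := ScaledConv.tendsto_prod W.hB (fun m => (P.V m).νB) W.νB P.cν W.isOpen_away
    (F := fun z x => (x : ℂ) / (z + x)) (by
      refine ContinuousOn.div (by fun_prop) (by fun_prop) ?_
      rintro ⟨p, x⟩ ⟨hp, hx⟩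
      exact hp.2 x hx) hz
  refine (h1.add h2).congr fun p => ?_
  rw [← mul_add]; rfl

theorem tendsto_U {a : ℕ → ℤ} {t : ℝ} (ha : Tendsto (fun m => (a m : ℝ) / m) atTop (𝓝 t)) {z : ℂ}
    (hz : Away A B z) (h0 : z ≠ 0) :
    Tendsto (fun p : ℕ × ℂ => (p.1 : ℝ)⁻¹ * (P.V p.1).U (a p.1) p.2) (atTop ×ˢ 𝓝 z)
      (𝓝 (W.U t z)) := by
  have hO : IsOpen {z | Away A B z ∧ z ≠ 0} := W.isOpen_away.inter isOpen_ne
  have h1 := ScaledConv.tendsto_prod_real W.hA (fun m => (P.V m).μA) W.μA P.cμ hO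
    (F := fun z x => Real.log ‖1 - (x : ℂ) * z‖) (by
      refine ContinuousOn.log (by fun_prop) ?_
      rintro ⟨p, x⟩ ⟨hp, hx⟩
      exact norm_ne_zero_iff.2 (hp.1.1 x hx)) ⟨hz, h0⟩
  have h2 := ScaledConv.tendsto_prod_real W.hB (fun m => (P.V m).νB) W.νB P.cν hO
    (F := fun z x => Real.log ‖1 + (x : ℂ) / z‖) (by
      refine ContinuousOn.log (ContinuousOn.norm ?_) ?_
      · refine continuousOn_const.add (ContinuousOn.div (by fun_prop) (by fun_prop) ?_)
        rintro ⟨p, x⟩ ⟨hp, hx⟩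
        exact hp.2
      rintro ⟨p, x⟩ ⟨hp, hx⟩
      have hp0 : p ≠ 0 := hp.2
      have : 1 + (x : ℂ) / p = (p + x) / p := by field_simp
      refine norm_ne_zero_iff.2 ?_
      show 1 + (x : ℂ) / p ≠ 0
      rw [this]
      exact div_ne_zero (hp.1.2 x hx) hp.2) ⟨hz, h0⟩
  have h3 : Tendsto (fun p : ℕ × ℂ => ((a p.1 : ℝ) / p.1) * Real.log ‖p.2‖) (atTop ×ˢ 𝓝 z)
      (𝓝 (t * Real.log ‖z‖)) := by
    refine (ha.comp tendsto_fst).mul ?_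
    have : ContinuousAt (fun z : ℂ => Real.log ‖z‖) z :=
      ContinuousAt.log (by fun_prop) (norm_ne_zero_iff.2 h0)
    exact this.tendsto.comp tendsto_snd
  refine ((h1.neg.sub h2).sub h3).congr fun p => ?_
  simp only [Weights.U, V, Weights.discrete]
  ring

end Approx

/-! ### Estimates along a segment starting at a contact point -/

/-- Integration of the bound `C/√ρ`, starting from `δ > 0` because the derivative bound is singular
at `0`. -/
theorem norm_sub_le_sqrt {f f' : ℝ → ℂ} {C l : ℝ} (hl : 0 ≤ l)
    (hc : ContinuousWithinAt f (Ioi 0) 0) (hd : ∀ ρ ∈ Ioc 0 l, HasDerivAt f (f' ρ) ρ)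
    (hf' : ∀ ρ ∈ Ioc 0 l, ‖f' ρ‖ ≤ C / √ρ) : ‖f l - f 0‖ ≤ 2 * C * √l := by
  rcases hl.eq_or_lt with rfl | hl
  · simp
  have key : ∀ δ ∈ Ioo 0 l, ‖f l - f δ‖ ≤ 2 * C * √l - 2 * C * √δ := by
    intro δ hδ
    have hB : ∀ x ∈ Ico δ l, HasDerivWithinAt (fun x => 2 * C * √x - 2 * C * √δ) (C / √x)
        (Ici x) x := by
      intro x hx
      have hx0 : 0 < x := hδ.1.trans_le hx.1
      have := ((Real.hasDerivAt_sqrt hx0.ne').const_mul (2 * C)).sub_const (2 * C * √δ)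
      refine (this.congr_deriv ?_).hasDerivWithinAt
      have : √x ≠ 0 := (Real.sqrt_pos.2 hx0).ne'
      field_simp
    have hg : ∀ x ∈ Icc δ l, HasDerivAt (fun x => f x - f δ) (f' x) x := fun x hx =>
      (hd x ⟨hδ.1.trans_le hx.1, hx.2⟩).sub_const _
    refine image_norm_le_of_norm_deriv_right_le_deriv_boundary' (f := fun x => f x - f δ)
      (f' := f') (a := δ) (b := l) (B := fun x => 2 * C * √x - 2 * C * √δ) (B' := fun x => C / √x)
      (fun x hx => (hg x hx).continuousAt.continuousWithinAt)
      (fun x hx => (hg x ⟨hx.1, hx.2.le⟩).hasDerivWithinAt) (by simp) ?_ hB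
      (fun x hx => hf' x ⟨hδ.1.trans_le hx.1, hx.2.le⟩) ⟨hδ.2.le, le_rfl⟩
    fun_prop
  have h1 : Tendsto (fun δ => ‖f l - f δ‖) (𝓝[>] 0) (𝓝 ‖f l - f 0‖) :=
    (tendsto_const_nhds.sub hc.tendsto).norm
  have h2 : Tendsto (fun δ => 2 * C * √l - 2 * C * √δ) (𝓝[>] 0) (𝓝 (2 * C * √l - 2 * C * √0)) := by
    have : Continuous fun δ => 2 * C * √l - 2 * C * √δ := by fun_prop
    exact (this.tendsto 0).mono_left nhdsWithin_le_nhds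
  have := le_of_tendsto_of_tendsto h1 h2 (by
    filter_upwards [Ioo_mem_nhdsGT hl] with δ hδ
    exact key δ hδ)
  simpa using this

namespace Weights

variable {A B : Set ℝ} {W : Weights A B}

theorem U_le_along {t : ℝ} {s e : ℂ} {l : ℝ}
    (ha : ∀ ρ ∈ Icc 0 l, Away A B (s + (ρ : ℝ) * e) ∧ s + (ρ : ℝ) * e ≠ 0)
    (hd : ∀ ρ ∈ Ioo 0 l, (e * (W.T (s + (ρ : ℝ) * e) - t) / (s + (ρ : ℝ) * e)).re ≤ 0) :
    ∀ ρ ∈ Icc 0 l, W.U t (s + (ρ : ℝ) * e) ≤ W.U t s := by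
  intro ρ hρ
  have h := antitoneOn_of_deriv_nonpos (convex_Icc 0 l) (f := fun ρ : ℝ => W.U t (s + ρ * e))
    (fun x hx => (hasDerivAt_U t (ha x hx).1 (ha x hx).2).continuousAt.continuousWithinAt)
    (fun x hx => by
      rw [interior_Icc] at hx
      have := ha x (Ioo_subset_Icc_self hx)
      exact (hasDerivAt_U t this.1 this.2).differentiableAt.differentiableWithinAt)
    (fun x hx => by
      rw [interior_Icc] at hx
      have := ha x (Ioo_subset_Icc_self hx)
      rw [(hasDerivAt_U t this.1 this.2).deriv]
      exact hd x hx)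
  have := h (show (0 : ℝ) ∈ Icc 0 l from ⟨le_rfl, hρ.1.trans hρ.2⟩) hρ hρ.1
  simpa using this

theorem U_lt_along {t : ℝ} {s e : ℂ} {l : ℝ} (hl : 0 < l)
    (ha : ∀ ρ ∈ Icc 0 l, Away A B (s + (ρ : ℝ) * e) ∧ s + (ρ : ℝ) * e ≠ 0)
    (hd : ∀ ρ ∈ Ioo 0 l, (e * (W.T (s + (ρ : ℝ) * e) - t) / (s + (ρ : ℝ) * e)).re < 0) :
    W.U t (s + (l : ℝ) * e) < W.U t s := by
  have h := strictAntiOn_of_deriv_neg (convex_Icc 0 l) (f := fun ρ : ℝ => W.U t (s + ρ * e))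
    (fun x hx => (hasDerivAt_U t (ha x hx).1 (ha x hx).2).continuousAt.continuousWithinAt)
    (fun x hx => by
      rw [interior_Icc] at hx
      have := ha x (Ioo_subset_Icc_self hx)
      rw [(hasDerivAt_U t this.1 this.2).deriv]
      exact hd x hx)
  have := h (show (0 : ℝ) ∈ Icc 0 l from ⟨le_rfl, hl.le⟩) (show l ∈ Icc 0 l from ⟨hl.le, le_rfl⟩) hl
  simpa using this

end Weights

theorem normSq_segment (s e : ℂ) (ρ : ℝ) (he : ‖e‖ = 1) :
    ‖s‖ ^ 2 - ‖s + ρ * e‖ ^ 2 = ρ * (-(2 * (s.re * e.re + s.im * e.im)) - ρ) := by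
  have h1 : e.re * e.re + e.im * e.im = 1 := by
    rw [← Complex.normSq_apply, Complex.normSq_eq_norm_sq, he, one_pow]
  rw [← Complex.normSq_eq_norm_sq, ← Complex.normSq_eq_norm_sq, Complex.normSq_apply,
    Complex.normSq_apply]
  simp
  linear_combination (-ρ ^ 2) * h1

namespace Approx

variable {A B : Set ℝ} {W : Weights A B} (P : Approx W)

/-- A primitive of the inner part of the integrand. -/
def IsPrim {n k : ℕ} {X : Fin n → ℝ} {Y : Fin k → ℝ} {q : ℤ} (L : Laurent X Y q) (p : ℤ)
    (Φ : ℂ → ℂ) : Prop := ∀ z ∈ Strip (Laurent.Jin X Y p), HasDerivAt Φ (L.hin p z) z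

/-- Along the segment `U` does not increase, so the exponential factor is at most `1`; the direction
points strictly into the disc, so `|s|² - |z|²` grows linearly. The constants do not depend on `m`
or on the length of the segment. -/
theorem exists_segment_bound (a : ℕ → ℤ) (p q : ℤ) {zs : ℕ → ℂ} {z₀ : ℂ}
    (hz : Tendsto zs atTop (𝓝 z₀)) (haz : Away A B z₀) (h0 : z₀ ≠ 0)
    (hcrit : ∀ᶠ m in atTop, (P.V m).D (zs m) = 0) {e : ℂ} (he : ‖e‖ = 1)
    (hin : z₀.re * e.re + z₀.im * e.im < 0) :
    ∃ C η : ℝ, 0 < η ∧ ∀ᶠ m in atTop, ∀ l ∈ Icc 0 η,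
      (∀ ρ ∈ Icc 0 l, 0 ≤ (zs m + (ρ : ℝ) * e).im) →
      (∀ ρ ∈ Ioo 0 l, (e * ((P.V m).T (zs m + (ρ : ℝ) * e) - (a m : ℝ)) /
        (zs m + (ρ : ℝ) * e)).re ≤ 0) →
      Away A B (zs m + (l : ℝ) * e) ∧
      ∀ (L : Laurent (P.X m) (P.Y m) (a m + q)) (Φ : ℂ → ℂ), IsPrim L (a m + p) Φ →
        ‖Φ (zs m + (l : ℝ) * e) - Φ (zs m)‖ ≤ C * √l := by
  set κ := -(z₀.re * e.re + z₀.im * e.im) with hκ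
  have hκ0 : 0 < κ := by linarith
  set M := ‖z₀‖ ^ (-p - 1) * ‖z₀‖ ^ (q + 1) + 1 with hM
  have hn0 := norm_ne_zero_iff.2 h0
  have hev : ∀ᶠ w : ℂ × ℂ in 𝓝 (z₀, z₀), Away A B w.1 ∧ w.1 ≠ 0 ∧ Away A B w.2 ∧ w.2 ≠ 0 ∧
      ‖w.1‖ ^ (-p - 1) * ‖w.2‖ ^ (q + 1) < M ∧ -(w.2.re * e.re + w.2.im * e.im) > κ * (3 / 4) := by
    have e1 : ∀ᶠ z in 𝓝 z₀, Away A B z := W.isOpen_away.mem_nhds haz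
    have e2 : ∀ᶠ z in 𝓝 z₀, z ≠ 0 := isOpen_ne.mem_nhds h0
    have c1 : ContinuousAt (fun w : ℂ × ℂ => ‖w.1‖ ^ (-p - 1) * ‖w.2‖ ^ (q + 1)) (z₀, z₀) := by
      refine ContinuousAt.mul (ContinuousAt.zpow₀ (by fun_prop) _ (Or.inl hn0))
        (ContinuousAt.zpow₀ (by fun_prop) _ (Or.inl hn0))
    have c2 : ContinuousAt (fun w : ℂ × ℂ => -(w.2.re * e.re + w.2.im * e.im)) (z₀, z₀) := by
      fun_prop
    have e3 := c1.eventually_lt_const (show _ < M by rw [hM]; exact lt_add_one _)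
    have e4 := c2.eventually_const_lt (show κ * (3 / 4) < _ by simp only; linarith)
    filter_upwards [continuousAt_fst.eventually e1, continuousAt_fst.eventually e2,
      continuousAt_snd.eventually e1, continuousAt_snd.eventually e2, e3, e4]
      with w h1 h2 h3 h4 h5 h6
    exact ⟨h1, h2, h3, h4, h5, h6⟩
  obtain ⟨δ, hδ, hb⟩ := Metric.eventually_nhds_iff_ball.1 hev
  -- With inward component above `3κ/4` and `ρ ≤ κ/2` one has `|s|² - |z|² ≥ κρ/2`, whence the
  -- derivative bound `(M/√(κ/2))/√ρ`; integrating doubles the constant.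
  refine ⟨2 * (M / √(κ / 2)), min (δ / 2) (κ / 2), by positivity, ?_⟩
  filter_upwards [hcrit, hz.eventually (Metric.ball_mem_nhds z₀ (half_pos hδ))]
    with m hD hm l hl him hT
  have hmδ : ‖zs m - z₀‖ < δ / 2 := by simpa [dist_eq_norm] using hm
  set s := zs m with hs
  have hball : ∀ ρ ∈ Icc 0 l, (s + (ρ : ℝ) * e, s) ∈ Metric.ball (z₀, z₀) δ := by
    intro ρ hρ
    have h1 : ρ ≤ δ / 2 := hρ.2.trans (hl.2.trans (min_le_left _ _))
    rw [mem_ball_iff_norm, Prod.mk_sub_mk, Prod.norm_mk]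
    refine max_lt ?_ (by linarith)
    have e1 : s + ρ * e - z₀ = (s - z₀) + ρ * e := by ring
    rw [e1]
    refine (norm_add_le _ _).trans_lt ?_
    rw [norm_mul, he, mul_one, Complex.norm_real, Real.norm_of_nonneg hρ.1]
    linarith
  have hpt : ∀ ρ ∈ Icc 0 l, Away A B (s + (ρ : ℝ) * e) ∧ s + (ρ : ℝ) * e ≠ 0 := fun ρ hρ =>
    ⟨(hb _ (hball ρ hρ)).1, (hb _ (hball ρ hρ)).2.1⟩
  have hl0 : (0 : ℝ) ∈ Icc 0 l := ⟨le_rfl, hl.1⟩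
  obtain ⟨-, -, hsa, hs0, -, hκs⟩ := hb _ (hball 0 hl0)
  simp only at hsa hs0 hκs
  have hU := Weights.U_le_along (W := P.V m) (t := (a m : ℝ)) hpt hT
  refine ⟨(hpt l ⟨hl.1, le_rfl⟩).1, fun L Φ hΦ => ?_⟩
  have hmem : ∀ ρ ∈ Icc 0 l, s + (ρ : ℝ) * e ∈ Strip (Laurent.Jin (P.X m) (P.Y m) (a m + p)) :=
    fun ρ hρ => Laurent.strip_mono (Laurent.Jout_subset _)
      (Laurent.mem_strip (P.away_range m (hpt ρ hρ).1) (hpt ρ hρ).2 (him ρ hρ))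
  have hline : ∀ ρ : ℝ, HasDerivAt (fun ρ : ℝ => s + (ρ : ℂ) * e) e ρ := by
    intro ρ
    have := ((Complex.ofRealCLM.hasDerivAt (x := ρ)).mul_const e).const_add s
    simpa using this
  have hdf : ∀ ρ ∈ Icc 0 l, HasDerivAt (fun ρ : ℝ => Φ (s + (ρ : ℂ) * e))
      (e • L.hin (a m + p) (s + (ρ : ℂ) * e)) ρ := fun ρ hρ =>
    HasDerivAt.scomp ρ (hΦ _ (hmem ρ hρ)) (hline ρ)
  have := norm_sub_le_sqrt (f := fun ρ : ℝ => Φ (s + (ρ : ℂ) * e)) (C := M / √(κ / 2)) hl.1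
    (hdf 0 hl0).continuousAt.continuousWithinAt (fun ρ hρ => hdf ρ ⟨hρ.1.le, hρ.2⟩) (by
      intro ρ hρ
      have hρ' : ρ ∈ Icc 0 l := ⟨hρ.1.le, hρ.2⟩
      have hκρ : κ / 2 * ρ ≤ ‖s‖ ^ 2 - ‖s + (ρ : ℝ) * e‖ ^ 2 := by
        rw [normSq_segment s e ρ he]
        have : ρ ≤ κ / 2 := hρ.2.trans (hl.2.trans (min_le_right _ _))
        have h3 : κ / 2 ≤ -(2 * (s.re * e.re + s.im * e.im)) - ρ := by linarith
        nlinarith [hρ.1]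
      have hpos : 0 < κ / 2 * ρ := mul_pos (by positivity) hρ.1
      have hlt : ‖s + (ρ : ℝ) * e‖ < ‖s‖ := by
        have : 0 < ‖s‖ ^ 2 - ‖s + (ρ : ℝ) * e‖ ^ 2 := hpos.trans_le hκρ
        exact lt_of_pow_lt_pow_left₀ 2 (norm_nonneg _) (by linarith)
      have hb1 := Laurent.norm_hin_le (P.X0 m) (P.Y0 m) L (p := p) (P.away_range m hsa) hs0 hD
        (P.away_range m (hpt ρ hρ').1) (hpt ρ hρ').2 hlt
      rw [smul_eq_mul, norm_mul, he, one_mul]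
      refine hb1.trans ?_
      have hU1 : Real.exp ((rangeWeights (P.X m) (P.Y m) (P.X0 m) (P.Y0 m)).U (a m)
          (s + (ρ : ℝ) * e) - (rangeWeights (P.X m) (P.Y m) (P.X0 m) (P.Y0 m)).U (a m) s) ≤ 1 :=
        Real.exp_le_one_iff.2 (sub_nonpos.2 (hU ρ hρ'))
      have hMb := (hb _ (hball ρ hρ')).2.2.2.2.1
      simp only at hMb
      rw [div_div, ← Real.sqrt_mul (by positivity)]
      refine (mul_le_of_le_one_left (by positivity) hU1).trans ?_
      refine div_le_div₀ (by positivity) hMb.le (Real.sqrt_pos.2 hpos) (Real.sqrt_le_sqrt hκρ))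
  simpa [mul_assoc] using this

end Approx

end

end DualSchur

namespace DualSchur

noncomputable section

/-! ### Descent directions at contact points -/

namespace Weights

variable {A B : Set ℝ}

/-- By `T_sub` the derivative of `U` in direction `e` splits into `(T(s) - t) Re (e/z)`, which is
nonpositive for an inward direction, and a quadratic term governed by `Q`. The scale `l` is `1/n`
for the finite weights. -/
theorem re_dir_neg (V : Weights A B) {s z e : ℂ} {ρ t l : ℝ} (hz : Away A B z)
    (hs : Away A B s) (hz0 : z ≠ 0) (hze : z = s + ρ * e) (hD : V.D s = 0)
    (hT : t ≤ (V.T s).re) (he : (e / z).re ≤ 0) (hρ : 0 < ρ) (hl : 0 < l)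
    (hneg : (e ^ 2 * (2 * Complex.I * s.im + ρ * e) * (l * V.Q z s / z)).re < 0) :
    (e * (V.T z - t) / z).re < 0 := by
  have h1 := T_sub (W := V) hz hs
  have h2 := T_eq_re hs hD
  have h3 : z - (starRingEnd ℂ) s = 2 * Complex.I * s.im + ρ * e := by
    have : s - (starRingEnd ℂ) s = 2 * Complex.I * s.im := by
      rw [Complex.sub_conj]; push_cast; ring
    rw [← this, hze]; ring
  have h4 : z - s = ρ * e := by rw [hze]; ring
  rw [hD, h3, h4, h2] at h1
  have hl0 : (l : ℂ) ≠ 0 := by exact_mod_cast hl.ne'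
  have e1 : e * (V.T z - t) / z = (((V.T s).re - t : ℝ) : ℂ) * (e / z) +
      ((ρ / l : ℝ) : ℂ) * (e ^ 2 * (2 * Complex.I * s.im + ρ * e) * (l * V.Q z s / z)) := by
    rw [h1]; push_cast; field_simp; ring
  rw [e1, Complex.add_re, Complex.re_ofReal_mul, Complex.re_ofReal_mul]
  have := mul_nonpos_of_nonneg_of_nonpos (sub_nonneg.2 hT) he
  have := mul_neg_of_pos_of_neg (div_pos hρ hl) hneg
  linarith

end Weights

/-- A direction in which the potential decreases at a contact point `z₀`, where
`c₀ = Q(z₀, z₀) / z₀`. -/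
structure Dir (z₀ c₀ e : ℂ) : Prop where
  norm : ‖e‖ = 1
  inward : z₀.re * e.re + z₀.im * e.im < 0
  im : 0 < z₀.im ∨ 0 < e.im
  neg : ∃ ε > 0, ∀ (y ρ : ℝ) (c : ℂ), 0 ≤ y → |y - z₀.im| < ε → 0 < ρ → ρ < ε → ‖c - c₀‖ < ε →
    (e ^ 2 * (2 * Complex.I * y + ρ * e) * c).re < 0

theorem re_div_eq (e z : ℂ) : (e / z).re = (z.re * e.re + z.im * e.im) / Complex.normSq z := by
  rw [Complex.div_re]; ring

namespace Crit

variable {A B : Set ℝ} {W : Weights A B} {zp vm : ℝ}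

/-- The inward radial direction works, since `Re (s · T'(s)) < 0` at the point; the condition is
open, so it persists nearby. -/
theorem exists_dir_of_im_pos (h : Crit W zp vm) {z₀ : ℂ} (hz : 0 < z₀.im) :
    ∃ e, Dir z₀ (W.Q z₀ z₀ / z₀) e := by
  have h0 := ne_zero_of_im_pos hz
  have hn : 0 < ‖z₀‖ := norm_pos_iff.2 h0
  have hnc : (‖z₀‖ : ℂ) ≠ 0 := by exact_mod_cast hn.ne'
  have hre := Weights.re_mul_deriv_T_neg h.nt hz
  have hsub : z₀ - (starRingEnd ℂ) z₀ = 2 * Complex.I * z₀.im := by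
    rw [Complex.sub_conj]; push_cast; ring
  refine ⟨-(z₀ / ‖z₀‖), ?_, ?_, Or.inl hz, ?_⟩
  · rw [norm_neg, norm_div, Complex.norm_real, norm_norm, div_self hn.ne']
  · have e1 : (-(z₀ / ‖z₀‖)).re = -(z₀.re / ‖z₀‖) := by
      rw [Complex.neg_re, Complex.div_ofReal_re]
    have e2 : (-(z₀ / ‖z₀‖)).im = -(z₀.im / ‖z₀‖) := by
      rw [Complex.neg_im, Complex.div_ofReal_im]
    rw [e1, e2]
    have e3 : z₀.re * -(z₀.re / ‖z₀‖) + z₀.im * -(z₀.im / ‖z₀‖) =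
        -((z₀.re ^ 2 + z₀.im ^ 2) / ‖z₀‖) := by ring
    rw [e3]
    have : 0 < z₀.re ^ 2 + z₀.im ^ 2 := by positivity
    have := div_pos this hn
    linarith
  · set e := -(z₀ / ‖z₀‖ : ℂ) with he
    have hcont : ContinuousAt (fun w : ℝ × ℝ × ℂ =>
        (e ^ 2 * (2 * Complex.I * w.1 + w.2.1 * e) * w.2.2).re) (z₀.im, 0, W.Q z₀ z₀ / z₀) := by
      fun_prop
    have hval : (e ^ 2 * (2 * Complex.I * z₀.im + (0 : ℝ) * e) * (W.Q z₀ z₀ / z₀)).re < 0 := by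
      have : e ^ 2 * (2 * Complex.I * z₀.im + (0 : ℝ) * e) * (W.Q z₀ z₀ / z₀) =
          (((‖z₀‖ ^ 2)⁻¹ : ℝ) : ℂ) * (z₀ * ((z₀ - (starRingEnd ℂ) z₀) * W.Q z₀ z₀)) := by
        rw [hsub, he]
        push_cast
        field_simp
        ring
      rw [this, Complex.re_ofReal_mul]
      exact mul_neg_of_pos_of_neg (by positivity) hre
    obtain ⟨ε, hε, hb⟩ := Metric.eventually_nhds_iff.1 (hcont.eventually_lt_const hval)
    refine ⟨ε, hε, fun y ρ c _ h1 h2 h3 h4 => hb (y := (y, ρ, c)) ?_⟩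
    rw [Prod.dist_eq, Prod.dist_eq]
    refine max_lt (by rwa [Real.dist_eq]) (max_lt ?_ (by rwa [dist_eq_norm]))
    simp [abs_of_pos h2, h3]

/-- At a real double critical point beyond the poles the finite critical points may be real or
nearly real. Therefore the direction has to make both the term in `e² · 2iy` and the term in `ρ e³`
descend, uniformly in the ratio of `y` and `ρ`. -/
theorem exists_dir_of_real (h : Crit W zp vm) {r : ℝ} (hr : r ≠ 0) (ha : Away A B r)
    (hI : In0 B A (-r⁻¹)) (hD : W.D r = 0) : ∃ e, Dir (r : ℂ) (W.Q r r / r) e := by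
  have hrc : (r : ℂ) ≠ 0 := by exact_mod_cast hr
  obtain ⟨κ, hκ, e0⟩ : ∃ κ : ℝ, 0 < κ ∧ W.Q r r = -(κ : ℂ) := by
    obtain ⟨q, hq, e1⟩ := Weights.Q_real_pos h.swap.nt hI hI
    have e2 := Weights.Q_swap (W := W) ha ha hrc hrc hD
    push_cast at e1
    rw [e1] at e2
    have hns : Complex.normSq (r : ℂ) = r ^ 2 := by rw [Complex.normSq_ofReal, sq]
    rw [hns] at e2
    refine ⟨q / r ^ 4, by positivity, ?_⟩
    push_cast at e2 ⊢
    field_simp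
    linear_combination e2
  set g : ℝ := r / |r| with hg
  have har : 0 < |r| := abs_pos.2 hr
  have hg2 : g * g = 1 := by
    rw [hg, div_mul_div_comm, abs_mul_abs_self, div_self (mul_ne_zero hr hr)]
  have hgr : r * g = |r| := by
    rw [hg, mul_div_assoc', ← abs_mul_abs_self, mul_div_assoc, div_self har.ne', mul_one]
  have h3 : √3 * √3 = 3 := Real.mul_self_sqrt (by norm_num)
  have hs3 : 1 < √3 := by nlinarith [Real.sqrt_nonneg 3]
  -- The direction makes an angle of 60 degrees with the inward real direction. Then `e³` is the
  -- real number `g`, and `e² · 2i` has real part `√3 g`.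
  set e : ℂ := ⟨-g / 2, √3 / 2⟩ with he
  have hnorm : ‖e‖ = 1 := by
    have : ‖e‖ ^ 2 = 1 := by
      rw [← Complex.normSq_eq_norm_sq, Complex.normSq_apply, he]
      simp only
      linear_combination hg2 / 4 + h3 / 4
    nlinarith [norm_nonneg e]
  have hre : ∀ y ρ : ℝ, (e ^ 2 * (2 * Complex.I * y + ρ * e)).re = g * (√3 * y + ρ) := by
    intro y ρ
    simp only [pow_two, Complex.mul_re, Complex.mul_im, Complex.add_re, Complex.add_im,
      Complex.I_re, Complex.I_im, Complex.ofReal_re, Complex.ofReal_im, Complex.re_ofNat,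
      Complex.im_ofNat, he]
    linear_combination (-ρ * g / 8) * hg2 + (3 * g * ρ / 8) * h3
  -- The tolerance `κ/(3|r|)` for the coefficient costs at most a third of `2y + ρ`, less than the
  -- gain `√3 y + ρ`.
  refine ⟨e, hnorm, ?_, Or.inr (by rw [he]; positivity), κ / |r| / 3, by positivity, ?_⟩
  · rw [Complex.ofReal_re, Complex.ofReal_im, zero_mul, add_zero, he]
    simp only
    nlinarith
  · intro y ρ c hy _ hρ _ hc
    have hc0 : W.Q r r / r = ((-(κ / |r|) * g : ℝ) : ℂ) := by
      rw [e0, hg]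
      rcases abs_cases r with ⟨h1, -⟩ | ⟨h1, -⟩ <;> rw [h1] <;> push_cast <;> field_simp
    have hdec : e ^ 2 * (2 * Complex.I * y + ρ * e) * c =
        ((-(κ / |r|) * g : ℝ) : ℂ) * (e ^ 2 * (2 * Complex.I * y + ρ * e)) +
        e ^ 2 * (2 * Complex.I * y + ρ * e) * (c - W.Q r r / r) := by
      rw [hc0]; ring
    rw [hdec, Complex.add_re, Complex.re_ofReal_mul, hre]
    have hb1 : ‖e ^ 2 * (2 * Complex.I * y + ρ * e)‖ ≤ 2 * y + ρ := by
      rw [norm_mul, norm_pow, hnorm, one_pow, one_mul]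
      refine (norm_add_le _ _).trans ?_
      rw [norm_mul, norm_mul, norm_mul, hnorm, Complex.norm_I, Complex.norm_real, Complex.norm_real,
        Real.norm_of_nonneg hy, Real.norm_of_nonneg hρ.le, Complex.norm_ofNat]
      linarith
    have hb2 : (e ^ 2 * (2 * Complex.I * y + ρ * e) * (c - W.Q r r / r)).re ≤
        (2 * y + ρ) * (κ / |r| / 3) := by
      refine (Complex.re_le_norm _).trans ?_
      rw [norm_mul]
      exact mul_le_mul hb1 hc.le (norm_nonneg _) (by positivity)
    have hk : 0 < κ / |r| := by positivity
    have e5 : -(κ / |r|) * g * (g * (√3 * y + ρ)) = -(κ / |r|) * (√3 * y + ρ) := by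
      linear_combination (-(κ / |r|) * (√3 * y + ρ)) * hg2
    rw [e5]
    have h6 : y ≤ √3 * y := by nlinarith
    nlinarith [mul_le_mul_of_nonneg_left h6 hk.le, mul_pos hk hρ, mul_nonneg hk.le hy]

end Crit

/-! ### Uniformity along segments at moving contact points -/

namespace Approx

variable {A B : Set ℝ} {W : Weights A B} (P : Approx W)

theorem eventually_Q_div {zs : ℕ → ℂ} {z₀ : ℂ} (hz : Tendsto zs atTop (𝓝 z₀))
    (haz : Away A B z₀) (h0 : z₀ ≠ 0) {e : ℂ} (he : ‖e‖ = 1) {ε : ℝ} (hε : 0 < ε) :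
    ∃ η > 0, ∀ᶠ m : ℕ in atTop, ∀ ρ : ℝ, |ρ| ≤ η →
      ‖((m : ℝ)⁻¹ : ℂ) * (P.V m).Q (zs m + ρ * e) (zs m) / (zs m + ρ * e) - W.Q z₀ z₀ / z₀‖ < ε := by
  have h1 : Tendsto (fun p : ℕ × ℂ × ℂ => ((p.1 : ℝ)⁻¹ : ℂ) * (P.V p.1).Q p.2.1 p.2.2 / p.2.1)
      (atTop ×ˢ 𝓝 (z₀, z₀)) (𝓝 (W.Q z₀ z₀ / z₀)) := by
    refine (P.tendsto_Q haz haz).div ?_ h0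
    exact (continuousAt_fst (p := (z₀, z₀))).tendsto.comp tendsto_snd
  have h2 := h1.eventually (Metric.ball_mem_nhds _ hε)
  obtain ⟨pa, hpa, pb, hpb, hp⟩ := Filter.eventually_prod_iff.1 h2
  obtain ⟨δ, hδ, hb⟩ := Metric.eventually_nhds_iff_ball.1 hpb
  refine ⟨δ / 2, by positivity, ?_⟩
  filter_upwards [hpa, hz.eventually (Metric.ball_mem_nhds z₀ (half_pos hδ))] with m h3 h4 ρ hρ
  have h4 : ‖zs m - z₀‖ < δ / 2 := by simpa [dist_eq_norm] using h4
  have := hp h3 (hb (zs m + ρ * e, zs m) (by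
    rw [mem_ball_iff_norm, Prod.mk_sub_mk, Prod.norm_mk]
    refine max_lt ?_ (by linarith)
    have e1 : zs m + ρ * e - z₀ = (zs m - z₀) + ρ * e := by ring
    rw [e1]
    refine (norm_add_le _ _).trans_lt ?_
    rw [norm_mul, he, mul_one, Complex.norm_real, Real.norm_eq_abs]
    linarith))
  rw [dist_eq_norm] at this
  exact this

theorem eventually_segment {zs : ℕ → ℂ} {z₀ : ℂ} (hz : Tendsto zs atTop (𝓝 z₀))
    {e : ℂ} (he : ‖e‖ = 1) {p : ℂ → Prop} (hp : ∀ᶠ z in 𝓝 z₀, p z) :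
    ∃ η > 0, ∀ᶠ m in atTop, ∀ ρ : ℝ, |ρ| ≤ η → p (zs m + ρ * e) := by
  obtain ⟨δ, hδ, hb⟩ := Metric.eventually_nhds_iff_ball.1 hp
  refine ⟨δ / 2, by positivity, ?_⟩
  filter_upwards [hz.eventually (Metric.ball_mem_nhds z₀ (half_pos hδ))] with m h4 ρ hρ
  have h4 : ‖zs m - z₀‖ < δ / 2 := by simpa [dist_eq_norm] using h4
  refine hb _ ?_
  rw [mem_ball_iff_norm]
  have e1 : zs m + ρ * e - z₀ = (zs m - z₀) + ρ * e := by ring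
  rw [e1]
  refine (norm_add_le _ _).trans_lt ?_
  rw [norm_mul, he, mul_one, Complex.norm_real, Real.norm_eq_abs]
  linarith

/-- The increment of the inner primitive between the contact point and the real interval between
the poles is small. -/
def InnerSmall (a : ℕ → ℤ) (p q : ℤ) (zs : ℕ → ℂ) : Prop :=
  ∀ ε > 0, ∀ᶠ m in atTop, ∀ (L : Laurent (P.X m) (P.Y m) (a m + q)) (Φ : ℂ → ℂ),
    IsPrim L (a m + p) Φ → |(Φ (zs m)).im - (Φ (crossing (P.X m))).im| ≤ ε

/-- The inner integrand is real on the real interval between `r` and the crossing. If that interval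
may contain `0`, the exponent of `z` in the prefactor has to be nonnegative, which is the
alternative on `p`. -/
theorem im_prim_eq_crossing {m : ℕ} {p q : ℤ} {L : Laurent (P.X m) (P.Y m) q} {Φ : ℂ → ℂ}
    (hΦ : IsPrim L p Φ) {r : ℝ} (hr : In0 A B r) (h : 0 < r ∨ p + 1 ≤ P.k m) :
    (Φ r).im = (Φ (crossing (P.X m))).im := by
  refine im_primitive_eq hΦ (fun x _ => L.im_hin_real _ x) fun x hx => ?_
  have hc := Laurent.crossing_pos (P.X0 m)
  have hX : ∀ i, P.X m i * x < 1 := by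
    intro i
    refine (mul_le_mul_of_nonneg_left hx.2 (P.X0 m i)).trans_lt ?_
    rcases max_choice r (crossing (P.X m)) with h | h <;> rw [h]
    · exact hr.1 _ (P.hX m i)
    · exact Laurent.mul_crossing_lt (P.X0 m) i
  rcases h with h | h
  · have hx0 : 0 < x := (lt_min h hc).trans_le hx.1
    exact ⟨Laurent.away_of_pos (P.Y0 m) hx0 hX, Or.inl hx0.ne'⟩
  · refine ⟨⟨?_, ?_⟩, Or.inr h⟩
    · rintro _ ⟨i, rfl⟩ h0
      have : 1 - P.X m i * x = 0 := by exact_mod_cast h0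
      linarith [hX i]
    · rintro _ ⟨j, rfl⟩ h0
      have h1 : x + P.Y m j = 0 := by exact_mod_cast h0
      have h2 := hr.2 _ (P.hY m j)
      have h3 := P.Y0 m j
      have h4 := hx.1
      have h5 : 0 < min r (crossing (P.X m)) + P.Y m j := by
        rcases min_choice r (crossing (P.X m)) with h | h <;> rw [h] <;> linarith
      linarith

end Approx

end

end DualSchur

namespace DualSchur

noncomputable section

namespace Approx

variable {A B : Set ℝ} {W : Weights A B} (P : Approx W) {zp vm : ℝ}

/-! ### Contact points near `zp` -/

/-- The contact points approach the real interval between the poles, so a single segment down to the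
axis suffices, and its length tends to `0`. A real contact point gives a segment of length zero, so
no inequality for `T` is asked of it. -/
theorem innerSmall_of_tendsto_zp (h : Crit W zp vm) (hzp : zp ≠ 0) {a : ℕ → ℤ} {p q : ℤ}
    {zs : ℕ → ℂ} (hz : Tendsto zs atTop (𝓝 (zp : ℂ)))
    (hcon : ∀ᶠ m in atTop, 0 ≤ (zs m).im ∧ (P.V m).D (zs m) = 0 ∧
      ((zs m).im = 0 ∨ (a m : ℝ) ≤ ((P.V m).T (zs m)).re))
    (hk : 0 < zp ∨ ∀ᶠ m in atTop, a m + p + 1 ≤ P.k m) : P.InnerSmall a p q zs := by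
  have hzc : (zp : ℂ) ≠ 0 := by exact_mod_cast hzp
  obtain ⟨κ, hκ, e0⟩ := Weights.Q_real_pos h.nt h.hp h.hp
  set g : ℝ := zp / |zp| with hg
  have har : 0 < |zp| := abs_pos.2 hzp
  have hg2 : g * g = 1 := by
    rw [hg, div_mul_div_comm, abs_mul_abs_self, div_self (mul_ne_zero hzp hzp)]
  have hgr : zp * g = |zp| := by
    rw [hg, mul_div_assoc', ← abs_mul_abs_self, mul_div_assoc, div_self har.ne', mul_one]
  have h3 : √3 * √3 = 3 := Real.mul_self_sqrt (by norm_num)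
  have hs3 : 1 < √3 := by nlinarith [Real.sqrt_nonneg 3]
  -- This direction points inwards and down at 30 degrees to the axis. The cube `e³` is purely
  -- imaginary, so the term quadratic in `ρ` drops out and only `-√3 g y` remains.
  set e : ℂ := ⟨-(g * √3) / 2, -1 / 2⟩ with he
  have hnorm : ‖e‖ = 1 := by
    have : ‖e‖ ^ 2 = 1 := by
      rw [← Complex.normSq_eq_norm_sq, Complex.normSq_apply, he]
      simp only
      linear_combination (√3 * √3 / 4) * hg2 + h3 / 4
    nlinarith [norm_nonneg e]
  have hre : ∀ y ρ : ℝ, (e ^ 2 * (2 * Complex.I * y + ρ * e)).re = -g * √3 * y := by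
    intro y ρ
    simp only [pow_two, Complex.mul_re, Complex.mul_im, Complex.add_re, Complex.add_im,
      Complex.I_re, Complex.I_im, Complex.ofReal_re, Complex.ofReal_im, Complex.re_ofNat,
      Complex.im_ofNat, he]
    linear_combination (-ρ * g * √3 * (√3 * √3) / 8) * hg2 + (-ρ * g * √3 / 8) * h3
  have hin : (zp : ℂ).re * e.re + (zp : ℂ).im * e.im < 0 := by
    rw [Complex.ofReal_re, Complex.ofReal_im, zero_mul, add_zero, he]
    simp only
    nlinarith
  have hezero : ∀ᶠ z in 𝓝 (zp : ℂ), z ≠ 0 ∧ (e / z).re ≤ 0 ∧ Away A B z ∧ In0 A B z.re ∧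
      (0 < zp → 0 < z.re) := by
    have c1 : ContinuousAt (fun z : ℂ => (e / z).re) (zp : ℂ) :=
      Complex.continuous_re.continuousAt.comp (ContinuousAt.div (by fun_prop) (by fun_prop) hzc)
    have v1 : (e / (zp : ℂ)).re < 0 := by
      rw [re_div_eq]
      exact div_neg_of_neg_of_pos hin (Complex.normSq_pos.2 hzc)
    have hcoe : ContinuousAt (fun z : ℂ => z.re) (zp : ℂ) := by fun_prop
    have c2 : ∀ᶠ z in 𝓝 (zp : ℂ), In0 A B z.re :=
      hcoe.eventually (p := fun r => In0 A B r) (by simpa using W.eventually_In0 h.hp)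
    have c3 : ∀ᶠ z in 𝓝 (zp : ℂ), 0 < zp → 0 < z.re := by
      by_cases hp : 0 < zp
      · filter_upwards [hcoe.eventually_const_lt (show (0 : ℝ) < (zp : ℂ).re by simpa using hp)]
          with z hz _ using hz
      · exact Eventually.of_forall fun z h => absurd h hp
    filter_upwards [isOpen_ne.mem_nhds hzc, c1.eventually_lt_const v1,
      W.isOpen_away.mem_nhds h.hp.away, c2, c3] with z h1 h2 h3 h4 h5
    exact ⟨h1, h2.le, h3, h4, h5⟩
  obtain ⟨η1, hη1, hQ⟩ := P.eventually_Q_div hz h.hp.away hzc hnorm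
    (show 0 < κ / |zp| / 4 by positivity)
  obtain ⟨η2, hη2, hE⟩ := eventually_segment hz hnorm hezero
  obtain ⟨C, η3, hη3, hS⟩ := P.exists_segment_bound a p q hz h.hp.away hzc
    (hcon.mono fun m hm => hm.2.1) hnorm hin
  intro ε hε
  have him0 : Tendsto (fun m => (zs m).im) atTop (𝓝 0) := by
    have := (Complex.continuous_im.tendsto (zp : ℂ)).comp hz
    rwa [Complex.ofReal_im] at this
  have hsq : Tendsto (fun m => C * √(2 * (zs m).im)) atTop (𝓝 0) := by
    have : Continuous fun x : ℝ => C * √(2 * x) := by fun_prop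
    have := (this.tendsto 0).comp him0
    rwa [mul_zero, Real.sqrt_zero, mul_zero] at this
  have hη : 0 < min η1 (min η2 η3) := lt_min hη1 (lt_min hη2 hη3)
  have hk' : ∀ᶠ m in atTop, 0 < zp ∨ a m + p + 1 ≤ P.k m := by
    rcases hk with hk | hk
    · exact Eventually.of_forall fun m => Or.inl hk
    · exact hk.mono fun m hm => Or.inr hm
  filter_upwards [hcon, hQ, hE, hS, hk', hsq.eventually_lt_const hε,
    him0.eventually_lt_const (half_pos hη), eventually_gt_atTop 0]
    with m ⟨hi, hD, hT⟩ hQm hEm hSm hkm hC hil hm0 L Φ hΦ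
  -- Since `Im e = -1/2`, this length ends exactly on the real axis. With `ρ ≤ 2y` the error is at
  -- most `4y` times the tolerance `κ/(4|zp|)`, below the gain `√3 y κ/|zp|`.
  set l := 2 * (zs m).im with hl
  have hlη : l ≤ min η1 (min η2 η3) := by linarith
  have hl0 : 0 ≤ l := by positivity
  have ime : ∀ ρ : ℝ, (zs m + (ρ : ℝ) * e).im = (zs m).im - ρ / 2 := by
    intro ρ; simp [he]; ring
  have hbd : ∀ ρ ∈ Icc 0 l, |ρ| ≤ η1 ∧ |ρ| ≤ η2 := by
    intro ρ hρ
    rw [abs_of_nonneg hρ.1]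
    exact ⟨hρ.2.trans (hlη.trans (min_le_left _ _)),
      hρ.2.trans (hlη.trans ((min_le_right _ _).trans (min_le_left _ _)))⟩
  have hres := hSm l ⟨hl0, hlη.trans ((min_le_right _ _).trans (min_le_right _ _))⟩
    (fun ρ hρ => by rw [ime]; linarith [hρ.2]) (fun ρ hρ => by
      have hρ' := hbd ρ ⟨hρ.1.le, hρ.2.le⟩
      have hi0 : (zs m).im ≠ 0 := by
        intro h0
        rw [hl, h0] at hρ
        linarith [hρ.1, hρ.2]
      have hy : 0 < (zs m).im := lt_of_le_of_ne hi hi0.symm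
      obtain ⟨z0, z1, z2, -⟩ := hEm ρ hρ'.2
      have hc := hQm ρ hρ'.1
      refine (Weights.re_dir_neg (P.V m) z2 (by simpa using (hEm 0 (by simpa using hη2.le)).2.2.1) z0
        rfl hD (hT.resolve_left hi0) z1 hρ.1 (l := (m : ℝ)⁻¹) (by positivity) ?_).le
      set c := ((m : ℝ)⁻¹ : ℂ) * (P.V m).Q (zs m + ρ * e) (zs m) / (zs m + ρ * e) with hcdef
      have hc0 : W.Q zp zp / zp = ((κ / |zp| * g : ℝ) : ℂ) := by
        rw [e0, hg]
        rcases abs_cases zp with ⟨h1, -⟩ | ⟨h1, -⟩ <;> rw [h1] <;> push_cast <;> field_simp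
      have hdec : e ^ 2 * (2 * Complex.I * (zs m).im + ρ * e) * c =
          ((κ / |zp| * g : ℝ) : ℂ) * (e ^ 2 * (2 * Complex.I * (zs m).im + ρ * e)) +
          e ^ 2 * (2 * Complex.I * (zs m).im + ρ * e) * (c - W.Q zp zp / zp) := by
        rw [hc0]; ring
      rw [Complex.ofReal_inv, ← hcdef, hdec, Complex.add_re, Complex.re_ofReal_mul, hre]
      have hb1 : ‖e ^ 2 * (2 * Complex.I * (zs m).im + ρ * e)‖ ≤ 4 * (zs m).im := by
        rw [norm_mul, norm_pow, hnorm, one_pow, one_mul]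
        refine (norm_add_le _ _).trans ?_
        rw [norm_mul, norm_mul, norm_mul, hnorm, Complex.norm_I, Complex.norm_real,
          Complex.norm_real, Real.norm_of_nonneg hi, Real.norm_of_nonneg hρ.1.le,
          Complex.norm_ofNat]
        linarith [hρ.2]
      have hb2 : (e ^ 2 * (2 * Complex.I * (zs m).im + ρ * e) * (c - W.Q zp zp / zp)).re ≤
          (4 * (zs m).im) * (κ / |zp| / 4) := by
        refine (Complex.re_le_norm _).trans ?_
        rw [norm_mul]
        exact mul_le_mul hb1 hc.le (norm_nonneg _) (by positivity)
      have hkk : 0 < κ / |zp| := by positivity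
      have e5 : κ / |zp| * g * (-g * √3 * (zs m).im) = -(κ / |zp|) * (√3 * (zs m).im) := by
        linear_combination (-(κ / |zp|) * (√3 * (zs m).im)) * hg2
      rw [e5]
      have h6 : (zs m).im < √3 * (zs m).im := by nlinarith
      nlinarith [mul_lt_mul_of_pos_left h6 hkk])
  obtain ⟨-, hres⟩ := hres
  have hfin := hres L Φ hΦ
  obtain ⟨-, -, -, hI, hpos⟩ := hEm l (hbd l ⟨hl0, le_rfl⟩).2
  set w := zs m + (l : ℝ) * e with hw
  have hwr : w = (w.re : ℂ) := by
    apply Complex.ext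
    · simp
    · rw [hw, ime, hl, Complex.ofReal_im]; ring
  have h1 := P.im_prim_eq_crossing hΦ hI (hkm.imp hpos id)
  rw [← hwr] at h1
  rw [← h1, abs_sub_comm, ← Complex.sub_im]
  exact (Complex.abs_im_le_norm _).trans (hfin.trans hC.le)

/-! ### Other contact points -/

-- On a compact subset of the region below the level of `z₀` the scaled potentials differ by a fixed
-- `κ`, uniformly for large `m`. Unscaled, the bound of `norm_hin_le` decays like `exp (-κ m)`.
set_option maxHeartbeats 1000000 in
theorem eventually_small_on_compact {zs : ℕ → ℂ} {z₀ : ℂ} (hz : Tendsto zs atTop (𝓝 z₀))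
    (haz : Away A B z₀) (h0 : z₀ ≠ 0) {a : ℕ → ℤ} {t : ℝ}
    (ha : Tendsto (fun m => (a m : ℝ) / m) atTop (𝓝 t))
    (hcon : ∀ᶠ m in atTop, (P.V m).D (zs m) = 0) (p q : ℤ) {K : Set ℂ}
    (hK : IsCompact K) (hKL : K ⊆ Low W t z₀) {ε : ℝ} (hε : 0 < ε) :
    ∀ᶠ m in atTop, ∀ z ∈ K, ∀ L : Laurent (P.X m) (P.Y m) (a m + q), ‖L.hin (a m + p) z‖ ≤ ε := by
  have haK : ∀ z ∈ K, Away A B z ∧ z ≠ 0 := by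
    intro z hz
    rcases (hKL hz).1 with h1 | h1
    · exact ⟨away_of_im_pos h1, ne_zero_of_im_pos h1⟩
    · exact ⟨Weights.away_of_In0_re h1.1, by rintro rfl; exact h1.2 rfl⟩
  have hUK : ContinuousOn (W.U t) K := (Weights.continuousOn_U t).mono haK
  obtain ⟨κ, hκ, hU⟩ : ∃ κ > 0, ∀ z ∈ K, W.U t z < W.U t z₀ - 2 * κ := by
    rcases K.eq_empty_or_nonempty with rfl | hne
    · exact ⟨1, one_pos, by simp⟩
    · obtain ⟨w, hw, hmax⟩ := hK.exists_isMaxOn hne hUK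
      have hlt := (hKL hw).2.2
      refine ⟨(W.U t z₀ - W.U t w) / 4, by linarith, fun z hz => ?_⟩
      have : W.U t z ≤ W.U t w := hmax hz
      linarith
  set G : ℂ × ℂ → ℝ := fun w => ‖w.1‖ ^ (-p - 1) * ‖w.2‖ ^ (q + 1) /
    √(‖w.2‖ ^ 2 - ‖w.1‖ ^ 2) with hG
  have hGc : ∀ z ∈ K, ContinuousAt G (z, z₀) := by
    intro z hzK
    have n1 := norm_ne_zero_iff.2 (haK z hzK).2
    have n2 := norm_ne_zero_iff.2 h0
    refine ContinuousAt.div (ContinuousAt.mul (ContinuousAt.zpow₀ (by fun_prop) _ (Or.inl n1))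
        (ContinuousAt.zpow₀ (by fun_prop) _ (Or.inl n2))) (by fun_prop) ?_
    have hlt := (hKL hzK).2.1
    refine (Real.sqrt_pos.2 ?_).ne'
    simp only
    nlinarith [norm_nonneg z]
  obtain ⟨M, hM⟩ : ∃ M, ∀ z ∈ K, G (z, z₀) < M := by
    have hc : ContinuousOn (fun z => G (z, z₀)) K := fun z hz =>
      (ContinuousAt.comp (g := G) (f := fun z => (z, z₀)) (hGc z hz)
        (by fun_prop)).continuousWithinAt
    obtain ⟨M, hM⟩ := (hK.image_of_continuousOn hc).bddAbove
    exact ⟨M + 1, fun z hz => (hM ⟨z, hz, rfl⟩).trans_lt (lt_add_one M)⟩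
  have hs : Tendsto (fun m : ℕ => (m : ℝ)⁻¹ * (P.V m).U (a m) (zs m)) atTop (𝓝 (W.U t z₀)) :=
    (P.tendsto_U ha haz h0).comp (tendsto_id.prodMk hz)
  have hev : ∀ᶠ m : ℕ in atTop, ∀ z ∈ K, (m : ℝ)⁻¹ * (P.V m).U (a m) z < W.U t z₀ - 2 * κ ∧
      G (z, zs m) < M ∧ ‖z‖ < ‖zs m‖ := by
    refine eventually_forall_compact hK fun z hzK => ?_
    have t1 := (P.tendsto_U ha (haK z hzK).1 (haK z hzK).2).eventually_lt_const (hU z hzK)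
    have hpair : Tendsto (fun w : ℕ × ℂ => (w.2, zs w.1)) (atTop ×ˢ 𝓝 z) (𝓝 (z, z₀)) :=
      tendsto_snd.prodMk_nhds (hz.comp tendsto_fst)
    have t2 := ((hGc z hzK).tendsto.comp hpair).eventually_lt_const (hM z hzK)
    have hcn : ContinuousAt (fun w : ℂ × ℂ => ‖w.2‖ - ‖w.1‖) (z, z₀) := by fun_prop
    have t3 := (hcn.tendsto.comp hpair).eventually_const_lt
      (show 0 < ‖z₀‖ - ‖z‖ from sub_pos.2 (hKL hzK).2.1)
    filter_upwards [t1, t2, t3] with w h1 h2 h3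
    exact ⟨h1, h2, by simpa using h3⟩
  have hexp : Tendsto (fun m : ℕ => Real.exp (-(κ * m)) * M) atTop (𝓝 0) := by
    have : Tendsto (fun m : ℕ => -(κ * (m : ℝ))) atTop atBot :=
      tendsto_neg_atTop_atBot.comp (tendsto_natCast_atTop_atTop.const_mul_atTop hκ)
    simpa using (Real.tendsto_exp_atBot.comp this).mul_const M
  have haws : ∀ᶠ m in atTop, Away A B (zs m) ∧ zs m ≠ 0 :=
    (hz.eventually (W.isOpen_away.mem_nhds haz)).and (hz.eventually (isOpen_ne.mem_nhds h0))
  filter_upwards [hev, hcon, hs.eventually_const_lt (show W.U t z₀ - κ < W.U t z₀ by linarith), haws,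
    hexp.eventually_lt_const hε, eventually_gt_atTop 0] with m h1 hD h2 h3 h4 hm0 z hzK L
  obtain ⟨u1, u2, u3⟩ := h1 z hzK
  have hb := Laurent.norm_hin_le (P.X0 m) (P.Y0 m) L (p := p) (P.away_range m h3.1) h3.2 hD
    (P.away_range m (haK z hzK).1) (haK z hzK).2 u3
  refine hb.trans (le_trans ?_ h4.le)
  have hm : (0 : ℝ) < m := by exact_mod_cast hm0
  have hle : (P.V m).U (a m) z - (P.V m).U (a m) (zs m) ≤ -(κ * m) := by
    have h5 : (m : ℝ)⁻¹ * (P.V m).U (a m) z < (m : ℝ)⁻¹ * (P.V m).U (a m) (zs m) - κ := by linarith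
    have h6 := mul_lt_mul_of_pos_left h5 hm
    rw [mul_sub, ← mul_assoc, ← mul_assoc, mul_inv_cancel₀ hm.ne', one_mul, one_mul] at h6
    linarith
  exact mul_le_mul (Real.exp_le_exp.2 hle) u2.le (by positivity) (Real.exp_pos _).le

/-- The path consists of a segment of fixed small length from the moving contact point, a short step
to the fixed endpoint of the limiting segment, and a fixed chain to a real point between the poles.
The first contributes `C√η`, the other two decay. -/
theorem innerSmall_of_contact (h : Crit W zp vm) {a : ℕ → ℤ} {t : ℝ}
    (ha : Tendsto (fun m => (a m : ℝ) / m) atTop (𝓝 t)) (ht : t < (W.T zp).re) {p q : ℤ}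
    {zs : ℕ → ℂ} {z₀ : ℂ} (hz : Tendsto zs atTop (𝓝 z₀)) (hs : Contact W zp vm t z₀)
    (hcon : ∀ᶠ m in atTop, 0 ≤ (zs m).im ∧ (P.V m).D (zs m) = 0 ∧
      (a m : ℝ) ≤ ((P.V m).T (zs m)).re)
    (hk : ∀ᶠ m in atTop, a m + p + 1 ≤ P.k m) : P.InnerSmall a p q zs := by
  obtain ⟨e, he⟩ : ∃ e, Dir z₀ (W.Q z₀ z₀ / z₀) e := by
    rcases hs.im.lt_or_eq with h1 | h1
    · exact h.exists_dir_of_im_pos h1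
    · have e : z₀ = (z₀.re : ℂ) := Complex.ext (by simp) (by simp [← h1])
      have hr : z₀.re ≠ 0 := fun h2 => hs.ne (by rw [e, h2]; simp)
      have haw : Away A B (z₀.re : ℂ) := e ▸ hs.aw
      have hD : W.D (z₀.re : ℂ) = 0 := e ▸ hs.D
      rcases h.away_of_real haw with h2 | h2
      · exfalso
        have := Weights.D_sign_of_In0 h.nt h2 h.hp h.Dp (by
          rintro h3
          have := hs.lo
          rw [e, h3, Complex.norm_real, Real.norm_eq_abs] at this
          exact lt_irrefl _ this)
        rw [hD, mul_zero] at this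
        exact lt_irrefl _ this
      · have := h.exists_dir_of_real hr haw h2.2 hD
        rwa [← e] at this
  obtain ⟨ε₁, hε₁, hneg⟩ := he.neg
  have hden : (e / z₀).re < 0 := by
    rw [re_div_eq]
    exact div_neg_of_neg_of_pos he.inward (Complex.normSq_pos.2 hs.ne)
  have hnear : ∀ᶠ z in 𝓝 z₀, z ≠ 0 ∧ (e / z).re ≤ 0 ∧ Away A B z ∧ |zp| < ‖z‖ := by
    have c1 : ContinuousAt (fun z : ℂ => (e / z).re) z₀ :=
      Complex.continuous_re.continuousAt.comp (ContinuousAt.div (by fun_prop) (by fun_prop) hs.ne)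
    have c2 : ContinuousAt (fun z : ℂ => ‖z‖) z₀ := by fun_prop
    filter_upwards [isOpen_ne.mem_nhds hs.ne, c1.eventually_lt_const hden,
      W.isOpen_away.mem_nhds hs.aw, c2.eventually_const_lt hs.lo] with z h1 h2 h3 h4
    exact ⟨h1, h2.le, h3, h4⟩
  obtain ⟨η1, hη1, hQ⟩ := P.eventually_Q_div hz hs.aw hs.ne he.norm hε₁
  obtain ⟨η2, hη2, hE⟩ := eventually_segment hz he.norm hnear
  obtain ⟨C, η3, hη3, hS⟩ := P.exists_segment_bound a p q hz hs.aw hs.ne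
    (hcon.mono fun m hm => hm.2.1) he.norm he.inward
  -- the limiting segment
  obtain ⟨η4, hη4, hE0⟩ : ∃ η > 0, ∀ ρ : ℝ, |ρ| ≤ η → (z₀ + ρ * e ≠ 0 ∧ (e / (z₀ + ρ * e)).re ≤ 0 ∧
      Away A B (z₀ + ρ * e) ∧ |zp| < ‖z₀ + ρ * e‖) ∧
      ‖W.Q (z₀ + ρ * e) z₀ / (z₀ + ρ * e) - W.Q z₀ z₀ / z₀‖ < ε₁ := by
    have c1 : ContinuousAt (fun z => W.Q z z₀ / z) z₀ := by
      refine ContinuousAt.div ?_ continuousAt_id hs.ne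
      exact ContinuousAt.comp (g := fun p : ℂ × ℂ => W.Q p.1 p.2) (f := fun z : ℂ => (z, z₀))
        (Weights.continuousAt_Q hs.aw hs.aw) (by fun_prop)
    have h2 := hnear.and (c1.eventually (Metric.ball_mem_nhds _ hε₁))
    have h3 : ContinuousAt (fun ρ : ℝ => z₀ + ρ * e) 0 := by fun_prop
    have h4 : Tendsto (fun ρ : ℝ => z₀ + ρ * e) (𝓝 0) (𝓝 z₀) := by simpa using h3.tendsto
    obtain ⟨δ, hδ, hb⟩ := Metric.eventually_nhds_iff.1 (h4.eventually h2)
    refine ⟨δ / 2, by positivity, fun ρ hρ => ?_⟩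
    have := hb (y := ρ) (by rw [Real.dist_0_eq_abs]; linarith)
    exact ⟨this.1, by simpa [dist_eq_norm] using this.2⟩
  obtain ⟨η5, hη5, hI0⟩ : ∃ η > 0, ∀ ρ : ℝ, 0 < ρ → ρ ≤ η → 0 < (z₀ + ρ * e).im := by
    rcases he.im with h1 | h1
    · have h3 : ContinuousAt (fun ρ : ℝ => (z₀ + ρ * e).im) 0 := by fun_prop
      obtain ⟨δ, hδ, hb⟩ := Metric.eventually_nhds_iff.1
        (h3.eventually_const_lt (show (0 : ℝ) < (z₀ + ((0 : ℝ) : ℂ) * e).im by simpa using h1))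
      refine ⟨δ / 2, by positivity, fun ρ h4 h5 => hb ?_⟩
      rw [Real.dist_0_eq_abs, abs_of_pos h4]; linarith
    · refine ⟨1, one_pos, fun ρ h2 _ => ?_⟩
      have := hs.im
      simp
      nlinarith [mul_pos h2 h1]
  obtain ⟨η6, hη6, hI⟩ : ∃ η > 0, ∀ᶠ m in atTop, ∀ ρ : ℝ, 0 ≤ ρ → ρ ≤ η →
      0 ≤ (zs m + ρ * e).im := by
    rcases he.im with h1 | h1
    · obtain ⟨η, hη, hb⟩ := eventually_segment hz he.norm (p := fun z => 0 < z.im)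
        (Complex.continuous_im.continuousAt.eventually_const_lt h1)
      refine ⟨η, hη, hb.mono fun m hm ρ h2 h3 => (hm ρ (by rwa [abs_of_nonneg h2])).le⟩
    · refine ⟨1, one_pos, hcon.mono fun m hm ρ h2 _ => ?_⟩
      have := hm.1
      simp
      nlinarith [mul_nonneg h2 h1.le]
  intro ε hε
  set ι : ℝ := -(z₀.re * e.re + z₀.im * e.im) with hι
  have hι0 : 0 < ι := neg_pos.2 he.inward
  -- The length is chosen from `ε` before `m` grows; afterwards the remaining compact set is fixed.
  obtain ⟨η, hη, hηle, hCη⟩ : ∃ η > 0, η < min ι (min ε₁ (min η1 (min η2 (min η3 (min η4 (min η5 η6)))))) ∧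
      C * √η < ε / 3 := by
    have h1 : ContinuousAt (fun η : ℝ => C * √η) 0 := by fun_prop
    have h2 : ∀ᶠ η in 𝓝 (0 : ℝ), C * √η < ε / 3 :=
      h1.eventually_lt_const (by simp only [Real.sqrt_zero, mul_zero]; positivity)
    have h3 : 0 < min ι (min ε₁ (min η1 (min η2 (min η3 (min η4 (min η5 η6)))))) := by positivity
    obtain ⟨η, h4, h5⟩ := ((h2.filter_mono nhdsWithin_le_nhds).and (Ioo_mem_nhdsGT h3)).exists
    exact ⟨η, h5.1, h5.2, h4⟩
  simp only [lt_min_iff] at hηle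
  obtain ⟨b7, b0, b1, b2, b3, b4, b5, b6⟩ := hηle
  set e₁ : ℂ := z₀ + η * e with he₁
  have hab : ∀ ρ ∈ Icc 0 η, |ρ| ≤ η := fun ρ hρ => by rw [abs_of_nonneg hρ.1]; exact hρ.2
  have hU1 : W.U t e₁ < W.U t z₀ := by
    refine Weights.U_lt_along hη (fun ρ hρ => ?_) fun ρ hρ => ?_
    · have := hE0 ρ ((hab ρ hρ).trans b4.le)
      exact ⟨this.1.2.2.1, this.1.1⟩
    · obtain ⟨⟨a1, a2, a3, -⟩, a4⟩ := hE0 ρ ((hab ρ ⟨hρ.1.le, hρ.2.le⟩).trans b4.le)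
      refine Weights.re_dir_neg W a3 hs.aw a1 rfl hs.D hs.T a2 hρ.1 one_pos ?_
      rw [Complex.ofReal_one, one_mul]
      exact hneg _ _ _ hs.im (by simpa using hε₁) hρ.1 (hρ.2.trans b0) a4
  have hn1 : ‖e₁‖ < ‖z₀‖ := by
    have h1 := normSq_segment z₀ e η he.norm
    have h2 : 0 < η * (-(2 * (z₀.re * e.re + z₀.im * e.im)) - η) := mul_pos hη (by linarith)
    exact lt_of_pow_lt_pow_left₀ 2 (norm_nonneg _) (by linarith)
  have hlow : |zp| < ‖e₁‖ := (hE0 η (by rw [abs_of_pos hη]; exact b4.le)).1.2.2.2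
  have hi1 : 0 < e₁.im := hI0 η hη b5.le
  obtain ⟨S, hSp, hSL, heS, a₀, ha₀, ha₀0, ha₀S⟩ := h.exists_preconnected ht hs hi1 hlow hn1 hU1
  obtain ⟨K, hKL, hK, C', hchain⟩ := exists_compact_chain (Crit.isOpen_low W t z₀) hSp hSL heS ha₀S
  obtain ⟨δ, hδ, hδb⟩ := Metric.nhds_basis_closedBall.mem_iff.1
    ((Crit.isOpen_low W t z₀).mem_nhds (hSL heS))
  set K' := K ∪ Metric.closedBall e₁ δ with hK'
  have hK'c : IsCompact K' := hK.union (isCompact_closedBall _ _)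
  have hK'L : K' ⊆ Low W t z₀ := union_subset hKL hδb
  have hsmall := P.eventually_small_on_compact hz hs.aw hs.ne ha (hcon.mono fun m hm => hm.2.1)
    p q hK'c hK'L (show 0 < ε / 3 / (|C'| + δ + 1) by positivity)
  have hte : ∀ᶠ m in atTop, zs m + η * e ∈ Metric.closedBall e₁ δ :=
    (hz.add_const (η * e)).eventually (Metric.closedBall_mem_nhds _ hδ)
  have hyconv : ∀ᶠ m in atTop, |(zs m).im - z₀.im| < ε₁ := by
    have := ((Complex.continuous_im.tendsto z₀).comp hz).eventually (Metric.ball_mem_nhds _ hε₁)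
    filter_upwards [this] with m hm
    simpa [Real.dist_eq] using hm
  filter_upwards [hcon, hk, hQ, hE, hS, hI, hsmall, hte, hyconv, eventually_gt_atTop 0]
    with m ⟨hi, hD, hT⟩ hkm hQm hEm hSm hIm hsm htm hym hm0 L Φ hΦ
  have hseg := hSm η ⟨hη.le, b3.le⟩ (fun ρ hρ => hIm ρ hρ.1 (hρ.2.trans b6.le)) (fun ρ hρ => by
    have hρ' := hab ρ ⟨hρ.1.le, hρ.2.le⟩
    obtain ⟨z0, z1, z2, -⟩ := hEm ρ (hρ'.trans b2.le)
    have hc := hQm ρ (hρ'.trans b1.le)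
    refine (Weights.re_dir_neg (P.V m) z2 (by simpa using (hEm 0 (by simpa using hη2.le)).2.2.1) z0
      rfl hD hT z1 hρ.1 (l := (m : ℝ)⁻¹) (by positivity) ?_).le
    rw [Complex.ofReal_inv]
    exact hneg _ _ _ hi hym hρ.1 (hρ.2.trans b0) hc)
  have s1 := hseg.2 L Φ hΦ
  have hder : ∀ z ∈ K', HasDerivAt Φ (L.hin (a m + p) z) z := by
    intro z hzK
    refine hΦ z ?_
    rcases (hK'L hzK).1 with h1 | h1
    · exact Or.inl h1
    · exact Or.inr ⟨P.away_range m h1.1.away, Or.inl h1.2⟩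
  set M := ε / 3 / (|C'| + δ + 1) with hM
  have s2 := hchain Φ _ M (fun z hz => hder z (Or.inl hz)) fun z hz => hsm z (Or.inl hz) L
  have s3 : ‖Φ (zs m + η * e) - Φ e₁‖ ≤ M * δ := by
    have := (convex_closedBall e₁ δ).norm_image_sub_le_of_norm_hasDerivWithin_le
      (fun z hz => (hder z (Or.inr hz)).hasDerivWithinAt) (fun z hz => hsm z (Or.inr hz) L)
      (Metric.mem_closedBall_self hδ.le) htm
    refine this.trans (mul_le_mul_of_nonneg_left (by simpa [dist_eq_norm] using htm) (by positivity))
  have hM0 : 0 < M := by positivity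
  have s4 : C' * M + M * δ ≤ ε / 3 := by
    have h1 : M * (|C'| + δ + 1) = ε / 3 := div_mul_cancel₀ _ (by positivity)
    have h2 := le_abs_self C'
    nlinarith
  have s5 := P.im_prim_eq_crossing hΦ ha₀ (Or.inr hkm)
  have e5 : Φ (zs m) - Φ a₀ = -(Φ (zs m + η * e) - Φ (zs m)) + (Φ (zs m + η * e) - Φ e₁)
      + -(Φ a₀ - Φ e₁) := by ring
  rw [← s5, ← Complex.sub_im, e5]
  refine (Complex.abs_im_le_norm _).trans ?_
  refine (norm_add₃_le).trans ?_
  rw [norm_neg, norm_neg]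
  linarith

end Approx

end

end DualSchur

/-! ### Finite contact points and convergence of the kernel -/

namespace DualSchur

noncomputable section

/-- Choosing at each index a solution that is nearest to `z₀` up to `1/(m+1)` avoids a diagonal
argument. -/
theorem exists_seq_tendsto {p : ℕ → ℂ → Prop} {z₀ : ℂ}
    (h : ∀ ε > 0, ∀ᶠ m in atTop, ∃ z, ‖z - z₀‖ < ε ∧ p m z) :
    ∃ zs : ℕ → ℂ, Tendsto zs atTop (𝓝 z₀) ∧ ∀ᶠ m in atTop, p m (zs m) := by
  have hex : ∀ m : ℕ, ∃ z, (∃ z, p m z) →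
      p m z ∧ dist z₀ z < Metric.infDist z₀ {z | p m z} + 1 / ((m : ℝ) + 1) := by
    intro m
    by_cases hm : ∃ z, p m z
    · have : Metric.infDist z₀ {z | p m z} < Metric.infDist z₀ {z | p m z} + 1 / ((m : ℝ) + 1) :=
        lt_add_of_pos_right _ (by positivity)
      obtain ⟨z, hz, h2⟩ := (Metric.infDist_lt_iff hm).1 this
      exact ⟨z, fun _ => ⟨hz, h2⟩⟩
    · exact ⟨z₀, fun h => absurd h hm⟩
  choose zs hzs using hex
  refine ⟨zs, ?_, ?_⟩
  · rw [Metric.tendsto_nhds]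
    intro ε hε
    filter_upwards [h (ε / 2) (half_pos hε),
      tendsto_one_div_add_atTop_nhds_zero_nat.eventually_lt_const (half_pos hε)] with m ⟨z, h1, h2⟩ h3
    have h4 := (hzs m ⟨z, h2⟩).2
    have h5 : Metric.infDist z₀ {z | p m z} ≤ dist z₀ z := Metric.infDist_le_dist_of_mem h2
    rw [dist_comm z₀ z, dist_eq_norm] at h5
    rw [dist_comm]
    linarith
  · filter_upwards [h 1 one_pos] with m ⟨z, _, h2⟩
    exact (hzs m ⟨z, h2⟩).1

open Laurent

/-- The argument is continuous at negative numbers when approached from the closed upper half plane,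
which is why `Im ≥ 0` is required along the sequence. -/
theorem tendsto_mainTerm (d : ℤ) {zs : ℕ → ℂ} {z₀ : ℂ} (hz : Tendsto zs atTop (𝓝 z₀))
    (h0 : z₀ ≠ 0) (hi : ∀ᶠ m in atTop, 0 ≤ (zs m).im) :
    Tendsto (fun m => mainTerm d (zs m)) atTop (𝓝 (mainTerm d z₀)) := by
  unfold mainTerm
  split_ifs with hd
  · by_cases hs : z₀ ∈ Complex.slitPlane
    · exact (Complex.continuousAt_arg hs).tendsto.comp hz
    · have him : z₀.im = 0 ∧ z₀.re < 0 := by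
        rw [Complex.mem_slitPlane_iff, not_or, not_lt, not_not] at hs
        refine ⟨hs.2, lt_of_le_of_ne hs.1 fun h => h0 (Complex.ext h hs.2)⟩
      have h1 := Complex.continuousWithinAt_arg_of_re_neg_of_im_zero him.2 him.1
      exact h1.tendsto.comp (tendsto_nhdsWithin_iff.2 ⟨hz, hi⟩)
  · have h1 : ContinuousAt (fun z : ℂ => -(z ^ (-d) / d).im) z₀ := by
      have h2 : ContinuousAt (fun z : ℂ => z ^ (-d)) z₀ := continuousAt_zpow₀ _ _ (Or.inl h0)
      exact (Complex.continuous_im.continuousAt.comp (h2.div_const _)).neg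
    exact h1.tendsto.comp hz

/-- In polar coordinates `z^(-d)` is `|z|^(-d)` times a phase of angle `-d arg z`; the conjugating
factor in the limit removes the modulus. -/
theorem norm_zpow_mul_mainTerm (d : ℤ) {z : ℂ} (h0 : z ≠ 0) :
    ‖z‖ ^ d * (mainTerm d z / π) = sineKernel z.arg d := by
  unfold mainTerm sineKernel
  split_ifs with hd
  · rw [hd, zpow_zero, one_mul]
  · have hn : 0 < ‖z‖ := norm_pos_iff.2 h0
    have h1 : z ^ (-d) = ((‖z‖ ^ (-d) : ℝ) : ℂ) * Complex.exp (((-(z.arg * d) : ℝ) : ℂ) * Complex.I) := by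
      conv_lhs => rw [← Complex.norm_mul_exp_arg_mul_I z]
      rw [mul_zpow, ← Complex.exp_int_mul, Complex.ofReal_zpow]
      congr 2
      push_cast; ring
    have h2 : (z ^ (-d) / d).im = -(‖z‖ ^ (-d) * Real.sin (z.arg * d)) / d := by
      have e : z ^ (-d) / d = ((‖z‖ ^ (-d) / d : ℝ) : ℂ) *
          Complex.exp (((-(z.arg * d) : ℝ) : ℂ) * Complex.I) := by
        rw [h1]; push_cast; ring
      rw [e, Complex.im_ofReal_mul, Complex.exp_ofReal_mul_I_im, Real.sin_neg]
      ring
    have hdc : (d : ℝ) ≠ 0 := by exact_mod_cast hd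
    rw [h2, zpow_neg]
    have : ‖z‖ ^ d ≠ 0 := (zpow_pos hn _).ne'
    field_simp

theorem mainTerm_real {r : ℝ} {d : ℤ} (hd : d ≠ 0) : mainTerm d r = 0 := by
  rw [mainTerm, if_neg hd]
  have : ((r : ℂ) ^ (-d) / d) = ((r ^ (-d) / d : ℝ) : ℂ) := by push_cast; rfl
  rw [this, Complex.ofReal_im, neg_zero]

namespace Approx

variable {A B : Set ℝ} {W : Weights A B} (P : Approx W) {zp vm : ℝ}

theorem eventually_nontriv (h : W.Nontriv) : ∀ᶠ m in atTop, (P.V m).Nontriv := by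
  have h1 := (P.cμ (fun x => x) continuousOn_id).add (P.cν (fun x => x) continuousOn_id)
  filter_upwards [h1.eventually_const_lt h] with m hm
  rw [← mul_add] at hm
  by_contra hc
  exact absurd hm (not_lt.2 (mul_nonpos_of_nonneg_of_nonpos (by positivity) (not_lt.1 hc)))

theorem tendsto_D {s : ℂ} (hs : Away A B s) :
    Tendsto (fun m : ℕ => (m : ℝ)⁻¹ * (P.V m).D s) atTop (𝓝 (W.D s)) := by
  have hc := Complex.continuous_normSq
  have h1 := P.cμ (fun x => x / Complex.normSq (1 - x * s))
    (ContinuousOn.div (by fun_prop) (by fun_prop) fun x hx => (hs.normSq_pos_left hx).ne')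
  have h2 := P.cν (fun y => y / Complex.normSq (s + y))
    (ContinuousOn.div (by fun_prop) (by fun_prop) fun x hx => (hs.normSq_pos_right hx).ne')
  refine (h1.sub h2).congr fun m => ?_
  rw [← mul_sub]; rfl

theorem eventually_exists_T_eq {a : ℕ → ℤ} {t : ℝ}
    (ha : Tendsto (fun m => (a m : ℝ) / m) atTop (𝓝 t)) {z₀ : ℂ} (hz : Away A B z₀)
    (h : W.T z₀ = t) (hne : ∀ᶠ z in 𝓝[≠] z₀, W.T z ≠ W.T z₀) {ε : ℝ} (hε : 0 < ε) :
    ∀ᶠ m in atTop, ∃ z, ‖z - z₀‖ < ε ∧ (P.V m).T z = a m := by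
  have := eventually_exists_zero (l := atTop)
    (F := fun (m : ℕ) z => ((m : ℝ)⁻¹ : ℂ) * (P.V m).T z - (((a m : ℝ) / m : ℝ) : ℂ))
    (f := fun z => W.T z - t) W.isOpen_away hz
    (Eventually.of_forall fun m => (Weights.differentiableOn_T.const_mul _).sub_const _)
    (Weights.differentiableOn_T.continuousOn.sub continuousOn_const)
    (fun z hz => (P.tendsto_T hz).sub
      ((Complex.continuous_ofReal.tendsto t).comp (ha.comp tendsto_fst)))
    (sub_eq_zero.2 h) (hne.mono fun z hz => by rw [← h]; exact sub_ne_zero.2 hz) hε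
  filter_upwards [this, eventually_gt_atTop 0] with m ⟨z, h1, h2⟩ hm
  refine ⟨z, h1, ?_⟩
  have hm0 : (m : ℂ) ≠ 0 := by exact_mod_cast hm.ne'
  push_cast at h2
  field_simp at h2
  linear_combination h2

/-- The function `D` changes sign at `zp`, and this sign change persists for the finite weights. The
zero obtained is real, which Hurwitz's argument alone would not give. -/
theorem eventually_exists_crit (h : Crit W zp vm) {ε : ℝ} (hε : 0 < ε) :
    ∀ᶠ m in atTop, ∃ r : ℝ, |r - zp| < ε ∧ In0 A B r ∧ (P.V m).D r = 0 := by
  obtain ⟨δ, hδ, hb⟩ := Metric.eventually_nhds_iff.1 (W.eventually_In0 h.hp)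
  obtain ⟨η, hη, hηm⟩ : ∃ η > 0, η < min δ ε := by
    have : 0 < min δ ε := lt_min hδ hε
    exact ⟨min δ ε / 2, by positivity, by linarith⟩
  rw [lt_min_iff] at hηm
  have hI : ∀ r ∈ Icc (zp - η) (zp + η), In0 A B r := fun r hr => hb (by
    rw [Real.dist_eq, abs_lt]; constructor <;> linarith [hr.1, hr.2])
  have m1 : zp - η ∈ Icc (zp - η) (zp + η) := ⟨le_rfl, by linarith⟩
  have m2 : zp + η ∈ Icc (zp - η) (zp + η) := ⟨by linarith, le_rfl⟩
  have s1 := Weights.D_sign_of_In0 h.nt (hI _ m1) h.hp h.Dp (by linarith)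
  have s2 := Weights.D_sign_of_In0 h.nt (hI _ m2) h.hp h.Dp (by linarith)
  have s1' : W.D ((zp - η : ℝ) : ℂ) < 0 := by nlinarith
  have s2' : 0 < W.D ((zp + η : ℝ) : ℂ) := by nlinarith
  filter_upwards [(P.tendsto_D (hI _ m1).away).eventually_lt_const s1',
    (P.tendsto_D (hI _ m2).away).eventually_const_lt s2', eventually_gt_atTop 0] with m h1 h2 hm
  have hm' : (0 : ℝ) < (m : ℝ)⁻¹ := by positivity
  have hcont : ContinuousOn (fun r : ℝ => (P.V m).D (r : ℂ)) (Icc (zp - η) (zp + η)) :=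
    Weights.continuousOn_D.comp (by fun_prop) fun r hr => (hI r hr).away
  obtain ⟨r, hr, e⟩ := intermediate_value_Icc (by linarith : zp - η ≤ zp + η) hcont
    (show (0 : ℝ) ∈ Icc _ _ from ⟨by nlinarith, by nlinarith⟩)
  exact ⟨r, by rw [abs_lt]; constructor <;> linarith [hr.1, hr.2], hI r hr, e⟩

/-- One wants contact points near `zp` with `T ≤ a` on the outer side. The real critical point of
the finite weights serves whenever its critical value is at most `a`, in particular if `T(zp) < t`.
-/
theorem exists_contact_seq (h : Crit W zp vm) {a : ℕ → ℤ} {t : ℝ}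
    (ha : Tendsto (fun m => (a m : ℝ) / m) atTop (𝓝 t)) (ht : (W.T zp).re ≤ t) :
    ∃ zs : ℕ → ℂ, Tendsto zs atTop (𝓝 (zp : ℂ)) ∧ ∀ᶠ m in atTop, 0 ≤ (zs m).im ∧
      (P.V m).D (zs m) = 0 ∧ ((P.V m).T (zs m)).re ≤ a m ∧
      ((zs m).im = 0 ∨ (a m : ℝ) ≤ ((P.V m).T (zs m)).re) := by
  refine exists_seq_tendsto (p := fun m z => 0 ≤ z.im ∧ (P.V m).D z = 0 ∧
    ((P.V m).T z).re ≤ a m ∧ (z.im = 0 ∨ (a m : ℝ) ≤ ((P.V m).T z).re)) fun ε hε => ?_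
  rcases ht.lt_or_eq with ht | ht
  · obtain ⟨c, hc1, hc2⟩ := exists_between ht
    have h1 := ((Complex.continuous_re.tendsto _).comp (P.tendsto_T h.hp.away)).eventually_lt_const
      hc1
    obtain ⟨p1, hp1, p2, hp2, h3⟩ := eventually_prod_iff.1 h1
    obtain ⟨δ, hδ, hb⟩ := Metric.eventually_nhds_iff.1 hp2
    filter_upwards [P.eventually_exists_crit h (lt_min hε hδ), hp1, ha.eventually_const_lt hc2,
      eventually_gt_atTop 0] with m ⟨r, hr, hI, hD⟩ h4 h5 hm
    rw [lt_min_iff] at hr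
    have hm' : (0 : ℝ) < m := by exact_mod_cast hm
    refine ⟨r, by rw [← Complex.ofReal_sub, Complex.norm_real]; exact hr.1, by simp, hD, ?_,
      Or.inl (by simp)⟩
    have h6 := h3 h4 (hb (y := (r : ℂ)) (by
      rw [dist_eq_norm, ← Complex.ofReal_sub, Complex.norm_real]; exact hr.2))
    simp only [Function.comp_apply] at h6
    rw [← Complex.ofReal_inv, Complex.re_ofReal_mul] at h6
    have h7 := h6.trans h5
    rw [inv_mul_eq_div] at h7
    exact ((div_lt_div_iff_of_pos_right hm').1 h7).le
  · obtain ⟨δ, hδ, hb⟩ := Metric.eventually_nhds_iff.1 (W.eventually_In0 h.hp)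
    have hT := P.eventually_exists_T_eq ha h.hp.away (by rw [h.T_real_eq, ht]) h.eventually_T_ne
      (lt_min hε hδ)
    filter_upwards [P.eventually_exists_crit h hε, hT, P.eventually_nontriv h.nt]
      with m ⟨r, hr, hI, hD⟩ ⟨z, hz, hTz⟩ hnt
    rw [lt_min_iff] at hz
    by_cases hle : ((P.V m).T r).re ≤ a m
    · exact ⟨r, by rw [← Complex.ofReal_sub, Complex.norm_real]; exact hr, by simp, hD, hle,
        Or.inl (by simp)⟩
    -- At the endpoint `t = T(zp)` the finite critical value may exceed `a`. Then `T = a` has a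
    -- solution near `zp` which cannot be real, because real values between the poles are at least
    -- the critical value.
    have hTr : ((P.V m).T z).re = a m := by rw [hTz]; simp
    have hi : z.im ≠ 0 := by
      intro h0
      have e : z = (z.re : ℂ) := Complex.ext (by simp) (by simp [h0])
      have hIz : In0 A B z.re := hb (by
        rw [Real.dist_eq]
        have := Complex.abs_re_le_norm (z - zp)
        rw [Complex.sub_re, Complex.ofReal_re] at this
        exact this.trans_lt hz.2)
      by_cases h1 : z.re = r
      · rw [← h1, ← e] at hle
        exact hle hTr.le
      · have := Weights.T_lt_of_In0 hnt hIz hI hD h1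
        rw [← e] at this
        linarith
    rcases hi.lt_or_gt with hi | hi
    · have hic : 0 < ((starRingEnd ℂ) z).im := by rw [Complex.conj_im]; linarith
      have hTc : (P.V m).T ((starRingEnd ℂ) z) = ((a m : ℝ) : ℂ) := by
        rw [Weights.T_conj, hTz]; simp
      have hre : ((P.V m).T ((starRingEnd ℂ) z)).re = a m := by rw [hTc, Complex.ofReal_re]
      refine ⟨(starRingEnd ℂ) z, ?_, hic.le, Weights.D_eq_zero_of_T_eq hic hTc, hre.le,
        Or.inr hre.ge⟩
      have : (starRingEnd ℂ) z - zp = (starRingEnd ℂ) (z - zp) := by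
        rw [map_sub, Complex.conj_ofReal]
      rw [this, Complex.norm_conj]
      exact hz.1
    · exact ⟨z, hz.1, hi.le, Weights.D_eq_zero_of_T_eq hi (t := a m) (by rw [hTz]; simp), hTr.le,
        Or.inr hTr.ge⟩

theorem exists_interior_seq (hW : W.Nontriv) {a : ℕ → ℤ} {t : ℝ}
    (ha : Tendsto (fun m => (a m : ℝ) / m) atTop (𝓝 t)) {z₀ : ℂ} (hz : 0 < z₀.im)
    (h : W.T z₀ = t) :
    ∃ zs : ℕ → ℂ, Tendsto zs atTop (𝓝 z₀) ∧ ∀ᶠ m in atTop, 0 < (zs m).im ∧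
      (P.V m).T (zs m) = ((a m : ℝ) : ℂ) := by
  have hd := Weights.hasDerivAt_T (W := W) (away_of_im_pos hz)
  rw [Weights.D_eq_zero_of_T_eq hz h] at hd
  have hd0 : ((0 : ℝ) : ℂ) + (z₀ - (starRingEnd ℂ) z₀) * W.Q z₀ z₀ ≠ 0 := by
    intro h0
    have := Weights.re_mul_deriv_T_neg hW hz
    rw [Complex.ofReal_zero, zero_add] at h0
    rw [h0] at this
    simp at this
  refine exists_seq_tendsto (p := fun m z => 0 < z.im ∧ (P.V m).T z = ((a m : ℝ) : ℂ))
    fun ε hε => ?_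
  filter_upwards [P.eventually_exists_T_eq ha (away_of_im_pos hz) h (hd.eventually_ne hd0)
    (lt_min hε hz)] with m ⟨z, h1, h2⟩
  rw [lt_min_iff] at h1
  refine ⟨z, h1.1, ?_, by rw [h2]; simp⟩
  have := (Complex.abs_im_le_norm (z - z₀)).trans_lt h1.2
  rw [Complex.sub_im, abs_lt] at this
  linarith

/-- In `corrKernel_eq_inner` both increments vanish in the limit, one by the inner estimate and one
by the same estimate for the exchanged data, and the main term is continuous. -/
theorem tendsto_corrKernel {a : ℕ → ℤ} {p q : ℤ} {zs : ℕ → ℂ} {z₀ : ℂ}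
    (hz : Tendsto zs atTop (𝓝 z₀)) (haz : Away A B z₀) (h0 : z₀ ≠ 0)
    (hi : ∀ᶠ m in atTop, 0 ≤ (zs m).im) (h1 : P.InnerSmall a p q zs)
    (h2 : P.swap.InnerSmall (fun m => -a m) (-p - 1) (-q - 1) (fun m => -(zs m)⁻¹)) :
    Tendsto (fun m => corrKernel (P.X m) (P.Y m) (a m + p) (a m + q)) atTop
      (𝓝 ((mainTerm (p - q) z₀ / π : ℝ) : ℂ)) := by
  have hpi : (π : ℂ) ≠ 0 := by exact_mod_cast Real.pi_ne_zero
  have hmain := (Complex.continuous_ofReal.tendsto _).comp (tendsto_mainTerm (p - q) hz h0 hi)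
  have hdiff : Tendsto (fun m => π * corrKernel (P.X m) (P.Y m) (a m + p) (a m + q) -
      (mainTerm (p - q) (zs m) : ℂ)) atTop (𝓝 0) := by
    rw [Metric.tendsto_nhds]
    intro ε hε
    filter_upwards [h1 (ε / 3) (by positivity), h2 (ε / 3) (by positivity), hi,
      hz.eventually (W.isOpen_away.mem_nhds haz), hz.eventually (isOpen_ne.mem_nhds h0)]
      with m k1 k2 him hzm h0m
    obtain ⟨L⟩ := exists_laurent (P.X m) (P.Y m) (a m + q)
    obtain ⟨Φ, hΦ⟩ := exists_primitive (Laurent.isOpen_Jin _) (L.differentiableOn_hin (a m + p))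
    obtain ⟨Φ', hΦ'⟩ := exists_primitive (Laurent.isOpen_Jin _)
      (L.swap.differentiableOn_hin (-(a m + p) - 1))
    -- The indices of `L.swap` agree with those in the hypothesis only up to arithmetic;
    -- generalizing them allows substitution in the dependent type.
    have key : ∀ Q', Q' = -a m + (-q - 1) → ∀ P', P' = -a m + (-p - 1) →
        ∀ (L' : Laurent (P.Y m) (P.X m) Q') (Φ : ℂ → ℂ),
        (∀ z ∈ Strip (Laurent.Jin (P.Y m) (P.X m) P'), HasDerivAt Φ (L'.hin P' z) z) →
        |(Φ (-(zs m)⁻¹)).im - (Φ (crossing (P.Y m))).im| ≤ ε / 3 := by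
      rintro _ rfl _ rfl L' Φ hΦ
      exact k2 L' Φ hΦ
    have b1 := k1 L Φ hΦ
    have b2 := key _ (by ring) _ (by ring) L.swap Φ' hΦ'
    rw [L.corrKernel_eq_inner (P.X0 m) (P.Y0 m) (a m + p) hΦ hΦ' (P.away_range m hzm) h0m him,
      show a m + p - (a m + q) = p - q by ring, dist_zero_right, ← Complex.ofReal_sub,
      Complex.norm_real, Real.norm_eq_abs]
    set u := (Φ (zs m)).im - (Φ (crossing (P.X m))).im
    set v := (Φ' (-(zs m)⁻¹)).im - (Φ' (crossing (P.Y m))).im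
    have e : u + mainTerm (p - q) (zs m) - (-1) ^ (a m + p + (a m + q)) * v -
        mainTerm (p - q) (zs m) = u - (-1) ^ (a m + p + (a m + q)) * v := by ring
    rw [e]
    refine (abs_sub _ _).trans_lt ?_
    rw [abs_mul, abs_zpow, abs_neg, abs_one, one_zpow, one_mul]
    linarith
  have := ((hdiff.add hmain).div_const (π : ℂ))
  rw [zero_add] at this
  push_cast
  refine this.congr fun m => ?_
  simp only [Function.comp_apply, sub_add_cancel]
  rw [mul_div_cancel_left₀ _ hpi]

end Approx

/-! ### Limits of the kernel -/

namespace Crit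

variable {A B : Set ℝ} {W : Weights A B} {zp vm : ℝ}

/-- Any point of the critical curve has modulus strictly between `|zp|` and `1/|vm|`, and the curve
is nonempty. -/
theorem mul_lt_one (h : Crit W zp vm) : |zp| * |vm| < 1 := by
  obtain ⟨t, h1, h2⟩ := exists_between h.lower_lt_upper
  obtain ⟨z, hz, hT⟩ := h.exists_T_eq h1 h2
  have hre : (W.T z).re = t := by rw [hT, Complex.ofReal_re]
  have := h.mem_rng hz (Weights.D_eq_zero_of_T_eq hz hT) (by rwa [hre]) (by rwa [hre])
  exact (mul_le_mul_of_nonneg_right this.1.le (abs_nonneg _)).trans_lt this.2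

theorem contact_swap {t : ℝ} {z : ℂ} (hi : 0 ≤ z.im) (haz : Away A B z)
    (h0 : z ≠ 0) (hD : W.D z = 0) (hT : (W.T z).re ≤ t) (h1 : ‖z‖ * |vm| < 1) (h2 : |zp| ≤ ‖z‖) :
    Contact W.swap vm zp (-t) (-z⁻¹) := by
  have hn : 0 < ‖z‖ := norm_pos_iff.2 h0
  refine ⟨?_, haz.swap h0, neg_ne_zero.2 (inv_ne_zero h0), ?_, ?_, ?_, ?_⟩
  · rw [Complex.neg_im, Complex.inv_im, neg_div, neg_neg]
    exact div_nonneg hi (Complex.normSq_nonneg _)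
  · rw [Weights.D_swap haz h0, hD, mul_zero, neg_zero]
  · rw [Weights.T_swap haz h0, Complex.neg_re]
    linarith
  · rw [Weights.swap_norm, ← one_div, lt_div_iff₀ hn, mul_comm]
    exact h1
  · rw [Weights.swap_norm, inv_mul_le_iff₀ hn, mul_one]
    exact h2

end Crit

namespace Approx

variable {A B : Set ℝ} {W : Weights A B} (P : Approx W) {zp vm : ℝ}

theorem tendsto_neg_div {a : ℕ → ℤ} {t : ℝ} (ha : Tendsto (fun m => (a m : ℝ) / m) atTop (𝓝 t)) :
    Tendsto (fun m => ((-a m : ℤ) : ℝ) / m) atTop (𝓝 (-t)) := by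
  refine ha.neg.congr fun m => ?_
  push_cast; ring

theorem swap_contact_data {m : ℕ} {a : ℝ} {z : ℂ} (hi : 0 ≤ z.im) (hz : Away A B z) (h0 : z ≠ 0)
    (hD : (P.V m).D z = 0) (hT : ((P.V m).T z).re ≤ a) :
    0 ≤ (-z⁻¹).im ∧ (P.swap.V m).D (-z⁻¹) = 0 ∧ -a ≤ ((P.swap.V m).T (-z⁻¹)).re := by
  refine ⟨?_, ?_, ?_⟩
  · rw [Complex.neg_im, Complex.inv_im, neg_div, neg_neg]
    exact div_nonneg hi (Complex.normSq_nonneg _)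
  · have := Weights.D_swap (W := P.V m) hz h0
    rw [hD, mul_zero, neg_zero] at this
    exact this
  · have := Weights.T_swap (W := P.V m) hz h0
    have e : (P.swap.V m).T (-z⁻¹) = -(P.V m).T z := this
    rw [e, Complex.neg_re]
    linarith

/-- The kernel in the bulk. -/
theorem tendsto_of_interior (h : Crit W zp vm) {a : ℕ → ℤ} {t : ℝ}
    (ha : Tendsto (fun m => (a m : ℝ) / m) atTop (𝓝 t)) (h1 : -(W.swap.T vm).re < t)
    (h2 : t < (W.T zp).re) {z₀ : ℂ} (hz : 0 < z₀.im) (hT : W.T z₀ = t) {p q : ℤ}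
    (hk : ∀ᶠ m in atTop, a m + p + 1 ≤ P.k m) (hn : ∀ᶠ m in atTop, -a m - p ≤ P.n m) :
    Tendsto (fun m => corrKernel (P.X m) (P.Y m) (a m + p) (a m + q)) atTop
      (𝓝 ((mainTerm (p - q) z₀ / π : ℝ) : ℂ)) := by
  have haz := away_of_im_pos (A := A) (B := B) hz
  have h0 := ne_zero_of_im_pos hz
  have hD := Weights.D_eq_zero_of_T_eq hz hT
  have hre : (W.T z₀).re = t := by rw [hT, Complex.ofReal_re]
  have hlo := h.norm_gt hz hD (by rwa [hre])
  have hhi := h.norm_lt hz hD (by rwa [hre])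
  obtain ⟨zs, hzs, hev⟩ := P.exists_interior_seq h.nt ha hz hT
  refine P.tendsto_corrKernel hzs haz h0 (hev.mono fun m hm => hm.1.le) ?_ ?_
  · refine P.innerSmall_of_contact h ha h2 hzs ⟨hz.le, haz, h0, hD, hre.ge, hlo, hhi.le⟩ ?_ hk
    filter_upwards [hev] with m hm
    refine ⟨hm.1.le, Weights.D_eq_zero_of_T_eq hm.1 hm.2, ?_⟩
    rw [hm.2, Complex.ofReal_re]
  · refine P.swap.innerSmall_of_contact h.swap (tendsto_neg_div ha) (by linarith)
      (hzs.inv₀ h0).neg (Crit.contact_swap hz.le haz h0 hD hre.le hhi hlo.le) ?_ ?_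
    · filter_upwards [hev] with m hm
      have := P.swap_contact_data hm.1.le (away_of_im_pos hm.1) (ne_zero_of_im_pos hm.1)
        (Weights.D_eq_zero_of_T_eq hm.1 hm.2) (a := a m) (by rw [hm.2, Complex.ofReal_re])
      push_cast
      exact this
    · filter_upwards [hn] with m hm
      change -a m + (-p - 1) + 1 ≤ P.n m
      linarith

/-- On the inner side the contact points are next to the interval between the poles and the short
segment suffices. On the outer side the inverted point is far from the interval of the exchanged
data, and the general contact estimate applies. -/
theorem innerSmall_pair (h : Crit W zp vm) (hzp : zp ≠ 0) {a : ℕ → ℤ} {t : ℝ}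
    (ha : Tendsto (fun m => (a m : ℝ) / m) atTop (𝓝 t)) (ht : (W.T zp).re ≤ t) {p q : ℤ}
    (hk : 0 < zp ∨ ∀ᶠ m in atTop, a m + p + 1 ≤ P.k m) (hn : ∀ᶠ m in atTop, -a m - p ≤ P.n m) :
    ∃ zs : ℕ → ℂ, Tendsto zs atTop (𝓝 (zp : ℂ)) ∧ (∀ᶠ m in atTop, 0 ≤ (zs m).im) ∧
      P.InnerSmall a p q zs ∧
      P.swap.InnerSmall (fun m => -a m) (-p - 1) (-q - 1) (fun m => -(zs m)⁻¹) := by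
  have h0 : (zp : ℂ) ≠ 0 := by exact_mod_cast hzp
  obtain ⟨zs, hzs, hev⟩ := P.exists_contact_seq h ha ht
  refine ⟨zs, hzs, hev.mono fun m hm => hm.1, ?_, ?_⟩
  · exact P.innerSmall_of_tendsto_zp h hzp hzs
      (hev.mono fun m hm => ⟨hm.1, hm.2.1, hm.2.2.2⟩) hk
  · have hlt := h.lower_lt_upper
    refine P.swap.innerSmall_of_contact h.swap (tendsto_neg_div ha) (by linarith)
      (hzs.inv₀ h0).neg (Crit.contact_swap (by simp) h.hp.away h0 h.Dp ht ?_ ?_) ?_ ?_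
    · rw [Complex.norm_real]; exact h.mul_lt_one
    · rw [Complex.norm_real, Real.norm_eq_abs]
    · filter_upwards [hev, hzs.eventually (W.isOpen_away.mem_nhds h.hp.away),
        hzs.eventually (isOpen_ne.mem_nhds h0)] with m hm h1 h2
      have := P.swap_contact_data hm.1 h1 h2 hm.2.1 hm.2.2.1
      push_cast
      exact this
    · filter_upwards [hn] with m hm
      change -a m + (-p - 1) + 1 ≤ P.n m
      linarith

/-- The kernel at the upper end of the support and above. -/
theorem tendsto_of_upper (h : Crit W zp vm) (hzp : zp ≠ 0) {a : ℕ → ℤ} {t : ℝ}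
    (ha : Tendsto (fun m => (a m : ℝ) / m) atTop (𝓝 t)) (ht : (W.T zp).re ≤ t) {p q : ℤ}
    (hk : 0 < zp ∨ ∀ᶠ m in atTop, a m + p + 1 ≤ P.k m) (hn : ∀ᶠ m in atTop, -a m - p ≤ P.n m) :
    Tendsto (fun m => corrKernel (P.X m) (P.Y m) (a m + p) (a m + q)) atTop
      (𝓝 ((mainTerm (p - q) zp / π : ℝ) : ℂ)) := by
  obtain ⟨zs, hzs, hi, h1, h2⟩ := P.innerSmall_pair h hzp ha ht (p := p) (q := q) hk hn
  exact P.tendsto_corrKernel hzs h.hp.away (by exact_mod_cast hzp) hi h1 h2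

/-- The kernel at the lower end of the support and below. -/
theorem tendsto_of_lower (h : Crit W zp vm) (hvm : vm ≠ 0) {a : ℕ → ℤ} {t : ℝ}
    (ha : Tendsto (fun m => (a m : ℝ) / m) atTop (𝓝 t)) (ht : t ≤ -(W.swap.T vm).re) {p q : ℤ}
    (hk : ∀ᶠ m in atTop, a m + p + 1 ≤ P.k m)
    (hn : 0 < vm ∨ ∀ᶠ m in atTop, -a m - p ≤ P.n m) :
    Tendsto (fun m => corrKernel (P.X m) (P.Y m) (a m + p) (a m + q)) atTop
      (𝓝 ((mainTerm (p - q) ((-vm⁻¹ : ℝ) : ℂ) / π : ℝ) : ℂ)) := by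
  have hv0 : (vm : ℂ) ≠ 0 := by exact_mod_cast hvm
  obtain ⟨vs, hvs, hi, h1, h2⟩ := P.swap.innerSmall_pair h.swap hvm (tendsto_neg_div ha)
    (by linarith) (p := -p - 1) (q := -q - 1) (by
      refine hn.imp id fun hn => hn.mono fun m hm => ?_
      change -a m + (-p - 1) + 1 ≤ P.n m
      linarith) (by
      refine hk.mono fun m hm => ?_
      change -(-a m) - (-p - 1) ≤ (P.k m : ℤ)
      linarith)
  simp only [neg_neg, show -(-p - 1) - 1 = p by ring, show -(-q - 1) - 1 = q by ring] at h2
  have e : ((-vm⁻¹ : ℝ) : ℂ) = -(vm : ℂ)⁻¹ := by push_cast; rfl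
  rw [e]
  refine P.tendsto_corrKernel (zs := fun m => -(vs m)⁻¹) (hvs.inv₀ hv0).neg (h.hm.away.swap hv0)
    (neg_ne_zero.2 (inv_ne_zero hv0)) ?_ h2 ?_
  · filter_upwards [hi] with m hm
    rw [Complex.neg_im, Complex.inv_im, neg_div, neg_neg]
    exact div_nonneg hm (Complex.normSq_nonneg _)
  · simpa only [Weights.neg_inv_neg_inv] using h1

end Approx

end

end DualSchur

namespace DualSchur

noncomputable section

/-! ### Riemann sums -/

theorem tendsto_riemann_sum {φ : ℝ → ℝ} (h : ContinuousOn φ (Icc 0 1)) :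
    Tendsto (fun n : ℕ => (n : ℝ)⁻¹ * ∑ i : Fin n, φ (((i : ℕ) + 1 : ℝ) / n)) atTop
      (𝓝 (∫ s in (0 : ℝ)..1, φ s)) := by
  have huc := isCompact_Icc.uniformContinuousOn_of_continuous h
  rw [Metric.uniformContinuousOn_iff] at huc
  rw [Metric.tendsto_nhds]
  intro ε hε
  obtain ⟨δ, hδ, hb⟩ := huc (ε / 2) (half_pos hε)
  filter_upwards [tendsto_inv_atTop_nhds_zero_nat.eventually_lt_const hδ, eventually_gt_atTop 0]
    with n hn hn0
  have hnp : (0 : ℝ) < n := by exact_mod_cast hn0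
  have hmem : ∀ i ≤ n, (i : ℝ) / n ∈ Icc (0 : ℝ) 1 := fun i hi =>
    ⟨by positivity, (div_le_one hnp).2 (by exact_mod_cast hi)⟩
  have hle : ∀ i : ℕ, (i : ℝ) / n ≤ ((i + 1 : ℕ) : ℝ) / n := fun i => by
    push_cast; gcongr; linarith
  have hsub : ∀ i < n, Icc ((i : ℝ) / n) (((i + 1 : ℕ) : ℝ) / n) ⊆ Icc 0 1 := fun i hi =>
    Icc_subset_Icc (hmem i hi.le).1 (hmem (i + 1) hi).2
  have hint : ∀ i < n, IntervalIntegrable φ volume ((i : ℝ) / n) (((i + 1 : ℕ) : ℝ) / n) :=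
    fun i hi => (h.mono (by rw [uIcc_of_le (hle i)]; exact hsub i hi)).intervalIntegrable
  have hsum := intervalIntegral.sum_integral_adjacent_intervals
    (a := fun i : ℕ => (i : ℝ) / n) (f := φ) (μ := volume) (n := n) hint
  simp only [Nat.cast_zero, zero_div, div_self hnp.ne'] at hsum
  rw [← hsum, Real.dist_eq, Finset.mul_sum,
    Fin.sum_univ_eq_sum_range (fun i => (n : ℝ)⁻¹ * φ (((i : ℕ) + 1 : ℝ) / n)) n,
    ← Finset.sum_sub_distrib]
  refine (Finset.abs_sum_le_sum_abs _ _).trans_lt ?_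
  have hterm : ∀ i ∈ Finset.range n, |(n : ℝ)⁻¹ * φ (((i : ℕ) + 1 : ℝ) / n) -
      ∫ s in ((i : ℝ) / n)..(((i + 1 : ℕ) : ℝ) / n), φ s| ≤ ε / 2 * (n : ℝ)⁻¹ := by
    intro i hi
    have hi := Finset.mem_range.1 hi
    have hlen : ((i + 1 : ℕ) : ℝ) / n - (i : ℝ) / n = (n : ℝ)⁻¹ := by
      push_cast; field_simp; ring
    have e : (n : ℝ)⁻¹ * φ (((i : ℕ) + 1 : ℝ) / n) =
        ∫ _ in ((i : ℝ) / n)..(((i + 1 : ℕ) : ℝ) / n), φ (((i : ℕ) + 1 : ℝ) / n) := by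
      rw [intervalIntegral.integral_const, hlen, smul_eq_mul]
    rw [e, ← intervalIntegral.integral_sub intervalIntegrable_const (hint i hi)]
    have := intervalIntegral.norm_integral_le_of_norm_le_const (C := ε / 2)
      (f := fun s => φ (((i : ℕ) + 1 : ℝ) / n) - φ s) (a := (i : ℝ) / n)
      (b := ((i + 1 : ℕ) : ℝ) / n) (fun s hs => by
        rw [uIoc_of_le (hle i)] at hs
        have h1 := hmem (i + 1) hi
        push_cast at h1
        refine (hb _ h1 _ (hsub i hi ⟨hs.1.le, hs.2⟩) ?_).le
        have h2 := hs.2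
        push_cast at h2 hlen
        rw [Real.dist_eq, abs_of_nonneg (by linarith)]
        linarith [hs.1])
    rwa [hlen, abs_of_pos (inv_pos.2 hnp)] at this
  refine (Finset.sum_le_sum hterm).trans_lt ?_
  rw [Finset.sum_const, Finset.card_range, nsmul_eq_mul]
  have : (n : ℝ) * (ε / 2 * (n : ℝ)⁻¹) = ε / 2 := by field_simp
  linarith

/-! ### The measures attached to profiles -/

/-- The distribution of `f` on `[0, 1]`. -/
def profile (f : ℝ → ℝ) : Measure ℝ := (volume.restrict (Icc (0 : ℝ) 1)).map f

instance (f : ℝ → ℝ) : IsFiniteMeasure (profile f) := by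
  unfold profile; infer_instance

theorem aemeasurable_profile {f : ℝ → ℝ} (hf : ContinuousOn f (Icc 0 1)) :
    AEMeasurable f (volume.restrict (Icc (0 : ℝ) 1)) :=
  hf.aemeasurable measurableSet_Icc

theorem isCompact_image_profile {f : ℝ → ℝ} (hf : ContinuousOn f (Icc 0 1)) :
    IsCompact (f '' Icc 0 1) := isCompact_Icc.image_of_continuousOn hf

theorem profile_restrict {f : ℝ → ℝ} (hf : ContinuousOn f (Icc 0 1)) :
    (profile f).restrict (f '' Icc 0 1) = profile f := by
  refine Measure.restrict_eq_self_of_ae_mem ?_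
  rw [profile]
  refine (ae_map_iff (aemeasurable_profile hf) (isCompact_image_profile hf).measurableSet).2 ?_
  exact (ae_restrict_mem measurableSet_Icc).mono fun s hs => ⟨s, hs, rfl⟩

theorem integral_profile {f : ℝ → ℝ} (hf : ContinuousOn f (Icc 0 1))
    {E : Type*} [NormedAddCommGroup E] [NormedSpace ℝ E] {φ : ℝ → E}
    (hφ : ContinuousOn φ (f '' Icc 0 1)) :
    ∫ x, φ x ∂profile f = ∫ s in (0 : ℝ)..1, φ (f s) := by
  rw [profile, integral_map (aemeasurable_profile hf), intervalIntegral.integral_of_le zero_le_one,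
    integral_Icc_eq_integral_Ioc]
  have := (integrable_of_continuousOn_carried (isCompact_image_profile hf) (profile_restrict hf)
    hφ).aestronglyMeasurable
  exact this

theorem profile_univ {f : ℝ → ℝ} (hf : ContinuousOn f (Icc 0 1)) : (profile f).real univ = 1 := by
  have := integral_profile hf (φ := fun _ => (1 : ℝ)) continuousOn_const
  simpa using this

theorem profile_scaledConv {f : ℝ → ℝ} (hf : ContinuousOn f (Icc 0 1)) :
    ScaledConv (fun n => diracs (sampled f n)) (profile f) (f '' Icc 0 1) := by
  intro φ hφ
  rw [integral_profile hf hφ]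
  refine (tendsto_riemann_sum (hφ.comp hf (mapsTo_image _ _))).congr fun n => ?_
  rw [integral_diracs]
  rfl

/-- The sum over `k` points divided by `n` is `k/n` times the Riemann sum with `k` points, and `k →
∞` because `c > 0`. -/
theorem profile_scaledConv_smul {f : ℝ → ℝ} (hf : ContinuousOn f (Icc 0 1))
    {c : ℝ} (hc : 0 < c) {k : ℕ → ℕ}
    (hk : Tendsto (fun n : ℕ => (k n : ℝ) / n) atTop (𝓝 c)) :
    ScaledConv (fun n => diracs (sampled f (k n))) (ENNReal.ofReal c • profile f)
      (f '' Icc 0 1) := by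
  intro φ hφ
  rw [integral_smul_measure, ENNReal.toReal_ofReal hc.le, smul_eq_mul]
  have hkt : Tendsto k atTop atTop := by
    rw [← tendsto_natCast_atTop_iff (R := ℝ)]
    refine (hk.pos_mul_atTop hc tendsto_natCast_atTop_atTop).congr' ?_
    filter_upwards [eventually_gt_atTop 0] with n hn
    have : (n : ℝ) ≠ 0 := by exact_mod_cast hn.ne'
    field_simp
  refine (hk.mul ((profile_scaledConv hf φ hφ).comp hkt)).congr' ?_
  filter_upwards [hkt.eventually_gt_atTop 0] with n hn
  have : (k n : ℝ) ≠ 0 := by exact_mod_cast hn.ne'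
  simp only [Function.comp_apply]
  field_simp

theorem sampled_mem {f : ℝ → ℝ} (n : ℕ) (i : Fin n) : sampled f n i ∈ f '' Icc 0 1 := by
  have h : ((i : ℕ) : ℝ) + 1 ≤ n := by exact_mod_cast i.2
  have hn : (0 : ℝ) < n := by linarith [(Nat.cast_nonneg (i : ℕ) : (0 : ℝ) ≤ _)]
  exact ⟨_, ⟨by positivity, (div_le_one hn).2 h⟩, rfl⟩

theorem blowUp_smul {m : Measure ℝ} {A : Set ℝ} (h : BlowUp m A) {c : ℝ} (hc : 0 < c) :
    BlowUp (ENNReal.ofReal c • m) A := by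
  intro r hr hrA M
  obtain ⟨z, h1, h2, h3, h4⟩ := h r hr hrA (M / c)
  refine ⟨z, h1, h2, h3, ?_⟩
  rw [integral_smul_measure, ENNReal.toReal_ofReal hc.le, smul_eq_mul]
  rwa [div_le_iff₀' hc] at h4

/-- Let `f(s₀) = 1/r` and put `z` on the circle at angle `η`. On an interval of length `η` near `s₀`
the Lipschitz bound gives `|1 - f z| ≤ Λ η`, so the integral is at least of order `η · η⁻²`. -/
theorem blowUp_profile {f : ℝ → ℝ} {K : NNReal} (hf : LipschitzOnWith K f (Icc 0 1))
    (hf0 : ∀ s ∈ Icc (0 : ℝ) 1, 0 ≤ f s) : BlowUp (profile f) (f '' Icc 0 1) := by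
  rintro r hr ⟨s₀, hs₀, hfs⟩ M
  have hc := hf.continuousOn
  obtain ⟨F, hF⟩ := (isCompact_image_profile hc).bddAbove
  have hF : ∀ s ∈ Icc (0 : ℝ) 1, f s ≤ F := fun s hs => hF ⟨s, hs, rfl⟩
  have hf₀ : 0 < f s₀ := by rw [hfs]; positivity
  have hF0 : 0 < F := hf₀.trans_le (hF s₀ hs₀)
  have hK : (0 : ℝ) ≤ K := K.2
  set Λ : ℝ := (K + F) * r with hΛ
  have hΛ0 : 0 < Λ := by positivity
  set M' : ℝ := max M 1 with hM'
  have hM0 : 0 < M' := lt_max_of_lt_right one_pos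
  -- The bounds make the interval fit into `[0, 1]`, keep `f ≥ f(s₀)/2` on it, and make
  -- `f(s₀)/(2Λ²η)` exceed `M`.
  obtain ⟨η, hη, hlt⟩ : ∃ η > 0, η < min (1 / 2) (min (f s₀ / 2 / (K + 1)) (f s₀ / 2 / Λ ^ 2 / M')) := by
    have : 0 < min (1 / 2) (min (f s₀ / 2 / (K + 1)) (f s₀ / 2 / Λ ^ 2 / M')) := by positivity
    exact ⟨_, half_pos this, half_lt_self this⟩
  simp only [lt_min_iff] at hlt
  obtain ⟨l1, l2, l3⟩ := hlt
  have hpi := Real.pi_gt_three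
  set z : ℂ := r * Complex.exp (η * Complex.I) with hz
  have hzi : 0 < z.im := by
    rw [hz, Complex.im_ofReal_mul, Complex.exp_ofReal_mul_I_im]
    exact mul_pos hr (Real.sin_pos_of_pos_of_lt_pi hη (by linarith))
  have hza : Away (f '' Icc 0 1) ∅ z := away_of_im_pos hzi
  have hdist : ‖(r : ℂ) - z‖ ≤ r * η := by
    have e : (r : ℂ) - z = -(r * (Complex.exp (η * Complex.I) - 1)) := by rw [hz]; ring
    rw [e, norm_neg, norm_mul, Complex.norm_real, Real.norm_of_nonneg hr.le]
    refine mul_le_mul_of_nonneg_left ?_ hr.le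
    have := Real.norm_exp_I_mul_ofReal_sub_one_le (x := η)
    rwa [mul_comm, Real.norm_of_nonneg hη.le] at this
  refine ⟨z, hzi, ?_, ?_, ?_⟩
  · rw [hz, norm_mul, Complex.norm_exp_ofReal_mul_I, mul_one, Complex.norm_real,
      Real.norm_of_nonneg hr.le]
  · rw [hz, Complex.re_ofReal_mul, Complex.exp_ofReal_mul_I_re]
    exact mul_nonneg hr.le (Real.cos_nonneg_of_neg_pi_div_two_le_of_le (by linarith) (by linarith))
  have hns := Complex.continuous_normSq
  have hcont : ContinuousOn (fun x : ℝ => x / Complex.normSq (1 - x * z)) (f '' Icc 0 1) :=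
    ContinuousOn.div (by fun_prop) (by fun_prop) fun x hx => (hza.normSq_pos_left hx).ne'
  rw [integral_profile hc hcont]
  obtain ⟨α, hα0, hα1, hαs⟩ : ∃ α : ℝ, 0 ≤ α ∧ α + η ≤ 1 ∧ ∀ s ∈ Icc α (α + η), |s - s₀| ≤ η := by
    rcases le_total s₀ (1 / 2) with h | h
    · refine ⟨s₀, hs₀.1, by linarith, fun s hs => abs_le.2 ⟨?_, ?_⟩⟩ <;> linarith [hs.1, hs.2]
    · refine ⟨s₀ - η, by linarith, by linarith [hs₀.2], fun s hs => abs_le.2 ⟨?_, ?_⟩⟩ <;>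
        linarith [hs.1, hs.2]
  have hcomp := hcont.comp hc (mapsTo_image _ _)
  have hi1 : IntervalIntegrable (fun s => f s / Complex.normSq (1 - f s * z)) volume 0 1 :=
    ContinuousOn.intervalIntegrable (by rw [uIcc_of_le zero_le_one]; exact hcomp)
  have hlow : ∫ s in α..(α + η), f s / Complex.normSq (1 - f s * z) ≤
      ∫ s in (0 : ℝ)..1, f s / Complex.normSq (1 - f s * z) := by
    refine intervalIntegral.integral_mono_interval hα0 (by linarith) hα1 ?_ hi1
    refine (ae_restrict_mem measurableSet_Ioc).mono fun s hs => ?_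
    exact div_nonneg (hf0 s ⟨hs.1.le, hs.2⟩) (Complex.normSq_nonneg _)
  refine le_trans ?_ hlow
  have hpt : ∀ s ∈ Icc α (α + η), f s₀ / 2 / (Λ * η) ^ 2 ≤ f s / Complex.normSq (1 - f s * z) := by
    intro s hs
    have hs01 : s ∈ Icc (0 : ℝ) 1 := ⟨hα0.trans hs.1, hs.2.trans hα1⟩
    have hd := hαs s hs
    have hfd : |f s - f s₀| ≤ K * η := by
      have := hf.dist_le_mul s hs01 s₀ hs₀
      rw [Real.dist_eq, Real.dist_eq] at this
      exact this.trans (mul_le_mul_of_nonneg_left hd hK)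
    have hge : f s₀ / 2 ≤ f s := by
      rw [lt_div_iff₀ (by positivity)] at l2
      have := (abs_le.1 hfd).1
      nlinarith
    have hnorm : ‖1 - (f s : ℂ) * z‖ ≤ Λ * η := by
      have hrs : (f s₀ : ℂ) * r = 1 := by
        rw [hfs, ← Complex.ofReal_mul, inv_mul_cancel₀ hr.ne', Complex.ofReal_one]
      have e : 1 - (f s : ℂ) * z = -(((f s - f s₀ : ℝ) : ℂ) * r) + f s * (r - z) := by
        push_cast; linear_combination -hrs
      rw [e]
      refine (norm_add_le _ _).trans ?_
      rw [norm_neg, norm_mul, norm_mul, Complex.norm_real, Complex.norm_real, Complex.norm_real,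
        Real.norm_eq_abs, Real.norm_of_nonneg hr.le, Real.norm_of_nonneg (hf0 s hs01)]
      have h1 := mul_le_mul_of_nonneg_right hfd hr.le
      have h2 := mul_le_mul (hF s hs01) hdist (norm_nonneg _) hF0.le
      rw [hΛ]
      linarith
    have hpos : 0 < Complex.normSq (1 - (f s : ℂ) * z) := hza.normSq_pos_left ⟨s, hs01, rfl⟩
    refine div_le_div₀ (hf0 s hs01) hge hpos ?_
    rw [Complex.normSq_eq_norm_sq]
    gcongr
  have hconst := intervalIntegral.integral_mono_on (by linarith : α ≤ α + η)
    (intervalIntegrable_const (c := f s₀ / 2 / (Λ * η) ^ 2)) (hi1.mono_set (by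
      rw [uIcc_of_le (by linarith : α ≤ α + η), uIcc_of_le zero_le_one]
      exact Icc_subset_Icc hα0 hα1)) hpt
  refine le_trans ?_ hconst
  rw [intervalIntegral.integral_const, smul_eq_mul, add_sub_cancel_left]
  refine (le_max_left M 1).trans ?_
  rw [lt_div_iff₀ hM0] at l3
  have e : η * (f s₀ / 2 / (Λ * η) ^ 2) = f s₀ / 2 / Λ ^ 2 / η := by field_simp
  rw [e, le_div_iff₀ hη]
  linarith

end

end DualSchur

/-! ### Frozen ranges and identification of the roots -/

namespace DualSchur

noncomputable section

open Laurent

theorem tendsto_sub_atTop_of_div {u w : ℕ → ℤ} {s t : ℝ}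
    (hu : Tendsto (fun m => (u m : ℝ) / m) atTop (𝓝 s))
    (hw : Tendsto (fun m => (w m : ℝ) / m) atTop (𝓝 t)) (h : s < t) :
    Tendsto (fun m => w m - u m) atTop atTop := by
  rw [← tendsto_intCast_atTop_iff (R := ℝ)]
  refine ((hw.sub hu).pos_mul_atTop (sub_pos.2 h) tendsto_natCast_atTop_atTop).congr' ?_
  filter_upwards [eventually_gt_atTop 0] with n hn
  have : (n : ℝ) ≠ 0 := by exact_mod_cast hn.ne'
  push_cast
  field_simp

theorem mainTerm_real_div_pi {r : ℝ} (hr : r ≠ 0) :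
    ∃ ρ : ℝ, (ρ = 0 ∨ ρ = 1) ∧ ∀ p q : ℤ, mainTerm (p - q) r / π = if p = q then ρ else 0 := by
  refine ⟨(r : ℂ).arg / π, ?_, fun p q => ?_⟩
  · rcases hr.lt_or_gt with h | h
    · rw [Complex.arg_ofReal_of_neg h, div_self Real.pi_ne_zero]; simp
    · rw [Complex.arg_ofReal_of_nonneg h.le]; simp
  · split_ifs with h
    · rw [h, sub_self, mainTerm, if_pos rfl]
    · rw [mainTerm_real (sub_ne_zero.2 h), zero_div]

namespace Approx

variable {A B : Set ℝ} {W : Weights A B} (P : Approx W) {zp vm : ℝ}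

theorem tendsto_k : Tendsto (fun m => ((P.k m : ℤ) : ℝ) / m) atTop (𝓝 (W.ν.real univ)) := by
  have := P.cν (fun _ => 1) continuousOn_const
  rw [integral_const, smul_eq_mul, mul_one] at this
  refine this.congr fun m => ?_
  rw [integral_diracs, Finset.sum_const, Finset.card_univ, Fintype.card_fin, nsmul_eq_mul, mul_one,
    Int.cast_natCast, inv_mul_eq_div]

theorem eventually_le_k {a : ℕ → ℤ} {t : ℝ} (ha : Tendsto (fun m => (a m : ℝ) / m) atTop (𝓝 t))
    (ht : t < W.ν.real univ) (p : ℤ) : ∀ᶠ m in atTop, a m + p + 1 ≤ P.k m := by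
  filter_upwards [(tendsto_sub_atTop_of_div ha P.tendsto_k ht).eventually_ge_atTop (p + 1)]
    with m hm
  linarith

theorem eventually_le_n {a : ℕ → ℤ} {t : ℝ} (ha : Tendsto (fun m => (a m : ℝ) / m) atTop (𝓝 t))
    (ht : -W.μ.real univ < t) (p : ℤ) : ∀ᶠ m in atTop, -a m - p ≤ P.n m := by
  filter_upwards [P.swap.eventually_le_k (tendsto_neg_div ha)
    (show -t < W.swap.ν.real univ by change -t < W.μ.real univ; linarith) (-p - 1)] with m hm
  change -a m + (-p - 1) + 1 ≤ P.n m at hm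
  linarith

/-- Above the mass of `ν` the kernel vanishes eventually. -/
theorem tendsto_zero_of_gt {a : ℕ → ℤ} {t : ℝ} (ha : Tendsto (fun m => (a m : ℝ) / m) atTop (𝓝 t))
    (ht : W.ν.real univ < t) (p q : ℤ) :
    Tendsto (fun m => corrKernel (P.X m) (P.Y m) (a m + p) (a m + q)) atTop (𝓝 0) := by
  refine tendsto_const_nhds.congr' ?_
  filter_upwards [(tendsto_sub_atTop_of_div P.tendsto_k ha ht).eventually_ge_atTop (-q)] with m hm
  exact (corrKernel_eq_zero (P.X0 m) (P.Y0 m) (by linarith)).symm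

/-- Below minus the mass of `μ` the kernel is eventually that of the identity. -/
theorem tendsto_delta_of_lt {a : ℕ → ℤ} {t : ℝ} (ha : Tendsto (fun m => (a m : ℝ) / m) atTop (𝓝 t))
    (ht : t < -W.μ.real univ) (p q : ℤ) :
    Tendsto (fun m => corrKernel (P.X m) (P.Y m) (a m + p) (a m + q)) atTop
      (𝓝 (((if p = q then 1 else 0 : ℝ)) : ℂ)) := by
  refine tendsto_const_nhds.congr' ?_
  have hn : Tendsto (fun m => ((-(P.n m : ℤ) : ℤ) : ℝ) / m) atTop (𝓝 (-W.μ.real univ)) :=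
    tendsto_neg_div P.swap.tendsto_k
  filter_upwards [(tendsto_sub_atTop_of_div ha hn ht).eventually_gt_atTop q] with m hm
  rw [corrKernel_eq_delta (P.X0 m) (P.Y0 m) (by linarith)]
  by_cases h : p = q <;> simp [h]

end Approx

/-! ### Limits inside and outside the support -/

namespace Crit

variable {A B : Set ℝ} {W : Weights A B} {zp vm : ℝ}

theorem T_le_mass (h : Crit W zp vm) : (W.T zp).re ≤ W.ν.real univ := by
  obtain ⟨q, hq, e⟩ := Weights.T_In0_eq h.nt h.hp h.Dp
  have : 0 ≤ zp ^ 2 * q := by positivity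
  linarith

theorem zp_ne_zero_of_T_ne (h : Crit W zp vm) (hT : (W.T zp).re ≠ W.ν.real univ) : zp ≠ 0 := by
  obtain ⟨q, hq, e⟩ := Weights.T_In0_eq h.nt h.hp h.Dp
  rintro rfl
  exact hT (by rw [e]; ring)

theorem neg_mass_le (h : Crit W zp vm) : -W.μ.real univ ≤ -(W.swap.T vm).re := by
  have := h.swap.T_le_mass
  change _ ≤ W.μ.real univ at this
  linarith

/-- In the open half plane `T_strictAnti` excludes a second point with the same value. On the real
line values between the poles exceed the critical one, and values beyond them are at most the
smaller critical value. -/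
theorem eq_zp_of_T_eq (h : Crit W zp vm) {z : ℂ} (hi : 0 ≤ z.im) (hz : Away A B z)
    (hT : W.T z = ((W.T zp).re : ℂ)) : z = zp := by
  rcases hi.lt_or_eq with hi | hi
  · have h1 := Weights.T_strictAnti h.nt hi h.hp.away (Weights.D_eq_zero_of_T_eq hi hT) h.Dp
      (by rintro rfl; simp at hi) (by rw [Complex.conj_ofReal]; rintro rfl; simp at hi)
    rw [hT, Complex.ofReal_re, sub_self, zero_mul] at h1
    exact absurd h1 (lt_irrefl _)
  · have e : z = (z.re : ℂ) := Complex.ext (by simp) (by simp [← hi])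
    have hre : (W.T (z.re : ℂ)).re = (W.T zp).re := by rw [← e, hT, Complex.ofReal_re]
    have hlt := h.lower_lt_upper
    rcases h.T_real (e ▸ hz : Away A B (z.re : ℂ)) with (h1 | h1) | ⟨h1, h2, h3 | h3⟩
    · rw [e, h1]
    · exact absurd h1 (by rw [hre]; exact lt_irrefl _)
    · exfalso
      have hs := Weights.T_swap (W := W) (e ▸ hz : Away A B (z.re : ℂ)) (by exact_mod_cast h1)
      have e2 : -(z.re : ℂ)⁻¹ = (vm : ℂ) := by rw [← h3]; push_cast; rfl
      rw [e2] at hs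
      rw [hs, Complex.neg_re, neg_neg, hre] at hlt
      exact lt_irrefl _ hlt
    · rw [hre] at h3
      exact absurd h3 (not_lt.2 hlt.le)

theorem eq_neg_inv_vm_of_T_eq (h : Crit W zp vm) {z : ℂ} (hi : 0 ≤ z.im) (hz : Away A B z)
    (hT : W.T z = ((-(W.swap.T vm).re : ℝ) : ℂ)) : z = ((-vm⁻¹ : ℝ) : ℂ) := by
  have h0 : z ≠ 0 := by
    rintro rfl
    have hre : (W.T ((0 : ℝ) : ℂ)).re = -(W.swap.T vm).re := by
      rw [Complex.ofReal_zero, hT, Complex.ofReal_re]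
    have hlt := h.lower_lt_upper
    rcases h.T_real (r := 0) (by simpa using hz) with (h1 | h1) | ⟨h1, -⟩
    · rw [← h1, hre] at hlt
      exact lt_irrefl _ hlt
    · linarith
    · exact h1 rfl
  have := h.swap.eq_zp_of_T_eq (z := -z⁻¹) (by
      rw [Complex.neg_im, Complex.inv_im, neg_div, neg_neg]
      exact div_nonneg hi (Complex.normSq_nonneg _)) (hz.swap h0)
    (by rw [Weights.T_swap hz h0, hT]; push_cast; rw [neg_neg])
  rw [← Weights.neg_inv_neg_inv z, this]
  push_cast; rfl

theorem im_pos_of_T_eq (h : Crit W zp vm) {t : ℝ} (h1 : -(W.swap.T vm).re < t)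
    (h2 : t < (W.T zp).re) {z : ℂ} (hi : 0 ≤ z.im) (hz : Away A B z) (hT : W.T z = t) :
    0 < z.im := by
  refine lt_of_le_of_ne hi fun hi => ?_
  have e : z = (z.re : ℂ) := Complex.ext (by simp) (by simp [← hi])
  have hre : (W.T (z.re : ℂ)).re = t := by rw [← e, hT, Complex.ofReal_re]
  rcases h.T_real (e ▸ hz : Away A B (z.re : ℂ)) with (h3 | h3) | ⟨h3, h4, h5 | h5⟩
  · rw [← h3, hre] at h2
    exact lt_irrefl _ h2
  · linarith
  · have hs := Weights.T_swap (W := W) (e ▸ hz : Away A B (z.re : ℂ)) (by exact_mod_cast h3)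
    have e2 : -(z.re : ℂ)⁻¹ = (vm : ℂ) := by rw [← h5]; push_cast; rfl
    rw [e2] at hs
    rw [hs, Complex.neg_re, neg_neg, hre] at h1
    exact lt_irrefl _ h1
  · linarith

/-- The limit of the kernel inside the support. -/
theorem exists_bulk_point (h : Crit W zp vm) (P : Approx W) {t : ℝ} (h1 : -(W.swap.T vm).re ≤ t)
    (h2 : t ≤ (W.T zp).re) (h3 : t ≠ -W.μ.real univ) (h4 : t ≠ W.ν.real univ) :
    ∃ z : ℂ, (∀ z', (0 ≤ z'.im ∧ Away A B z' ∧ W.T z' = t) ↔ z' = z) ∧ z ≠ 0 ∧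
      ∀ a : ℕ → ℤ, Tendsto (fun m => (a m : ℝ) / m) atTop (𝓝 t) → ∀ p q : ℤ,
        Tendsto (fun m => corrKernel (P.X m) (P.Y m) (a m + p) (a m + q)) atTop
          (𝓝 ((mainTerm (p - q) z / π : ℝ) : ℂ)) := by
  have ht1 : -W.μ.real univ < t := lt_of_le_of_ne (h.neg_mass_le.trans h1) h3.symm
  have ht2 : t < W.ν.real univ := lt_of_le_of_ne (h2.trans h.T_le_mass) h4
  rcases h2.lt_or_eq with h2 | h2
  · rcases h1.lt_or_eq with h1 | h1
    · obtain ⟨z, hz, hT⟩ := h.exists_T_eq h1 h2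
      refine ⟨z, fun z' => ⟨fun hz' => ?_, ?_⟩, ne_zero_of_im_pos hz, fun a ha p q => ?_⟩
      · exact h.T_unique (h.im_pos_of_T_eq h1 h2 hz'.1 hz'.2.1 hz'.2.2) hz hz'.2.2 hT
      · rintro rfl
        exact ⟨hz.le, away_of_im_pos hz, hT⟩
      · exact P.tendsto_of_interior h ha h1 h2 hz hT (P.eventually_le_k ha ht2 p)
          (P.eventually_le_n ha ht1 p)
    -- At the lower endpoint `vm = 0`, that is, a root at infinity, would force `t` to be minus the
    -- mass of `μ`.
    · have hv : vm ≠ 0 := h.swap.zp_ne_zero_of_T_ne (by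
        change (W.swap.T vm).re ≠ W.μ.real univ
        intro h5
        exact h3 (by rw [← h1, h5]))
      have hv0 : (vm : ℂ) ≠ 0 := by exact_mod_cast hv
      have e : ((-vm⁻¹ : ℝ) : ℂ) = -(vm : ℂ)⁻¹ := by push_cast; rfl
      have haw : Away A B ((-vm⁻¹ : ℝ) : ℂ) := by rw [e]; exact h.hm.away.swap hv0
      refine ⟨((-vm⁻¹ : ℝ) : ℂ), fun z' => ⟨fun hz' => ?_, ?_⟩, ?_, fun a ha p q => ?_⟩
      · exact h.eq_neg_inv_vm_of_T_eq hz'.1 hz'.2.1 (by rw [hz'.2.2, h1])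
      · rintro rfl
        refine ⟨by rw [Complex.ofReal_im], haw, ?_⟩
        have := Weights.T_swap (W := W.swap) h.hm.away hv0
        rw [Weights.swap_swap, h.swap.T_real_eq] at this
        rw [e, this, ← h1]
        push_cast; rfl
      · exact_mod_cast neg_ne_zero.2 (inv_ne_zero hv)
      · exact P.tendsto_of_lower h hv ha h1.ge (P.eventually_le_k ha ht2 p)
          (Or.inr (P.eventually_le_n ha ht1 p))
  · have hz : zp ≠ 0 := h.zp_ne_zero_of_T_ne (by rwa [← h2])
    refine ⟨zp, fun z' => ⟨fun hz' => ?_, ?_⟩, by exact_mod_cast hz, fun a ha p q => ?_⟩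
    · exact h.eq_zp_of_T_eq hz'.1 hz'.2.1 (by rw [hz'.2.2, h2])
    · rintro rfl
      exact ⟨by rw [Complex.ofReal_im], h.hp.away, by rw [h.T_real_eq, h2]⟩
    · exact P.tendsto_of_upper h hz ha h2.ge (Or.inr (P.eventually_le_k ha ht2 p))
        (P.eventually_le_n ha ht1 p)

/-- The limit of the kernel outside the support. -/
theorem exists_frozen_value (h : Crit W zp vm) (P : Approx W) {t : ℝ}
    (ht : t < -(W.swap.T vm).re ∨ (W.T zp).re < t) (h3 : t = -W.μ.real univ → 0 < vm)
    (h4 : t = W.ν.real univ → 0 < zp) :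
    ∃ ρ : ℝ, (ρ = 0 ∨ ρ = 1) ∧
      ∀ a : ℕ → ℤ, Tendsto (fun m => (a m : ℝ) / m) atTop (𝓝 t) → ∀ p q : ℤ,
        Tendsto (fun m => corrKernel (P.X m) (P.Y m) (a m + p) (a m + q)) atTop
          (𝓝 (((if p = q then ρ else 0 : ℝ)) : ℂ)) := by
  have hlt := h.lower_lt_upper
  have b1 := h.neg_mass_le
  have b2 := h.T_le_mass
  rcases ht with ht | ht
  · rcases lt_or_ge t (-W.μ.real univ) with h5 | h5
    · exact ⟨1, Or.inr rfl, fun a ha p q => P.tendsto_delta_of_lt ha h5 p q⟩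
    have hv : vm ≠ 0 := by
      rcases h5.lt_or_eq with h5 | h5
      · refine h.swap.zp_ne_zero_of_T_ne ?_
        change (W.swap.T vm).re ≠ W.μ.real univ
        intro h6
        rw [h6] at ht
        linarith
      · exact (h3 h5.symm).ne'
    obtain ⟨ρ, hρ, e⟩ := mainTerm_real_div_pi (r := -vm⁻¹) (neg_ne_zero.2 (inv_ne_zero hv))
    refine ⟨ρ, hρ, fun a ha p q => ?_⟩
    rw [← e]
    refine P.tendsto_of_lower h hv ha ht.le (P.eventually_le_k ha (by linarith) p) ?_
    rcases h5.lt_or_eq with h5 | h5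
    · exact Or.inr (P.eventually_le_n ha h5 p)
    · exact Or.inl (h3 h5.symm)
  · rcases lt_or_ge (W.ν.real univ) t with h5 | h5
    · refine ⟨0, Or.inl rfl, fun a ha p q => ?_⟩
      simpa using P.tendsto_zero_of_gt ha h5 p q
    have hz : zp ≠ 0 := by
      rcases h5.lt_or_eq with h5 | h5
      · exact h.zp_ne_zero_of_T_ne (by linarith)
      · exact (h4 h5).ne'
    obtain ⟨ρ, hρ, e⟩ := mainTerm_real_div_pi hz
    refine ⟨ρ, hρ, fun a ha p q => ?_⟩
    rw [← e]
    refine P.tendsto_of_upper h hz ha ht.le ?_ (P.eventually_le_n ha (by linarith) p)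
    -- Strictly below the mass of `ν` the exponent at the origin is eventually nonnegative. At the
    -- mass this may fail, but with `zp > 0` the real path does not meet the origin.
    rcases h5.lt_or_eq with h5 | h5
    · exact Or.inr (P.eventually_le_k ha h5 p)
    · exact Or.inl (h4 h5)

end Crit

/-! ### Critical points of the limiting profile -/

/-- This matches the derivative obtained from `T_sub` with the integrals of squares in the equation
for the double critical points. -/
theorem Weights.deriv_T_eq {A B : Set ℝ} (W : Weights A B) {s : ℂ} (hs : Away A B s) :
    W.D s + (s - (starRingEnd ℂ) s) * W.Q s s =
      (∫ x, (x : ℂ) / (1 - x * s) ^ 2 ∂W.μ) - ∫ y, (y : ℂ) / (s + y) ^ 2 ∂W.ν := by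
  have a3 : ∀ x ∈ A, (Complex.normSq (1 - (x : ℂ) * s) : ℂ) ≠ 0 := fun x hx => by
    exact_mod_cast (hs.normSq_pos_left hx).ne'
  have b3 : ∀ x ∈ B, (Complex.normSq (s + (x : ℂ)) : ℂ) ≠ 0 := fun x hx => by
    exact_mod_cast (hs.normSq_pos_right hx).ne'
  have hns := Complex.continuous_normSq
  have i1 := W.intDivA (φ := fun x : ℝ => (x : ℂ)) (by fun_prop) (by fun_prop) a3
  have i2 := W.intDivB (φ := fun x : ℝ => (x : ℂ)) (by fun_prop) (by fun_prop) b3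
  have i3 := W.intDivA (φ := fun x : ℝ => (x : ℂ) ^ 2) (by fun_prop) (by fun_prop)
    fun x hx => mul_ne_zero (hs.1 x hx) (a3 x hx)
  have i4 := W.intDivB (φ := fun x : ℝ => (x : ℂ)) (by fun_prop) (by fun_prop)
    fun x hx => mul_ne_zero (hs.2 x hx) (b3 x hx)
  rw [W.ofReal_D, Weights.Q, mul_add, ← integral_const_mul, ← integral_const_mul,
    sub_add_eq_add_sub, ← add_assoc, ← integral_add i1 (i3.const_mul _), add_sub_assoc,
    ← integral_sub (i4.const_mul _) i2, sub_eq_add_neg _ (∫ y, (y : ℂ) / (s + y) ^ 2 ∂W.ν),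
    ← integral_neg]
  congr 1
  · refine W.congrA fun x hx => ?_
    have h1 := hs.1 x hx
    have h2 := a3 x hx
    rw [Complex.normSq_eq_conj_mul_self] at h2 ⊢
    simp only [map_sub, map_one, map_mul, Complex.conj_ofReal] at h2 ⊢
    have h3 := left_ne_zero_of_mul h2
    field_simp
    ring
  · refine W.congrB fun x hx => ?_
    have h1 := hs.2 x hx
    have h2 := b3 x hx
    rw [Complex.normSq_eq_conj_mul_self] at h2 ⊢
    simp only [map_add, Complex.conj_ofReal] at h2 ⊢
    have h3 := left_ne_zero_of_mul h2
    field_simp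
    ring

/-- Two smooth profiles, not both zero, with relative weight `c`. -/
structure Profiles (f g : ℝ → ℝ) (c : ℝ) : Prop where
  hc : 0 < c
  hf : ContDiffOn ℝ ∞ f (Icc 0 1)
  hg : ContDiffOn ℝ ∞ g (Icc 0 1)
  hf0 : ∀ s ∈ Icc (0 : ℝ) 1, 0 ≤ f s
  hg0 : ∀ s ∈ Icc (0 : ℝ) 1, 0 ≤ g s
  ne : ∃ s ∈ Icc (0 : ℝ) 1, f s ≠ 0 ∨ g s ≠ 0

namespace Profiles

variable {f g : ℝ → ℝ} {c : ℝ} (h : Profiles f g c)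

def W : Weights (f '' Icc 0 1) (g '' Icc 0 1) where
  μ := profile f
  ν := ENNReal.ofReal c • profile g
  finμ := inferInstance
  finν := Measure.smul_finite _ ENNReal.ofReal_ne_top
  hA := isCompact_image_profile h.hf.continuousOn
  hB := isCompact_image_profile h.hg.continuousOn
  A0 := by rintro _ ⟨s, hs, rfl⟩; exact h.hf0 s hs
  B0 := by rintro _ ⟨s, hs, rfl⟩; exact h.hg0 s hs
  μA := profile_restrict h.hf.continuousOn
  νB := by rw [Measure.restrict_smul, profile_restrict h.hg.continuousOn]

theorem integral_μ {E : Type*} [NormedAddCommGroup E] [NormedSpace ℝ E] {φ : ℝ → E}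
    (hφ : ContinuousOn φ (f '' Icc 0 1)) : ∫ x, φ x ∂h.W.μ = ∫ s in (0 : ℝ)..1, φ (f s) :=
  integral_profile h.hf.continuousOn hφ

theorem integral_ν {E : Type*} [NormedAddCommGroup E] [NormedSpace ℝ E] {φ : ℝ → E}
    (hφ : ContinuousOn φ (g '' Icc 0 1)) :
    ∫ x, φ x ∂h.W.ν = c • ∫ s in (0 : ℝ)..1, φ (g s) := by
  rw [← integral_profile h.hg.continuousOn hφ]
  change ∫ x, φ x ∂(ENNReal.ofReal c • profile g) = _
  rw [integral_smul_measure, ENNReal.toReal_ofReal h.hc.le]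

theorem μ_univ : h.W.μ.real univ = 1 := profile_univ h.hf.continuousOn

theorem ν_univ : h.W.ν.real univ = c := by
  have := h.integral_ν (φ := fun _ => (1 : ℝ)) continuousOn_const
  simpa using this

theorem nontriv : h.W.Nontriv := by
  rw [Weights.Nontriv, h.integral_μ (φ := fun x => x) continuousOn_id,
    h.integral_ν (φ := fun x => x) continuousOn_id, smul_eq_mul]
  have hc := h.hc
  have n1 : 0 ≤ ∫ s in (0 : ℝ)..1, f s := intervalIntegral.integral_nonneg zero_le_one h.hf0
  have n2 : 0 ≤ ∫ s in (0 : ℝ)..1, g s := intervalIntegral.integral_nonneg zero_le_one h.hg0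
  obtain ⟨s, hs, h1 | h1⟩ := h.ne
  · have := intervalIntegral.integral_pos zero_lt_one h.hf.continuousOn
      (fun s hs => h.hf0 s ⟨hs.1.le, hs.2⟩) ⟨s, hs, lt_of_le_of_ne (h.hf0 s hs) h1.symm⟩
    positivity
  · have := intervalIntegral.integral_pos zero_lt_one h.hg.continuousOn
      (fun s hs => h.hg0 s ⟨hs.1.le, hs.2⟩) ⟨s, hs, lt_of_le_of_ne (h.hg0 s hs) h1.symm⟩
    positivity

def approx {k : ℕ → ℕ} (hk : Tendsto (fun n : ℕ => (k n : ℝ) / n) atTop (𝓝 c)) : Approx h.W where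
  n := fun m => m
  k := k
  X := fun m => sampled f m
  Y := fun m => sampled g (k m)
  hX := fun m i => sampled_mem m i
  hY := fun m j => sampled_mem (k m) j
  cμ := profile_scaledConv h.hf.continuousOn
  cν := profile_scaledConv_smul h.hg.continuousOn h.hc hk

theorem away_iff {z : ℂ} : AwayFromPoles f g (z : OnePoint ℂ) ↔
    Away (f '' Icc 0 1) (g '' Icc 0 1) z := by
  change (∀ s ∈ Icc (0 : ℝ) 1, 1 - (f s : ℂ) * z ≠ 0 ∧ z + (g s : ℂ) ≠ 0) ↔ _
  simp only [Away, forall_mem_image]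
  exact ⟨fun h => ⟨fun s hs => (h s hs).1, fun s hs => (h s hs).2⟩,
    fun h s hs => ⟨h.1 hs, h.2 hs⟩⟩

theorem critFun_eq {z : ℂ} (hz : Away (f '' Icc 0 1) (g '' Icc 0 1) z) :
    critFun f g c (z : OnePoint ℂ) = h.W.T z := by
  rw [Weights.T, h.integral_μ (φ := fun x => (x : ℂ) * z / (1 - x * z))
      (ContinuousOn.div (by fun_prop) (by fun_prop) hz.1),
    h.integral_ν (φ := fun y => (y : ℂ) / (z + y))
      (ContinuousOn.div (by fun_prop) (by fun_prop) hz.2), Complex.real_smul]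
  rfl

theorem deriv_eq_zero {z : ℂ} (hz : IsDoubleCritical f g c (z : OnePoint ℂ)) :
    h.W.D z + (z - (starRingEnd ℂ) z) * h.W.Q z z = 0 := by
  have ha := away_iff.1 hz.1
  rw [h.W.deriv_T_eq ha,
    h.integral_μ (φ := fun x => (x : ℂ) / (1 - x * z) ^ 2)
      (ContinuousOn.div (by fun_prop) (by fun_prop) fun x hx => pow_ne_zero 2 (ha.1 x hx)),
    h.integral_ν (φ := fun y => (y : ℂ) / (z + y) ^ 2)
      (ContinuousOn.div (by fun_prop) (by fun_prop) fun x hx => pow_ne_zero 2 (ha.2 x hx)),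
    Complex.real_smul]
  exact hz.2

/-- At a nonreal point with real `T` one has `D = 0`, and `re_mul_deriv_T_neg` then makes the
derivative nonzero. The lower half plane is reduced to the upper one by conjugation. -/
theorem im_eq_zero (h : Profiles f g c) {z : ℂ} (hz : IsDoubleCritical f g c (z : OnePoint ℂ)) {x : ℝ}
    (hx : critFun f g c (z : OnePoint ℂ) = x) : z.im = 0 := by
  have ha := away_iff.1 hz.1
  have hd := h.deriv_eq_zero hz
  rw [h.critFun_eq ha] at hx
  have key : ∀ w : ℂ, 0 < w.im → h.W.T w = x →
      h.W.D w + (w - (starRingEnd ℂ) w) * h.W.Q w w ≠ 0 := by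
    intro w hw hT h0
    have := Weights.re_mul_deriv_T_neg h.nontriv hw
    rw [Weights.D_eq_zero_of_T_eq hw hT, Complex.ofReal_zero, zero_add] at h0
    rw [h0] at this
    simp at this
  by_contra hi
  rcases Ne.lt_or_gt hi with hi | hi
  · have hic : 0 < ((starRingEnd ℂ) z).im := by rw [Complex.conj_im]; linarith
    refine key _ hic (by rw [Weights.T_conj, hx, Complex.conj_ofReal]) ?_
    rw [h.W.deriv_T_eq (Weights.away_conj ha)]
    rw [h.W.deriv_T_eq ha] at hd
    have := congrArg (starRingEnd ℂ) hd
    simpa only [map_sub, map_zero, ← integral_conj, map_div₀, map_pow, map_sub, map_one, map_mul,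
      map_add, Complex.conj_ofReal] using this
  · exact key _ hi hx hd

/-- Beyond the poles the coordinate `v = -1/z` is used, so that the point at infinity becomes the
ordinary point `v = 0`. -/
theorem critical_cases {z : OnePoint ℂ} (hz : IsDoubleCritical f g c z) {x : ℝ}
    (hx : critFun f g c z = x) :
    (∃ r : ℝ, z = ((r : ℂ) : OnePoint ℂ) ∧ In0 (f '' Icc 0 1) (g '' Icc 0 1) r ∧ h.W.D r = 0 ∧
      x = (h.W.T r).re) ∨
    ∃ v : ℝ, In0 (g '' Icc 0 1) (f '' Icc 0 1) v ∧ h.W.swap.D v = 0 ∧ x = -(h.W.swap.T v).re ∧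
      (v = 0 ∧ z = OnePoint.infty ∨ v ≠ 0 ∧ z = (((-v⁻¹ : ℝ) : ℂ) : OnePoint ℂ)) := by
  induction z using OnePoint.rec with
  | infty =>
    right
    have hne : ∀ s ∈ Icc (0 : ℝ) 1, f s ≠ 0 := hz.1
    have h2 : (∫ s in (0 : ℝ)..1, 1 / f s) - c * (∫ s in (0 : ℝ)..1, g s) = 0 := hz.2
    have h3 : (-1 : ℂ) = x := hx
    have hA : ∀ y ∈ f '' Icc 0 1, y ≠ 0 := by rintro _ ⟨s, hs, rfl⟩; exact hne s hs
    refine ⟨0, ⟨fun y _ => by simp, ?_⟩, ?_, ?_, Or.inl ⟨rfl, rfl⟩⟩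
    · rintro _ ⟨s, hs, rfl⟩
      rw [zero_add]
      exact lt_of_le_of_ne (h.hf0 s hs) (hne s hs).symm
    · have e1 : h.W.swap.D ((0 : ℝ) : ℂ) = (∫ y, y ∂h.W.ν) - ∫ y, 1 / y ∂h.W.μ := by
        rw [Weights.D]
        congr 1
        · refine integral_congr_ae (Eventually.of_forall fun y => ?_)
          simp
        · refine h.W.congrA fun y hy => ?_
          have := hA y hy
          simp only [Complex.ofReal_zero, zero_add, Complex.normSq_ofReal]
          field_simp
      rw [e1, h.integral_μ (φ := fun y => 1 / y) (ContinuousOn.div continuousOn_const continuousOn_id hA),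
        h.integral_ν (φ := fun y => y) continuousOn_id, smul_eq_mul]
      linarith
    · have e2 : h.W.swap.T ((0 : ℝ) : ℂ) = 1 := by
        have e3 : h.W.swap.T ((0 : ℝ) : ℂ) = (∫ _, (0 : ℂ) ∂h.W.ν) + ∫ _, (1 : ℂ) ∂h.W.μ := by
          rw [Weights.T]
          congr 1
          · refine integral_congr_ae (Eventually.of_forall fun y => ?_)
            simp
          · refine h.W.congrA fun y hy => ?_
            have : (y : ℂ) ≠ 0 := by exact_mod_cast hA y hy
            rw [Complex.ofReal_zero, zero_add, div_self this]
        rw [e3, integral_zero, integral_const, h.μ_univ]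
        simp
      rw [e2, Complex.one_re]
      exact_mod_cast h3.symm
  | coe z =>
    have ha := away_iff.1 hz.1
    have hi := h.im_eq_zero hz hx
    have hd := h.deriv_eq_zero hz
    rw [h.critFun_eq ha] at hx
    have e : z = (z.re : ℂ) := Complex.ext (by simp) (by simp [hi])
    have hre : x = (h.W.T z).re := by rw [hx, Complex.ofReal_re]
    have hD : h.W.D z = 0 := by
      have e1 : (starRingEnd ℂ) z = z := by rw [e, Complex.conj_ofReal]
      rw [e1, sub_self, zero_mul, add_zero] at hd
      exact_mod_cast hd
    have hcon : IsPreconnected (Icc (0 : ℝ) 1) := isPreconnected_Icc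
    have hne : (Icc (0 : ℝ) 1).Nonempty := ⟨0, by simp⟩
    rcases h.W.away_of_real (hcon.image f h.hf.continuousOn) (hcon.image g h.hg.continuousOn)
      (hne.image f) (hne.image g) (e ▸ ha : Away _ _ (z.re : ℂ)) with h1 | ⟨h1, h2⟩
    · exact Or.inl ⟨z.re, by rw [← e], h1, by rw [← e]; exact hD, by rw [← e]; exact hre⟩
    · right
      have h0 : z ≠ 0 := by rintro rfl; exact h1 rfl
      have e2 : ((-z.re⁻¹ : ℝ) : ℂ) = -z⁻¹ := by rw [Complex.ofReal_neg, Complex.ofReal_inv, ← e]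
      refine ⟨-z.re⁻¹, h2, ?_, ?_, Or.inr ⟨neg_ne_zero.2 (inv_ne_zero h1), ?_⟩⟩
      · rw [e2, Weights.D_swap ha h0, hD, mul_zero, neg_zero]
      · rw [e2, Weights.T_swap ha h0, Complex.neg_re, neg_neg, hre]
      · rw [inv_neg, inv_inv, neg_neg, ← e]

theorem crit {zp vm : ℝ} (hp : In0 (f '' Icc 0 1) (g '' Icc 0 1) zp) (Dp : h.W.D zp = 0)
    (hm : In0 (g '' Icc 0 1) (f '' Icc 0 1) vm) (Dm : h.W.swap.D vm = 0) : Crit h.W zp vm := by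
  have hcon : IsPreconnected (Icc (0 : ℝ) 1) := isPreconnected_Icc
  have hne : (Icc (0 : ℝ) 1).Nonempty := ⟨0, by simp⟩
  obtain ⟨K, hK⟩ := h.hf.exists_lipschitzOnWith (by simp) (convex_Icc 0 1) isCompact_Icc
  obtain ⟨K', hK'⟩ := h.hg.exists_lipschitzOnWith (by simp) (convex_Icc 0 1) isCompact_Icc
  exact ⟨h.nontriv, hcon.image f h.hf.continuousOn, hcon.image g h.hg.continuousOn, hne.image f,
    hne.image g, hp, Dp, hm, Dm, blowUp_profile hK h.hf0, blowUp_smul (blowUp_profile hK' h.hg0) h.hc⟩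

/-- Each of the two intervals contains at most one critical point, so distinct roots occupy
different intervals. The assignment opposite to the labelling would contradict `lower_lt_upper`. -/
theorem exists_crit {zm zp : OnePoint ℂ} {xm xp : ℝ} (hzm : IsDoubleCritical f g c zm)
    (hzp : IsDoubleCritical f g c zp) (hne : zm ≠ zp) (hxm : critFun f g c zm = xm)
    (hxp : critFun f g c zp = xp) (hx : xm ≤ xp) :
    ∃ r v : ℝ, Crit h.W r v ∧ zp = ((r : ℂ) : OnePoint ℂ) ∧ xp = (h.W.T r).re ∧
      xm = -(h.W.swap.T v).re ∧
      (v = 0 ∧ zm = OnePoint.infty ∨ v ≠ 0 ∧ zm = (((-v⁻¹ : ℝ) : ℂ) : OnePoint ℂ)) := by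
  have hnt := h.nontriv
  have hnt' : h.W.swap.Nontriv := by
    unfold Weights.Nontriv at *
    rw [add_comm]
    exact hnt
  have uniq : ∀ {A B : Set ℝ} (W : Weights A B), W.Nontriv → ∀ {r s : ℝ}, In0 A B r → In0 A B s →
      W.D r = 0 → W.D s = 0 → r = s := by
    intro A B W hW r s hr hs h1 h2
    by_contra h3
    have := Weights.D_sign_of_In0 hW hr hs h2 h3
    rw [h1, mul_zero] at this
    exact lt_irrefl _ this
  rcases h.critical_cases hzm hxm with ⟨r, e1, h1, d1, t1⟩ | ⟨v, h1, d1, t1, e1⟩ <;>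
    rcases h.critical_cases hzp hxp with ⟨r', e2, h2, d2, t2⟩ | ⟨v', h2, d2, t2, e2⟩
  · rw [uniq h.W hnt h1 h2 d1 d2, ← e2] at e1
    exact absurd e1 hne
  · have := (h.crit h1 d1 h2 d2).lower_lt_upper
    linarith
  · exact ⟨r', v, h.crit h2 d2 h1 d1, e2, t2, t1, e1⟩
  · have hv := uniq h.W.swap hnt' h1 h2 d1 d2
    subst hv
    refine absurd ?_ hne
    rcases e1 with ⟨a1, b1⟩ | ⟨a1, b1⟩ <;> rcases e2 with ⟨a2, b2⟩ | ⟨a2, b2⟩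
    · rw [b1, b2]
    · exact absurd a1 a2
    · exact absurd a2 a1
    · rw [b1, b2]

end Profiles

end

end DualSchur


/-! ### The theorem for sampled profiles -/

theorem mainTheorem4
    (f g : ℝ → ℝ) (c : ℝ) (k : ℕ → ℕ) (zm zp : OnePoint ℂ) (xm xp : ℝ)
    -- `k/n → c ∈ (0, ∞)`
    (hc : 0 < c)
    (hk : Tendsto (fun n : ℕ => (k n : ℝ) / n) atTop (𝓝 c))
    -- 1) `f, g : [0,1] → [0,∞)` are smooth
    (hf : ContDiffOn ℝ ∞ f (Icc 0 1)) (hg : ContDiffOn ℝ ∞ g (Icc 0 1))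
    (hf0 : ∀ s ∈ Icc (0 : ℝ) 1, 0 ≤ f s) (hg0 : ∀ s ∈ Icc (0 : ℝ) 1, 0 ≤ g s)
    -- 2) convergence of the integrals away from the poles
    (hint : ∀ z : ℂ, DualSchur.AwayFromPoles f g (z : OnePoint ℂ) →
      IntervalIntegrable (fun s => 1 / (1 - (f s : ℂ) * z) ^ 2) volume 0 1 ∧
      IntervalIntegrable (fun s => 1 / (z + (g s : ℂ)) ^ 2) volume 0 1)
    -- 3) the equation, not being the identity `0 = 0`, has two roots `z₋`, `z₊`
    (hfg : ∃ s ∈ Icc (0 : ℝ) 1, f s ≠ 0 ∨ g s ≠ 0)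
    (hzm : DualSchur.IsDoubleCritical f g c zm) (hzp : DualSchur.IsDoubleCritical f g c zp)
    (hne : zm ≠ zp)
    -- the real numbers `x₋ ≤ x₊` attached to them
    (hxm : DualSchur.critFun f g c zm = (xm : ℂ)) (hxp : DualSchur.critFun f g c zp = (xp : ℂ))
    (hx : xm ≤ xp) :
    (-1 ≤ xm ∧ xp ≤ c) ∧
    -- inside the support
    (∀ t ∈ Icc xm xp, t ≠ -1 → t ≠ c →
      ∃ z : ℂ,
        (∀ z' : ℂ, (0 ≤ z'.im ∧ DualSchur.AwayFromPoles f g (z' : OnePoint ℂ) ∧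
          DualSchur.critFun f g c (z' : OnePoint ℂ) - (t : ℂ) = 0) ↔ z' = z) ∧
        z ≠ 0 ∧
        ∀ a : ℕ → ℤ, Tendsto (fun n : ℕ => (a n : ℝ) / n) atTop (𝓝 t) →
          ∀ p q : ℤ, Tendsto
            (fun n : ℕ => ((‖z‖ ^ (p - q) : ℝ) : ℂ) *
              DualSchur.corrKernel (DualSchur.sampled f n) (DualSchur.sampled g (k n))
                (a n + p) (a n + q))
            atTop (𝓝 ((DualSchur.sineKernel z.arg (p - q) : ℝ) : ℂ))) ∧
    -- outside the support
    (∀ t : ℝ, t ∉ Icc xm xp →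
      (t = -1 → ∃ r : ℝ, r < 0 ∧ zm = ((r : ℂ) : OnePoint ℂ)) →
      (t = c → ∃ r : ℝ, 0 < r ∧ zp = ((r : ℂ) : OnePoint ℂ)) →
      ∃ ρ : ℝ, (ρ = 0 ∨ ρ = 1) ∧
        ∀ a : ℕ → ℤ, Tendsto (fun n : ℕ => (a n : ℝ) / n) atTop (𝓝 t) →
          ∀ p q : ℤ, Tendsto
            (fun n : ℕ =>
              DualSchur.corrKernel (DualSchur.sampled f n) (DualSchur.sampled g (k n))
                (a n + p) (a n + q))
            atTop (𝓝 (((if p = q then ρ else 0 : ℝ)) : ℂ))) := by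
  have h : DualSchur.Profiles f g c := ⟨hc, hf, hg, hf0, hg0, hfg⟩
  obtain ⟨r, v, hcr, hr, ep, em, hv⟩ := h.exists_crit hzm hzp hne hxm hxp hx
  have hμ := h.μ_univ
  have hν := h.ν_univ
  have b1 := hcr.neg_mass_le
  have b2 := hcr.T_le_mass
  rw [hμ, ← em] at b1
  rw [hν, ← ep] at b2
  refine ⟨⟨b1, b2⟩, fun t ht h1 h2 => ?_, fun t ht h1 h2 => ?_⟩
  · obtain ⟨z, hz, hz0, hlim⟩ := hcr.exists_bulk_point (h.approx hk) (t := t) (em ▸ ht.1)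
      (ep ▸ ht.2) (by rwa [hμ]) (by rwa [hν])
    refine ⟨z, fun z' => ?_, hz0, fun a ha p q => ?_⟩
    · rw [← hz z', DualSchur.Profiles.away_iff, sub_eq_zero]
      exact and_congr_right fun _ => and_congr_right fun hz' => by rw [h.critFun_eq hz']
    · rw [← DualSchur.norm_zpow_mul_mainTerm _ hz0, Complex.ofReal_mul]
      exact (hlim a ha p q).const_mul _
  · refine hcr.exists_frozen_value (h.approx hk) (t := t) ?_ (fun e => ?_) (fun e => ?_)
    · rw [mem_Icc, not_and_or, not_le, not_le] at ht
      rwa [← em, ← ep]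
    · rw [hμ] at e
      obtain ⟨s, hs, e1⟩ := h1 e
      rcases hv with ⟨-, e2⟩ | ⟨-, e2⟩
      · rw [e2] at e1
        exact absurd e1 (OnePoint.infty_ne_coe _)
      · rw [e2, OnePoint.coe_eq_coe, Complex.ofReal_inj] at e1
        rw [← e1] at hs
        exact inv_pos.1 (neg_lt_zero.1 hs)
    · rw [hν] at e
      obtain ⟨s, hs, e1⟩ := h2 e
      rw [hr, OnePoint.coe_eq_coe, Complex.ofReal_inj] at e1
      rwa [e1]
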